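/- **Setting.** Let $\delta\in\mathbb R$, $q_0>0$, $q_\pm\in\mathbb C$ with $|q_\pm|=q_0$, let $q(x,t)$ be a complex potential, and fix a time $t$. Assume that $q(\cdot,t)\in C^2(\mathbb R)$, $q(x,t)\to q_\pm$ as $x\to\pm\infty$, $(1+|x|)(q-q_\pm)\in L^1(\mathbb R^\pm)$ and $q_x,q_{xx}\in L^1(\mathbb R)$. (This covers any solution of the sextic NLS equation with non-zero boundary conditions having this regularity and decay at time $t$; all scattering data below are those of $q(\cdot,t)$.) Write $z^*$ for the complex conjugate and put $$k=\tfrac12\Big(z-\frac{q_0^2}{z}\Big),\quad \lambda=\tfrac12\Big(z+\frac{q_0^2}{z}\Big),\quad \theta(x,t;z)=\lambda\big[x+(32\delta k^5-16\delta q_0^2k^3+12\delta q_0^4k+k)t\big],\quad \gamma=1+\frac{q_0^2}{z^2},$$ $$\sigma_3=\begin{pmatrix}1&0\\0&-1\end{pmatrix},\quad Q=\begin{pmatrix}0&iq^*\\iq&0\end{pmatrix},\quad Q_\pm=\begin{pmatrix}0&iq_\pm^*\\iq_\pm&0\end{pmatrix},\quad Y_\pm=\mathbb I+\frac iz\sigma_3Q_\pm,$$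 $$D^\pm=\{z:\ \pm(|z|^2-q_0^2)\,\mathrm{Im}\,z>0\},\qquad \Sigma=\mathbb R\cup\{|z|=q_0\},$$ where $\Sigma$ is oriented with $D^+$ on its left. Let $\psi_\pm$ be the Jost solutions of $\psi_x=(ik\sigma_3+Q)\psi$, normalised columnwise by $\mu_\pm:=\psi_\pm e^{-i\theta\sigma_3}\to Y_\pm$ as $x\to\pm\infty$. Here $\mu_{\pm,j}$ is the $j$-th column and $\mu_{-,22}$ the second entry of $\mu_{-,2}$; the columns $\mu_{+,1},\mu_{-,2}$ are defined for $z\in D^+\cup\Sigma$, the columns $\mu_{-,1},\mu_{+,2}$ for $z\in D^-\cup\Sigma$, with $z\neq0,\pm iq_0$. Let $s_{ij}$ be the scattering coefficients, $\psi_+=\psi_-S$; that is, with $W$ the Wronskian, $$s_{11}=\tfrac{W(\psi_{+,1},\psi_{-,2})}{\gamma},\quad s_{12}=\tfrac{W(\psi_{+,2},\psi_{-,2})}{\gamma},\quad s_{21}=\tfrac{W(\psi_{-,1},\psi_{+,1})}{\gamma},\quad s_{22}=\tfrac{W(\psi_{-,1},\psi_{+,2})}{\gamma}.$$ Put $\rho=s_{21}/s_{11}$,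 $\tilde\rho=s_{12}/s_{22}$ and $$M^+=\Big(\frac{\mu_{+,1}}{s_{11}},\mu_{-,2}\Big),\quad M^-=\Big(\mu_{-,1},\frac{\mu_{+,2}}{s_{22}}\Big),\quad M=M^\pm\text{ in }D^\pm,\quad G=\begin{pmatrix}0&-\tilde\rho e^{2i\theta}\\ \rho e^{-2i\theta}&\rho\tilde\rho\end{pmatrix}.$$ Assume that there are no spectral singularities: every $\zeta\in\Sigma\setminus\{0\}$ has a neighbourhood on whose intersection with $D^+$ the function $|s_{11}|$ is bounded below by a positive constant. Assume that the zeros of $s_{11}$ in $D^+\cap\{\mathrm{Im}\,z>0\}$ are finitely many distinct points $z_1,\dots,z_N$ ($N\ge0$), all simple. Put $\xi_n=z_n$, $\xi_{N+n}=-q_0^2/z_n^*$ for $1\le n\le N$. For $1\le n\le 2N$ let $C_n=b_n/s_{11}'(\xi_n)$ and $\tilde C_n=\tilde b_n/s_{22}'(\xi_n^*)$, where $\psi_{+,1}(\xi_n)=b_n\psi_{-,2}(\xi_n)$ and $\psi_{+,2}(\xi_n^*)=\tilde b_n\psi_{-,1}(\xi_n^*)$ for all $x$. **Conclusion.** For every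 $x\in\mathbb R$: 1. $M$ solves the generalized Riemann–Hilbert problem: it is meromorphic in $\mathbb C\setminus\Sigma$; on $\Sigma\setminus\{0,\pm iq_0\}$ it has the boundary values $M^\pm$ from $D^\pm$, with $M^-=M^+(\mathbb I-G)$; $M=\mathbb I+O(1/z)$ as $z\to\infty$; and $M=\frac iz\sigma_3Q_-+O(1)$ as $z\to0$. 2. The zeros of $s_{11}$ in $D^+$ are exactly the $\xi_n$ and those of $s_{22}$ in $D^-$ exactly the $\xi_n^*$, $1\le n\le 2N$. Moreover $\tilde C_n=-C_n^*$ for $1\le n\le 2N$, and $C_{N+n}=-\frac{q_-}{q_-^*}\big(\frac{q_0}{z_n^*}\big)^2\tilde C_n$ for $1\le n\le N$. 3. At $\xi_n$ and $\xi_n^*$ the matrix $M$ has at most simple poles, with $$\operatorname*{Res}_{z=\xi_n}M^+=\big(C_ne^{-2i\theta(\xi_n)}\mu_{-,2}(\xi_n),\,0\big),\qquad \operatorname*{Res}_{z=\xi_n^*}M^-=\big(0,\,\tilde C_ne^{2i\theta(\xi_n^*)}\mu_{-,1}(\xi_n^*)\big).$$ 4. $M^+G$ and, for every $z\notin\Sigma$,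 $M^+(s)G(s)/(s-z)$ are absolutely integrable on $\Sigma$. For all $z\in\mathbb C\setminus\Sigma$ other than the points $\xi_n,\xi_n^*$, $$M(z)=\mathbb I+\frac iz\sigma_3Q_-+\sum_{n=1}^{2N}\frac{\operatorname{Res}_{\xi_n^*}M^-}{z-\xi_n^*}+\sum_{n=1}^{2N}\frac{\operatorname{Res}_{\xi_n}M^+}{z-\xi_n}+\frac1{2\pi i}\int_\Sigma\frac{M^+(s)G(s)}{s-z}\,ds.$$ 5. For $1\le n\le 2N$, with $(\cdot)_j$ denoting the $j$-th column, $$\mu_{-,2}(\xi_n)=\begin{pmatrix}-q_-^*/\xi_n\\1\end{pmatrix}+\sum_{k=1}^{2N}\frac{\tilde C_ke^{2i\theta(\xi_k^*)}}{\xi_n-\xi_k^*}\mu_{-,1}(\xi_k^*)+\frac1{2\pi i}\int_\Sigma\frac{(M^+G)_2(s)}{s-\xi_n}ds,$$ $$\mu_{-,1}(\xi_n^*)=\begin{pmatrix}1\\q_- /\xi_n^*\end{pmatrix}+\sum_{k=1}^{2N}\frac{C_ke^{-2i\theta(\xi_k)}}{\xi_n^*-\xi_k}\mu_{-,2}(\xi_k)+\frac1{2\pi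 i}\int_\Sigma\frac{(M^+G)_1(s)}{s-\xi_n^*}ds.$$ 6. As $z\to\infty$ in $\mathbb C\setminus\Sigma$, $$M(z)=\mathbb I+\frac1z\Big\{i\sigma_3Q_-+\sum_{n=1}^{2N}\big(\operatorname{Res}_{\xi_n^*}M^-+\operatorname{Res}_{\xi_n}M^+\big)-\frac1{2\pi i}\int_\Sigma M^+(s)G(s)\,ds\Big\}+O(z^{-2}).$$ 7. The potential is $$q(x,t)=q_-+\sum_{n=1}^{2N}C_ne^{-2i\theta(\xi_n)}\mu_{-,22}(\xi_n)-\frac1{2\pi i}\int_\Sigma\big(M^+(s)G(s)\big)_{21}\,ds.$$ -/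

import Mathlib

open Filter Topology Asymptotics MeasureTheory
open scoped ComplexConjugate Matrix

noncomputable section

/-- The data of the scattering problem with non-zero boundary conditions: the real coefficient `δ`,
the amplitude `q₀`, the limits `qm`, `qp` of the potential as `x → -∞`, `x → +∞`, and the potential
`q x t` itself. The conditions on these data are hypotheses of the theorem. -/
structure NZBCData where
  δ : ℝ
  q₀ : ℝ
  qm : ℂ
  qp : ℂ
  q : ℝ → ℝ → ℂ

namespace NZBCData

/-- `σ₃`. -/
def sigma3 : Matrix (Fin 2) (Fin 2) ℂ := !![1, 0; 0, -1]

/-- The off-diagonal matrix `Q` built from the value `v` of the potential. -/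
def Qmat (v : ℂ) : Matrix (Fin 2) (Fin 2) ℂ := !![0, Complex.I * conj v; Complex.I * v, 0]

/-- The matrix `X = i k σ₃ + Q` of the `x`-part of the Lax pair. -/
def Xmat (k v : ℂ) : Matrix (Fin 2) (Fin 2) ℂ := (Complex.I * k) • sigma3 + Qmat v

/-- `Y(z) = 1 + (i / z) σ₃ Q`, the eigenvector matrix of the limit problem. -/
def Ymat (v z : ℂ) : Matrix (Fin 2) (Fin 2) ℂ := 1 + (Complex.I / z) • (sigma3 * Qmat v)

/-- The Wronskian of two vectors. -/
def wronskian (φ ψ : Fin 2 → ℂ) : ℂ := φ 0 * ψ 1 - φ 1 * ψ 0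

variable (P : NZBCData)

/-- `k(z) = (z - q₀² / z) / 2`. -/
def k (z : ℂ) : ℂ := (z - (P.q₀ : ℂ) ^ 2 / z) / 2

/-- `λ(z) = (z + q₀² / z) / 2`. -/
def lam (z : ℂ) : ℂ := (z + (P.q₀ : ℂ) ^ 2 / z) / 2

/-- `θ(x, t; z) = λ [x + (32 δ k⁵ - 16 δ q₀² k³ + 12 δ q₀⁴ k + k) t]`. -/
def theta (x t : ℝ) (z : ℂ) : ℂ :=
  P.lam z * (x + (32 * P.δ * P.k z ^ 5 - 16 * P.δ * (P.q₀ : ℂ) ^ 2 * P.k z ^ 3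
    + 12 * P.δ * (P.q₀ : ℂ) ^ 4 * P.k z + P.k z) * t)

/-- `γ(z) = det Y(z) = 1 + q₀² / z²`. -/
def gam (z : ℂ) : ℂ := 1 + (P.q₀ : ℂ) ^ 2 / z ^ 2

/-- `D⁺ = {(|z|² - q₀²) Im z > 0}`. -/
def Dplus : Set ℂ := {z | 0 < (‖z‖ ^ 2 - P.q₀ ^ 2) * z.im}

/-- `D⁻ = {(|z|² - q₀²) Im z < 0}`. -/
def Dminus : Set ℂ := {z | (‖z‖ ^ 2 - P.q₀ ^ 2) * z.im < 0}

/-- `Σ`: the real axis together with the circle `|z| = q₀`. -/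
def contour : Set ℂ := {z | z.im = 0 ∨ ‖z‖ = P.q₀}

/-- `ψ` is the column `j` (`0` is the first column, `1` the second) of the Jost solution at time `t`
that is normalised at the end `l` (`atBot` or `atTop`), where the potential tends to `v`:
it solves `ψ_x = X ψ`, and `ψ e^{∓ i θ}` (minus for the first column, plus for the second)
tends to the column `j` of `Y(z)`. -/
def IsJost (l : Filter ℝ) (v : ℂ) (j : Fin 2) (t : ℝ) (z : ℂ) (ψ : ℝ → Fin 2 → ℂ) : Prop :=
  (∀ x, HasDerivAt ψ (Xmat (P.k z) (P.q x t) *ᵥ ψ x) x) ∧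
    Tendsto (fun x => Complex.exp (-(Complex.I * sigma3 j j * P.theta x t z)) • ψ x) l
      (𝓝 fun i => Ymat v z i j)

/-- The columns of `ψ₋(x, t; z)`. -/
def psiMinus (j : Fin 2) (x t : ℝ) (z : ℂ) : Fin 2 → ℂ :=
  Classical.epsilon (P.IsJost atBot P.qm j t z) x

/-- The columns of `ψ₊(x, t; z)`. -/
def psiPlus (j : Fin 2) (x t : ℝ) (z : ℂ) : Fin 2 → ℂ :=
  Classical.epsilon (P.IsJost atTop P.qp j t z) x

/-- The columns of `μ₋ = ψ₋ e^{-i θ σ₃}`. -/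
def muMinus (j : Fin 2) (x t : ℝ) (z : ℂ) : Fin 2 → ℂ :=
  Complex.exp (-(Complex.I * sigma3 j j * P.theta x t z)) • P.psiMinus j x t z

/-- The columns of `μ₊ = ψ₊ e^{-i θ σ₃}`. -/
def muPlus (j : Fin 2) (x t : ℝ) (z : ℂ) : Fin 2 → ℂ :=
  Complex.exp (-(Complex.I * sigma3 j j * P.theta x t z)) • P.psiPlus j x t z

/-! The entries of the scattering matrix, `ψ₊ = ψ₋ S`, through Wronskians. The Wronskians do not
depend on `x`, because `X` is trace-free; they are evaluated at `x = 0`. -/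

def s11 (t : ℝ) (z : ℂ) : ℂ := wronskian (P.psiPlus 0 0 t z) (P.psiMinus 1 0 t z) / P.gam z

def s12 (t : ℝ) (z : ℂ) : ℂ := wronskian (P.psiPlus 1 0 t z) (P.psiMinus 1 0 t z) / P.gam z

def s21 (t : ℝ) (z : ℂ) : ℂ := wronskian (P.psiMinus 0 0 t z) (P.psiPlus 0 0 t z) / P.gam z

def s22 (t : ℝ) (z : ℂ) : ℂ := wronskian (P.psiMinus 0 0 t z) (P.psiPlus 1 0 t z) / P.gam z

/-- The reflection coefficient `ρ = s₂₁ / s₁₁`. -/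
def rho (t : ℝ) (z : ℂ) : ℂ := P.s21 t z / P.s11 t z

/-- The reflection coefficient `ρ̃ = s₁₂ / s₂₂`. -/
def rhoTilde (t : ℝ) (z : ℂ) : ℂ := P.s12 t z / P.s22 t z

/-- The matrix `G` in the jump condition `M⁻ = M⁺ (1 - G)`. -/
def G (x t : ℝ) (z : ℂ) : Matrix (Fin 2) (Fin 2) ℂ :=
  !![0, -P.rhoTilde t z * Complex.exp (2 * Complex.I * P.theta x t z);
    P.rho t z * Complex.exp (-(2 * Complex.I * P.theta x t z)), P.rho t z * P.rhoTilde t z]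

/-- `M⁺ = (μ₊₁ / s₁₁, μ₋₂)`. -/
def Mplus (x t : ℝ) (z : ℂ) : Matrix (Fin 2) (Fin 2) ℂ :=
  !![P.muPlus 0 x t z 0 / P.s11 t z, P.muMinus 1 x t z 0;
    P.muPlus 0 x t z 1 / P.s11 t z, P.muMinus 1 x t z 1]

/-- `M⁻ = (μ₋₁, μ₊₂ / s₂₂)`. -/
def Mminus (x t : ℝ) (z : ℂ) : Matrix (Fin 2) (Fin 2) ℂ :=
  !![P.muMinus 0 x t z 0, P.muPlus 1 x t z 0 / P.s22 t z;
    P.muMinus 0 x t z 1, P.muPlus 1 x t z 1 / P.s22 t z]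

open Classical in
/-- The sectionally meromorphic matrix `M` off `Σ`: `M⁺` in `D⁺` and `M⁻` in `D⁻`. -/
def M (x t : ℝ) (z : ℂ) : Matrix (Fin 2) (Fin 2) ℂ :=
  if z ∈ P.Dplus then P.Mplus x t z else P.Mminus x t z

/-- The generalized Riemann-Hilbert problem at `(x, t)` for a sectionally meromorphic matrix `A`
with boundary values `Ap` and `Am` on `Σ` from `D⁺` and `D⁻`. The boundary values are taken away
from the origin, where `A` is singular, and from the branch points `± i q₀`. -/
structure IsRHPSolution (x t : ℝ) (A Ap Am : ℂ → Matrix (Fin 2) (Fin 2) ℂ) : Prop where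
  meromorphic : ∀ i j, MeromorphicOn (fun z => A z i j) P.contourᶜ
  boundary_plus : ∀ s ∈ P.contour, s ≠ 0 → s ^ 2 ≠ -(P.q₀ : ℂ) ^ 2 →
    Tendsto A (𝓝[P.Dplus] s) (𝓝 (Ap s))
  boundary_minus : ∀ s ∈ P.contour, s ≠ 0 → s ^ 2 ≠ -(P.q₀ : ℂ) ^ 2 →
    Tendsto A (𝓝[P.Dminus] s) (𝓝 (Am s))
  jump : ∀ s ∈ P.contour, s ≠ 0 → s ^ 2 ≠ -(P.q₀ : ℂ) ^ 2 → Am s = Ap s * (1 - P.G x t s)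
  at_infinity : ∀ i j, (fun z => A z i j - (1 : Matrix (Fin 2) (Fin 2) ℂ) i j)
    =O[Bornology.cobounded ℂ ⊓ 𝓟 P.contourᶜ] fun z => 1 / z
  at_zero : ∀ i j, (fun z => A z i j - ((Complex.I / z) • (sigma3 * Qmat P.qm)) i j)
    =O[𝓝[P.contourᶜ] 0] fun _ => (1 : ℂ)

/-- The constant `b` with `ψ₊₁(x, t; ξ) = b ψ₋₂(x, t; ξ)` for all `x`, at a zero `ξ` of `s₁₁`. -/
def b (t : ℝ) (ξ : ℂ) : ℂ :=
  Classical.epsilon fun c => ∀ x, P.psiPlus 0 x t ξ = c • P.psiMinus 1 x t ξ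

/-- The constant `b̃` with `ψ₊₂(x, t; η) = b̃ ψ₋₁(x, t; η)` for all `x`, at a zero `η` of `s₂₂`. -/
def bTilde (t : ℝ) (η : ℂ) : ℂ :=
  Classical.epsilon fun c => ∀ x, P.psiPlus 1 x t η = c • P.psiMinus 0 x t η

/-- The norming constant `C = b / s₁₁'` at a zero of `s₁₁`. -/
def C (t : ℝ) (ξ : ℂ) : ℂ := P.b t ξ / deriv (P.s11 t) ξ

/-- The norming constant `C̃ = b̃ / s₂₂'` at a zero of `s₂₂`. -/
def CTilde (t : ℝ) (η : ℂ) : ℂ := P.bTilde t η / deriv (P.s22 t) η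

/-- The points `ξ_n = z_n` and `ξ_{N+n} = -q₀² / z_n^*`. -/
def xi {N : ℕ} (z : Fin N → ℂ) : Fin N ⊕ Fin N → ℂ :=
  Sum.elim z fun n => -(P.q₀ : ℂ) ^ 2 / conj (z n)

/-- The residue of `M⁺` at a zero `ξ` of `s₁₁`, as the matrix
`(C e^{-2 i θ(ξ)} μ₋₂(ξ), 0)`. -/
def resPlus (x t : ℝ) (ξ : ℂ) : Matrix (Fin 2) (Fin 2) ℂ :=
  (P.C t ξ * Complex.exp (-(2 * Complex.I * P.theta x t ξ))) •
    !![P.muMinus 1 x t ξ 0, 0; P.muMinus 1 x t ξ 1, 0]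

/-- The residue of `M⁻` at a zero `η` of `s₂₂`, as the matrix
`(0, C̃ e^{2 i θ(η)} μ₋₁(η))`. -/
def resMinus (x t : ℝ) (η : ℂ) : Matrix (Fin 2) (Fin 2) ℂ :=
  (P.CTilde t η * Complex.exp (2 * Complex.I * P.theta x t η)) •
    !![0, P.muMinus 0 x t η 0; 0, P.muMinus 0 x t η 1]

/-- The point `q₀ e^{i φ}` of the circle. -/
def circlePt (φ : ℝ) : ℂ := P.q₀ * Complex.exp (φ * Complex.I)

/-- Absolute integrability along `Σ`. -/
def ContourIntegrable (f : ℂ → ℂ) : Prop :=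
  Integrable (fun s : ℝ => f s) ∧
    IntervalIntegrable (fun φ : ℝ => f (P.circlePt φ)) volume 0 (2 * Real.pi)

/-- The integral along `Σ`, oriented with `D⁺` on its left: the real axis to the right where
`|s| > q₀` and to the left where `|s| < q₀`, the upper half circle clockwise, the lower half circle
counterclockwise. -/
def contourIntegral (f : ℂ → ℂ) : ℂ :=
  (∫ s in {s : ℝ | P.q₀ < |s|}, f s) - (∫ s in {s : ℝ | |s| < P.q₀}, f s)
    - (∫ φ in (0 : ℝ)..Real.pi, f (P.circlePt φ) * (Complex.I * P.circlePt φ))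
    + ∫ φ in Real.pi..(2 * Real.pi), f (P.circlePt φ) * (Complex.I * P.circlePt φ)

/-- The entrywise integral along `Σ`. -/
def contourIntegralMat (F : ℂ → Matrix (Fin 2) (Fin 2) ℂ) : Matrix (Fin 2) (Fin 2) ℂ :=
  Matrix.of fun i j => P.contourIntegral fun s => F s i j

end NZBCData

end

/-! ### Volterra equations on a left half-line with a holomorphic parameter. -/

section Volterra

open Set

/-! Only one Jost column has to be constructed, `μ₋₂`; the others are its images under three
symmetries. The reflection `(x, t) ↦ (-x, -t)` turns `ψ₊₁` into `ψ₋₂` of reflected data, the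
antilinear map `conjJ` passes from `z` to `z^*` and so from `D⁺` to `D⁻`, and `hat`, which is `z ↦
-q₀²/z`, keeps `k` and changes the sign of `λ`.

In the unknowns `(μ₁ + (q₋^*/z) μ₂, μ₂)` the column `μ₋₂` solves a Volterra equation on `(-∞, x]`.
The only factor that could be singular at the branch points `±i q₀` is `(e^{2iλ(x-y)} - 1)/(2λ)`,
and for `Im λ ≥ 0` it is at most `x - y`, which the first moment of `q - q₋` pays for. Hence the
solution is holomorphic in `D⁺`, continuous up to `Σ` off the origin and the branch points, and
bounded uniformly in `z` away from the origin, also near the branch points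
(`exists_jost_components`). Uniqueness is a Wronskian argument (`isJost_unique`).

Replacing `q₋` by `q(x)` in this change of unknowns and integrating twice gives the expansion at
infinity up to `O(1/z²)` (`muMinus_one_asymptotics`); the coefficient of `1/z` in the entry `(2,1)`
of `M` is `q`. The behaviour at the origin needs no analysis of its own, since `M⁺(z) = M⁻(-q₀²/z)
(i/z) σ₃ Q₋` (`Mplus_eq_hat`). The jump relation is Cramer's rule for `ψ₊ = ψ₋ S`, and the residues
come from the proportionality of `ψ₊₁` and `ψ₋₂` at a zero of `s₁₁`.

The integral formula arises by subtracting from `M` its explicit part: the limit at infinity, the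
pole at the origin and the poles at the discrete spectrum. The remainder is analytic on both sides
of `Σ`, is bounded by `C/(1+|z|)` and has the jump `M⁺G` (`exists_regularPart`). At the branch
points it is only known to be bounded, but single points do not matter in Cauchy's theorem for half
annuli, by dominated convergence. Cauchy's formula on each side (`contourIntegral_cauchy` and its
variants) then recovers the remainder from its jump. At `ξ_n` and `ξ_n^*` the same formula is read
in the column of `M` that has no pole there.

The last two conclusions are not obtained by expanding the Cauchy integral, which would ask for a
moment of `M⁺G`. The remainders on the two sides have the same, already known coefficient `a` of
`1/z`. This makes their difference `O(1/s²)`, so that `M⁺G` is integrable, and Cauchy's theorem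
gives `∫ M⁺G = -2πi a` (`SectionallyAnalytic.contourIntegral_sub`). Comparing coefficients yields
the expansion of `M`, and its entry `(2,1)` is the formula for `q`. -/

theorem differentiableOn_integral_of_dominated {α E : Type*} [MeasurableSpace α] {μ : Measure α}
    [NormedAddCommGroup E] [NormedSpace ℂ E] [CompleteSpace E] {U : Set ℂ} (hU : IsOpen U)
    {f : α → ℂ → E} {bound : α → ℝ}
    (hmeas : ∀ z ∈ U, AEStronglyMeasurable (fun y => f y z) μ)
    (hb : ∀ᵐ y ∂μ, ∀ z ∈ U, ‖f y z‖ ≤ bound y) (hbi : Integrable bound μ)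
    (hd : ∀ᵐ y ∂μ, DifferentiableOn ℂ (f y) U) :
    DifferentiableOn ℂ (fun z => ∫ y, f y z ∂μ) U := by
  intro z₀ hz₀
  obtain ⟨ε, hε, hball⟩ := Metric.isOpen_iff.1 hU z₀ hz₀
  have hε2 : 0 < ε / 2 := by positivity
  have hsub : ∀ z ∈ Metric.ball z₀ (ε / 2), Metric.closedBall z (ε / 2) ⊆ U := by
    intro z hz w hw
    apply hball
    rw [Metric.mem_ball] at *
    rw [Metric.mem_closedBall] at hw
    linarith [dist_triangle w z z₀]
  have hsubU : Metric.ball z₀ (ε / 2) ⊆ U :=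
    fun z hz => hsub z hz (Metric.mem_closedBall_self hε2.le)
  have hderiv : ∀ᵐ y ∂μ, ∀ z ∈ Metric.ball z₀ (ε / 2), HasDerivAt (f y) (deriv (f y) z) z := by
    filter_upwards [hd] with y hy z hz
    exact (hy.differentiableAt (hU.mem_nhds (hsubU hz))).hasDerivAt
  -- The derivative is measurable in `y` as an almost everywhere limit of difference quotients along
  -- a sequence that tends to `z₀`.
  have hF'meas : AEStronglyMeasurable (fun y => deriv (f y) z₀) μ := by
    have hseq : Tendsto (fun n : ℕ => z₀ + ((ε / 4 / (n + 1 : ℝ) : ℝ) : ℂ)) atTop (𝓝[≠] z₀) := by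
      refine tendsto_nhdsWithin_iff.2 ⟨?_, .of_forall fun n => ?_⟩
      · have h1 : Tendsto (fun n : ℕ => (ε / 4 / (n + 1 : ℝ))) atTop (𝓝 0) := by
          simpa [div_eq_mul_inv, mul_assoc] using
            (tendsto_one_div_add_atTop_nhds_zero_nat (𝕜 := ℝ)).const_mul (ε / 4)
        have h2 := (Complex.continuous_ofReal.tendsto 0).comp h1
        simpa [Function.comp_def] using h2.const_add z₀
      · have : (0 : ℝ) < ε / 4 / (n + 1 : ℝ) := by positivity
        simp only [mem_compl_iff, mem_singleton_iff, add_eq_left, Complex.ofReal_eq_zero]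
        exact this.ne'
    refine aestronglyMeasurable_of_tendsto_ae atTop
      (f := fun (n : ℕ) y => slope (f y) z₀ (z₀ + ((ε / 4 / (n + 1 : ℝ) : ℝ) : ℂ))) ?_ ?_
    · intro n
      simp only [slope_def_module]
      refine ((hmeas _ ?_).sub (hmeas _ hz₀)).const_smul _
      apply hball
      have hn : (0 : ℝ) < n + 1 := by positivity
      rw [Metric.mem_ball, dist_eq_norm, add_sub_cancel_left, Complex.norm_real, Real.norm_eq_abs,
        abs_of_pos (by positivity)]
      calc ε / 4 / (n + 1 : ℝ) ≤ ε / 4 := div_le_self (by positivity) (by linarith [n.cast_nonneg (α := ℝ)])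
        _ < ε := by linarith
    · filter_upwards [hderiv] with y hy
      exact (hasDerivAt_iff_tendsto_slope.1 (hy z₀ (Metric.mem_ball_self hε2))).comp hseq
  -- Cauchy's estimate on discs of radius `ε / 2` turns the bound for `f` into `bound y / (ε / 2)`
  -- for the derivative, so no hypothesis on the derivative is needed.
  have := hasDerivAt_integral_of_dominated_loc_of_deriv_le (μ := μ) (𝕜 := ℂ)
    (F := fun z y => f y z) (F' := fun z y => deriv (f y) z) (x₀ := z₀)
    (s := Metric.ball z₀ (ε / 2)) (bound := fun y => bound y / (ε / 2))
    (Metric.ball_mem_nhds _ hε2)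
    (by filter_upwards [hU.mem_nhds hz₀] with z hz using hmeas z hz)
    (by
      refine hbi.mono' (hmeas z₀ hz₀) ?_
      filter_upwards [hb] with y hy using hy z₀ hz₀)
    hF'meas
    (by
      filter_upwards [hb, hd] with y hy hdy z hz
      refine Complex.norm_deriv_le_of_forall_mem_sphere_norm_le hε2 ?_ ?_
      · refine (hdy.mono ?_).diffContOnCl
        rw [closure_ball _ hε2.ne']
        exact hsub z hz
      · intro w hw
        exact hy w (hsub z hz (Metric.sphere_subset_closedBall hw)))
    (hbi.div_const _) hderiv
  exact this.2.differentiableAt.differentiableWithinAt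

theorem setIntegral_Iic_hasDerivAt {E : Type*} [NormedAddCommGroup E] [NormedSpace ℝ E]
    [CompleteSpace E] {g : ℝ → E} (hg : Continuous g) (hi : ∀ x, IntegrableOn g (Iic x)) (x : ℝ) :
    HasDerivAt (fun x => ∫ y in Iic x, g y) (g x) x := by
  have h : (fun x => ∫ y in Iic x, g y) = fun x => (∫ y in Iic 0, g y) + ∫ y in (0 : ℝ)..x, g y := by
    funext x
    rw [intervalIntegral.integral_Iic_sub_Iic (hi 0) (hi x) |>.symm]
    abel
  rw [h]
  exact (intervalIntegral.integral_hasDerivAt_right (hg.intervalIntegrable _ _)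
    (hg.stronglyMeasurableAtFilter _ _) hg.continuousAt).const_add _

theorem tendsto_setIntegral_Iic_atBot {E : Type*} [NormedAddCommGroup E] [NormedSpace ℝ E]
    {g : ℝ → E} {X : ℝ} (hi : IntegrableOn g (Iic X)) :
    Tendsto (fun x => ∫ y in Iic x, g y) atBot (𝓝 0) := by
  have h := tendsto_integral_filter_of_dominated_convergence (μ := volume.restrict (Iic X))
    (F := fun x y => (Iic x).indicator g y) (f := fun _ => (0 : E)) (l := (atBot : Filter ℝ))
    (fun y => ‖g y‖) (.of_forall fun x => hi.aestronglyMeasurable.indicator measurableSet_Iic)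
    (.of_forall fun x => .of_forall fun y => norm_indicator_le_norm_self _ _) hi.norm
    (.of_forall fun y => by
      refine tendsto_const_nhds.congr' ?_
      filter_upwards [Iio_mem_atBot y] with x hx
      rw [indicator_of_notMem]
      exact notMem_Iic.2 (mem_Iio.1 hx))
  simp only [integral_zero] at h
  refine h.congr' ?_
  filter_upwards [Iic_mem_atBot X] with x hx
  rw [integral_indicator measurableSet_Iic, Measure.restrict_restrict measurableSet_Iic,
    inter_eq_left.2 (Iic_subset_Iic.2 hx)]

/-- With `K` the primitive of `κ` that vanishes at `-∞`, the integrand is the derivative of `e^{2K}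
/ 2`. The `2` in the exponent produces the factor `1/2`, which makes the Volterra operator a
contraction in the weighted norm without any smallness of `κ`. -/
theorem setIntegral_mul_exp_two_primitive {κ : ℝ → ℝ} (hκ : Continuous κ) (hκ0 : ∀ y, 0 ≤ κ y)
    (hκi : ∀ x, IntegrableOn κ (Iic x)) (x : ℝ) :
    IntegrableOn (fun y => κ y * Real.exp (2 * ∫ s in Iic y, κ s)) (Iic x) ∧
    ∫ y in Iic x, κ y * Real.exp (2 * ∫ s in Iic y, κ s) ≤ Real.exp (2 * ∫ s in Iic x, κ s) / 2 := by
  have hK := setIntegral_Iic_hasDerivAt hκ hκi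
  have hKc : Continuous fun x => ∫ y in Iic x, κ y :=
    continuous_iff_continuousAt.2 fun x => (hK x).continuousAt
  have hmono : ∀ y ≤ x, ∫ s in Iic y, κ s ≤ ∫ s in Iic x, κ s := fun y hy =>
    setIntegral_mono_set (hκi x) (.of_forall hκ0) (Iic_subset_Iic.2 hy).eventuallyLE
  have hint : IntegrableOn (fun y => κ y * Real.exp (2 * ∫ s in Iic y, κ s)) (Iic x) := by
    refine ((hκi x).mul_const (Real.exp (2 * ∫ s in Iic x, κ s))).mono'
      (by fun_prop) ?_
    filter_upwards [ae_restrict_mem measurableSet_Iic] with y hy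
    rw [Real.norm_eq_abs, abs_of_nonneg (mul_nonneg (hκ0 y) (Real.exp_nonneg _))]
    have := hmono y hy
    gcongr
    exact hκ0 y
  refine ⟨hint, ?_⟩
  have hd : ∀ y ∈ Iic x, HasDerivAt (fun y => Real.exp (2 * ∫ s in Iic y, κ s) / 2)
      (κ y * Real.exp (2 * ∫ s in Iic y, κ s)) y := by
    intro y _
    refine (((hK y).const_mul 2).exp.div_const 2).congr_deriv ?_
    ring
  have hlim : Tendsto (fun y => Real.exp (2 * ∫ s in Iic y, κ s) / 2) atBot (𝓝 (1 / 2)) := by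
    have h := tendsto_setIntegral_Iic_atBot (hκi x)
    have h2 := (Real.continuous_exp.tendsto _).comp (h.const_mul 2)
    simpa [Function.comp_def] using h2.div_const 2
  rw [integral_Iic_of_hasDerivAt_of_tendsto' hd hint hlim]
  linarith

/-- Assumptions on a nonlinear Volterra kernel on `(-∞, x]` which depends on a complex parameter. -/
structure IsVolterraKernel {E : Type*} [NormedAddCommGroup E] [NormedSpace ℂ E] (Ω U : Set ℂ)
    (N : ℝ → ℝ → ℂ → E → E) (a κ : ℝ → ℝ) : Prop where
  isOpen : IsOpen U
  subset : U ⊆ Ω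
  mono_a : Monotone a
  one_le_a : ∀ x, 1 ≤ a x
  cont_κ : Continuous κ
  nonneg_κ : ∀ y, 0 ≤ κ y
  int_κ : ∀ x, IntegrableOn κ (Iic x)
  zero : ∀ x y z, N x y z 0 = 0
  lip : ∀ x y, y ≤ x → ∀ z ∈ Ω, ∀ e e', ‖N x y z e - N x y z e'‖ ≤ a x * (κ y / a y) * ‖e - e'‖
  cont : ∀ z ∈ Ω, Continuous fun p : ℝ × ℝ × E => N p.1 p.2.1 z p.2.2
  cont_param : ∀ x y, ContinuousOn (fun p : ℂ × E => N x y p.1 p.2) (Ω ×ˢ univ)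
  diff_param : ∀ x y, DifferentiableOn ℂ (fun p : ℂ × E => N x y p.1 p.2) (U ×ˢ univ)

/-- The exponential weight that controls the solutions of a Volterra equation. -/
noncomputable def volterraWeight (a κ : ℝ → ℝ) (x : ℝ) : ℝ := a x * Real.exp (2 * ∫ s in Iic x, κ s)

/-- Continuity, holomorphy and growth of a family of functions on the line. -/
structure IsVolterraFamily {E : Type*} [NormedAddCommGroup E] [NormedSpace ℂ E] (Ω U : Set ℂ)
    (a κ : ℝ → ℝ) (B : ℝ) (g : ℝ → ℂ → E) : Prop where
  cont : ∀ z ∈ Ω, Continuous fun x => g x z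
  cont_param : ∀ x, ContinuousOn (g x) Ω
  diff_param : ∀ x, DifferentiableOn ℂ (g x) U
  bound : ∀ z ∈ Ω, ∀ x, ‖g x z‖ ≤ B * volterraWeight a κ x

namespace IsVolterraKernel

variable {E : Type*} [NormedAddCommGroup E] [NormedSpace ℂ E] {Ω U : Set ℂ}
  {N : ℝ → ℝ → ℂ → E → E} {a κ : ℝ → ℝ}

theorem norm_le (h : IsVolterraKernel Ω U N a κ) {x y : ℝ} (hy : y ≤ x) {z : ℂ} (hz : z ∈ Ω)
    (e : E) : ‖N x y z e‖ ≤ a x * (κ y / a y) * ‖e‖ := by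
  simpa [h.zero] using h.lip x y hy z hz e 0

theorem weight_nonneg (h : IsVolterraKernel Ω U N a κ) (x : ℝ) : 0 ≤ volterraWeight a κ x :=
  mul_nonneg (zero_le_one.trans (h.one_le_a x)) (Real.exp_nonneg _)

theorem integral_mono (h : IsVolterraKernel Ω U N a κ) {x y : ℝ} (hy : y ≤ x) :
    ∫ s in Iic y, κ s ≤ ∫ s in Iic x, κ s :=
  setIntegral_mono_set (h.int_κ x) (.of_forall h.nonneg_κ) (Iic_subset_Iic.2 hy).eventuallyLE

theorem weight_mono (h : IsVolterraKernel Ω U N a κ) : Monotone (volterraWeight a κ) := by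
  intro y x hy
  have h1 := h.mono_a hy
  have h2 := h.integral_mono hy
  have := h.one_le_a y
  have := h.one_le_a x
  unfold volterraWeight
  gcongr

theorem one_le_weight (h : IsVolterraKernel Ω U N a κ) (x : ℝ) : 1 ≤ volterraWeight a κ x := by
  have h1 := h.one_le_a x
  have h2 : 1 ≤ Real.exp (2 * ∫ s in Iic x, κ s) := by
    apply Real.one_le_exp
    have := setIntegral_nonneg (μ := volume) (s := Iic x) measurableSet_Iic fun y _ => h.nonneg_κ y
    positivity
  exact one_le_mul_of_one_le_of_one_le h1 h2

theorem integrand_le (h : IsVolterraKernel Ω U N a κ) {x y : ℝ} (hy : y ≤ x) {z : ℂ} (hz : z ∈ Ω)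
    {B : ℝ} {e : E} (he : ‖e‖ ≤ B * volterraWeight a κ y) :
    ‖N x y z e‖ ≤ B * a x * (κ y * Real.exp (2 * ∫ s in Iic y, κ s)) := by
  have hay : 0 < a y := zero_lt_one.trans_le (h.one_le_a y)
  have hax : 0 < a x := zero_lt_one.trans_le (h.one_le_a x)
  refine (h.norm_le hy hz e).trans ?_
  refine (mul_le_mul_of_nonneg_left he
    (mul_nonneg hax.le (div_nonneg (h.nonneg_κ y) hay.le))).trans_eq ?_
  unfold volterraWeight
  field_simp

theorem diff_integrand_le (h : IsVolterraKernel Ω U N a κ) {x y : ℝ} (hy : y ≤ x) {z : ℂ}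
    (hz : z ∈ Ω) {B : ℝ} {e e' : E} (he : ‖e - e'‖ ≤ B * volterraWeight a κ y) :
    ‖N x y z e - N x y z e'‖ ≤ B * a x * (κ y * Real.exp (2 * ∫ s in Iic y, κ s)) := by
  have hay : 0 < a y := zero_lt_one.trans_le (h.one_le_a y)
  have hax : 0 < a x := zero_lt_one.trans_le (h.one_le_a x)
  refine (h.lip x y hy z hz e e').trans ?_
  refine (mul_le_mul_of_nonneg_left he
    (mul_nonneg hax.le (div_nonneg (h.nonneg_κ y) hay.le))).trans_eq ?_
  unfold volterraWeight
  field_simp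

theorem majorant_integrableOn (h : IsVolterraKernel Ω U N a κ) (c x : ℝ) :
    IntegrableOn (fun y => c * (κ y * Real.exp (2 * ∫ s in Iic y, κ s))) (Iic x) :=
  (setIntegral_mul_exp_two_primitive h.cont_κ h.nonneg_κ h.int_κ x).1.const_mul c

theorem integrand_continuous (h : IsVolterraKernel Ω U N a κ) {B : ℝ} {g : ℝ → ℂ → E}
    (hg : IsVolterraFamily Ω U a κ B g) (x : ℝ) {z : ℂ} (hz : z ∈ Ω) :
    Continuous fun y => N x y z (g y z) :=
  (h.cont z hz).comp (continuous_const.prodMk (continuous_id.prodMk (hg.cont z hz)))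

theorem integrand_integrableOn (h : IsVolterraKernel Ω U N a κ) {B : ℝ} {g : ℝ → ℂ → E}
    (hg : IsVolterraFamily Ω U a κ B g) (x : ℝ) {z : ℂ} (hz : z ∈ Ω) :
    IntegrableOn (fun y => N x y z (g y z)) (Iic x) := by
  refine (h.majorant_integrableOn (B * a x) x).mono'
    (h.integrand_continuous hg x hz).aestronglyMeasurable ?_
  filter_upwards [ae_restrict_mem measurableSet_Iic] with y hy
  exact h.integrand_le hy hz (hg.bound z hz y)

/-- The contraction estimate: integration halves the constant in a bound by the weight `a e^{2K}`.
The factor `a y` of the input has already cancelled against `κ y / a y` in the Lipschitz constant.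
-/
theorem norm_integral_le (h : IsVolterraKernel Ω U N a κ) {B x : ℝ} (hB : 0 ≤ B) {F : ℝ → E}
    (hF : ∀ y ≤ x, ‖F y‖ ≤ B * a x * (κ y * Real.exp (2 * ∫ s in Iic y, κ s))) :
    ‖∫ y in Iic x, F y‖ ≤ B / 2 * volterraWeight a κ x := by
  have hax : 0 ≤ a x := zero_le_one.trans (h.one_le_a x)
  refine (norm_integral_le_of_norm_le (h.majorant_integrableOn (B * a x) x) ?_).trans ?_
  · filter_upwards [ae_restrict_mem measurableSet_Iic] with y hy using hF y hy
  · rw [integral_const_mul]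
    have := (setIntegral_mul_exp_two_primitive h.cont_κ h.nonneg_κ h.int_κ x).2
    calc _ ≤ B * a x * (Real.exp (2 * ∫ s in Iic x, κ s) / 2) := by gcongr
      _ = _ := by unfold volterraWeight; ring

/-- One Picard step preserves regularity and the bound `B`: the inhomogeneity uses one half of `B`,
the integral the other. -/
theorem family_map [CompleteSpace E] (h : IsVolterraKernel Ω U N a κ) {B : ℝ} (hB : 0 ≤ B) {g : ℝ → ℂ → E}
    (hg : IsVolterraFamily Ω U a κ B g) {f₀ : E} (hf₀ : ‖f₀‖ ≤ B / 2) :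
    IsVolterraFamily Ω U a κ B fun x z => f₀ + ∫ y in Iic x, N x y z (g y z) where
  cont z hz := by
    refine continuous_const.add (continuous_iff_continuousAt.2 fun x₀ => ?_)
    -- The moving end point is absorbed into an indicator on a fixed half-line. The new integrand is
    -- continuous in `x` at `x₀` for every `y ≠ x₀`, which suffices for dominated convergence.
    have heq : ∀ x < x₀ + 1, ∫ y in Iic x, N x y z (g y z) =
        ∫ y in Iic (x₀ + 1), (Iic x).indicator (fun y => N x y z (g y z)) y := by
      intro x hx
      rw [integral_indicator measurableSet_Iic, Measure.restrict_restrict measurableSet_Iic,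
        inter_eq_left.2 (Iic_subset_Iic.2 hx.le)]
    refine ContinuousAt.congr ?_ (f := fun x => ∫ y in Iic (x₀ + 1),
      (Iic x).indicator (fun y => N x y z (g y z)) y) ?_
    · refine continuousAt_of_dominated (bound := fun y => B * a (x₀ + 1) *
        (κ y * Real.exp (2 * ∫ s in Iic y, κ s))) ?_ ?_ (h.majorant_integrableOn _ _) ?_
      · exact .of_forall fun x =>
          ((h.integrand_continuous hg x hz).aestronglyMeasurable).indicator measurableSet_Iic
      · filter_upwards [Iio_mem_nhds (lt_add_one x₀)] with x hx
        refine .of_forall fun y => ?_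
        have hpos : 0 ≤ κ y * Real.exp (2 * ∫ s in Iic y, κ s) :=
          mul_nonneg (h.nonneg_κ y) (Real.exp_nonneg _)
        have hmono : a x ≤ a (x₀ + 1) := h.mono_a (le_of_lt hx)
        have hax : 0 ≤ a (x₀ + 1) := zero_le_one.trans (h.one_le_a _)
        by_cases hy : y ∈ Iic x
        · rw [indicator_of_mem hy]
          refine (h.integrand_le hy hz (hg.bound z hz y)).trans ?_
          gcongr
        · rw [indicator_of_notMem hy, norm_zero]
          positivity
      · have : ∀ᵐ y ∂(volume.restrict (Iic (x₀ + 1))), y ≠ x₀ :=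
          ae_restrict_of_ae (by simp [ae_iff, measure_singleton])
        filter_upwards [this] with y hy
        have hc : Continuous fun x => N x y z (g y z) :=
          (h.cont z hz).comp (continuous_id.prodMk (continuous_const.prodMk continuous_const))
        rcases lt_or_gt_of_ne hy with hlt | hgt
        · refine hc.continuousAt.congr ?_
          filter_upwards [Ioi_mem_nhds hlt] with x hx
          rw [indicator_of_mem (mem_Iic.2 (le_of_lt (mem_Ioi.1 hx)))]
        · refine (continuousAt_const (y := (0 : E))).congr ?_
          filter_upwards [Iio_mem_nhds hgt] with x hx
          rw [indicator_of_notMem (notMem_Iic.2 (mem_Iio.1 hx))]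
    · filter_upwards [Iio_mem_nhds (lt_add_one x₀)] with x hx using (heq x hx).symm
  cont_param x := by
    refine continuousOn_const.add fun z₀ hz₀ => ?_
    refine continuousWithinAt_of_dominated (bound := fun y => B * a x *
        (κ y * Real.exp (2 * ∫ s in Iic y, κ s))) ?_ ?_ (h.majorant_integrableOn _ _) ?_
    · filter_upwards [self_mem_nhdsWithin] with z hz
      exact (h.integrand_continuous hg x hz).aestronglyMeasurable
    · filter_upwards [self_mem_nhdsWithin] with z hz
      filter_upwards [ae_restrict_mem measurableSet_Iic] with y hy
      exact h.integrand_le hy hz (hg.bound z hz y)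
    · refine .of_forall fun y => ?_
      have h1 := h.cont_param x y (z₀, g y z₀) ⟨hz₀, mem_univ _⟩
      exact ContinuousWithinAt.comp (f := fun z => (z, g y z)) (x := z₀) (s := Ω) h1
        (continuousWithinAt_id.prodMk (hg.cont_param y z₀ hz₀)) fun z hz => ⟨hz, mem_univ _⟩
  diff_param x := by
    refine (differentiableOn_const _).add ?_
    refine differentiableOn_integral_of_dominated h.isOpen (bound := fun y => B * a x *
        (κ y * Real.exp (2 * ∫ s in Iic y, κ s))) ?_ ?_ (h.majorant_integrableOn _ _) ?_
    · intro z hz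
      exact (h.integrand_continuous hg x (h.subset hz)).aestronglyMeasurable
    · filter_upwards [ae_restrict_mem measurableSet_Iic] with y hy z hz
      exact h.integrand_le hy (h.subset hz) (hg.bound z (h.subset hz) y)
    · refine .of_forall fun y => ?_
      exact DifferentiableOn.comp (f := fun z => (z, g y z)) (s := U) (h.diff_param x y)
        (differentiableOn_id.prodMk (hg.diff_param y)) fun z hz => ⟨hz, mem_univ _⟩
  bound z hz x := by
    have h1 := h.norm_integral_le (x := x) hB (F := fun y => N x y z (g y z))
      fun y hy => h.integrand_le hy hz (hg.bound z hz y)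
    have h2 := h.one_le_weight x
    calc _ ≤ ‖f₀‖ + ‖∫ y in Iic x, N x y z (g y z)‖ := norm_add_le _ _
      _ ≤ B / 2 * volterraWeight a κ x + B / 2 * volterraWeight a κ x := by
        gcongr
        nlinarith
      _ = _ := by ring

theorem solution_tendsto [CompleteSpace E] (h : IsVolterraKernel Ω U N a κ) {B : ℝ} (hB : 0 ≤ B)
    {f : ℝ → ℂ → E} {f₀ : E} (hf : IsVolterraFamily Ω U a κ B f) {z : ℂ} (hz : z ∈ Ω)
    (heq : ∀ x, f x z = f₀ + ∫ y in Iic x, N x y z (f y z)) :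
    Tendsto (fun x => f x z) atBot (𝓝 f₀) := by
  rw [tendsto_iff_norm_sub_tendsto_zero]
  have h0 := tendsto_setIntegral_Iic_atBot (h.majorant_integrableOn (B * a 0) 0)
  refine squeeze_zero' (.of_forall fun x => norm_nonneg _) ?_ h0
  filter_upwards [Iic_mem_atBot 0] with x hx
  rw [heq x, add_sub_cancel_left]
  refine norm_integral_le_of_norm_le (h.majorant_integrableOn _ _) ?_
  filter_upwards [ae_restrict_mem measurableSet_Iic] with y hy
  refine (h.integrand_le hy hz (hf.bound z hz y)).trans ?_
  have hmono : a x ≤ a 0 := h.mono_a hx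
  have hpos : 0 ≤ κ y * Real.exp (2 * ∫ s in Iic y, κ s) :=
    mul_nonneg (h.nonneg_κ y) (Real.exp_nonneg _)
  gcongr

/-- Picard iteration from the constant `f₀`. Successive differences are at most `B / 2ⁿ` times the
weight, uniformly for `z ∈ Ω` and, the weight being monotone, for `x` in left half-lines; hence
continuity in each variable and holomorphy in `z` survive the limit. -/
theorem exists_solution [CompleteSpace E] (h : IsVolterraKernel Ω U N a κ) (f₀ : E) :
    ∃ f : ℝ → ℂ → E, IsVolterraFamily Ω U a κ (2 * ‖f₀‖) f ∧
      ∀ z ∈ Ω, ∀ x, f x z = f₀ + ∫ y in Iic x, N x y z (f y z) := by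
  set B := 2 * ‖f₀‖ with hBdef
  have hB : 0 ≤ B := by positivity
  let T : (ℝ → ℂ → E) → (ℝ → ℂ → E) := fun g x z => f₀ + ∫ y in Iic x, N x y z (g y z)
  let s : ℕ → ℝ → ℂ → E := fun n => T^[n] fun _ _ => f₀
  have hs_succ : ∀ n x z, s (n + 1) x z = f₀ + ∫ y in Iic x, N x y z (s n y z) := by
    intro n x z
    simp only [s, Function.iterate_succ_apply']
    rfl
  have hs : ∀ n, IsVolterraFamily Ω U a κ B (s n) := by
    intro n
    induction n with
    | zero =>
      refine ⟨fun z _ => continuous_const, fun x => continuousOn_const,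
        fun x => differentiableOn_const _, fun z _ x => ?_⟩
      have := h.one_le_weight x
      change ‖f₀‖ ≤ _
      nlinarith [norm_nonneg f₀]
    | succ n ih =>
      have := h.family_map hB ih (f₀ := f₀) (by rw [hBdef]; linarith)
      have heq : s (n + 1) = fun x z => f₀ + ∫ y in Iic x, N x y z (s n y z) := by
        funext x z; exact hs_succ n x z
      rwa [heq]
  have hint : ∀ n x, ∀ z ∈ Ω, IntegrableOn (fun y => N x y z (s n y z)) (Iic x) :=
    fun n x z hz => h.integrand_integrableOn (hs n) x hz
  have hstep : ∀ n, ∀ z ∈ Ω, ∀ x, ‖s (n + 1) x z - s n x z‖ ≤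
      B / 2 ^ n * volterraWeight a κ x := by
    intro n
    induction n with
    | zero =>
      intro z hz x
      rw [hs_succ]
      change ‖f₀ + _ - f₀‖ ≤ _
      rw [add_sub_cancel_left]
      refine (h.norm_integral_le hB fun y hy =>
        h.integrand_le hy hz ((hs 0).bound z hz y)).trans ?_
      have := h.weight_nonneg x
      rw [pow_zero, div_one]
      gcongr
      linarith
    | succ n ih =>
      intro z hz x
      rw [hs_succ (n + 1), hs_succ n, add_sub_add_left_eq_sub,
        ← integral_sub (hint _ x z hz) (hint _ x z hz)]
      refine (h.norm_integral_le (B := B / 2 ^ n) (by positivity) fun y hy =>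
        h.diff_integrand_le hy hz (ih z hz y)).trans_eq ?_
      rw [pow_succ]; ring
  have hdist : ∀ z ∈ Ω, ∀ x n, dist (s n x z) (s (n + 1) x z) ≤
      2 * B * volterraWeight a κ x / 2 / 2 ^ n := by
    intro z hz x n
    rw [dist_comm, dist_eq_norm]
    refine (hstep n z hz x).trans_eq (by ring)
  have hlim : ∀ x z, ∃ l, z ∈ Ω → Tendsto (fun n => s n x z) atTop (𝓝 l) := by
    intro x z
    by_cases hz : z ∈ Ω
    · obtain ⟨l, hl⟩ := cauchySeq_tendsto_of_complete (cauchySeq_of_le_geometric_two (hdist z hz x))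
      exact ⟨l, fun _ => hl⟩
    · exact ⟨0, fun h => absurd h hz⟩
  choose f hf using hlim
  have hrate : ∀ z ∈ Ω, ∀ x n, ‖s n x z - f x z‖ ≤ 2 * B / 2 ^ n * volterraWeight a κ x := by
    intro z hz x n
    rw [← dist_eq_norm]
    refine (dist_le_of_le_geometric_two_of_tendsto (hdist z hz x) (hf x z hz) n).trans_eq (by ring)
  have hgeom : ∀ c : ℝ, Tendsto (fun n : ℕ => 2 * B / 2 ^ n * c) atTop (𝓝 0) := by
    intro c
    have h1 := (tendsto_pow_atTop_nhds_zero_of_lt_one (r := (1 / 2 : ℝ)) (by norm_num)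
      (by norm_num)).const_mul (2 * B * c)
    rw [mul_zero] at h1
    refine h1.congr fun n => ?_
    rw [div_pow, one_pow]; ring
  have hunif : ∀ x, TendstoUniformlyOn (fun n z => s n x z) (f x) atTop Ω := by
    intro x
    rw [Metric.tendstoUniformlyOn_iff]
    intro ε hε
    filter_upwards [(hgeom (volterraWeight a κ x)).eventually_lt_const hε] with n hn z hz
    rw [dist_comm, dist_eq_norm]
    exact (hrate z hz x n).trans_lt hn
  have hfam : IsVolterraFamily Ω U a κ B f := by
    refine ⟨fun z hz => ?_, fun x => ?_, fun x => ?_, fun z hz x => ?_⟩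
    · refine continuous_iff_continuousAt.2 fun x => ?_
      have : ContinuousOn (fun x => f x z) (Iic (x + 1)) := by
        refine TendstoUniformlyOn.continuousOn (F := fun n x => s n x z) (p := atTop) ?_
          (Frequently.of_forall fun n => ((hs n).cont z hz).continuousOn)
        rw [Metric.tendstoUniformlyOn_iff]
        intro ε hε
        filter_upwards [(hgeom (volterraWeight a κ (x + 1))).eventually_lt_const hε] with n hn y hy
        rw [dist_comm, dist_eq_norm]
        refine (hrate z hz y n).trans_lt (lt_of_le_of_lt ?_ hn)
        have := h.weight_mono hy
        gcongr
      exact this.continuousAt (Iic_mem_nhds (lt_add_one x))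
    · exact (hunif x).continuousOn (Frequently.of_forall fun n => (hs n).cont_param x)
    · exact (((hunif x).mono h.subset).tendstoLocallyUniformlyOn).differentiableOn
        (.of_forall fun n => (hs n).diff_param x) h.isOpen
    · exact le_of_tendsto (hf x z hz).norm (.of_forall fun n => (hs n).bound z hz x)
  refine ⟨f, hfam, fun z hz x => ?_⟩
  refine tendsto_nhds_unique ((tendsto_add_atTop_iff_nat 1).2 (hf x z hz)) ?_
  simp only [hs_succ]
  refine tendsto_const_nhds.add ?_
  refine tendsto_integral_of_dominated_convergence (fun y => B * a x *
        (κ y * Real.exp (2 * ∫ s in Iic y, κ s))) ?_ (h.majorant_integrableOn _ _) ?_ ?_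
  · exact fun n => (h.integrand_continuous (hs n) x hz).aestronglyMeasurable
  · intro n
    filter_upwards [ae_restrict_mem measurableSet_Iic] with y hy
    exact h.integrand_le hy hz ((hs n).bound z hz y)
  · refine .of_forall fun y => ?_
    have hc : Continuous fun e => N x y z e :=
      (h.cont z hz).comp (continuous_const.prodMk (continuous_const.prodMk continuous_id))
    exact (hc.tendsto _).comp (hf y z hz)

end IsVolterraKernel

end Volterra

/-! ### The Volterra kernel of the column `μ₋₂`, uniformly up to the branch points. -/

namespace NZBCData

open Set

variable (P : NZBCData)

/-- The standing assumptions on the potential at time `t`. -/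
structure Admissible (t : ℝ) : Prop where
  pos : 0 < P.q₀
  norm_qm : ‖P.qm‖ = P.q₀
  norm_qp : ‖P.qp‖ = P.q₀
  lim_m : Tendsto (fun x => P.q x t) atBot (𝓝 P.qm)
  lim_p : Tendsto (fun x => P.q x t) atTop (𝓝 P.qp)
  smooth : ContDiff ℝ 2 fun x => P.q x t
  int_m : IntegrableOn (fun x => (1 + |x|) * ‖P.q x t - P.qm‖) (Iic 0)
  int_p : IntegrableOn (fun x => (1 + |x|) * ‖P.q x t - P.qp‖) (Ici 0)
  int_1 : Integrable (deriv fun x => P.q x t)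
  int_2 : Integrable (deriv (deriv fun x => P.q x t))

/-- `D⁺ ∪ Σ` without the origin and the branch points `± i q₀`. -/
def Omega : Set ℂ :=
  {z | z ≠ 0 ∧ z ^ 2 ≠ -(P.q₀ : ℂ) ^ 2 ∧ 0 ≤ (‖z‖ ^ 2 - P.q₀ ^ 2) * z.im}

variable {P}

/-- The reason for the form of `D⁺` and `D⁻`: they are the regions `Im λ > 0` and `Im λ < 0`. -/
theorem lam_im {z : ℂ} (hz : z ≠ 0) :
    (P.lam z).im = (‖z‖ ^ 2 - P.q₀ ^ 2) * z.im / (2 * ‖z‖ ^ 2) := by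
  have hn : ‖z‖ ^ 2 ≠ 0 := by simpa using hz
  have h1 : ((P.q₀ : ℂ) ^ 2 / z).im = -(P.q₀ ^ 2 * z.im) / ‖z‖ ^ 2 := by
    rw [Complex.div_im, ← Complex.ofReal_pow, Complex.ofReal_im, Complex.ofReal_re,
      Complex.normSq_eq_norm_sq]
    ring
  have h2 : (P.lam z).im = (z.im + ((P.q₀ : ℂ) ^ 2 / z).im) / 2 := by
    unfold lam
    rw [show (z + (P.q₀ : ℂ) ^ 2 / z) / 2 = (z + (P.q₀ : ℂ) ^ 2 / z) / ((2 : ℝ) : ℂ) by norm_num,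
      Complex.div_ofReal_im, Complex.add_im]
  rw [h2, h1]
  field_simp
  ring

theorem Omega.lam_im_nonneg {z : ℂ} (hz : z ∈ P.Omega) : 0 ≤ (P.lam z).im := by
  rw [lam_im hz.1]
  exact div_nonneg hz.2.2 (by positivity)

theorem gam_eq_lam {z : ℂ} (hz : z ≠ 0) : P.gam z = 2 * P.lam z / z := by
  unfold gam lam
  field_simp

theorem lam_ne_zero {z : ℂ} (hz : z ≠ 0) (hz' : z ^ 2 ≠ -(P.q₀ : ℂ) ^ 2) : P.lam z ≠ 0 := by
  intro h
  unfold lam at h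
  apply hz'
  field_simp at h
  linear_combination h

theorem gam_ne_zero {z : ℂ} (hz : z ≠ 0) (hz' : z ^ 2 ≠ -(P.q₀ : ℂ) ^ 2) : P.gam z ≠ 0 := by
  rw [gam_eq_lam hz]
  exact div_ne_zero (mul_ne_zero two_ne_zero (lam_ne_zero hz hz')) hz

theorem isOpen_Dplus : IsOpen P.Dplus := by
  refine isOpen_lt continuous_const ?_
  exact ((continuous_norm.pow 2).sub continuous_const).mul Complex.continuous_im

theorem isOpen_Dminus : IsOpen P.Dminus := by
  refine isOpen_lt ?_ continuous_const
  exact ((continuous_norm.pow 2).sub continuous_const).mul Complex.continuous_im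

theorem ne_zero_of_im_ne {z : ℂ} (h : (‖z‖ ^ 2 - P.q₀ ^ 2) * z.im ≠ 0) :
    z ≠ 0 ∧ z ^ 2 ≠ -(P.q₀ : ℂ) ^ 2 := by
  refine ⟨?_, fun h2 => h ?_⟩
  · rintro rfl; simp at h
  · have h3 : ‖z ^ 2‖ = ‖-(P.q₀ : ℂ) ^ 2‖ := by rw [h2]
    rw [norm_neg, norm_pow, norm_pow, Complex.norm_real, Real.norm_eq_abs, sq_abs] at h3
    rw [h3, sub_self, zero_mul]

theorem Dplus_subset_Omega : P.Dplus ⊆ P.Omega := fun _ hz =>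
  ⟨(ne_zero_of_im_ne (P := P) (ne_of_gt hz)).1, (ne_zero_of_im_ne (P := P) (ne_of_gt hz)).2, le_of_lt hz⟩

/-- Mean value inequality on the convex half-plane where `|exp| ≤ 1`. It bounds `(e^{2iλ(x-y)} -
1)/(2λ)` by `x - y` however small `λ` is. -/
theorem norm_exp_sub_one_le_of_re_nonpos {w : ℂ} (hw : w.re ≤ 0) : ‖Complex.exp w - 1‖ ≤ ‖w‖ := by
  have h := (convex_halfSpace_re_le 0).norm_image_sub_le_of_norm_hasDerivWithin_le
    (f := Complex.exp) (f' := Complex.exp) (C := 1) (x := 0) (y := w)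
    (fun x _ => (Complex.hasDerivAt_exp x).hasDerivWithinAt)
    (fun x hx => by
      rw [Complex.norm_exp]
      exact Real.exp_le_one_iff.2 hx) (by simp) hw
  simpa using h

theorem Admissible.exists_bound {t : ℝ} (h : P.Admissible t) : ∃ M, 0 ≤ M ∧ ∀ x, ‖P.q x t‖ ≤ M := by
  have hc : Continuous fun x => ‖P.q x t‖ := h.smooth.continuous.norm
  obtain ⟨a, ha⟩ := eventually_atBot.1
    (h.lim_m.norm.eventually_lt_const (lt_add_one ‖P.qm‖))
  obtain ⟨b, hb⟩ := eventually_atTop.1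
    (h.lim_p.norm.eventually_lt_const (lt_add_one ‖P.qp‖))
  obtain ⟨C, hC⟩ := isCompact_Icc.exists_bound_of_continuousOn (s := Icc a b) hc.continuousOn
  refine ⟨max (max (‖P.qm‖ + 1) (‖P.qp‖ + 1)) C, ?_, fun x => ?_⟩
  · exact le_max_of_le_left (le_max_of_le_left (by positivity))
  · rcases le_total x a with hx | hx
    · exact le_max_of_le_left (le_max_of_le_left (ha x hx).le)
    · rcases le_total b x with hx' | hx'
      · exact le_max_of_le_left (le_max_of_le_right (hb x hx').le)
      · have := hC x ⟨hx, hx'⟩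
        rw [norm_norm] at this
        exact le_max_of_le_right this

theorem Admissible.int_weight {t : ℝ} (h : P.Admissible t) (x : ℝ) :
    IntegrableOn (fun y => (1 + |y|) * ‖P.q y t - P.qm‖) (Iic x) := by
  have hc : Continuous fun y => (1 + |y|) * ‖P.q y t - P.qm‖ := by
    have := h.smooth.continuous
    fun_prop
  have h2 : IntegrableOn (fun y => (1 + |y|) * ‖P.q y t - P.qm‖) (Icc 0 x) :=
    hc.continuousOn.integrableOn_compact isCompact_Icc
  refine (h.int_m.union h2).mono_set fun y hy => ?_
  rcases le_total y 0 with h0 | h0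
  · exact Or.inl h0
  · exact Or.inr ⟨h0, hy⟩

variable (P)

/-- The source term of the Volterra equation for the first component. -/
noncomputable def jostSource (t y : ℝ) (z : ℂ) (e : ℂ × ℂ) : ℂ :=
  Complex.I * conj (P.q y t - P.qm) * e.2
    + Complex.I * (conj P.qm / z) * (P.q y t - P.qm) * (e.1 - conj P.qm / z * e.2)

/-- The kernel of the Volterra equation, in the unknowns `(μ₁ + (q₋^* / z) μ₂, μ₂)`. -/
noncomputable def jostKernel (t x y : ℝ) (z : ℂ) (e : ℂ × ℂ) : ℂ × ℂ :=
  (Complex.exp (2 * Complex.I * P.lam z * (x - y)) * P.jostSource t y z e,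
    P.qm / (2 * P.lam z) * (Complex.exp (2 * Complex.I * P.lam z * (x - y)) - 1)
        * P.jostSource t y z e
      + Complex.I * (P.q y t - P.qm) * (e.1 - conj P.qm / z * e.2))

variable {P}

theorem jostKernel_sub (t x y : ℝ) (z : ℂ) (e e' : ℂ × ℂ) :
    P.jostKernel t x y z e - P.jostKernel t x y z e' = P.jostKernel t x y z (e - e') := by
  ext <;> simp only [jostKernel, jostSource, Prod.fst_sub, Prod.snd_sub] <;> ring

/-- No inverse power of `λ` is left: the price for uniformity near `±i q₀` is the linear growth `1 +
(x - y)`. The constant `c` only requires a distance from the origin. -/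
theorem jostKernel_norm_le {t x y : ℝ} (hy : y ≤ x) {z : ℂ} (hz : z ∈ P.Omega) {c : ℝ}
    (hc : ‖conj P.qm / z‖ ≤ c) (e : ℂ × ℂ) :
    ‖P.jostKernel t x y z e‖ ≤
      (1 + ‖P.qm‖) * (1 + c + c ^ 2) * (1 + (x - y)) * ‖P.q y t - P.qm‖ * ‖e‖ := by
  have hl := lam_ne_zero hz.1 hz.2.1
  have hc0 : 0 ≤ c := (norm_nonneg _).trans hc
  set d := ‖P.q y t - P.qm‖ with hd
  have hd0 : 0 ≤ d := norm_nonneg _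
  have hs : 0 ≤ x - y := sub_nonneg.2 hy
  have he1 : ‖e.1‖ ≤ ‖e‖ := norm_fst_le e
  have he2 : ‖e.2‖ ≤ ‖e‖ := norm_snd_le e
  have hm : ‖e.1 - conj P.qm / z * e.2‖ ≤ (1 + c) * ‖e‖ := by
    refine (norm_sub_le _ _).trans ?_
    rw [norm_mul]
    nlinarith [mul_le_mul hc he2 (norm_nonneg _) hc0]
  have hF : ‖P.jostSource t y z e‖ ≤ (1 + c + c ^ 2) * d * ‖e‖ := by
    unfold jostSource
    refine (norm_add_le _ _).trans ?_
    rw [norm_mul, norm_mul, norm_mul, norm_mul, norm_mul, RCLike.norm_conj, Complex.norm_I,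
      ← hd, one_mul, one_mul]
    calc d * ‖e.2‖ + ‖conj P.qm / z‖ * d * ‖e.1 - conj P.qm / z * e.2‖
        ≤ d * ‖e‖ + c * d * ((1 + c) * ‖e‖) := by gcongr
      _ = _ := by ring
  have hre : (2 * Complex.I * P.lam z * ((x : ℂ) - y)).re ≤ 0 := by
    have : (2 * Complex.I * P.lam z * ((x : ℂ) - y)).re = -(2 * (P.lam z).im * (x - y)) := by
      rw [← Complex.ofReal_sub, Complex.re_mul_ofReal]
      simp
    rw [this]
    have := Omega.lam_im_nonneg hz
    have : 0 ≤ 2 * (P.lam z).im * (x - y) := by positivity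
    linarith
  have hexp : ‖Complex.exp (2 * Complex.I * P.lam z * (x - y))‖ ≤ 1 := by
    rw [Complex.norm_exp]
    exact Real.exp_le_one_iff.2 hre
  have hphi : ‖P.qm / (2 * P.lam z) * (Complex.exp (2 * Complex.I * P.lam z * (x - y)) - 1)‖
      ≤ ‖P.qm‖ * (x - y) := by
    have h1 := norm_exp_sub_one_le_of_re_nonpos hre
    have h2 : ‖2 * Complex.I * P.lam z * ((x : ℂ) - y)‖ = 2 * ‖P.lam z‖ * (x - y) := by
      rw [norm_mul, norm_mul, norm_mul, Complex.norm_I, ← Complex.ofReal_sub, Complex.norm_real,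
        Real.norm_of_nonneg hs]
      simp
    rw [h2] at h1
    have hl' : 0 < ‖P.lam z‖ := norm_pos_iff.2 hl
    rw [norm_mul, norm_div, norm_mul, Complex.norm_ofNat]
    calc ‖P.qm‖ / (2 * ‖P.lam z‖) * ‖Complex.exp (2 * Complex.I * P.lam z * (x - y)) - 1‖
        ≤ ‖P.qm‖ / (2 * ‖P.lam z‖) * (2 * ‖P.lam z‖ * (x - y)) := by gcongr
      _ = _ := by field_simp
  have hA : 0 ≤ (1 + c + c ^ 2) * d * ‖e‖ := by positivity
  rw [Prod.norm_def]
  refine max_le ?_ ?_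
  · unfold jostKernel
    simp only
    rw [norm_mul]
    have h1 : (1 : ℝ) ≤ (1 + ‖P.qm‖) * (1 + (x - y)) := by nlinarith [norm_nonneg P.qm]
    calc _ ≤ 1 * ((1 + c + c ^ 2) * d * ‖e‖) := by gcongr
      _ ≤ ((1 + ‖P.qm‖) * (1 + (x - y))) * ((1 + c + c ^ 2) * d * ‖e‖) := by gcongr
      _ = _ := by ring
  · unfold jostKernel
    simp only
    refine (norm_add_le _ _).trans ?_
    rw [norm_mul, norm_mul (Complex.I * _), norm_mul Complex.I, Complex.norm_I, one_mul, ← hd]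
    calc _ ≤ ‖P.qm‖ * (x - y) * ((1 + c + c ^ 2) * d * ‖e‖) + d * ((1 + c) * ‖e‖) := by gcongr
      _ ≤ ‖P.qm‖ * (x - y) * ((1 + c + c ^ 2) * d * ‖e‖) + d * ((1 + c + c ^ 2) * ‖e‖) := by
        have : 1 + c ≤ 1 + c + c ^ 2 := le_add_of_nonneg_right (sq_nonneg c)
        gcongr
      _ = (‖P.qm‖ * (x - y) + 1) * ((1 + c + c ^ 2) * d * ‖e‖) := by ring
      _ ≤ ((1 + ‖P.qm‖) * (1 + (x - y))) * ((1 + c + c ^ 2) * d * ‖e‖) := by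
        gcongr
        nlinarith [norm_nonneg P.qm]
      _ = _ := by ring

theorem isVolterraKernel_jostKernel {t : ℝ} (h : P.Admissible t) {ε : ℝ} (hε : 0 < ε) :
    ∃ C : ℝ, IsVolterraKernel (P.Omega ∩ {z | ε ≤ ‖z‖}) (P.Dplus ∩ {z | ε < ‖z‖})
      (P.jostKernel t) (fun x => 1 + max x 0) (fun y => C * ((1 + |y|) * ‖P.q y t - P.qm‖)) := by
  set c := ‖P.qm‖ / ε with hc
  have hc0 : 0 ≤ c := by positivity
  have hqc : Continuous fun y => P.q y t := h.smooth.continuous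
  have hlam : ∀ z ∈ P.Omega, 2 * P.lam z ≠ 0 := fun z hz =>
    mul_ne_zero two_ne_zero (lam_ne_zero hz.1 hz.2.1)
  have hlamc : ContinuousOn P.lam P.Omega := by
    unfold lam
    have : ∀ z ∈ P.Omega, z ≠ 0 := fun z hz => hz.1
    fun_prop (disch := assumption)
  have hlamd : DifferentiableOn ℂ P.lam P.Dplus := by
    unfold lam
    have : ∀ z ∈ P.Dplus, z ≠ 0 := fun z hz => (Dplus_subset_Omega hz).1
    fun_prop (disch := assumption)
  refine ⟨(1 + ‖P.qm‖) * (1 + c + c ^ 2), ?_⟩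
  refine
    { isOpen := isOpen_Dplus.inter (isOpen_lt continuous_const continuous_norm)
      subset := inter_subset_inter Dplus_subset_Omega fun z (hz : ε < ‖z‖) => hz.le
      mono_a := fun x y hxy => by
        have := max_le_max_right 0 hxy
        simpa using this
      one_le_a := fun x => by simp
      cont_κ := by fun_prop
      nonneg_κ := fun y => by positivity
      int_κ := fun x => (h.int_weight x).const_mul _
      zero := fun x y z => by simp [jostKernel, jostSource]
      lip := ?_
      cont := ?_
      cont_param := ?_
      diff_param := ?_ }
  · intro x y hy z hz e e'
    rw [jostKernel_sub]
    have hcz : ‖conj P.qm / z‖ ≤ c := by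
      rw [norm_div, RCLike.norm_conj, hc]
      have : ε ≤ ‖z‖ := hz.2
      gcongr
    refine (jostKernel_norm_le hy hz.1 hcz _).trans ?_
    have hay : 0 < 1 + max y 0 := by positivity
    -- The growth in `x - y` is shared between the variables: `1 + max x 0` becomes the weight `a
    -- x`, and `1 + |y|` goes into `κ`, which is integrable at `-∞` by the first-moment hypothesis.
    have hkey : (1 + (x - y)) * (1 + max y 0) ≤ (1 + max x 0) * (1 + |y|) := by
      rcases le_total y 0 with h0 | h0
      · rw [max_eq_right h0, abs_of_nonpos h0]
        have := le_max_left x 0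
        have := le_max_right x 0
        nlinarith
      · rw [max_eq_left h0, abs_of_nonneg h0, max_eq_left (h0.trans hy)]
        nlinarith
    have h1 : (1 + (x - y)) ≤ (1 + max x 0) * (1 + |y|) / (1 + max y 0) := by
      rwa [le_div_iff₀ hay]
    calc _ ≤ (1 + ‖P.qm‖) * (1 + c + c ^ 2) * ((1 + max x 0) * (1 + |y|) / (1 + max y 0))
          * ‖P.q y t - P.qm‖ * ‖e - e'‖ := by gcongr
      _ = _ := by ring
  · intro z hz
    unfold jostKernel jostSource
    fun_prop
  · intro x y
    have hz0 : ∀ p ∈ (P.Omega ∩ {z | ε ≤ ‖z‖}) ×ˢ (univ : Set (ℂ × ℂ)), p.1 ≠ 0 :=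
      fun p hp => hp.1.1.1
    have hl0 : ∀ p ∈ (P.Omega ∩ {z | ε ≤ ‖z‖}) ×ˢ (univ : Set (ℂ × ℂ)), 2 * P.lam p.1 ≠ 0 :=
      fun p hp => hlam _ hp.1.1
    have hlc : ContinuousOn (fun p : ℂ × ℂ × ℂ => P.lam p.1)
        ((P.Omega ∩ {z | ε ≤ ‖z‖}) ×ˢ (univ : Set (ℂ × ℂ))) :=
      hlamc.comp continuousOn_fst fun p hp => hp.1.1
    unfold jostKernel jostSource
    fun_prop (disch := assumption)
  · intro x y
    have hz0 : ∀ p ∈ (P.Dplus ∩ {z | ε < ‖z‖}) ×ˢ (univ : Set (ℂ × ℂ)), p.1 ≠ 0 :=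
      fun p hp => (Dplus_subset_Omega hp.1.1).1
    have hl0 : ∀ p ∈ (P.Dplus ∩ {z | ε < ‖z‖}) ×ˢ (univ : Set (ℂ × ℂ)), 2 * P.lam p.1 ≠ 0 :=
      fun p hp => hlam _ (Dplus_subset_Omega hp.1.1)
    have hlc : DifferentiableOn ℂ (fun p : ℂ × ℂ × ℂ => P.lam p.1)
        ((P.Dplus ∩ {z | ε < ‖z‖}) ×ˢ (univ : Set (ℂ × ℂ))) :=
      hlamd.comp differentiableOn_fst fun p hp => hp.1.1
    have hE : DifferentiableOn ℂ (fun p : ℂ × ℂ × ℂ =>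
        Complex.exp (2 * Complex.I * P.lam p.1 * ((x : ℂ) - y)))
        ((P.Dplus ∩ {z | ε < ‖z‖}) ×ˢ (univ : Set (ℂ × ℂ))) :=
      DifferentiableOn.cexp (by fun_prop)
    have hS : DifferentiableOn ℂ (fun p : ℂ × ℂ × ℂ => P.jostSource t y p.1 p.2)
        ((P.Dplus ∩ {z | ε < ‖z‖}) ×ˢ (univ : Set (ℂ × ℂ))) := by
      unfold jostSource
      fun_prop (disch := assumption)
    have hQ : DifferentiableOn ℂ (fun p : ℂ × ℂ × ℂ => P.qm / (2 * P.lam p.1))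
        ((P.Dplus ∩ {z | ε < ‖z‖}) ×ˢ (univ : Set (ℂ × ℂ))) := by
      simp only [div_eq_mul_inv]
      exact ((hlc.const_mul 2).inv hl0).const_mul P.qm
    have hR : DifferentiableOn ℂ (fun p : ℂ × ℂ × ℂ => conj P.qm / p.1)
        ((P.Dplus ∩ {z | ε < ‖z‖}) ×ˢ (univ : Set (ℂ × ℂ))) := by
      simp only [div_eq_mul_inv]
      exact (differentiableOn_fst.inv hz0).const_mul _
    exact (hE.mul hS).prodMk (((hQ.mul (hE.sub_const 1)).mul hS).add
      (by fun_prop (disch := assumption)))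

end NZBCData

/-! ### Construction of the Jost column from the Volterra equation. -/

namespace NZBCData

open Set

variable {P : NZBCData}

/-- The inhomogeneity `(0, 1)` is the second column of `Y₋` in the new unknowns. The bound `W` is
independent of `z`; it serves both as local boundedness at the branch points and as the a priori
bound for the expansion at infinity. -/
theorem exists_jost_components {t : ℝ} (h : P.Admissible t) {ε : ℝ} (hε : 0 < ε) :
    ∃ (m : Fin 2 → ℝ → ℂ → ℂ) (W : ℝ → ℝ), Monotone W ∧
      (∀ z ∈ P.Omega, ε ≤ ‖z‖ →
        (∀ x, HasDerivAt (fun x => m 0 x z)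
          (Complex.I * z * m 0 x z + Complex.I * conj (P.q x t) * m 1 x z) x) ∧
        (∀ x, HasDerivAt (fun x => m 1 x z)
          (Complex.I * P.q x t * m 0 x z + Complex.I * ((P.q₀ : ℂ) ^ 2 / z) * m 1 x z) x) ∧
        Tendsto (fun x => m 0 x z) atBot (𝓝 (-conj P.qm / z)) ∧
        Tendsto (fun x => m 1 x z) atBot (𝓝 1) ∧ ∀ x i, ‖m i x z‖ ≤ W x) ∧
      (∀ i x, ContinuousOn (m i x) (P.Omega ∩ {z | ε ≤ ‖z‖})) ∧
      ∀ i x, DifferentiableOn ℂ (m i x) (P.Dplus ∩ {z | ε < ‖z‖}) := by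
  obtain ⟨C, hV⟩ := isVolterraKernel_jostKernel h hε
  obtain ⟨f, hf, hfeq⟩ := hV.exists_solution ((0, 1) : ℂ × ℂ)
  set B : ℝ := 2 * ‖((0, 1) : ℂ × ℂ)‖ with hB
  have hB0 : 0 ≤ B := by positivity
  set c := ‖P.qm‖ / ε with hc
  have hc0 : 0 ≤ c := by positivity
  have hqc : Continuous fun y => P.q y t := h.smooth.continuous
  set V := volterraWeight (fun x => 1 + max x 0) (fun y => C * ((1 + |y|) * ‖P.q y t - P.qm‖))
    with hVdef
  let m : Fin 2 → ℝ → ℂ → ℂ := fun i x z =>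
    ![(f x z).1 - conj P.qm / z * (f x z).2, (f x z).2] i
  refine ⟨m, fun x => (1 + c) * (B * V x), ?_, ?_, ?_, ?_⟩
  · intro x y hxy
    have := hV.weight_mono hxy
    dsimp only
    gcongr
  · intro z hzΩ hzε
    have hz : z ∈ P.Omega ∩ {z | ε ≤ ‖z‖} := ⟨hzΩ, hzε⟩
    have hz0 := hzΩ.1
    have hl := lam_ne_zero hzΩ.1 hzΩ.2.1
    have hfc := hf.cont z hz
    let F : ℝ → ℂ := fun y => P.jostSource t y z (f y z)
    have hFc : Continuous F := by
      simp only [F]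
      unfold jostSource
      fun_prop
    -- The kernel depends on `x` only through the factor `e^{2iλx}`. With that factor taken out, the
    -- integrands `G₁` and `G₂` are functions of `y` alone and the integral equation can be
    -- differentiated.
    let G₁ : ℝ → ℂ := fun y => Complex.exp (-(2 * Complex.I * P.lam z * y)) * F y
    let G₂ : ℝ → ℂ := fun y => Complex.I * (P.q y t - P.qm) * ((f y z).1 - conj P.qm / z * (f y z).2)
      - P.qm / (2 * P.lam z) * F y
    have hG₁c : Continuous G₁ := by fun_prop
    have hG₂c : Continuous G₂ := by fun_prop
    have hint := fun x => hV.integrand_integrableOn hf x hz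
    have hfst : ∀ x y, (P.jostKernel t x y z (f y z)).1 =
        Complex.exp (2 * Complex.I * P.lam z * x) * G₁ y := by
      intro x y
      simp only [jostKernel, G₁, F]
      rw [← mul_assoc, ← Complex.exp_add]
      congr 2
      ring
    have hsnd : ∀ x y, (P.jostKernel t x y z (f y z)).2 =
        P.qm / (2 * P.lam z) * (Complex.exp (2 * Complex.I * P.lam z * x) * G₁ y) + G₂ y := by
      intro x y
      rw [← hfst x y]
      simp only [jostKernel, G₂, F]
      ring
    have hi₁ : ∀ x : ℝ, IntegrableOn (fun y => Complex.exp (2 * Complex.I * P.lam z * x) * G₁ y) (Iic x) := by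
      intro x
      have := (hint x).fst
      exact this.congr (.of_forall fun y => hfst x y)
    have hG₁i : ∀ x, IntegrableOn G₁ (Iic x) := by
      intro x
      have := (hi₁ x).const_mul (Complex.exp (2 * Complex.I * P.lam z * x))⁻¹
      refine this.congr (.of_forall fun y => ?_)
      dsimp only
      rw [← mul_assoc, inv_mul_cancel₀ (Complex.exp_ne_zero _), one_mul]
    have hG₂i : ∀ x, IntegrableOn G₂ (Iic x) := by
      intro x
      have := (hint x).snd.sub ((hi₁ x).const_mul (P.qm / (2 * P.lam z)))
      refine this.congr (.of_forall fun y => ?_)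
      simp only [Pi.sub_apply, hsnd]
      ring
    have hf1 : ∀ x, (f x z).1 = Complex.exp (2 * Complex.I * P.lam z * x) * ∫ y in Iic x, G₁ y := by
      intro x
      rw [hfeq z hz x, Prod.fst_add, fst_integral (hint x), ← integral_const_mul]
      simp only [hfst, zero_add]
    have hf2 : ∀ x, (f x z).2 = 1 + (P.qm / (2 * P.lam z) *
        (Complex.exp (2 * Complex.I * P.lam z * x) * ∫ y in Iic x, G₁ y) + ∫ y in Iic x, G₂ y) := by
      intro x
      rw [hfeq z hz x, Prod.snd_add, snd_integral (hint x), ← integral_const_mul,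
        ← integral_const_mul, ← integral_add ((hi₁ x).const_mul _) (hG₂i x)]
      simp only [hsnd]
    have hd1 : ∀ x, HasDerivAt (fun x => (f x z).1) (2 * Complex.I * P.lam z * (f x z).1 + F x) x := by
      intro x
      have he : HasDerivAt (fun x : ℝ => Complex.exp (2 * Complex.I * P.lam z * x))
          (Complex.exp (2 * Complex.I * P.lam z * x) * (2 * Complex.I * P.lam z)) x := by
        have := ((hasDerivAt_id (x : ℂ)).const_mul (2 * Complex.I * P.lam z)).cexp.comp_ofReal
        simpa using this
      have hm := he.mul (setIntegral_Iic_hasDerivAt hG₁c hG₁i x)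
      refine (hm.congr_deriv ?_).congr_of_eventuallyEq (.of_forall fun x => hf1 x)
      rw [hf1 x]
      simp only [G₁]
      rw [← mul_assoc (Complex.exp _) (Complex.exp _) (F x), ← Complex.exp_add, add_neg_cancel,
        Complex.exp_zero]
      ring
    have hd2 : ∀ x, HasDerivAt (fun x => (f x z).2) (Complex.I * P.qm * (f x z).1 +
        Complex.I * (P.q x t - P.qm) * ((f x z).1 - conj P.qm / z * (f x z).2)) x := by
      intro x
      have hm := ((hd1 x).const_mul (P.qm / (2 * P.lam z))).add
        (setIntegral_Iic_hasDerivAt hG₂c hG₂i x)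
      refine ((hm.const_add 1).congr_deriv ?_).congr_of_eventuallyEq (.of_forall fun x => ?_)
      · simp only [G₂]
        field_simp
        ring
      · simp only [Pi.add_apply]
        rw [hf2 x, hf1 x]
    have hqq : P.qm * conj P.qm = (P.q₀ : ℂ) ^ 2 := by
      rw [Complex.mul_conj, Complex.normSq_eq_norm_sq, h.norm_qm]
      norm_cast
    have hlz : 2 * P.lam z = z + (P.q₀ : ℂ) ^ 2 / z := by unfold lam; ring
    refine ⟨fun x => ?_, fun x => ?_, ?_, ?_, ?_⟩
    · refine ((hd1 x).sub ((hd2 x).const_mul (conj P.qm / z))).congr_deriv ?_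
      simp only [m, F, jostSource, Matrix.cons_val_zero, Matrix.cons_val_one, map_sub]
      rw [show 2 * Complex.I * P.lam z = Complex.I * (2 * P.lam z) by ring, hlz, ← hqq]
      field_simp
      ring
    · refine (hd2 x).congr_deriv ?_
      simp only [m, Matrix.cons_val_zero, Matrix.cons_val_one]
      rw [← hqq]
      field_simp
      ring
    · have ht := hV.solution_tendsto hB0 hf hz (hfeq z hz)
      have h1 := (continuous_fst.tendsto _).comp ht
      have h2 := (continuous_snd.tendsto _).comp ht
      have h3 := h1.sub (h2.const_mul (conj P.qm / z))
      simpa [m, Function.comp_def, neg_div] using h3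
    · have ht := hV.solution_tendsto hB0 hf hz (hfeq z hz)
      have h2 := (continuous_snd.tendsto _).comp ht
      simpa [m, Function.comp_def] using h2
    · intro x i
      have hb := hf.bound z hz x
      have h1 : ‖(f x z).1‖ ≤ B * V x := (norm_fst_le _).trans hb
      have h2 : ‖(f x z).2‖ ≤ B * V x := (norm_snd_le _).trans hb
      have hBV : 0 ≤ B * V x := mul_nonneg hB0 (hV.weight_nonneg x)
      have hcz : ‖conj P.qm / z‖ ≤ c := by
        rw [norm_div, RCLike.norm_conj, hc]
        gcongr
      fin_cases i
      · simp only [m, Fin.zero_eta, Matrix.cons_val_zero]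
        refine (norm_sub_le _ _).trans ?_
        rw [norm_mul]
        calc _ ≤ B * V x + c * (B * V x) := by gcongr
          _ = _ := by ring
      · simp only [m, Fin.mk_one, Matrix.cons_val_one, Matrix.cons_val_zero]
        nlinarith
  · intro i x
    have h0 : ∀ z ∈ P.Omega ∩ {z | ε ≤ ‖z‖}, z ≠ 0 := fun z hz => hz.1.1
    have hfx := hf.cont_param x
    fin_cases i
    · simp only [m, Fin.zero_eta, Matrix.cons_val_zero]
      fun_prop (disch := assumption)
    · simp only [m, Fin.mk_one, Matrix.cons_val_one, Matrix.cons_val_zero]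
      fun_prop
  · intro i x
    have h0 : ∀ z ∈ P.Dplus ∩ {z | ε < ‖z‖}, z ≠ 0 := fun z hz => (Dplus_subset_Omega hz.1).1
    have hfx := hf.diff_param x
    fin_cases i
    · simp only [m, Fin.zero_eta, Matrix.cons_val_zero]
      fun_prop (disch := assumption)
    · simp only [m, Fin.mk_one, Matrix.cons_val_one, Matrix.cons_val_zero]
      fun_prop

end NZBCData

/-! ### Solutions of the Lax equation, Wronskians and uniqueness of the Jost column. -/

namespace NZBCData

open Set

variable {P : NZBCData}

theorem sigma3_zero_zero : sigma3 0 0 = 1 := by simp [sigma3]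

theorem sigma3_one_one : sigma3 1 1 = -1 := by simp [sigma3]

theorem Xmat_mulVec (k v : ℂ) (y : Fin 2 → ℂ) : Xmat k v *ᵥ y =
    ![Complex.I * k * y 0 + Complex.I * conj v * y 1, Complex.I * v * y 0 - Complex.I * k * y 1] := by
  ext i
  fin_cases i <;> simp [Xmat, sigma3, Qmat, Matrix.mulVec, dotProduct, Fin.sum_univ_two] <;> ring

theorem Ymat_apply (v z : ℂ) : Ymat v z = !![1, -conj v / z; v / z, 1] := by
  ext i j
  fin_cases i <;> fin_cases j <;>
    simp [Ymat, sigma3, Qmat, ← mul_assoc, div_mul_eq_mul_div, neg_div] <;> ring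

theorem theta_eq (x t : ℝ) (z : ℂ) : P.theta x t z = P.lam z * x + P.theta 0 t z := by
  simp only [theta, Complex.ofReal_zero]
  ring

theorem hasDerivAt_theta (x t : ℝ) (z : ℂ) : HasDerivAt (fun x => P.theta x t z) (P.lam z) x := by
  have h : (fun x : ℝ => P.theta x t z) = fun x : ℝ => P.lam z * x + P.theta 0 t z := by
    funext x; exact theta_eq x t z
  rw [h]
  have := (((hasDerivAt_id (x : ℂ)).const_mul (P.lam z)).add_const (P.theta 0 t z)).comp_ofReal
  simpa using this

theorem k_eq (z : ℂ) : P.k z = z - P.lam z := by unfold k lam; ring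

theorem q₀_sq_div (z : ℂ) : (P.q₀ : ℂ) ^ 2 / z = 2 * P.lam z - z := by unfold lam; ring

variable (P) in
/-- Solutions of the `x`-part of the Lax pair at time `t`. -/
def IsLaxSolution (t : ℝ) (κ : ℂ) (ψ : ℝ → Fin 2 → ℂ) : Prop :=
  ∀ x, HasDerivAt ψ (Xmat κ (P.q x t) *ᵥ ψ x) x

theorem isLaxSolution_iff {t : ℝ} {κ : ℂ} {ψ : ℝ → Fin 2 → ℂ} : P.IsLaxSolution t κ ψ ↔
    (∀ x, HasDerivAt (fun x => ψ x 0)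
      (Complex.I * κ * ψ x 0 + Complex.I * conj (P.q x t) * ψ x 1) x) ∧
    ∀ x, HasDerivAt (fun x => ψ x 1)
      (Complex.I * P.q x t * ψ x 0 - Complex.I * κ * ψ x 1) x := by
  simp only [IsLaxSolution, Xmat_mulVec]
  constructor
  · intro h
    exact ⟨fun x => (hasDerivAt_pi.1 (h x)) 0, fun x => (hasDerivAt_pi.1 (h x)) 1⟩
  · rintro ⟨h0, h1⟩ x
    refine hasDerivAt_pi.2 fun i => ?_
    fin_cases i
    · exact h0 x
    · exact h1 x

theorem IsLaxSolution.smul {t : ℝ} {κ : ℂ} {ψ : ℝ → Fin 2 → ℂ} (h : P.IsLaxSolution t κ ψ) (c : ℂ) :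
    P.IsLaxSolution t κ fun x => c • ψ x := fun x => by
  rw [Matrix.mulVec_smul]
  exact (h x).const_smul c

theorem IsLaxSolution.sub {t : ℝ} {κ : ℂ} {φ ψ : ℝ → Fin 2 → ℂ} (hφ : P.IsLaxSolution t κ φ)
    (hψ : P.IsLaxSolution t κ ψ) : P.IsLaxSolution t κ fun x => φ x - ψ x := fun x => by
  rw [Matrix.mulVec_sub]
  exact (hφ x).sub (hψ x)

theorem IsLaxSolution.wronskian_eq {t : ℝ} {κ : ℂ} {φ ψ : ℝ → Fin 2 → ℂ}
    (hφ : P.IsLaxSolution t κ φ) (hψ : P.IsLaxSolution t κ ψ) (x y : ℝ) :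
    wronskian (φ x) (ψ x) = wronskian (φ y) (ψ y) := by
  obtain ⟨h0, h1⟩ := isLaxSolution_iff.1 hφ
  obtain ⟨g0, g1⟩ := isLaxSolution_iff.1 hψ
  have hd : ∀ x, HasDerivAt (fun x => wronskian (φ x) (ψ x)) 0 x := by
    intro x
    refine (((h0 x).mul (g1 x)).sub ((h1 x).mul (g0 x))).congr_deriv ?_
    ring
  exact is_const_of_deriv_eq_zero (fun x => (hd x).differentiableAt) (fun x => (hd x).deriv) x y

theorem IsLaxSolution.eq_of_eq_at {t : ℝ} (h : P.Admissible t) {κ : ℂ} {φ ψ : ℝ → Fin 2 → ℂ}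
    (hφ : P.IsLaxSolution t κ φ) (hψ : P.IsLaxSolution t κ ψ) {x₀ : ℝ} (h0 : φ x₀ = ψ x₀) :
    φ = ψ := by
  obtain ⟨M, hM0, hM⟩ := h.exists_bound
  refine ODE_solution_unique_univ (K := ⟨‖κ‖ + M, by positivity⟩) (s := fun _ => univ)
    (v := fun x y => Xmat κ (P.q x t) *ᵥ y) (t₀ := x₀) ?_ (fun x => ⟨hφ x, mem_univ _⟩)
    (fun x => ⟨hψ x, mem_univ _⟩) h0
  intro x
  refine LipschitzWith.lipschitzOnWith (LipschitzWith.of_dist_le_mul fun a b => ?_)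
  rw [dist_eq_norm, dist_eq_norm, ← Matrix.mulVec_sub, Xmat_mulVec]
  set e := a - b
  have h1 : ‖e 0‖ ≤ ‖e‖ := norm_le_pi_norm e 0
  have h2 : ‖e 1‖ ≤ ‖e‖ := norm_le_pi_norm e 1
  have hq := hM x
  change _ ≤ (‖κ‖ + M) * ‖e‖
  have hk := norm_nonneg κ
  refine (pi_norm_le_iff_of_nonneg (by positivity)).2 fun i => ?_
  fin_cases i
  · simp only [Fin.zero_eta, Matrix.cons_val_zero]
    refine (norm_add_le _ _).trans ?_
    rw [norm_mul, norm_mul, norm_mul, norm_mul, RCLike.norm_conj, Complex.norm_I, one_mul, one_mul,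
      add_mul]
    gcongr
  · simp only [Fin.mk_one, Matrix.cons_val_one, Matrix.cons_val_zero]
    refine (norm_sub_le _ _).trans ?_
    rw [norm_mul, norm_mul, norm_mul, norm_mul, Complex.norm_I, one_mul, one_mul, add_mul, add_comm]
    gcongr

theorem exists_smul_of_wronskian_eq_zero {a b : Fin 2 → ℂ} (hw : wronskian a b = 0) (hb : b ≠ 0) :
    ∃ c : ℂ, a = c • b := by
  unfold wronskian at hw
  by_cases h0 : b 0 = 0
  · have h1 : b 1 ≠ 0 := fun h1 => hb (by ext i; fin_cases i <;> simp [h0, h1])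
    refine ⟨a 1 / b 1, ?_⟩
    ext i
    fin_cases i
    · rw [h0, mul_zero, sub_zero] at hw
      have := (mul_eq_zero.1 hw).resolve_right h1
      simp [h0, this]
    · simp [h1]
  · refine ⟨a 0 / b 0, ?_⟩
    ext i
    fin_cases i
    · simp [h0]
    · simp only [Fin.mk_one, Pi.smul_apply, smul_eq_mul]
      field_simp
      linear_combination -hw

theorem IsLaxSolution.exists_smul {t : ℝ} (h : P.Admissible t) {κ : ℂ} {φ ψ : ℝ → Fin 2 → ℂ}
    (hφ : P.IsLaxSolution t κ φ) (hψ : P.IsLaxSolution t κ ψ) {x₀ : ℝ}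
    (hw : wronskian (φ x₀) (ψ x₀) = 0) (h0 : ψ x₀ ≠ 0) : ∃ c : ℂ, ∀ x, φ x = c • ψ x := by
  obtain ⟨c, hc⟩ := exists_smul_of_wronskian_eq_zero hw h0
  exact ⟨c, fun x => congrFun (hφ.eq_of_eq_at h (hψ.smul c) hc) x⟩

theorem IsJost.isLaxSolution {l : Filter ℝ} {v : ℂ} {j : Fin 2} {t : ℝ} {z : ℂ}
    {ψ : ℝ → Fin 2 → ℂ} (h : P.IsJost l v j t z ψ) : P.IsLaxSolution t (P.k z) ψ := h.1

/-- A zero at one point forces the zero solution, whose limit contradicts the diagonal entry `1` of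
`Y`. -/
theorem IsJost.ne_zero {l : Filter ℝ} [NeBot l] {v : ℂ} {j : Fin 2} {t : ℝ} {z : ℂ}
    {ψ : ℝ → Fin 2 → ℂ} (hP : P.Admissible t) (h : P.IsJost l v j t z ψ) (x : ℝ) : ψ x ≠ 0 := by
  intro h0
  have hz : P.IsLaxSolution t (P.k z) fun _ => 0 := fun x => by
    simpa using hasDerivAt_const x (0 : Fin 2 → ℂ)
  have := IsLaxSolution.eq_of_eq_at hP h.isLaxSolution hz h0
  have h2 := h.2
  rw [this] at h2
  simp only [smul_zero] at h2
  have h3 := tendsto_nhds_unique tendsto_const_nhds h2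
  have h4 := congrFun h3 j
  fin_cases j <;> simp [Ymat_apply] at h4

/-- After removal of the exponential the coefficients become `k + λ = z` and `λ - k = q₀²/z`. In
this form the time dependence of `θ` has disappeared. -/
theorem isJost_one_iff {l : Filter ℝ} {v : ℂ} {t : ℝ} {z : ℂ} (m : ℝ → Fin 2 → ℂ) :
    P.IsJost l v 1 t z (fun x => Complex.exp (-(Complex.I * P.theta x t z)) • m x) ↔
    (∀ x, HasDerivAt (fun x => m x 0)
      (Complex.I * z * m x 0 + Complex.I * conj (P.q x t) * m x 1) x) ∧
    (∀ x, HasDerivAt (fun x => m x 1)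
      (Complex.I * P.q x t * m x 0 + Complex.I * ((P.q₀ : ℂ) ^ 2 / z) * m x 1) x) ∧
    Tendsto (fun x => m x 0) l (𝓝 (-conj v / z)) ∧ Tendsto (fun x => m x 1) l (𝓝 1) := by
  have hexp : ∀ (s : ℂ) (x : ℝ), HasDerivAt (fun x => Complex.exp (s * (Complex.I * P.theta x t z)))
      (Complex.exp (s * (Complex.I * P.theta x t z)) * (s * (Complex.I * P.lam z))) x :=
    fun s x => (((hasDerivAt_theta x t z).const_mul Complex.I).const_mul s).cexp
  have hp := hexp 1
  have hn := hexp (-1)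
  simp only [one_mul, neg_mul] at hp hn
  have hinv : ∀ x, Complex.exp (Complex.I * P.theta x t z) *
      Complex.exp (-(Complex.I * P.theta x t z)) = 1 := by
    intro x; rw [← Complex.exp_add, add_neg_cancel, Complex.exp_zero]
  have hT : Tendsto (fun x => Complex.exp (-(Complex.I * sigma3 1 1 * P.theta x t z)) •
      (Complex.exp (-(Complex.I * P.theta x t z)) • m x)) l (𝓝 fun i => Ymat v z i 1) ↔
      Tendsto (fun x => m x 0) l (𝓝 (-conj v / z)) ∧ Tendsto (fun x => m x 1) l (𝓝 1) := by
    have : (fun x => Complex.exp (-(Complex.I * sigma3 1 1 * P.theta x t z)) •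
      (Complex.exp (-(Complex.I * P.theta x t z)) • m x)) = m := by
      funext x
      rw [sigma3_one_one, smul_smul, mul_neg_one, neg_mul, neg_neg, hinv, one_smul]
    rw [this, tendsto_pi_nhds, Fin.forall_fin_two]
    simp [Ymat_apply]
  have hS : P.IsLaxSolution t (P.k z) (fun x => Complex.exp (-(Complex.I * P.theta x t z)) • m x) ↔
    (∀ x, HasDerivAt (fun x => m x 0)
      (Complex.I * z * m x 0 + Complex.I * conj (P.q x t) * m x 1) x) ∧
    (∀ x, HasDerivAt (fun x => m x 1)
      (Complex.I * P.q x t * m x 0 + Complex.I * ((P.q₀ : ℂ) ^ 2 / z) * m x 1) x) := by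
    rw [isLaxSolution_iff, k_eq, q₀_sq_div]
    simp only [Pi.smul_apply, smul_eq_mul]
    constructor
    · rintro ⟨h0, h1⟩
      refine ⟨fun x => ?_, fun x => ?_⟩
      · refine (((hp x).mul (h0 x)).congr_deriv ?_).congr_of_eventuallyEq (.of_forall fun y => ?_)
        · linear_combination (Complex.I * z * m x 0 + Complex.I * conj (P.q x t) * m x 1) * hinv x
        · simp only [Pi.mul_apply]
          rw [← mul_assoc, hinv, one_mul]
      · refine (((hp x).mul (h1 x)).congr_deriv ?_).congr_of_eventuallyEq (.of_forall fun y => ?_)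
        · linear_combination (Complex.I * P.q x t * m x 0 +
            Complex.I * (2 * P.lam z - z) * m x 1) * hinv x
        · simp only [Pi.mul_apply]
          rw [← mul_assoc, hinv, one_mul]
    · rintro ⟨h0, h1⟩
      refine ⟨fun x => ((hn x).mul (h0 x)).congr_deriv ?_,
        fun x => ((hn x).mul (h1 x)).congr_deriv ?_⟩ <;> ring
  change P.IsLaxSolution t (P.k z) _ ∧ _ ↔ _
  rw [hS, hT, and_assoc]

/-- The Wronskian of the difference with one of the solutions is constant and tends to zero at `-∞`,
so the difference is a multiple of that solution. The factor is zero because the normalised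
difference tends to zero while the second entry of the normalised solution tends to `1`. -/
theorem isJost_unique {t : ℝ} (h : P.Admissible t) {z : ℂ} (hz : z ∈ P.Omega)
    {φ ψ : ℝ → Fin 2 → ℂ} (hφ : P.IsJost atBot P.qm 1 t z φ) (hψ : P.IsJost atBot P.qm 1 t z ψ) :
    φ = ψ := by
  have hE := hφ.isLaxSolution.sub hψ.isLaxSolution
  have hlim : Tendsto (fun x => Complex.exp (-(Complex.I * sigma3 1 1 * P.theta x t z)) •
      (φ x - ψ x)) atBot (𝓝 0) := by
    simpa [smul_sub] using hφ.2.sub hψ.2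
  have hψ2 := hψ.2
  rw [sigma3_one_one] at hlim hψ2
  simp only [mul_neg_one, neg_mul, neg_neg] at hlim hψ2
  have hW : Tendsto (fun x => wronskian (φ x - ψ x) (ψ x)) atBot (𝓝 0) := by
    have h1 : Tendsto (fun x => wronskian (Complex.exp (Complex.I * P.theta x t z) • (φ x - ψ x))
        (Complex.exp (Complex.I * P.theta x t z) • ψ x)) atBot (𝓝 0) := by
      unfold wronskian
      have a0 := tendsto_pi_nhds.1 hlim 0
      have a1 := tendsto_pi_nhds.1 hlim 1
      have b0 := tendsto_pi_nhds.1 hψ2 0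
      have b1 := tendsto_pi_nhds.1 hψ2 1
      simpa using (a0.mul b1).sub (a1.mul b0)
    -- Here `Im λ ≥ 0` enters: `|e^{-2iθ}|` is, up to a constant factor, `e^{2x Im λ}`, which stays
    -- bounded as `x → -∞`.
    have h2 : IsBoundedUnder (· ≤ ·) atBot
        fun x => ‖Complex.exp (-(2 * Complex.I * P.theta x t z))‖ := by
      refine ⟨‖Complex.exp (-(2 * Complex.I * P.theta 0 t z))‖, ?_⟩
      rw [eventually_map]
      filter_upwards [Iic_mem_atBot 0] with x hx
      rw [Complex.norm_exp, Complex.norm_exp]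
      refine Real.exp_le_exp.2 ?_
      rw [theta_eq x]
      have hre : ∀ w : ℂ, (-(2 * Complex.I * w)).re = 2 * w.im := by intro w; simp
      rw [hre, hre, Complex.add_im, Complex.im_mul_ofReal]
      have := mul_nonneg_of_nonpos_of_nonpos (neg_nonpos.2 (Omega.lam_im_nonneg hz)) hx
      linarith
    have h3 := h1.zero_smul_isBoundedUnder_le h2
    refine h3.congr fun x => ?_
    simp only [wronskian, Pi.smul_apply, smul_eq_mul]
    have : Complex.exp (Complex.I * P.theta x t z) * Complex.exp (Complex.I * P.theta x t z)
        * Complex.exp (-(2 * Complex.I * P.theta x t z)) = 1 := by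
      rw [← Complex.exp_add, ← Complex.exp_add, ← Complex.exp_zero]
      congr 1; ring
    linear_combination ((φ x - ψ x) 0 * ψ x 1 - (φ x - ψ x) 1 * ψ x 0) * this
  have hW0 : wronskian (φ 0 - ψ 0) (ψ 0) = 0 := by
    refine tendsto_nhds_unique ?_ hW
    exact tendsto_const_nhds.congr fun x => hE.wronskian_eq hψ.isLaxSolution 0 x
  obtain ⟨c, hc⟩ := hE.exists_smul h hψ.isLaxSolution hW0 (hψ.ne_zero h 0)
  have hc0 : c = 0 := by
    have h1 := tendsto_pi_nhds.1 (hψ2.const_smul c) 1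
    have h2 := tendsto_pi_nhds.1 hlim 1
    simp only [hc] at h2
    have h3 := tendsto_nhds_unique (h1.congr fun x => by rw [smul_comm]) h2
    simpa [Ymat_apply] using h3
  funext x
  have := hc x
  rw [hc0, zero_smul] at this
  exact sub_eq_zero.1 this

theorem isJost_psiMinus_one {t : ℝ} (h : P.Admissible t) {z : ℂ} (hz : z ∈ P.Omega) :
    P.IsJost atBot P.qm 1 t z fun x => P.psiMinus 1 x t z := by
  obtain ⟨m, W, -, hm, -⟩ := exists_jost_components h (norm_pos_iff.2 hz.1)
  obtain ⟨h0, h1, l0, l1, -⟩ := hm z hz le_rfl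
  exact Classical.epsilon_spec (p := P.IsJost atBot P.qm 1 t z)
    ⟨_, (isJost_one_iff fun x i => m i x z).2 ⟨h0, h1, l0, l1⟩⟩

theorem muMinus_one_eq (x t : ℝ) (z : ℂ) :
    P.muMinus 1 x t z = Complex.exp (Complex.I * P.theta x t z) • P.psiMinus 1 x t z := by
  rw [muMinus, sigma3_one_one, mul_neg_one, neg_mul, neg_neg]

theorem psiMinus_one_eq (x t : ℝ) (z : ℂ) :
    P.psiMinus 1 x t z = Complex.exp (-(Complex.I * P.theta x t z)) • P.muMinus 1 x t z := by
  rw [muMinus_one_eq, smul_smul, ← Complex.exp_add, neg_add_cancel, Complex.exp_zero, one_smul]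

theorem muMinus_one_spec {t : ℝ} (h : P.Admissible t) {z : ℂ} (hz : z ∈ P.Omega) :
    (∀ x, HasDerivAt (fun x => P.muMinus 1 x t z 0) (Complex.I * z * P.muMinus 1 x t z 0
      + Complex.I * conj (P.q x t) * P.muMinus 1 x t z 1) x) ∧
    (∀ x, HasDerivAt (fun x => P.muMinus 1 x t z 1) (Complex.I * P.q x t * P.muMinus 1 x t z 0
      + Complex.I * ((P.q₀ : ℂ) ^ 2 / z) * P.muMinus 1 x t z 1) x) ∧
    Tendsto (fun x => P.muMinus 1 x t z 0) atBot (𝓝 (-conj P.qm / z)) ∧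
    Tendsto (fun x => P.muMinus 1 x t z 1) atBot (𝓝 1) := by
  have h1 := isJost_psiMinus_one h hz
  simp only [psiMinus_one_eq] at h1
  exact (isJost_one_iff fun x => P.muMinus 1 x t z).1 h1

/-- The Volterra solution depends on `ε`; by uniqueness it agrees with the chosen Jost column, which
therefore inherits its regularity for every `ε`. -/
theorem muMinus_one_regular {t : ℝ} (h : P.Admissible t) {ε : ℝ} (hε : 0 < ε) :
    (∃ W : ℝ → ℝ, Monotone W ∧ ∀ z ∈ P.Omega, ε ≤ ‖z‖ → ∀ x i, ‖P.muMinus 1 x t z i‖ ≤ W x) ∧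
    (∀ i x, ContinuousOn (fun z => P.muMinus 1 x t z i) (P.Omega ∩ {z | ε ≤ ‖z‖})) ∧
    ∀ i x, DifferentiableOn ℂ (fun z => P.muMinus 1 x t z i) (P.Dplus ∩ {z | ε < ‖z‖}) := by
  obtain ⟨m, W, hW, hm, hc, hd⟩ := exists_jost_components h hε
  have heq : ∀ z ∈ P.Omega, ε ≤ ‖z‖ → ∀ x i, P.muMinus 1 x t z i = m i x z := by
    intro z hz hzε x i
    obtain ⟨h0, h1, l0, l1, -⟩ := hm z hz hzε
    have h2 := isJost_unique h hz (isJost_psiMinus_one h hz)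
      ((isJost_one_iff fun x i => m i x z).2 ⟨h0, h1, l0, l1⟩)
    rw [muMinus_one_eq, congrFun h2 x, smul_smul, ← Complex.exp_add, add_neg_cancel,
      Complex.exp_zero, one_smul]
  refine ⟨⟨W, hW, fun z hz hzε x i => ?_⟩, fun i x => ?_, fun i x => ?_⟩
  · rw [heq z hz hzε]
    exact (hm z hz hzε).2.2.2.2 x i
  · exact (hc i x).congr fun z hz => heq z hz.1 hz.2 x i
  · exact (hd i x).congr fun z hz => heq z (Dplus_subset_Omega hz.1) (le_of_lt hz.2) x i

theorem muMinus_one_continuousOn {t : ℝ} (h : P.Admissible t) (x : ℝ) (i : Fin 2) :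
    ContinuousOn (fun z => P.muMinus 1 x t z i) P.Omega := by
  intro z hz
  have hpos : 0 < ‖z‖ := norm_pos_iff.2 hz.1
  have h1 := (muMinus_one_regular h (half_pos hpos)).2.1 i x z ⟨hz, by simp⟩
  refine h1.mono_of_mem_nhdsWithin (inter_mem self_mem_nhdsWithin (mem_nhdsWithin_of_mem_nhds ?_))
  filter_upwards [continuous_norm.continuousAt.eventually (lt_mem_nhds (half_lt_self hpos))]
    with w hw using le_of_lt hw

theorem muMinus_one_differentiableOn {t : ℝ} (h : P.Admissible t) (x : ℝ) (i : Fin 2) :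
    DifferentiableOn ℂ (fun z => P.muMinus 1 x t z i) P.Dplus := by
  intro z hz
  have hpos : 0 < ‖z‖ := norm_pos_iff.2 (Dplus_subset_Omega hz).1
  have h1 := (muMinus_one_regular h (half_pos hpos)).2.2 i x z ⟨hz, half_lt_self hpos⟩
  refine h1.mono_of_mem_nhdsWithin (inter_mem self_mem_nhdsWithin (mem_nhdsWithin_of_mem_nhds ?_))
  exact continuous_norm.continuousAt.eventually (lt_mem_nhds (half_lt_self hpos))

end NZBCData

/-! ### The three symmetries of the Lax equation. -/

namespace NZBCData

open Set

variable {P : NZBCData}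

variable (P) in
/-- The image of the data under `(x, t) ↦ (-x, -t)`. -/
def reflect : NZBCData where
  δ := P.δ
  q₀ := P.q₀
  qm := -conj P.qp
  qp := -conj P.qm
  q x t := -conj (P.q (-x) (-t))

variable (P) in
/-- The involution `z ↦ -q₀² / z`, which exchanges the two sheets `±λ`. -/
noncomputable def hat (z : ℂ) : ℂ := -(P.q₀ : ℂ) ^ 2 / z

/-- The antilinear symmetry `(a, b) ↦ (b^*, -a^*)`. -/
def conjJ (y : Fin 2 → ℂ) : Fin 2 → ℂ := ![conj (y 1), -conj (y 0)]

/-- Exchange of the two components. -/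
def swap (y : Fin 2 → ℂ) : Fin 2 → ℂ := ![y 1, y 0]

theorem conjJ_conjJ (y : Fin 2 → ℂ) : conjJ (conjJ y) = -y := by
  ext i; fin_cases i <;> simp [conjJ]

theorem conjJ_smul (c : ℂ) (y : Fin 2 → ℂ) : conjJ (c • y) = conj c • conjJ y := by
  ext i; fin_cases i <;> simp [conjJ]

theorem swap_swap (y : Fin 2 → ℂ) : swap (swap y) = y := by
  ext i; fin_cases i <;> simp [swap]

theorem swap_smul (c : ℂ) (y : Fin 2 → ℂ) : swap (c • y) = c • swap y := by
  ext i; fin_cases i <;> simp [swap]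

theorem Admissible.reflect {t : ℝ} (h : P.Admissible t) : P.reflect.Admissible (-t) := by
  have hd : (deriv fun x => P.reflect.q x (-t)) =
      fun x => conj (deriv (fun x => P.q x t) (-x)) := by
    funext x
    have h1 : DifferentiableAt ℝ (fun x => P.q x t) (-x) :=
      (h.smooth.differentiable (by norm_num)).differentiableAt
    have h2 := (h1.hasDerivAt.scomp x (hasDerivAt_neg x)).star.neg
    have h3 := h2.deriv
    simp only [NZBCData.reflect, neg_neg]
    refine Eq.trans ?_ (h3.trans ?_)
    · rfl
    · simp
  have hd2 : (deriv (deriv fun x => P.reflect.q x (-t))) =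
      fun x => -conj (deriv (deriv fun x => P.q x t) (-x)) := by
    rw [hd]
    funext x
    have h1 : DifferentiableAt ℝ (deriv fun x => P.q x t) (-x) :=
      (((contDiff_succ_iff_deriv (n := 1)).1 h.smooth).2.2.differentiable (by norm_num)).differentiableAt
    have h2 := (h1.hasDerivAt.scomp x (hasDerivAt_neg x)).star
    refine Eq.trans ?_ (h2.deriv.trans ?_)
    · rfl
    · simp
  have hn : ∀ x y : ℂ, ‖-conj x - -conj y‖ = ‖x - y‖ := fun x y => by
    rw [neg_sub_neg, ← map_sub, RCLike.norm_conj, norm_sub_rev]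
  refine ⟨h.pos, ?_, ?_, ?_, ?_, ?_, ?_, ?_, ?_, ?_⟩
  · simpa [NZBCData.reflect] using h.norm_qp
  · simpa [NZBCData.reflect] using h.norm_qm
  · simp only [NZBCData.reflect, neg_neg]
    exact ((Complex.continuous_conj.tendsto _).comp (h.lim_p.comp tendsto_neg_atBot_atTop)).neg
  · simp only [NZBCData.reflect, neg_neg]
    exact ((Complex.continuous_conj.tendsto _).comp (h.lim_m.comp tendsto_neg_atTop_atBot)).neg
  · simp only [NZBCData.reflect, neg_neg]
    exact (Complex.conjCLE.contDiff.comp (h.smooth.comp contDiff_neg)).neg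
  · have h1 := ((Measure.measurePreserving_neg (volume : Measure ℝ)).integrableOn_comp_preimage
      (MeasurableEquiv.neg ℝ).measurableEmbedding (s := Ici 0)).2 h.int_p
    rw [neg_preimage, neg_Ici, neg_zero] at h1
    refine h1.congr_fun (fun x _ => ?_) measurableSet_Iic
    simp only [Function.comp_apply, NZBCData.reflect, neg_neg, hn, abs_neg]
  · have h1 := ((Measure.measurePreserving_neg (volume : Measure ℝ)).integrableOn_comp_preimage
      (MeasurableEquiv.neg ℝ).measurableEmbedding (s := Iic 0)).2 h.int_m
    rw [neg_preimage, neg_Iic, neg_zero] at h1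
    refine h1.congr_fun (fun x _ => ?_) measurableSet_Ici
    simp only [Function.comp_apply, NZBCData.reflect, neg_neg, hn, abs_neg]
  · rw [hd]
    exact Complex.conjCLE.integrable_comp_iff.2 h.int_1.comp_neg
  · rw [hd2]
    exact (Complex.conjCLE.integrable_comp_iff.2 h.int_2.comp_neg).neg

theorem theta_reflect (x t : ℝ) (z : ℂ) : P.reflect.theta (-x) (-t) z = -P.theta x t z := by
  simp only [theta, lam, k, NZBCData.reflect, Complex.ofReal_neg]
  ring

theorem hat_ne_zero (hq : 0 < P.q₀) {z : ℂ} (hz : z ≠ 0) : P.hat z ≠ 0 := by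
  have : (P.q₀ : ℂ) ≠ 0 := by exact_mod_cast hq.ne'
  unfold hat
  exact div_ne_zero (neg_ne_zero.2 (pow_ne_zero 2 this)) hz

theorem hat_hat (hq : 0 < P.q₀) {z : ℂ} (hz : z ≠ 0) : P.hat (P.hat z) = z := by
  have : (P.q₀ : ℂ) ≠ 0 := by exact_mod_cast hq.ne'
  unfold hat
  field_simp

theorem lam_hat (hq : 0 < P.q₀) {z : ℂ} (hz : z ≠ 0) : P.lam (P.hat z) = -P.lam z := by
  have : (P.q₀ : ℂ) ≠ 0 := by exact_mod_cast hq.ne'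
  unfold lam hat
  field_simp
  ring

theorem k_hat (hq : 0 < P.q₀) {z : ℂ} (hz : z ≠ 0) : P.k (P.hat z) = P.k z := by
  have : (P.q₀ : ℂ) ≠ 0 := by exact_mod_cast hq.ne'
  unfold k hat
  field_simp
  ring

theorem theta_hat (hq : 0 < P.q₀) (x t : ℝ) {z : ℂ} (hz : z ≠ 0) :
    P.theta x t (P.hat z) = -P.theta x t z := by
  simp only [theta, lam_hat hq hz, k_hat hq hz]
  ring

theorem hat_conj (z : ℂ) : P.hat (conj z) = conj (P.hat z) := by
  simp [hat]

theorem k_conj (z : ℂ) : P.k (conj z) = conj (P.k z) := by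
  simp [k, Complex.conj_ofNat]

theorem lam_conj (z : ℂ) : P.lam (conj z) = conj (P.lam z) := by
  simp [lam, Complex.conj_ofNat]

theorem gam_conj (z : ℂ) : P.gam (conj z) = conj (P.gam z) := by
  simp [gam]

theorem theta_conj (x t : ℝ) (z : ℂ) : P.theta x t (conj z) = conj (P.theta x t z) := by
  simp only [theta, lam_conj, k_conj, map_mul, map_add, map_sub, map_pow, Complex.conj_ofReal,
    Complex.conj_ofNat]

theorem norm_hat (z : ℂ) : ‖P.hat z‖ = P.q₀ ^ 2 / ‖z‖ := by
  simp [hat]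

theorem hat_im {z : ℂ} : (P.hat z).im = P.q₀ ^ 2 * z.im / ‖z‖ ^ 2 := by
  unfold hat
  rw [Complex.div_im, Complex.neg_im, Complex.neg_re, ← Complex.ofReal_pow, Complex.ofReal_im,
    Complex.ofReal_re, Complex.normSq_eq_norm_sq]
  ring

theorem hat_sign (hz : z ≠ 0) : (‖P.hat z‖ ^ 2 - P.q₀ ^ 2) * (P.hat z).im =
    -(P.q₀ ^ 4 / ‖z‖ ^ 4) * ((‖z‖ ^ 2 - P.q₀ ^ 2) * z.im) := by
  have : ‖z‖ ≠ 0 := norm_ne_zero_iff.2 hz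
  rw [norm_hat, hat_im]
  field_simp
  ring

/-- Both `hat` and conjugation exchange the two sides of `Σ`, so their composition keeps the side.
-/
theorem conj_hat_mem_Omega (hq : 0 < P.q₀) {z : ℂ} (hz : z ∈ P.Omega) : conj (P.hat z) ∈ P.Omega := by
  have hq' : (P.q₀ : ℂ) ≠ 0 := by exact_mod_cast hq.ne'
  refine ⟨?_, ?_, ?_⟩
  · simpa using hat_ne_zero hq hz.1
  · rw [← map_pow]
    intro h
    apply hz.2.1
    have h2 := congrArg conj h
    have hz0 := hz.1
    simp only [Complex.conj_conj, map_neg, map_pow, Complex.conj_ofReal] at h2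
    unfold hat at h2
    field_simp at h2
    linear_combination h2
  · rw [RCLike.norm_conj, Complex.conj_im, mul_neg, hat_sign hz.1]
    have := hz.2.2
    have h4 : 0 ≤ P.q₀ ^ 4 / ‖z‖ ^ 4 := by positivity
    nlinarith [mul_nonneg h4 this]

theorem hat_mem_Dminus (hq : 0 < P.q₀) {z : ℂ} (hz : z ∈ P.Dplus) : P.hat z ∈ P.Dminus := by
  have hz0 := (Dplus_subset_Omega hz).1
  have h : 0 < (‖z‖ ^ 2 - P.q₀ ^ 2) * z.im := hz
  change (‖P.hat z‖ ^ 2 - P.q₀ ^ 2) * (P.hat z).im < 0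
  rw [hat_sign hz0, neg_mul]
  have : 0 < ‖z‖ := norm_pos_iff.2 hz0
  have : 0 < P.q₀ ^ 4 / ‖z‖ ^ 4 * ((‖z‖ ^ 2 - P.q₀ ^ 2) * z.im) := by positivity
  linarith

theorem conj_mem_Dplus {z : ℂ} : conj z ∈ P.Dplus ↔ z ∈ P.Dminus := by
  simp [Dplus, Dminus]

theorem conj_mem_Dminus {z : ℂ} : conj z ∈ P.Dminus ↔ z ∈ P.Dplus := by
  simp [Dplus, Dminus]

/-- Reversing `x` changes the sign of the matrix in the equation. The exchange of components
restores the sign of `i k σ₃`, and the off-diagonal part becomes that of the potential `-q^*`. -/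
theorem IsJost.reflect {l l' : Filter ℝ} (hl : Tendsto Neg.neg l' l) {v : ℂ} {j : Fin 2} {t : ℝ}
    {z : ℂ} {ψ : ℝ → Fin 2 → ℂ} (h : P.IsJost l v j t z ψ) :
    P.reflect.IsJost l' (-conj v) j.rev (-t) z fun x => swap (ψ (-x)) := by
  obtain ⟨h0, h1⟩ := isLaxSolution_iff.1 h.isLaxSolution
  refine ⟨isLaxSolution_iff.2 ⟨fun x => ?_, fun x => ?_⟩, ?_⟩
  · have := (h1 (-x)).scomp x (hasDerivAt_neg x)
    refine this.congr_deriv ?_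
    simp [swap, NZBCData.reflect, k]
    ring
  · have := (h0 (-x)).scomp x (hasDerivAt_neg x)
    refine this.congr_deriv ?_
    simp [swap, NZBCData.reflect, k]
    ring
  · have h2 := h.2.comp hl
    have hsw : Continuous swap := by
      unfold swap
      fun_prop
    have h3 := (hsw.tendsto _).comp h2
    have hfun : (fun x : ℝ => Complex.exp (-(Complex.I * sigma3 j.rev j.rev *
        P.reflect.theta x (-t) z)) • swap (ψ (-x))) = swap ∘ (fun x =>
        Complex.exp (-(Complex.I * sigma3 j j * P.theta x t z)) • ψ x) ∘ Neg.neg := by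
      funext x
      simp only [Function.comp_apply, swap_smul]
      congr 2
      rw [← neg_neg x, theta_reflect, neg_neg]
      fin_cases j <;> simp [sigma3]
    have hval : (fun i => Ymat (-conj v) z i j.rev) = swap fun i => Ymat v z i j := by
      ext i
      fin_cases i <;> fin_cases j <;> simp [Ymat_apply, swap]
    rw [hfun, hval]
    exact h3

/-- The equation at `k` is carried by `conjJ` to the one at `k^*`. The sign `-σ₃ j j` repairs the
normalisation: up to it, column `j` of `Y(z)` goes to the other column of `Y(z^*)`. -/
theorem IsJost.conjJ {l : Filter ℝ} {v : ℂ} {j : Fin 2} {t : ℝ} {z : ℂ} {ψ : ℝ → Fin 2 → ℂ}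
    (h : P.IsJost l v j t z ψ) :
    P.IsJost l v j.rev t (conj z) fun x => (-sigma3 j j) • NZBCData.conjJ (ψ x) := by
  obtain ⟨h0, h1⟩ := isLaxSolution_iff.1 h.isLaxSolution
  refine ⟨?_, ?_⟩
  · refine IsLaxSolution.smul (ψ := fun x => NZBCData.conjJ (ψ x)) ?_ _
    refine isLaxSolution_iff.2 ⟨fun x => ?_, fun x => ?_⟩
    · refine (h1 x).star.congr_deriv ?_
      simp [NZBCData.conjJ, k_conj]
      ring
    · refine (h0 x).star.neg.congr_deriv ?_
      simp [NZBCData.conjJ, k_conj]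
  · have hc : Continuous NZBCData.conjJ := by
      unfold NZBCData.conjJ
      fun_prop
    have h3 := ((hc.tendsto _).comp h.2).const_smul (-sigma3 j j)
    have hfun : (fun x : ℝ => Complex.exp (-(Complex.I * sigma3 j.rev j.rev *
        P.theta x t (conj z))) • ((-sigma3 j j) • NZBCData.conjJ (ψ x))) = fun x =>
        (-sigma3 j j) • (NZBCData.conjJ ∘ (fun x =>
          Complex.exp (-(Complex.I * sigma3 j j * P.theta x t z)) • ψ x)) x := by
      funext x
      rw [smul_comm]
      simp only [Function.comp_apply, conjJ_smul, ← Complex.exp_conj]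
      congr 3
      rw [theta_conj]
      fin_cases j <;> simp [sigma3]
    have hval : (fun i => Ymat v (conj z) i j.rev) =
        (-sigma3 j j) • NZBCData.conjJ fun i => Ymat v z i j := by
      ext i
      fin_cases i <;> fin_cases j <;> simp [Ymat_apply, NZBCData.conjJ, sigma3, neg_div]
    rw [hfun, hval]
    exact h3

/-- Since `k` is invariant under `hat` and `θ` changes sign, the first column at `-q₀²/z` obeys the
equation and the exponential rate of the second column at `z`. The scalar is the ratio of the two
columns of `Y`, where `|v| = q₀` is used. -/
theorem IsJost.hat_one (hq : 0 < P.q₀) {l : Filter ℝ} {v : ℂ} (hv : ‖v‖ = P.q₀) {t : ℝ} {z : ℂ}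
    (hz : z ≠ 0) {ψ : ℝ → Fin 2 → ℂ} (h : P.IsJost l v 0 t (P.hat z) ψ) :
    P.IsJost l v 1 t z fun x => (-(conj v / z)) • ψ x := by
  have hk := h.isLaxSolution
  rw [k_hat hq hz] at hk
  refine ⟨hk.smul _, ?_⟩
  have h3 := h.2.const_smul (-(conj v / z))
  have hvv : conj v * v = (P.q₀ : ℂ) ^ 2 := by
    rw [mul_comm, Complex.mul_conj, Complex.normSq_eq_norm_sq, hv]; norm_cast
  have hq' : (P.q₀ : ℂ) ≠ 0 := by exact_mod_cast hq.ne'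
  have hval : (fun i => Ymat v z i 1) = (-(conj v / z)) • fun i => Ymat v (P.hat z) i 0 := by
    ext i
    fin_cases i
    · simp [Ymat_apply, neg_div]
    · simp [Ymat_apply, hat]
      field_simp
      exact hvv.symm
  rw [hval]
  refine h3.congr fun x => ?_
  rw [smul_comm, theta_hat hq _ _ hz]
  simp [sigma3]

theorem IsJost.hat_zero (hq : 0 < P.q₀) {l : Filter ℝ} {v : ℂ} (hv : ‖v‖ = P.q₀) {t : ℝ} {z : ℂ}
    (hz : z ≠ 0) {ψ : ℝ → Fin 2 → ℂ} (h : P.IsJost l v 1 t (P.hat z) ψ) :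
    P.IsJost l v 0 t z fun x => (v / z) • ψ x := by
  have hk := h.isLaxSolution
  rw [k_hat hq hz] at hk
  refine ⟨hk.smul _, ?_⟩
  have h3 := h.2.const_smul (v / z)
  have hvv : conj v * v = (P.q₀ : ℂ) ^ 2 := by
    rw [mul_comm, Complex.mul_conj, Complex.normSq_eq_norm_sq, hv]; norm_cast
  have hq' : (P.q₀ : ℂ) ≠ 0 := by exact_mod_cast hq.ne'
  have hval : (fun i => Ymat v z i 0) = (v / z) • fun i => Ymat v (P.hat z) i 1 := by
    ext i
    fin_cases i
    · simp [Ymat_apply, hat]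
      field_simp
      linear_combination -hvv
    · simp [Ymat_apply]
  rw [hval]
  refine h3.congr fun x => ?_
  rw [smul_comm, theta_hat hq _ _ hz]
  simp [sigma3]

end NZBCData

/-! ### All Jost columns and `s₁₁`, `s₂₂` through the symmetries. -/

namespace NZBCData

open Set

variable {P : NZBCData} {t : ℝ}

theorem reflect_reflect : P.reflect.reflect = P := by
  cases P
  simp [reflect]

theorem Omega_reflect : P.reflect.Omega = P.Omega := rfl

theorem isJost_psiPlus_zero_aux (h : P.Admissible t) {z : ℂ} (hz : z ∈ P.Omega) :
    P.IsJost atTop P.qp 0 t z fun x => swap (P.reflect.psiMinus 1 (-x) (-t) z) := by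
  have h1 := (isJost_psiMinus_one h.reflect (z := z) hz).reflect
    (l' := atTop) tendsto_neg_atTop_atBot
  rw [reflect_reflect, neg_neg] at h1
  simpa [reflect] using h1

theorem isJost_psiPlus_zero (h : P.Admissible t) {z : ℂ} (hz : z ∈ P.Omega) :
    P.IsJost atTop P.qp 0 t z fun x => P.psiPlus 0 x t z :=
  Classical.epsilon_spec (p := P.IsJost atTop P.qp 0 t z) ⟨_, isJost_psiPlus_zero_aux h hz⟩

theorem isJost_unique_psiPlus_zero (h : P.Admissible t) {z : ℂ} (hz : z ∈ P.Omega)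
    {ψ : ℝ → Fin 2 → ℂ} (hψ : P.IsJost atTop P.qp 0 t z ψ) (x : ℝ) :
    ψ x = swap (P.reflect.psiMinus 1 (-x) (-t) z) := by
  have h1 := hψ.reflect (l' := atBot) tendsto_neg_atBot_atTop
  have h2 := congrFun (isJost_unique h.reflect (z := z) hz h1
    (isJost_psiMinus_one h.reflect hz)) (-x)
  simp only [neg_neg] at h2
  rw [← h2, swap_swap]

theorem psiPlus_zero_eq_reflect (h : P.Admissible t) (x : ℝ) {z : ℂ} (hz : z ∈ P.Omega) :
    P.psiPlus 0 x t z = swap (P.reflect.psiMinus 1 (-x) (-t) z) :=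
  isJost_unique_psiPlus_zero h hz (isJost_psiPlus_zero h hz) x

/-- The involution carries over existence and uniqueness at once; the second part determines the
column that the definition merely selects. -/
theorem psiMinus_zero_spec (h : P.Admissible t) {z : ℂ} (hz : conj z ∈ P.Omega) :
    (P.IsJost atBot P.qm 0 t z fun x => P.psiMinus 0 x t z) ∧
    ∀ ψ, P.IsJost atBot P.qm 0 t z ψ → ∀ x, ψ x = conjJ (P.psiMinus 1 x t (conj z)) := by
  constructor
  · have h1 := (isJost_psiMinus_one h hz).conjJ
    rw [Complex.conj_conj] at h1
    exact Classical.epsilon_spec (p := P.IsJost atBot P.qm 0 t z) ⟨_, h1⟩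
  · intro ψ hψ x
    have h1 := congrFun (isJost_unique h hz hψ.conjJ (isJost_psiMinus_one h hz)) x
    rw [← h1, conjJ_smul, conjJ_conjJ]
    simp [sigma3]

theorem psiPlus_one_spec (h : P.Admissible t) {z : ℂ} (hz : conj z ∈ P.Omega) :
    (P.IsJost atTop P.qp 1 t z fun x => P.psiPlus 1 x t z) ∧
    ∀ ψ, P.IsJost atTop P.qp 1 t z ψ → ∀ x, ψ x = -conjJ (P.psiPlus 0 x t (conj z)) := by
  constructor
  · have h1 := (isJost_psiPlus_zero h hz).conjJ
    rw [Complex.conj_conj] at h1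
    exact Classical.epsilon_spec (p := P.IsJost atTop P.qp 1 t z) ⟨_, h1⟩
  · intro ψ hψ x
    have h1 := isJost_unique_psiPlus_zero h hz hψ.conjJ x
    rw [← psiPlus_zero_eq_reflect h x hz] at h1
    rw [← h1, conjJ_smul, conjJ_conjJ]
    simp [sigma3]

theorem psiMinus_zero_eq_conj (h : P.Admissible t) (x : ℝ) {z : ℂ} (hz : conj z ∈ P.Omega) :
    P.psiMinus 0 x t z = conjJ (P.psiMinus 1 x t (conj z)) :=
  (psiMinus_zero_spec h hz).2 _ (psiMinus_zero_spec h hz).1 x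

theorem psiPlus_one_eq_conj (h : P.Admissible t) (x : ℝ) {z : ℂ} (hz : conj z ∈ P.Omega) :
    P.psiPlus 1 x t z = -conjJ (P.psiPlus 0 x t (conj z)) :=
  (psiPlus_one_spec h hz).2 _ (psiPlus_one_spec h hz).1 x

theorem psiMinus_one_eq_hat (h : P.Admissible t) (x : ℝ) {z : ℂ} (hz : z ∈ P.Omega) :
    P.psiMinus 1 x t z = (-(conj P.qm / z)) • P.psiMinus 0 x t (P.hat z) :=
  congrFun (isJost_unique h hz (isJost_psiMinus_one h hz)
    ((psiMinus_zero_spec h (conj_hat_mem_Omega h.pos hz)).1.hat_one h.pos h.norm_qm hz.1)) x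

theorem psiPlus_zero_eq_hat (h : P.Admissible t) (x : ℝ) {z : ℂ} (hz : z ∈ P.Omega) :
    P.psiPlus 0 x t z = (P.qp / z) • P.psiPlus 1 x t (P.hat z) := by
  rw [psiPlus_zero_eq_reflect h x hz]
  exact (isJost_unique_psiPlus_zero h hz
    ((psiPlus_one_spec h (conj_hat_mem_Omega h.pos hz)).1.hat_zero h.pos h.norm_qp hz.1) x).symm

theorem muPlus_zero_eq_reflect (h : P.Admissible t) (x : ℝ) {z : ℂ} (hz : z ∈ P.Omega) :
    P.muPlus 0 x t z = swap (P.reflect.muMinus 1 (-x) (-t) z) := by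
  rw [muPlus, muMinus, psiPlus_zero_eq_reflect h x hz, swap_smul, theta_reflect, sigma3_one_one,
    sigma3_zero_zero]
  congr 3
  ring

theorem muMinus_zero_eq_conj (h : P.Admissible t) (x : ℝ) {z : ℂ} (hz : conj z ∈ P.Omega) :
    P.muMinus 0 x t z = conjJ (P.muMinus 1 x t (conj z)) := by
  rw [muMinus, muMinus, psiMinus_zero_eq_conj h x hz, conjJ_smul, ← Complex.exp_conj, theta_conj,
    sigma3_one_one, sigma3_zero_zero]
  congr 2
  simp

theorem muPlus_one_eq_conj (h : P.Admissible t) (x : ℝ) {z : ℂ} (hz : conj z ∈ P.Omega) :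
    P.muPlus 1 x t z = -conjJ (P.muPlus 0 x t (conj z)) := by
  rw [muPlus, muPlus, psiPlus_one_eq_conj h x hz, conjJ_smul, ← Complex.exp_conj, theta_conj,
    sigma3_one_one, sigma3_zero_zero, smul_neg]
  congr 3
  simp

theorem muMinus_one_eq_hat (h : P.Admissible t) (x : ℝ) {z : ℂ} (hz : z ∈ P.Omega) :
    P.muMinus 1 x t z = (-(conj P.qm / z)) • P.muMinus 0 x t (P.hat z) := by
  rw [muMinus, muMinus, psiMinus_one_eq_hat h x hz, smul_comm, theta_hat h.pos _ _ hz.1,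
    sigma3_one_one, sigma3_zero_zero]
  congr 3
  simp

theorem muPlus_zero_eq_hat (h : P.Admissible t) (x : ℝ) {z : ℂ} (hz : z ∈ P.Omega) :
    P.muPlus 0 x t z = (P.qp / z) • P.muPlus 1 x t (P.hat z) := by
  rw [muPlus, muPlus, psiPlus_zero_eq_hat h x hz, smul_comm, theta_hat h.pos _ _ hz.1,
    sigma3_one_one, sigma3_zero_zero]
  congr 3
  simp

theorem muPlus_zero_continuousOn (h : P.Admissible t) (x : ℝ) (i : Fin 2) :
    ContinuousOn (fun z => P.muPlus 0 x t z i) P.Omega := by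
  refine (muMinus_one_continuousOn h.reflect (-x) i.rev).congr fun z hz => ?_
  rw [muPlus_zero_eq_reflect h x hz]
  fin_cases i <;> rfl

theorem muPlus_zero_differentiableOn (h : P.Admissible t) (x : ℝ) (i : Fin 2) :
    DifferentiableOn ℂ (fun z => P.muPlus 0 x t z i) P.Dplus := by
  refine (muMinus_one_differentiableOn h.reflect (-x) i.rev).congr fun z hz => ?_
  rw [muPlus_zero_eq_reflect h x (Dplus_subset_Omega hz)]
  fin_cases i <;> rfl

theorem wronskian_smul (a b : ℂ) (y w : Fin 2 → ℂ) :
    wronskian (a • y) (b • w) = a * b * wronskian y w := by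
  simp only [wronskian, Pi.smul_apply, smul_eq_mul]; ring

theorem wronskian_comm (y w : Fin 2 → ℂ) : wronskian y w = -wronskian w y := by
  simp only [wronskian]; ring

theorem wronskian_conjJ (y w : Fin 2 → ℂ) :
    wronskian (conjJ y) (conjJ w) = conj (wronskian y w) := by
  simp [wronskian, conjJ]; ring

/-- The exponentials of the two columns cancel, so `s₁₁` is a Wronskian of normalised columns at any
`x`. Regularity and expansion of `s₁₁` follow from those of the columns. -/
theorem s11_eq (h : P.Admissible t) (x : ℝ) {z : ℂ} (hz : z ∈ P.Omega) :
    P.s11 t z = wronskian (P.muPlus 0 x t z) (P.muMinus 1 x t z) / P.gam z := by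
  rw [s11, (isJost_psiPlus_zero h hz).isLaxSolution.wronskian_eq
    (isJost_psiMinus_one h hz).isLaxSolution 0 x, muPlus, muMinus, wronskian_smul, ← Complex.exp_add,
    sigma3_one_one, sigma3_zero_zero]
  congr 1
  rw [← one_mul (wronskian _ _), ← Complex.exp_zero]
  congr 2
  · simp
  · rw [Complex.exp_zero, one_mul]

theorem gam_ne_zero_of_mem {z : ℂ} (hz : z ∈ P.Omega) : P.gam z ≠ 0 := gam_ne_zero hz.1 hz.2.1

theorem s11_continuousOn (h : P.Admissible t) : ContinuousOn (P.s11 t) P.Omega := by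
  have h1 := muPlus_zero_continuousOn h 0
  have h2 := muMinus_one_continuousOn h 0
  have h3 : ContinuousOn P.gam P.Omega := by
    unfold gam
    have : ∀ z ∈ P.Omega, z ^ 2 ≠ 0 := fun z hz => pow_ne_zero 2 hz.1
    fun_prop (disch := assumption)
  exact ((((h1 0).mul (h2 1)).sub ((h1 1).mul (h2 0))).div h3 fun z hz =>
    gam_ne_zero_of_mem hz).congr fun z hz => s11_eq h 0 hz

theorem s11_differentiableOn (h : P.Admissible t) : DifferentiableOn ℂ (P.s11 t) P.Dplus := by
  have h1 := muPlus_zero_differentiableOn h 0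
  have h2 := muMinus_one_differentiableOn h 0
  have h3 : DifferentiableOn ℂ P.gam P.Dplus := by
    unfold gam
    have : ∀ z ∈ P.Dplus, z ^ 2 ≠ 0 := fun z hz => pow_ne_zero 2 (Dplus_subset_Omega hz).1
    fun_prop (disch := assumption)
  exact ((((h1 0).mul (h2 1)).sub ((h1 1).mul (h2 0))).div h3 fun z hz =>
    gam_ne_zero_of_mem (Dplus_subset_Omega hz)).congr fun z hz =>
      s11_eq h 0 (Dplus_subset_Omega hz)

theorem s22_eq_conj (h : P.Admissible t) {z : ℂ} (hz : conj z ∈ P.Omega) :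
    P.s22 t z = conj (P.s11 t (conj z)) := by
  rw [s22, s11, psiMinus_zero_eq_conj h 0 hz, psiPlus_one_eq_conj h 0 hz, map_div₀, ← gam_conj,
    Complex.conj_conj, ← wronskian_conjJ]
  congr 1
  simp only [wronskian, Pi.neg_apply]
  ring

theorem gam_hat (hq : 0 < P.q₀) {z : ℂ} (hz : z ≠ 0) :
    P.gam (P.hat z) = z ^ 2 / (P.q₀ : ℂ) ^ 2 * P.gam z := by
  have hq' : (P.q₀ : ℂ) ≠ 0 := by exact_mod_cast hq.ne'
  unfold gam hat
  field_simp
  ring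

theorem mul_conj_of_norm {v : ℂ} (hv : ‖v‖ = P.q₀) : v * conj v = (P.q₀ : ℂ) ^ 2 := by
  rw [Complex.mul_conj, Complex.normSq_eq_norm_sq, hv]
  norm_cast

theorem Admissible.qm_ne_zero (h : P.Admissible t) : P.qm ≠ 0 :=
  norm_ne_zero_iff.1 (h.norm_qm.trans_ne h.pos.ne')

theorem Admissible.qp_ne_zero (h : P.Admissible t) : P.qp ≠ 0 :=
  norm_ne_zero_iff.1 (h.norm_qp.trans_ne h.pos.ne')

/-- The scalars of the two columns multiply to `-q₊ q₋^*/z²`. Exchanging the columns removes the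
sign, and the factor `q₀² = q₋ q₋^*` from `gam_hat` leaves `q₊/q₋`. -/
theorem s11_eq_hat (h : P.Admissible t) {z : ℂ} (hz : z ∈ P.Omega) :
    P.s11 t z = P.qp / P.qm * P.s22 t (P.hat z) := by
  have hq' : (P.q₀ : ℂ) ≠ 0 := by exact_mod_cast h.pos.ne'
  have hz0 := hz.1
  have hg := gam_ne_zero_of_mem hz
  have hm := h.qm_ne_zero
  rw [s11, s22, psiPlus_zero_eq_hat h 0 hz, psiMinus_one_eq_hat h 0 hz, wronskian_smul,
    gam_hat h.pos hz0, wronskian_comm]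
  field_simp
  linear_combination P.qp * (wronskian (P.psiMinus 0 0 t (P.hat z)) (P.psiPlus 1 0 t (P.hat z))) *
    (mul_conj_of_norm h.norm_qm)

end NZBCData

/-! ### Asymptotics of the Jost column for large `z`. -/

namespace NZBCData

open Set

variable {P : NZBCData} {t : ℝ}

/-- The integrating factor `e^{-2iℓy}` has modulus `e^{2y Im ℓ}`, nondecreasing in `y`; its value at
`X` dominates all earlier ones and then cancels. The case `ℓ = 0` is plain integration. -/
theorem norm_le_setIntegral_of_hasDerivAt {f S : ℝ → ℂ} {ℓ : ℂ} (hℓ : 0 ≤ ℓ.im) {b : ℝ → ℝ} {X : ℝ}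
    (hd : ∀ y, HasDerivAt f (2 * Complex.I * ℓ * f y + S y) y) (hS : Continuous S)
    (hf : Tendsto f atBot (𝓝 0)) (hb : ∀ y ≤ X, ‖S y‖ ≤ b y) (hbi : IntegrableOn b (Iic X)) :
    ‖f X‖ ≤ ∫ y in Iic X, b y := by
  have hnorm : ∀ y : ℝ, ‖Complex.exp (-(2 * Complex.I * ℓ * y))‖ = Real.exp (2 * ℓ.im * y) := by
    intro y
    rw [Complex.norm_exp]
    congr 1
    rw [← neg_mul, Complex.re_mul_ofReal]
    simp
  have he : ∀ y : ℝ, HasDerivAt (fun y : ℝ => Complex.exp (-(2 * Complex.I * ℓ * y)))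
      (Complex.exp (-(2 * Complex.I * ℓ * y)) * (-(2 * Complex.I * ℓ))) y := by
    intro y
    have := ((hasDerivAt_id (y : ℂ)).const_mul (2 * Complex.I * ℓ)).neg.cexp.comp_ofReal
    simpa using this
  have hg : ∀ y ∈ Iic X, HasDerivAt (fun y : ℝ => Complex.exp (-(2 * Complex.I * ℓ * y)) * f y)
      (Complex.exp (-(2 * Complex.I * ℓ * y)) * S y) y := by
    intro y _
    refine ((he y).mul (hd y)).congr_deriv ?_
    ring
  have hle : ∀ y ≤ X, ‖Complex.exp (-(2 * Complex.I * ℓ * y)) * S y‖ ≤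
      Real.exp (2 * ℓ.im * X) * b y := by
    intro y hy
    rw [norm_mul, hnorm]
    have := hb y hy
    gcongr
  have hgi : IntegrableOn (fun y : ℝ => Complex.exp (-(2 * Complex.I * ℓ * y)) * S y) (Iic X) := by
    refine (hbi.const_mul (Real.exp (2 * ℓ.im * X))).mono'
      (by fun_prop : Continuous _).aestronglyMeasurable ?_
    filter_upwards [ae_restrict_mem measurableSet_Iic] with y hy using hle y hy
  have hlim : Tendsto (fun y : ℝ => Complex.exp (-(2 * Complex.I * ℓ * y)) * f y) atBot (𝓝 0) := by
    refine squeeze_zero_norm' ?_ (tendsto_zero_iff_norm_tendsto_zero.1 hf)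
    filter_upwards [Iic_mem_atBot 0] with y hy
    rw [norm_mul, hnorm]
    have : Real.exp (2 * ℓ.im * y) ≤ 1 := by
      apply Real.exp_le_one_iff.2
      exact mul_nonpos_of_nonneg_of_nonpos (by positivity) hy
    exact mul_le_of_le_one_left (norm_nonneg _) this
  have hint := integral_Iic_of_hasDerivAt_of_tendsto' hg hgi hlim
  rw [sub_zero] at hint
  have h1 : ‖Complex.exp (-(2 * Complex.I * ℓ * X)) * f X‖ ≤
      Real.exp (2 * ℓ.im * X) * ∫ y in Iic X, b y := by
    rw [← hint, ← integral_const_mul]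
    refine norm_integral_le_of_norm_le (hbi.const_mul _) ?_
    filter_upwards [ae_restrict_mem measurableSet_Iic] with y hy using hle y hy
  rw [norm_mul, hnorm] at h1
  exact le_of_mul_le_mul_left h1 (Real.exp_pos _)

theorem Admissible.deriv_spec (h : P.Admissible t) :
    Continuous (deriv fun x => P.q x t) ∧ Continuous (deriv (deriv fun x => P.q x t)) ∧
    (∀ x, HasDerivAt (fun x => P.q x t) (deriv (fun x => P.q x t) x) x) ∧
    (∀ x, HasDerivAt (deriv fun x => P.q x t) (deriv (deriv fun x => P.q x t) x) x) ∧
    Tendsto (deriv fun x => P.q x t) atBot (𝓝 0) := by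
  have h1 : ContDiff ℝ 1 (deriv fun x => P.q x t) :=
    ((contDiff_succ_iff_deriv (n := 1)).1 h.smooth).2.2
  have hd : ∀ x, HasDerivAt (deriv fun x => P.q x t) (deriv (deriv fun x => P.q x t) x) x :=
    fun x => (h1.differentiable (by norm_num)).differentiableAt.hasDerivAt
  refine ⟨h1.continuous, h1.continuous_deriv le_rfl,
    fun x => (h.smooth.differentiable (by norm_num)).differentiableAt.hasDerivAt, hd, ?_⟩
  exact tendsto_zero_of_hasDerivAt_of_integrableOn_Iic (a := 0) (fun x _ => hd x)
    h.int_2.integrableOn h.int_1.integrableOn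

theorem Admissible.int_excess (h : P.Admissible t) (X : ℝ) :
    IntegrableOn (fun y => ‖P.q y t‖ ^ 2 - P.q₀ ^ 2) (Iic X) := by
  obtain ⟨M, hM0, hM⟩ := h.exists_bound
  have hqc : Continuous fun y => P.q y t := h.smooth.continuous
  refine ((h.int_weight X).const_mul (M + P.q₀)).mono'
    (by fun_prop : Continuous _).aestronglyMeasurable (.of_forall fun y => ?_)
  have h1 : |‖P.q y t‖ - P.q₀| ≤ ‖P.q y t - P.qm‖ := by
    rw [← h.norm_qm]; exact abs_norm_sub_norm_le _ _
  have h2 : |‖P.q y t‖ + P.q₀| ≤ M + P.q₀ := by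
    rw [abs_of_nonneg (add_nonneg (norm_nonneg _) h.pos.le)]
    linarith [hM y]
  rw [sq_sub_sq, Real.norm_eq_abs, abs_mul]
  have h3 : ‖P.q y t - P.qm‖ ≤ (1 + |y|) * ‖P.q y t - P.qm‖ :=
    le_mul_of_one_le_left (norm_nonneg _) (by linarith [abs_nonneg y])
  have := h1.trans h3
  have := h.pos
  gcongr

/-- With `q(x)` in place of `q₋` in the change of unknowns, the sources are `1/z` times the
integrable functions `q_x` and `|q|² - q₀²`. A first pass with the a priori bound gives `μ₁` and `μ₂
- 1` of order `1/z`; inserting this improves everything except the leading sources. The one of the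
first component meets the rate `2iλ`, so an integration by parts, paid for by `q_xx ∈ L¹`, gains
another `1/z`. The one of the second component is integrated exactly and yields `β`. -/
theorem muMinus_one_asymptotics (h : P.Admissible t) (X : ℝ) :
    ∃ (β C R : ℝ), 1 ≤ R ∧ ∀ z ∈ P.Omega, R ≤ ‖z‖ →
      ‖P.muMinus 1 X t z 0 + conj (P.q X t) / z‖ ≤ C / ‖z‖ ^ 2 ∧
      ‖P.muMinus 1 X t z 1 - 1 - Complex.I * β / z‖ ≤ C / ‖z‖ ^ 2 := by
  obtain ⟨M, hM0, hM⟩ := h.exists_bound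
  obtain ⟨hu1c, hu2c, hu1, hu2, hu1lim⟩ := h.deriv_spec
  obtain ⟨⟨W, hWmono, hW⟩, -, -⟩ := muMinus_one_regular h (zero_lt_one (α := ℝ))
  have hqc : Continuous fun y => P.q y t := h.smooth.continuous
  have hq := h.pos
  set u : ℝ → ℂ := fun y => P.q y t with hu
  set u₁ : ℝ → ℂ := deriv u with hu₁
  set u₂ : ℝ → ℂ := deriv u₁ with hu₂
  set e : ℝ → ℝ := fun y => ‖u y‖ ^ 2 - P.q₀ ^ 2 with he
  have hec : Continuous e := by fun_prop
  have hei := h.int_excess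
  set b : ℝ → ℝ := fun y => ‖u₁ y‖ + ‖e y‖ with hb
  have hbi : ∀ X, IntegrableOn b (Iic X) := fun X => h.int_1.norm.integrableOn.add (hei X).norm
  have hb0 : ∀ y, 0 ≤ b y := fun y => by positivity
  set J := ∫ y in Iic X, b y with hJ
  have hJ0 : 0 ≤ J := setIntegral_nonneg measurableSet_Iic fun y _ => hb0 y
  set J₂ := ∫ y in Iic X, ‖u₂ y‖ with hJ₂
  have hJ₂0 : 0 ≤ J₂ := setIntegral_nonneg measurableSet_Iic fun y _ => norm_nonneg _
  set B := max (W X) 0 with hB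
  have hB0 : 0 ≤ B := le_max_right _ _
  set D := B * J + P.q₀ ^ 2 + M * B with hD
  have hD0 : 0 ≤ D := by positivity
  set C := D * J + P.q₀ ^ 2 + M * D + 2 * J₂ + 2 * ‖u₁ X‖ with hC
  -- For `|z| ≥ 1` the bound `W` applies, and `|z| ≥ 2 q₀` gives `|2λ| ≥ |z|/2`.
  refine ⟨-∫ y in Iic X, e y, C, max 1 (2 * P.q₀), le_max_left _ _, fun z hz hzR => ?_⟩
  have hz1 : 1 ≤ ‖z‖ := (le_max_left _ _).trans hzR
  have hz2 : 2 * P.q₀ ≤ ‖z‖ := (le_max_right _ _).trans hzR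
  have hzp : 0 < ‖z‖ := by linarith
  have hz0 : z ≠ 0 := hz.1
  obtain ⟨hm0, hm1, hl0, hl1⟩ := muMinus_one_spec h hz
  set m₀ : ℝ → ℂ := fun y => P.muMinus 1 y t z 0 with hm₀
  set m₁ : ℝ → ℂ := fun y => P.muMinus 1 y t z 1 with hm₁
  have hm0c : Continuous m₀ := continuous_iff_continuousAt.2 fun y => (hm0 y).continuousAt
  have hm1c : Continuous m₁ := continuous_iff_continuousAt.2 fun y => (hm1 y).continuousAt
  have hmB : ∀ y ≤ X, ‖m₀ y‖ ≤ B ∧ ‖m₁ y‖ ≤ B := fun y hy =>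
    ⟨((hW z hz hz1 y 0).trans (hWmono hy)).trans (le_max_left _ _),
      ((hW z hz hz1 y 1).trans (hWmono hy)).trans (le_max_left _ _)⟩
  set ℓ := P.lam z with hℓ
  have hℓim : 0 ≤ ℓ.im := Omega.lam_im_nonneg hz
  have h2ℓ : 2 * ℓ = z + (P.q₀ : ℂ) ^ 2 / z := by rw [hℓ]; unfold lam; ring
  have hℓ0 : ℓ ≠ 0 := lam_ne_zero hz.1 hz.2.1
  have hℓn : ‖z‖ / 2 ≤ ‖2 * ℓ‖ := by
    have h1 : ‖(P.q₀ : ℂ) ^ 2 / z‖ ≤ ‖z‖ / 2 := by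
      rw [norm_div, norm_pow, Complex.norm_real, Real.norm_of_nonneg hq.le, div_le_iff₀ hzp]
      nlinarith
    have h2 := norm_sub_le_norm_add z ((P.q₀ : ℂ) ^ 2 / z)
    rw [h2ℓ]
    linarith
  have heC : ∀ y, (e y : ℂ) = u y * conj (u y) - (P.q₀ : ℂ) ^ 2 := by
    intro y
    rw [Complex.mul_conj, Complex.normSq_eq_norm_sq]
    simp only [he]
    push_cast
    rfl
  have hustar : ∀ y, HasDerivAt (fun y => conj (u y)) (conj (u₁ y)) y := fun y => (hu1 y).star
  have hu1star : ∀ y, HasDerivAt (fun y => conj (u₁ y)) (conj (u₂ y)) y := fun y => (hu2 y).star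
  -- Both combinations vanish at `-∞`; in `p` this is the purpose of the constant `1 + q₀²/z²`, the
  -- limit of the other terms. `w` has the rate `2iλ`, `p` has rate zero.
  let w : ℝ → ℂ := fun y => m₀ y + conj (u y) / z * m₁ y
  let p : ℝ → ℂ := fun y => m₁ y - u y / z * m₀ y - (1 + (P.q₀ : ℂ) ^ 2 / z ^ 2)
  let S₁ : ℝ → ℂ := fun y => (conj (u₁ y) * m₁ y + Complex.I * e y * m₀ y) / z
  let S₂ : ℝ → ℂ := fun y => (-(Complex.I * e y * m₁ y) - u₁ y * m₀ y) / z
  have hS₁c : Continuous S₁ := by fun_prop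
  have hS₂c : Continuous S₂ := by fun_prop
  have hwd : ∀ y, HasDerivAt w (2 * Complex.I * ℓ * w y + S₁ y) y := by
    intro y
    refine ((hm0 y).add (((hustar y).div_const z).mul (hm1 y))).congr_deriv ?_
    simp only [w, S₁, heC]
    rw [show 2 * Complex.I * ℓ = Complex.I * (2 * ℓ) by ring, h2ℓ]
    field_simp
    ring
  have hpd : ∀ y, HasDerivAt p (2 * Complex.I * 0 * p y + S₂ y) y := by
    intro y
    refine (((hm1 y).sub (((hu1 y).div_const z).mul (hm0 y))).sub_const _).congr_deriv ?_
    simp only [S₂, heC]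
    field_simp
    ring
  have hwlim : Tendsto w atBot (𝓝 0) := by
    have h1 := hl0.add ((((Complex.continuous_conj.tendsto _).comp h.lim_m).div_const z).mul hl1)
    refine h1.trans (le_of_eq ?_)
    congr 1
    ring
  have hplim : Tendsto p atBot (𝓝 0) := by
    have h1 := (hl1.sub ((h.lim_m.div_const z).mul hl0)).sub_const (1 + (P.q₀ : ℂ) ^ 2 / z ^ 2)
    refine h1.trans (le_of_eq ?_)
    congr 1
    rw [← mul_conj_of_norm h.norm_qm]
    field_simp
    ring
  have hnorm_e : ∀ y, ‖(e y : ℂ)‖ = ‖e y‖ := fun y => Complex.norm_real _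
  have hSb : ∀ (c : ℝ) (y : ℝ) (a₀ a₁ : ℂ), ‖a₀‖ ≤ c → ‖a₁‖ ≤ c →
      ‖(conj (u₁ y) * a₁ + Complex.I * e y * a₀) / z‖ ≤ c / ‖z‖ * b y ∧
      ‖(-(Complex.I * e y * a₁) - u₁ y * a₀) / z‖ ≤ c / ‖z‖ * b y := by
    intro c y a₀ a₁ h0 h1
    have hc : 0 ≤ c := (norm_nonneg _).trans h0
    constructor
    · rw [norm_div, div_mul_eq_mul_div]
      gcongr
      refine (norm_add_le _ _).trans ?_
      rw [norm_mul, norm_mul, norm_mul, Complex.norm_I, one_mul, RCLike.norm_conj, hnorm_e]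
      calc ‖u₁ y‖ * ‖a₁‖ + ‖e y‖ * ‖a₀‖ ≤ ‖u₁ y‖ * c + ‖e y‖ * c := by gcongr
        _ = c * b y := by simp only [hb]; ring
    · rw [norm_div, div_mul_eq_mul_div]
      gcongr
      refine (norm_sub_le _ _).trans ?_
      rw [norm_neg, norm_mul, norm_mul, norm_mul, Complex.norm_I, one_mul, hnorm_e]
      calc ‖e y‖ * ‖a₁‖ + ‖u₁ y‖ * ‖a₀‖ ≤ ‖e y‖ * c + ‖u₁ y‖ * c := by gcongr
        _ = c * b y := by simp only [hb]; ring
  have hJmono : ∀ y ≤ X, ∫ s in Iic y, b s ≤ J := fun y hy =>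
    setIntegral_mono_set (hbi X) (.of_forall hb0) (Iic_subset_Iic.2 hy).eventuallyLE
  have hbc : ∀ c y, ∫ s in Iic y, c * b s = c * ∫ s in Iic y, b s := fun c y =>
    integral_const_mul _ _
  have hw1 : ∀ y ≤ X, ‖w y‖ ≤ B * J / ‖z‖ := by
    intro y hy
    refine (norm_le_setIntegral_of_hasDerivAt hℓim hwd hS₁c hwlim (b := fun s => B / ‖z‖ * b s)
      (fun s hs => (hSb B s _ _ (hmB s (hs.trans hy)).1 (hmB s (hs.trans hy)).2).1)
      ((hbi y).const_mul _)).trans ?_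
    rw [hbc, mul_div_right_comm]
    have := hJmono y hy
    gcongr
  have hp1 : ∀ y ≤ X, ‖p y‖ ≤ B * J / ‖z‖ := by
    intro y hy
    refine (norm_le_setIntegral_of_hasDerivAt (ℓ := 0) le_rfl hpd hS₂c hplim
      (b := fun s => B / ‖z‖ * b s)
      (fun s hs => (hSb B s _ _ (hmB s (hs.trans hy)).1 (hmB s (hs.trans hy)).2).2)
      ((hbi y).const_mul _)).trans ?_
    rw [hbc, mul_div_right_comm]
    have := hJmono y hy
    gcongr
  have hquot : ‖(P.q₀ : ℂ) ^ 2 / z ^ 2‖ = P.q₀ ^ 2 / ‖z‖ ^ 2 := by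
    rw [norm_div, norm_pow, norm_pow, Complex.norm_real, Real.norm_of_nonneg hq.le]
  have hsq : 1 / ‖z‖ ^ 2 ≤ 1 / ‖z‖ := by
    apply one_div_le_one_div_of_le hzp
    nlinarith
  have hm1D : ∀ y ≤ X, ‖m₁ y - 1‖ ≤ D / ‖z‖ := by
    intro y hy
    have heq : m₁ y - 1 = p y + (P.q₀ : ℂ) ^ 2 / z ^ 2 + u y / z * m₀ y := by simp only [p]; ring
    have hmy := (hmB y hy).1
    have huy := hM y
    rw [heq]
    refine (norm_add₃_le).trans ?_
    rw [hquot, norm_mul, norm_div]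
    calc _ ≤ B * J / ‖z‖ + P.q₀ ^ 2 * (1 / ‖z‖) + M / ‖z‖ * B := by
          rw [div_eq_mul_one_div (P.q₀ ^ 2)]
          have := hp1 y hy
          gcongr
      _ = D / ‖z‖ := by rw [hD]; ring
  have hm0D : ∀ y ≤ X, ‖m₀ y‖ ≤ D / ‖z‖ := by
    intro y hy
    have heq : m₀ y = w y - conj (u y) / z * m₁ y := by simp only [w]; ring
    have hmy := (hmB y hy).2
    have huy := hM y
    rw [heq]
    refine (norm_sub_le _ _).trans ?_
    rw [norm_mul, norm_div, RCLike.norm_conj]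
    calc _ ≤ B * J / ‖z‖ + M / ‖z‖ * B := by
          have := hw1 y hy
          gcongr
      _ ≤ B * J / ‖z‖ + P.q₀ ^ 2 / ‖z‖ + M / ‖z‖ * B := by
          have : 0 ≤ P.q₀ ^ 2 / ‖z‖ := by positivity
          linarith
      _ = D / ‖z‖ := by rw [hD]; ring
  have hDJ : D / ‖z‖ / ‖z‖ * J = D * J / ‖z‖ ^ 2 := by field_simp
  constructor
  -- The added term is the boundary term of the integration by parts: it replaces the source `q_x^*
  -- μ₂/z` by `q_x^* (μ₂ - 1)/z` at the cost of `q_xx^*/(2iλz)`.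
  · let f : ℝ → ℂ := fun y => w y + conj (u₁ y) / (2 * Complex.I * ℓ * z)
    have hI : Complex.I ≠ 0 := Complex.I_ne_zero
    have hfd : ∀ y, HasDerivAt f (2 * Complex.I * ℓ * f y +
        ((conj (u₁ y) * (m₁ y - 1) + Complex.I * e y * m₀ y) / z +
          conj (u₂ y) / (2 * Complex.I * ℓ * z))) y := by
      intro y
      refine ((hwd y).add ((hu1star y).div_const _)).congr_deriv ?_
      simp only [f, S₁]
      field_simp
      ring
    have hflim : Tendsto f atBot (𝓝 0) := by
      have h1 := hwlim.add (((Complex.continuous_conj.tendsto _).comp hu1lim).div_const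
        (2 * Complex.I * ℓ * z))
      simpa [Function.comp_def] using h1
    have hden : ∀ a : ℂ, ‖conj a / (2 * Complex.I * ℓ * z)‖ ≤ 2 / ‖z‖ ^ 2 * ‖a‖ := by
      intro a
      have hℓp : 0 < ‖2 * ℓ‖ := (half_pos hzp).trans_le hℓn
      rw [norm_div, RCLike.norm_conj, show 2 * Complex.I * ℓ * z = Complex.I * (2 * ℓ) * z by ring,
        norm_mul, norm_mul Complex.I, Complex.norm_I, one_mul, div_le_iff₀ (by positivity)]
      have : 1 ≤ 2 / ‖z‖ ^ 2 * (‖2 * ℓ‖ * ‖z‖) := by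
        calc (1 : ℝ) = 2 / ‖z‖ ^ 2 * (‖z‖ / 2 * ‖z‖) := by field_simp
          _ ≤ _ := by gcongr
      calc ‖a‖ = ‖a‖ * 1 := (mul_one _).symm
        _ ≤ ‖a‖ * (2 / ‖z‖ ^ 2 * (‖2 * ℓ‖ * ‖z‖)) := by gcongr
        _ = _ := by ring
    have hfX := norm_le_setIntegral_of_hasDerivAt hℓim hfd (by fun_prop) hflim
      (b := fun s => D / ‖z‖ / ‖z‖ * b s + 2 / ‖z‖ ^ 2 * ‖u₂ s‖) (X := X)
      (fun s hs => (norm_add_le _ _).trans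
        (add_le_add (hSb _ s _ _ (hm0D s hs) (hm1D s hs)).1 (hden _)))
      (((hbi X).const_mul _).add (h.int_2.norm.integrableOn.const_mul _))
    rw [integral_add ((hbi X).const_mul _) (h.int_2.norm.integrableOn.const_mul _),
      integral_const_mul, integral_const_mul, ← hJ, ← hJ₂, hDJ] at hfX
    have heq : m₀ X + conj (u X) / z = f X - conj (u₁ X) / (2 * Complex.I * ℓ * z)
        - conj (u X) / z * (m₁ X - 1) := by
      simp only [f, w]; ring
    have h3 : ‖conj (u X) / z * (m₁ X - 1)‖ ≤ M / ‖z‖ * (D / ‖z‖) := by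
      rw [norm_mul, norm_div, RCLike.norm_conj]
      have := hm1D X le_rfl
      have := hM X
      gcongr
    change ‖m₀ X + conj (u X) / z‖ ≤ _
    rw [heq]
    refine (norm_sub_le _ _).trans ((add_le_add_left (norm_sub_le _ _) _).trans ?_)
    calc _ ≤ (D * J / ‖z‖ ^ 2 + 2 / ‖z‖ ^ 2 * J₂) + 2 / ‖z‖ ^ 2 * ‖u₁ X‖ + M / ‖z‖ * (D / ‖z‖) :=
          add_le_add (add_le_add hfX (hden _)) h3
      _ ≤ (D * J / ‖z‖ ^ 2 + 2 / ‖z‖ ^ 2 * J₂) + 2 / ‖z‖ ^ 2 * ‖u₁ X‖ + M / ‖z‖ * (D / ‖z‖)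
          + P.q₀ ^ 2 / ‖z‖ ^ 2 := le_add_of_nonneg_right (by positivity)
      _ = C / ‖z‖ ^ 2 := by rw [hC]; field_simp; ring
  · let E : ℝ → ℂ := fun y => ∫ s in Iic y, (e s : ℂ)
    have heiC : ∀ y, IntegrableOn (fun s => (e s : ℂ)) (Iic y) := fun y => (hei y).ofReal
    have hEd : ∀ y, HasDerivAt E (e y : ℂ) y :=
      setIntegral_Iic_hasDerivAt (by fun_prop) heiC
    have hElim : Tendsto E atBot (𝓝 0) := tendsto_setIntegral_Iic_atBot (heiC 0)
    -- The term with `E` removes the source `-i (|q|² - q₀²)/z`; what remains contains the small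
    -- factor `μ₂ - 1` or `μ₁`.
    let f : ℝ → ℂ := fun y => p y + Complex.I / z * E y
    have hfd : ∀ y, HasDerivAt f (2 * Complex.I * 0 * f y +
        (-(Complex.I * e y * (m₁ y - 1)) - u₁ y * m₀ y) / z) y := by
      intro y
      refine ((hpd y).add ((hEd y).const_mul _)).congr_deriv ?_
      simp only [S₂]
      field_simp
      ring
    have hflim : Tendsto f atBot (𝓝 0) := by
      simpa using hplim.add (hElim.const_mul (Complex.I / z))
    have hfX := norm_le_setIntegral_of_hasDerivAt (ℓ := 0) le_rfl hfd (by fun_prop) hflim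
      (b := fun s => D / ‖z‖ / ‖z‖ * b s) (X := X)
      (fun s hs => (hSb _ s _ _ (hm0D s hs) (hm1D s hs)).2) ((hbi X).const_mul _)
    rw [integral_const_mul, ← hJ, hDJ] at hfX
    have hEX : E X = ((∫ y in Iic X, e y : ℝ) : ℂ) := integral_ofReal
    have heq : m₁ X - 1 - Complex.I * ((-∫ y in Iic X, e y : ℝ) : ℂ) / z =
        f X + (P.q₀ : ℂ) ^ 2 / z ^ 2 + u X / z * m₀ X := by
      simp only [f, p, hEX, Complex.ofReal_neg]; ring
    have h3 : ‖u X / z * m₀ X‖ ≤ M / ‖z‖ * (D / ‖z‖) := by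
      rw [norm_mul, norm_div]
      have := hm0D X le_rfl
      have := hM X
      gcongr
    change ‖m₁ X - 1 - Complex.I * ((-∫ y in Iic X, e y : ℝ) : ℂ) / z‖ ≤ _
    rw [heq]
    refine norm_add₃_le.trans ?_
    rw [hquot]
    calc _ ≤ D * J / ‖z‖ ^ 2 + P.q₀ ^ 2 / ‖z‖ ^ 2 + M / ‖z‖ * (D / ‖z‖) := by gcongr
      _ ≤ D * J / ‖z‖ ^ 2 + P.q₀ ^ 2 / ‖z‖ ^ 2 + M / ‖z‖ * (D / ‖z‖)
          + (2 * J₂ + 2 * ‖u₁ X‖) / ‖z‖ ^ 2 := le_add_of_nonneg_right (by positivity)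
      _ = C / ‖z‖ ^ 2 := by rw [hC]; field_simp; ring

end NZBCData

/-- `f z = a + b / z + O(1 / z²)` along `l`. -/
def HasExpansion (l : Filter ℂ) (f : ℂ → ℂ) (a b : ℂ) : Prop :=
  (fun z => f z - a - b / z) =O[l] fun z => 1 / z ^ 2

/-! ### Calculus of two-term expansions at infinity. -/

namespace HasExpansion

variable {l : Filter ℂ} {f g : ℂ → ℂ} {a b c d : ℂ}

theorem congr' (hf : HasExpansion l f a b) (h : f =ᶠ[l] g) : HasExpansion l g a b := by
  refine IsBigO.congr' hf ?_ EventuallyEq.rfl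
  filter_upwards [h] with z hz
  rw [hz]

theorem mono {l' : Filter ℂ} (hf : HasExpansion l f a b) (h : l' ≤ l) : HasExpansion l' f a b :=
  IsBigO.mono hf h

theorem inv_tendsto_zero (hl : l ≤ Bornology.cobounded ℂ) : Tendsto (fun z : ℂ => 1 / z) l (𝓝 0) := by
  simpa using (tendsto_inv₀_cobounded (α := ℂ)).mono_left hl

theorem inv_sq_isBigO (hl : l ≤ Bornology.cobounded ℂ) :
    (fun z : ℂ => 1 / z ^ 2) =O[l] fun z => 1 / z := by
  have h1 : (fun z : ℂ => 1 / z) =O[l] fun _ => (1 : ℂ) := (inv_tendsto_zero hl).isBigO_one ℂ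
  have h2 := h1.mul (isBigO_refl (fun z : ℂ => 1 / z) l)
  refine h2.congr (fun z => ?_) (fun z => ?_)
  · ring
  · ring

theorem sub_isBigO (hl : l ≤ Bornology.cobounded ℂ) (hf : HasExpansion l f a b) :
    (fun z => f z - a) =O[l] fun z => 1 / z := by
  have h1 := (IsBigO.trans hf (inv_sq_isBigO hl)).add
    ((isBigO_refl (fun z : ℂ => 1 / z) l).const_mul_left b)
  refine h1.congr_left fun z => ?_
  ring

theorem tendsto (hl : l ≤ Bornology.cobounded ℂ) (hf : HasExpansion l f a b) :
    Tendsto f l (𝓝 a) := by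
  have h1 := (hf.sub_isBigO hl).trans_tendsto (inv_tendsto_zero hl)
  simpa using h1.add_const a

theorem const (a : ℂ) : HasExpansion l (fun _ => a) a 0 := by
  refine (isBigO_zero (E' := ℂ) (fun z : ℂ => 1 / z ^ 2) l).congr_left fun z => ?_
  ring

theorem add (hf : HasExpansion l f a b) (hg : HasExpansion l g c d) :
    HasExpansion l (fun z => f z + g z) (a + c) (b + d) := by
  refine (IsBigO.add hf hg).congr_left fun z => ?_
  ring

theorem neg (hf : HasExpansion l f a b) : HasExpansion l (fun z => -f z) (-a) (-b) := by
  refine (IsBigO.neg_left hf).congr_left fun z => ?_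
  ring

theorem sub (hf : HasExpansion l f a b) (hg : HasExpansion l g c d) :
    HasExpansion l (fun z => f z - g z) (a - c) (b - d) := by
  simpa [sub_eq_add_neg] using hf.add hg.neg

theorem mul (hl : l ≤ Bornology.cobounded ℂ) (hf : HasExpansion l f a b)
    (hg : HasExpansion l g c d) : HasExpansion l (fun z => f z * g z) (a * c) (a * d + b * c) := by
  have h1 := IsBigO.mul hf ((hg.tendsto hl).isBigO_one ℂ)
  have h2 : (fun z : ℂ => a + b / z) =O[l] fun _ => (1 : ℂ) := by
    have : Tendsto (fun z : ℂ => a + b * (1 / z)) l (𝓝 (a + b * 0)) :=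
      ((inv_tendsto_zero hl).const_mul b).const_add a
    simpa [div_eq_mul_inv] using this.isBigO_one ℂ
  have h3 := h2.mul hg
  have h4 := (isBigO_refl (fun z : ℂ => 1 / z ^ 2) l).const_mul_left (b * d)
  simp only [mul_one, one_mul] at h1 h3
  refine ((h1.add h3).add h4).congr_left fun z => ?_
  ring

theorem inv (hl : l ≤ Bornology.cobounded ℂ) (hf : HasExpansion l f 1 b) :
    HasExpansion l (fun z => (f z)⁻¹) 1 (-b) := by
  have ht := hf.tendsto hl
  have h0 : ∀ᶠ z in l, f z ≠ 0 := ht.eventually_ne one_ne_zero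
  have hinv : (fun z => (f z)⁻¹) =O[l] fun _ => (1 : ℂ) := (ht.inv₀ one_ne_zero).isBigO_one ℂ
  have h1 := (IsBigO.neg_left hf).mul hinv
  have h2 := (((hf.sub_isBigO hl).mul ((isBigO_refl (fun z : ℂ => 1 / z) l).const_mul_left b))).mul hinv
  have h3 := (h1.congr_right (g₂ := fun z => 1 / z ^ 2) fun z => mul_one _).add
    (h2.congr_right (g₂ := fun z => 1 / z ^ 2) fun z => by ring)
  refine h3.congr' ?_ EventuallyEq.rfl
  filter_upwards [h0] with z hz
  field_simp
  ring

theorem div (hl : l ≤ Bornology.cobounded ℂ) (hf : HasExpansion l f a b)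
    (hg : HasExpansion l g 1 d) : HasExpansion l (fun z => f z / g z) a (b - a * d) := by
  have h := hf.mul hl (hg.inv hl)
  rw [mul_one, mul_one] at h
  simpa [div_eq_mul_inv, sub_eq_neg_add] using h

theorem conj_comp {l' : Filter ℂ} (hf : HasExpansion l f a b)
    (hl' : Tendsto (starRingEnd ℂ) l' l) :
    HasExpansion l' (fun z => starRingEnd ℂ (f (starRingEnd ℂ z))) (starRingEnd ℂ a)
      (starRingEnd ℂ b) := by
  have h1 := IsBigO.comp_tendsto hf hl'
  refine IsBigO.trans (IsBigO.of_bound 1 (.of_forall fun z => ?_)) (h1.trans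
    (IsBigO.of_bound 1 (.of_forall fun z => ?_)))
  · simp only [Function.comp_apply]
    rw [one_mul, ← RCLike.norm_conj]
    simp
  · simp

end HasExpansion

/-! ### Expansion of `M` at infinity and at the origin. -/

namespace NZBCData

open Set

variable {P : NZBCData} {t : ℝ}

theorem hasExpansion_gam : HasExpansion (Bornology.cobounded ℂ) P.gam 1 0 := by
  refine IsBigO.of_bound (‖(P.q₀ : ℂ) ^ 2‖) (.of_forall fun z => ?_)
  simp [gam, div_eq_mul_inv]

variable (P) in
/-- The coefficient of `1 / z` in the expansion of `M` at infinity. -/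
noncomputable def expansionCoeff (x t β : ℝ) : Matrix (Fin 2) (Fin 2) ℂ :=
  !![-(Complex.I * β), -conj (P.q x t); P.q x t, Complex.I * β]

theorem hasExpansion_muMinus_one (h : P.Admissible t) (x : ℝ) : ∃ β : ℝ,
    HasExpansion (Bornology.cobounded ℂ ⊓ 𝓟 P.Omega) (fun z => P.muMinus 1 x t z 0) 0
      (-conj (P.q x t)) ∧
    HasExpansion (Bornology.cobounded ℂ ⊓ 𝓟 P.Omega) (fun z => P.muMinus 1 x t z 1) 1
      (Complex.I * β) := by
  obtain ⟨β, C, R, hR, hb⟩ := muMinus_one_asymptotics h x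
  have hev : ∀ᶠ z in Bornology.cobounded ℂ ⊓ 𝓟 P.Omega, z ∈ P.Omega ∧ R ≤ ‖z‖ := by
    have h1 : ∀ᶠ z : ℂ in Bornology.cobounded ℂ, R ≤ ‖z‖ :=
      tendsto_norm_cobounded_atTop.eventually_ge_atTop R
    exact ((eventually_principal.2 fun z hz => hz).filter_mono inf_le_right).and
      (h1.filter_mono inf_le_left)
  refine ⟨β, IsBigO.of_bound C ?_, IsBigO.of_bound C ?_⟩
  · filter_upwards [hev] with z hz
    have := (hb z hz.1 hz.2).1
    simpa [neg_div, div_eq_mul_inv] using this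
  · filter_upwards [hev] with z hz
    have := (hb z hz.1 hz.2).2
    simpa [div_eq_mul_inv] using this

/-- The constant `β'` of the reflected data drops out: since `s₁₁ = 1 + i(β + β')/z + O(1/z²)`, the
division of the first column by `s₁₁` turns `iβ'` into `-iβ`. -/
theorem hasExpansion_Mplus (h : P.Admissible t) (x : ℝ) : ∃ β : ℝ, ∀ i j,
    HasExpansion (Bornology.cobounded ℂ ⊓ 𝓟 P.Omega) (fun z => P.Mplus x t z i j)
      ((1 : Matrix (Fin 2) (Fin 2) ℂ) i j) (P.expansionCoeff x t β i j) := by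
  obtain ⟨β, h0, h1⟩ := hasExpansion_muMinus_one h x
  obtain ⟨β', g0, g1⟩ := hasExpansion_muMinus_one h.reflect (-x)
  rw [Omega_reflect] at g0 g1
  set l := Bornology.cobounded ℂ ⊓ 𝓟 P.Omega with hl_def
  have hl : l ≤ Bornology.cobounded ℂ := inf_le_left
  have hmem : ∀ᶠ z in l, z ∈ P.Omega := eventually_inf_principal.2 (.of_forall fun z hz => hz)
  have e0 : HasExpansion l (fun z => P.muPlus 0 x t z 0) 1 (Complex.I * β') := by
    refine g1.congr' ?_
    filter_upwards [hmem] with z hz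
    rw [muPlus_zero_eq_reflect h x hz]
    rfl
  have e1 : HasExpansion l (fun z => P.muPlus 0 x t z 1) 0 (P.q x t) := by
    have : -conj (P.reflect.q (-x) (-t)) = P.q x t := by simp [reflect]
    rw [this] at g0
    refine g0.congr' ?_
    filter_upwards [hmem] with z hz
    rw [muPlus_zero_eq_reflect h x hz]
    rfl
  have es : HasExpansion l (P.s11 t) 1 (Complex.I * β' + Complex.I * β) := by
    have := ((e0.mul hl h1).sub (e1.mul hl h0)).div hl ((hasExpansion_gam (P := P)).mono hl)
    have h2 := this.congr' (g := P.s11 t) (by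
      filter_upwards [hmem] with z hz
      rw [s11_eq h x hz]
      rfl)
    convert h2 using 1 <;> ring
  have d0 := e0.div hl es
  have d1 := e1.div hl es
  rw [show Complex.I * (β' : ℂ) - 1 * (Complex.I * β' + Complex.I * β) = -(Complex.I * β) by ring] at d0
  rw [zero_mul, sub_zero] at d1
  refine ⟨β, ?_⟩
  simp only [Fin.forall_fin_two]
  exact ⟨⟨by simpa [expansionCoeff, Mplus] using d0, by simpa [expansionCoeff, Mplus] using h0⟩,
    by simpa [expansionCoeff, Mplus] using d1, by simpa [expansionCoeff, Mplus] using h1⟩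

theorem Mminus_eq_conj (h : P.Admissible t) (x : ℝ) {z : ℂ} (hz : conj z ∈ P.Omega) :
    P.Mminus x t z = !![conj (P.Mplus x t (conj z) 1 1), -conj (P.Mplus x t (conj z) 1 0);
      -conj (P.Mplus x t (conj z) 0 1), conj (P.Mplus x t (conj z) 0 0)] := by
  ext i j
  fin_cases i <;> fin_cases j <;>
    simp [Mminus, Mplus, muMinus_zero_eq_conj h x hz, muPlus_one_eq_conj h x hz,
      s22_eq_conj h hz, conjJ, neg_div]

theorem tendsto_conj_Omega : Tendsto (starRingEnd ℂ)
    (Bornology.cobounded ℂ ⊓ 𝓟 {z | conj z ∈ P.Omega}) (Bornology.cobounded ℂ ⊓ 𝓟 P.Omega) := by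
  refine tendsto_inf.2 ⟨?_, ?_⟩
  · refine Tendsto.mono_left ?_ inf_le_left
    rw [← tendsto_norm_atTop_iff_cobounded]
    simpa using tendsto_norm_cobounded_atTop (E := ℂ)
  · exact tendsto_principal.2 (eventually_inf_principal.2 (.of_forall fun z hz => hz))

/-- Because `β` is real, the coefficient matrix is invariant under the involution that relates `M⁻`
to `M⁺`. The two sides thus share their coefficient of `1/z`, the fact behind the integrability of
`M⁺G` and behind the formula for `q`. -/
theorem hasExpansion_Mminus (h : P.Admissible t) (x : ℝ) {β : ℝ} (hβ : ∀ i j,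
    HasExpansion (Bornology.cobounded ℂ ⊓ 𝓟 P.Omega) (fun z => P.Mplus x t z i j)
      ((1 : Matrix (Fin 2) (Fin 2) ℂ) i j) (P.expansionCoeff x t β i j)) (i j : Fin 2) :
    HasExpansion (Bornology.cobounded ℂ ⊓ 𝓟 {z | conj z ∈ P.Omega}) (fun z => P.Mminus x t z i j)
      ((1 : Matrix (Fin 2) (Fin 2) ℂ) i j) (P.expansionCoeff x t β i j) := by
  have hmem : ∀ᶠ z in Bornology.cobounded ℂ ⊓ 𝓟 {z | conj z ∈ P.Omega}, conj z ∈ P.Omega :=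
    eventually_inf_principal.2 (.of_forall fun z hz => hz)
  have hc := fun i j => (hβ i j).conj_comp (tendsto_conj_Omega (P := P))
  fin_cases i <;> fin_cases j
  · have := (hc 1 1).congr' (g := fun z => P.Mminus x t z 0 0) (by
      filter_upwards [hmem] with z hz
      rw [Mminus_eq_conj h x hz]; rfl)
    simpa [expansionCoeff] using this
  · have := (hc 1 0).neg.congr' (g := fun z => P.Mminus x t z 0 1) (by
      filter_upwards [hmem] with z hz
      rw [Mminus_eq_conj h x hz]; rfl)
    simpa [expansionCoeff] using this
  · have := (hc 0 1).neg.congr' (g := fun z => P.Mminus x t z 1 0) (by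
      filter_upwards [hmem] with z hz
      rw [Mminus_eq_conj h x hz]; rfl)
    simpa [expansionCoeff] using this
  · have := (hc 0 0).congr' (g := fun z => P.Mminus x t z 1 1) (by
      filter_upwards [hmem] with z hz
      rw [Mminus_eq_conj h x hz]; rfl)
    simpa [expansionCoeff] using this

variable (P) in
/-- The singular part of `M` at the origin. -/
noncomputable def zeroPart (z : ℂ) : Matrix (Fin 2) (Fin 2) ℂ :=
  (Complex.I / z) • (sigma3 * Qmat P.qm)

theorem zeroPart_eq (z : ℂ) : P.zeroPart z = !![0, -(conj P.qm / z); P.qm / z, 0] := by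
  have hI : Complex.I * Complex.I = -1 := Complex.I_mul_I
  ext i j
  fin_cases i <;> fin_cases j <;> simp [zeroPart, sigma3, Qmat]
  · linear_combination conj P.qm / z * hI
  · linear_combination -(P.qm / z) * hI

/-- This identity exchanges the origin with infinity and the two sides of `Σ`. -/
theorem Mplus_eq_hat (h : P.Admissible t) (x : ℝ) {z : ℂ} (hz : z ∈ P.Omega) :
    P.Mplus x t z = P.Mminus x t (P.hat z) * P.zeroPart z := by
  have hm := h.qm_ne_zero
  have hp := h.qp_ne_zero
  have hz0 := hz.1
  rw [zeroPart_eq]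
  ext i j
  fin_cases i <;> fin_cases j <;>
    simp [Mminus, Mplus, muMinus_one_eq_hat h x hz, muPlus_zero_eq_hat h x hz,
      s11_eq_hat h hz, Matrix.mul_apply, Fin.sum_univ_two] <;> field_simp

/-- By `Mplus_eq_hat` the difference is `(M⁻(-q₀²/z) - 1)` times the singular part. The first factor
is `O(z)` by the expansion at infinity, the second is `O(1/z)`. -/
theorem Mplus_sub_zeroPart_isBigO (h : P.Admissible t) (x : ℝ) (i j : Fin 2) :
    (fun z => (P.Mplus x t z - P.zeroPart z) i j) =O[𝓝 0 ⊓ 𝓟 P.Omega] fun _ => (1 : ℂ) := by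
  obtain ⟨β, hβ⟩ := hasExpansion_Mplus h x
  have hM := hasExpansion_Mminus h x hβ
  have hq' : (P.q₀ : ℂ) ≠ 0 := by exact_mod_cast h.pos.ne'
  set l := 𝓝 (0 : ℂ) ⊓ 𝓟 P.Omega
  have hmem : ∀ᶠ z in l, z ∈ P.Omega := eventually_inf_principal.2 (.of_forall fun z hz => hz)
  have ht : Tendsto P.hat l (Bornology.cobounded ℂ ⊓ 𝓟 {z | conj z ∈ P.Omega}) := by
    refine tendsto_inf.2 ⟨?_, tendsto_principal.2 ?_⟩
    · have h1 : Tendsto (fun z : ℂ => -(P.q₀ : ℂ) ^ 2 * z⁻¹) (𝓝[≠] 0) (Bornology.cobounded ℂ) :=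
        (Filter.tendsto_mul_left_cobounded (neg_ne_zero.2 (pow_ne_zero 2 hq'))).comp
          tendsto_inv₀_nhdsNE_zero
      have h2 : l ≤ 𝓝[≠] 0 := inf_le_inf_left _ (principal_mono.2 fun z hz => hz.1)
      refine (h1.mono_left h2).congr fun z => ?_
      rw [hat, div_eq_mul_inv]
    · filter_upwards [hmem] with z hz using conj_hat_mem_Omega h.pos hz
  have hkey : ∀ i j, (fun z => (P.Mminus x t (P.hat z) i j - (1 : Matrix (Fin 2) (Fin 2) ℂ) i j) / z)
      =O[l] fun _ => (1 : ℂ) := by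
    intro i j
    have h1 := ((hM i j).sub_isBigO inf_le_left).comp_tendsto ht
    have h2 := h1.mul (isBigO_refl (fun z : ℂ => z⁻¹) l)
    refine (h2.trans (IsBigO.of_bound (‖((P.q₀ : ℂ) ^ 2)⁻¹‖) ?_)).congr_left fun z => ?_
    · filter_upwards [hmem] with z hz
      have hz0 := hz.1
      simp only [Function.comp_apply, hat, norm_one, mul_one]
      rw [← norm_neg ((P.q₀ : ℂ) ^ 2)⁻¹]
      apply le_of_eq
      congr 1
      field_simp
    · simp [div_eq_mul_inv]
  have hk0 := (hkey i 1).const_mul_left P.qm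
  have hk1 := (hkey i 0).const_mul_left (-conj P.qm)
  have e : ∀ z ∈ P.Omega, ∀ j, (P.Mplus x t z - P.zeroPart z) i j =
      ∑ k, (P.Mminus x t (P.hat z) i k - (1 : Matrix (Fin 2) (Fin 2) ℂ) i k) * P.zeroPart z k j := by
    intro z hz j
    rw [Mplus_eq_hat h x hz]
    nth_rewrite 2 [← one_mul (P.zeroPart z)]
    rw [← sub_mul, Matrix.mul_apply]
    simp only [Matrix.sub_apply]
  fin_cases j
  · refine hk0.congr' ?_ EventuallyEq.rfl
    filter_upwards [hmem] with z hz
    rw [e z hz]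
    simp [zeroPart_eq, Fin.sum_univ_two]
    ring
  · refine hk1.congr' ?_ EventuallyEq.rfl
    filter_upwards [hmem] with z hz
    rw [e z hz]
    simp [zeroPart_eq, Fin.sum_univ_two]
    ring

theorem Mminus_sub_zeroPart_eq (h : P.Admissible t) (x : ℝ) {z : ℂ} (hz : conj z ∈ P.Omega)
    (i j : Fin 2) : ‖(P.Mminus x t z - P.zeroPart z) i j‖ =
      ‖(P.Mplus x t (conj z) - P.zeroPart (conj z)) i.rev j.rev‖ := by
  rw [Mminus_eq_conj h x hz, zeroPart_eq, zeroPart_eq, ← RCLike.norm_conj]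
  fin_cases i <;> fin_cases j <;> simp
  · rw [← norm_neg]; congr 1; ring
  · rw [← norm_neg]; congr 1; ring

end NZBCData

/-! ### Cauchy's theorem for the exterior and the interior half disc. -/

section HalfAnnulus

open Set

/-- The integral along the upper half of the circle of radius `ρ`, counterclockwise. -/
noncomputable def upperArc (f : ℂ → ℂ) (ρ : ℝ) : ℂ :=
  ∫ φ in (0 : ℝ)..Real.pi, f (ρ * Complex.exp (φ * Complex.I)) *
    (Complex.I * (ρ * Complex.exp (φ * Complex.I)))

theorem norm_mul_exp_mul_I {ρ : ℝ} (hρ : 0 ≤ ρ) (φ : ℝ) :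
    ‖(ρ : ℂ) * Complex.exp (φ * Complex.I)‖ = ρ := by
  rw [norm_mul, Complex.norm_exp_ofReal_mul_I, mul_one, Complex.norm_real, Real.norm_of_nonneg hρ]

theorem im_mul_exp_mul_I (ρ φ : ℝ) :
    ((ρ : ℂ) * Complex.exp (φ * Complex.I)).im = ρ * Real.sin φ := by
  rw [Complex.im_ofReal_mul, Complex.exp_ofReal_mul_I_im]

/-- The exponential maps the rectangle `[log r, log R] × [0, π]` onto the half annulus, so Cauchy's
theorem for rectangles applies to `f(e^ζ) e^ζ`. -/
theorem halfAnnulus_integral_eq_zero {f : ℂ → ℂ} {r R : ℝ} (hr : 0 < r) (hrR : r ≤ R)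
    (hc : ContinuousOn f {z | 0 ≤ z.im ∧ r ≤ ‖z‖ ∧ ‖z‖ ≤ R})
    (hd : DifferentiableOn ℂ f {z | 0 < z.im ∧ r < ‖z‖ ∧ ‖z‖ < R}) :
    (∫ s in r..R, f s) + (∫ s in r..R, f (-s)) + upperArc f R - upperArc f r = 0 := by
  have hR : 0 < R := hr.trans_le hrR
  have hlog : Real.log r ≤ Real.log R := Real.log_le_log hr hrR
  have hpi := Real.pi_pos.le
  have hexpn : ∀ ζ : ℂ, ‖Complex.exp ζ‖ = Real.exp ζ.re := Complex.norm_exp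
  have him : ∀ ζ : ℂ, (Complex.exp ζ).im = Real.exp ζ.re * Real.sin ζ.im := Complex.exp_im
  have hre1 : ((Real.log r : ℂ)).re = Real.log r := Complex.ofReal_re _
  have hre2 : ((Real.log R : ℂ) + Real.pi * Complex.I).re = Real.log R := by simp
  have him1 : ((Real.log r : ℂ)).im = 0 := Complex.ofReal_im _
  have him2 : ((Real.log R : ℂ) + Real.pi * Complex.I).im = Real.pi := by simp
  have hrect := Complex.integral_boundary_rect_eq_zero_of_continuousOn_of_differentiableOn
    (fun ζ => f (Complex.exp ζ) * Complex.exp ζ) (Real.log r : ℂ)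
    ((Real.log R : ℂ) + Real.pi * Complex.I)
    (by
      refine ContinuousOn.mul (hc.comp Complex.continuous_exp.continuousOn ?_)
        Complex.continuous_exp.continuousOn
      intro ζ hζ
      rw [hre1, hre2, him1, him2, uIcc_of_le hlog, uIcc_of_le hpi] at hζ
      obtain ⟨⟨h1, h2⟩, h3⟩ := hζ
      refine ⟨?_, ?_, ?_⟩
      · rw [him]
        exact mul_nonneg (Real.exp_nonneg _) (Real.sin_nonneg_of_mem_Icc h3)
      · rw [hexpn, ← Real.log_le_iff_le_exp hr]; exact h1
      · rw [hexpn, ← Real.le_log_iff_exp_le hR]; exact h2)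
    (by
      refine DifferentiableOn.mul (hd.comp Complex.differentiable_exp.differentiableOn ?_)
        Complex.differentiable_exp.differentiableOn
      intro ζ hζ
      rw [hre1, hre2, him1, him2, min_eq_left hlog, max_eq_right hlog, min_eq_left hpi,
        max_eq_right hpi] at hζ
      obtain ⟨⟨h1, h2⟩, h3⟩ := hζ
      refine ⟨?_, ?_, ?_⟩
      · rw [him]
        exact mul_pos (Real.exp_pos _) (Real.sin_pos_of_mem_Ioo h3)
      · rw [hexpn, ← Real.log_lt_iff_lt_exp hr]; exact h1
      · rw [hexpn, ← Real.lt_log_iff_exp_lt hR]; exact h2)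
  rw [hre1, hre2, him1, him2] at hrect
  have hsub : ∀ g : ℝ → ℂ, ContinuousOn g (Icc r R) →
      ∫ x in Real.log r..Real.log R, g (Real.exp x) * Real.exp x = ∫ s in r..R, g s := by
    intro g hg
    have := intervalIntegral.integral_deriv_smul_comp' (a := Real.log r) (b := Real.log R)
      (f := Real.exp) (f' := Real.exp) (g := g) (fun x _ => Real.hasDerivAt_exp x)
      Real.continuous_exp.continuousOn (hg.mono (by
        rintro _ ⟨x, hx, rfl⟩
        rw [uIcc_of_le hlog] at hx
        exact ⟨(Real.log_le_iff_le_exp hr).1 hx.1, (Real.le_log_iff_exp_le hR).1 hx.2⟩))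
    rw [Real.exp_log hr, Real.exp_log hR] at this
    rw [← this]
    refine intervalIntegral.integral_congr fun x _ => ?_
    simp only [Function.comp_apply, Complex.real_smul]
    ring
  have hpos : ∀ s ∈ Icc r R, ‖(s : ℂ)‖ = s := fun s hs => by
    rw [Complex.norm_real, Real.norm_of_nonneg (hr.le.trans hs.1)]
  have hg1 := hsub (fun s => f s) (hc.comp Complex.continuous_ofReal.continuousOn (by
    intro s hs
    exact ⟨by simp, by rw [hpos s hs]; exact hs.1, by rw [hpos s hs]; exact hs.2⟩))
  have hg2 := hsub (fun s => f (-s)) (hc.comp (Complex.continuous_ofReal.neg).continuousOn (by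
    intro s hs
    exact ⟨by simp, by rw [norm_neg, hpos s hs]; exact hs.1,
      by rw [norm_neg, hpos s hs]; exact hs.2⟩))
  have e1 : ∫ x : ℝ in Real.log r..Real.log R, f (Complex.exp (x + (0 : ℝ) * Complex.I)) *
      Complex.exp (x + (0 : ℝ) * Complex.I) = ∫ s in r..R, f s := by
    rw [← hg1]
    refine intervalIntegral.integral_congr fun x _ => ?_
    simp
  have e2 : ∫ x : ℝ in Real.log r..Real.log R, f (Complex.exp (x + Real.pi * Complex.I)) *
      Complex.exp (x + Real.pi * Complex.I) = -∫ s in r..R, f (-s) := by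
    rw [← hg2, ← intervalIntegral.integral_neg]
    refine intervalIntegral.integral_congr fun x _ => ?_
    simp [Complex.exp_add]
  have e3 : ∀ ρ : ℝ, 0 < ρ → Complex.I • ∫ y : ℝ in (0 : ℝ)..Real.pi,
      f (Complex.exp ((Real.log ρ : ℝ) + y * Complex.I)) *
        Complex.exp ((Real.log ρ : ℝ) + y * Complex.I) = upperArc f ρ := by
    intro ρ hρ
    rw [upperArc, ← intervalIntegral.integral_smul]
    refine intervalIntegral.integral_congr fun y _ => ?_
    simp only [Complex.exp_add, ← Complex.ofReal_exp, Real.exp_log hρ, smul_eq_mul]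
    ring
  simp only [e1, e2, e3 R hR, e3 r hr] at hrect
  linear_combination hrect

theorem tendsto_intervalIntegral_of_exhaust {f : ℝ → ℂ} {S : Set ℝ} (hS : MeasurableSet S)
    (hf : IntegrableOn f S) {r R : ℕ → ℝ} (hrR : ∀ n, r n ≤ R n)
    (hsub : ∀ n, Ioc (r n) (R n) ⊆ S) (hev : ∀ s ∈ S, ∀ᶠ n in atTop, s ∈ Ioc (r n) (R n)) :
    Tendsto (fun n => ∫ s in r n..R n, f s) atTop (𝓝 (∫ s in S, f s)) := by
  have h := tendsto_integral_of_dominated_convergence (μ := volume.restrict S)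
    (F := fun n => (Ioc (r n) (R n)).indicator f) (f := f) (fun s => ‖f s‖)
    (fun n => hf.aestronglyMeasurable.indicator measurableSet_Ioc) hf.norm
    (fun n => .of_forall fun s => norm_indicator_le_norm_self _ _)
    (by
      filter_upwards [ae_restrict_mem hS] with s hs
      refine tendsto_const_nhds.congr' ?_
      filter_upwards [hev s hs] with n hn
      rw [indicator_of_mem hn])
  refine h.congr fun n => ?_
  rw [integral_indicator measurableSet_Ioc, Measure.restrict_restrict measurableSet_Ioc,
    inter_eq_left.2 (hsub n), intervalIntegral.integral_of_le (hrR n)]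

theorem tendsto_upperArc_zero {f : ℂ → ℂ} {ρ : ℕ → ℝ} (hρ : ∀ n, 0 < ρ n) {ε : ℕ → ℝ}
    (hf : ∀ n, ∀ φ ∈ Icc 0 Real.pi, ‖f (ρ n * Complex.exp (φ * Complex.I))‖ * ρ n ≤ ε n)
    (hε : Tendsto ε atTop (𝓝 0)) : Tendsto (fun n => upperArc f (ρ n)) atTop (𝓝 0) := by
  refine squeeze_zero_norm (a := fun n => ε n * |Real.pi - 0|) (fun n => ?_) ?_
  · refine intervalIntegral.norm_integral_le_of_norm_le_const fun φ hφ => ?_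
    rw [uIoc_of_le Real.pi_pos.le] at hφ
    rw [norm_mul, norm_mul Complex.I, Complex.norm_I, one_mul, norm_mul_exp_mul_I (hρ n).le]
    exact hf n φ ⟨hφ.1.le, hφ.2⟩
  · simpa using hε.mul_const |Real.pi - 0|

theorem exp_sq_ne_neg {φ : ℝ} (hφ : φ ∈ Icc 0 Real.pi) (h2 : φ ≠ Real.pi / 2) {ρ : ℝ} (hρ : 0 < ρ) :
    ((ρ : ℂ) * Complex.exp (φ * Complex.I)) ^ 2 ≠ -(ρ : ℂ) ^ 2 := by
  intro h
  have hρ' : (ρ : ℂ) ≠ 0 := by exact_mod_cast hρ.ne'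
  have h3 : Complex.exp (φ * Complex.I) ^ 2 = -1 := by
    rw [mul_pow] at h
    have : (ρ : ℂ) ^ 2 * (Complex.exp (φ * Complex.I) ^ 2 + 1) = 0 := by linear_combination h
    have := (mul_eq_zero.1 this).resolve_left (pow_ne_zero 2 hρ')
    linear_combination this
  have h4 : Complex.exp (φ * Complex.I) ^ 2 = ((Real.cos φ : ℝ) + (Real.sin φ : ℝ) * Complex.I) ^ 2 := by
    rw [Complex.exp_mul_I, Complex.ofReal_cos, Complex.ofReal_sin]
  have h5 : Real.cos φ ^ 2 - Real.sin φ ^ 2 = -1 := by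
    have := congrArg Complex.re (h4.symm.trans h3)
    simpa [pow_two, -Complex.ofReal_cos, -Complex.ofReal_sin] using this
  have h6 : Real.cos φ = 0 := by nlinarith [Real.sin_sq_add_cos_sq φ]
  rcases lt_or_gt_of_ne h2 with hlt | hgt
  · exact (Real.cos_pos_of_mem_Ioo ⟨by linarith [hφ.1, Real.pi_pos], hlt⟩).ne' h6
  · exact (Real.cos_neg_of_pi_div_two_lt_of_lt hgt (by linarith [hφ.2, Real.pi_pos])).ne h6

/-- The point `i q` may be missing from `K`: one angle is a null set, and boundedness replaces
continuity there. This is how the branch points are admitted. -/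
theorem tendsto_upperArc {f : ℂ → ℂ} {K : Set ℂ} {q : ℝ} (hc : ContinuousOn f K)
    {C : ℝ} (hb : ∀ z ∈ K, ‖f z‖ ≤ C) {ρ : ℕ → ℝ} (hρ : ∀ n, 0 < ρ n)
    (hρK : ∀ n, ∀ φ ∈ Icc 0 Real.pi, (ρ n * Complex.exp (φ * Complex.I) : ℂ) ∈ K)
    (hqK : ∀ φ ∈ Icc 0 Real.pi, φ ≠ Real.pi / 2 → (q * Complex.exp (φ * Complex.I) : ℂ) ∈ K)
    (hlim : Tendsto ρ atTop (𝓝 q)) :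
    Tendsto (fun n => upperArc f (ρ n)) atTop (𝓝 (upperArc f q)) := by
  obtain ⟨Q, hQ⟩ := hlim.bddAbove_range
  have hQ' : ∀ n, ρ n ≤ Q := fun n => hQ ⟨n, rfl⟩
  have hC : 0 ≤ C := (norm_nonneg _).trans (hb _ (hρK 0 0 ⟨le_rfl, Real.pi_pos.le⟩))
  refine intervalIntegral.tendsto_integral_filter_of_dominated_convergence (fun _ => C * Q) ?_ ?_
    intervalIntegrable_const ?_
  · refine .of_forall fun n => ?_
    have hcont : ContinuousOn (fun φ : ℝ => f (ρ n * Complex.exp (φ * Complex.I)) *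
        (Complex.I * (ρ n * Complex.exp (φ * Complex.I)))) (Icc 0 Real.pi) := by
      refine ContinuousOn.mul (hc.comp (by fun_prop) (hρK n)) (by fun_prop)
    rw [uIoc_of_le Real.pi_pos.le]
    exact (hcont.mono Ioc_subset_Icc_self).aestronglyMeasurable measurableSet_Ioc
  · refine .of_forall fun n => .of_forall fun φ hφ => ?_
    rw [uIoc_of_le Real.pi_pos.le] at hφ
    rw [norm_mul, norm_mul Complex.I, Complex.norm_I, one_mul, norm_mul_exp_mul_I (hρ n).le]
    have := hb _ (hρK n φ ⟨hφ.1.le, hφ.2⟩)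
    have := hQ' n
    have := (hρ n).le
    gcongr
  · have hne : ∀ᵐ φ : ℝ, φ ≠ Real.pi / 2 := by simp [ae_iff, measure_singleton]
    filter_upwards [hne] with φ hφ hφm
    rw [uIoc_of_le Real.pi_pos.le] at hφm
    have hφI : φ ∈ Icc 0 Real.pi := ⟨hφm.1.le, hφm.2⟩
    have ht : Tendsto (fun n => (ρ n * Complex.exp (φ * Complex.I) : ℂ)) atTop
        (𝓝 (q * Complex.exp (φ * Complex.I))) :=
      ((Complex.continuous_ofReal.tendsto q).comp hlim).mul_const _
    have ht' : Tendsto (fun n => (ρ n * Complex.exp (φ * Complex.I) : ℂ)) atTop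
        (𝓝[K] (q * Complex.exp (φ * Complex.I))) :=
      tendsto_nhdsWithin_iff.2 ⟨ht, .of_forall fun n => hρK n φ hφI⟩
    exact ((hc _ (hqK φ hφI hφ)).tendsto.comp ht').mul (ht.const_mul _)

theorem integrableOn_of_norm_le_div {f : ℝ → ℂ} {S : Set ℝ} (hS : MeasurableSet S)
    (hc : ContinuousOn f S) {C : ℝ} (hb : ∀ s ∈ S, ‖f s‖ ≤ C / (1 + s ^ 2)) : IntegrableOn f S := by
  refine ((integrable_inv_one_add_sq.const_mul C).integrableOn).mono'
    (hc.aestronglyMeasurable hS) ?_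
  filter_upwards [ae_restrict_mem hS] with s hs
  exact (hb s hs).trans_eq (div_eq_mul_inv _ _)

theorem sq_ne_neg_of_real {q : ℝ} (hq : 0 < q) (s : ℝ) : (s : ℂ) ^ 2 ≠ -(q : ℂ) ^ 2 := by
  intro h
  have : s ^ 2 = -q ^ 2 := by exact_mod_cast h
  nlinarith [sq_nonneg s]

/-- Half annuli with inner radius decreasing to `q` and outer radius going to infinity, where the
quadratic decay kills the arc. -/
theorem upperExterior_integral_eq {f : ℂ → ℂ} {q : ℝ} (hq : 0 < q)
    (hc : ContinuousOn f {z | 0 ≤ z.im ∧ q ≤ ‖z‖ ∧ z ^ 2 ≠ -(q : ℂ) ^ 2})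
    (hd : DifferentiableOn ℂ f {z | 0 < z.im ∧ q < ‖z‖}) {C : ℝ}
    (hb : ∀ z : ℂ, 0 ≤ z.im → q ≤ ‖z‖ → z ^ 2 ≠ -(q : ℂ) ^ 2 → ‖f z‖ ≤ C / (1 + ‖z‖ ^ 2)) :
    (∫ s in Ioi q, f s) + (∫ s in Ioi q, f (-s)) = upperArc f q := by
  have hsq : ∀ z : ℂ, q < ‖z‖ → z ^ 2 ≠ -(q : ℂ) ^ 2 := by
    intro z hz h
    have h3 : ‖z ^ 2‖ = ‖-(q : ℂ) ^ 2‖ := by rw [h]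
    rw [norm_neg, norm_pow, norm_pow, Complex.norm_real, Real.norm_of_nonneg hq.le] at h3
    nlinarith [norm_nonneg z]
  have hC : 0 ≤ C := by
    have h1 := (norm_nonneg _).trans (hb (q : ℂ) (by simp)
      (by rw [Complex.norm_real, Real.norm_of_nonneg hq.le]) (sq_ne_neg_of_real hq q))
    by_contra hC
    exact absurd h1 (not_le.2 (div_neg_of_neg_of_pos (not_le.1 hC) (by positivity)))
  have hmem : ∀ s ∈ Ioi q, (s : ℂ) ∈ {z : ℂ | 0 ≤ z.im ∧ q ≤ ‖z‖ ∧ z ^ 2 ≠ -(q : ℂ) ^ 2} ∧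
      (-s : ℂ) ∈ {z : ℂ | 0 ≤ z.im ∧ q ≤ ‖z‖ ∧ z ^ 2 ≠ -(q : ℂ) ^ 2} := by
    intro s hs
    have hs' : q < s := hs
    have hn : ‖(s : ℂ)‖ = s := by rw [Complex.norm_real, Real.norm_of_nonneg (hq.le.trans hs'.le)]
    refine ⟨⟨by simp, by rw [hn]; exact hs'.le, sq_ne_neg_of_real hq s⟩,
      ⟨by simp, by rw [norm_neg, hn]; exact hs'.le, ?_⟩⟩
    rw [neg_sq]; exact sq_ne_neg_of_real hq s
  have hi1 : IntegrableOn (fun s : ℝ => f s) (Ioi q) := by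
    refine integrableOn_of_norm_le_div measurableSet_Ioi
      (hc.comp Complex.continuous_ofReal.continuousOn fun s hs => (hmem s hs).1) (C := C) ?_
    intro s hs
    obtain ⟨h1, h2, h3⟩ := (hmem s hs).1
    simpa using hb s h1 h2 h3
  have hi2 : IntegrableOn (fun s : ℝ => f (-s)) (Ioi q) := by
    refine integrableOn_of_norm_le_div measurableSet_Ioi
      (hc.comp Complex.continuous_ofReal.neg.continuousOn fun s hs => (hmem s hs).2) (C := C) ?_
    intro s hs
    obtain ⟨h1, h2, h3⟩ := (hmem s hs).2
    simpa using hb (-s) h1 h2 h3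
  let r : ℕ → ℝ := fun n => q + q / (n + 2 : ℝ)
  let R : ℕ → ℝ := fun n => 2 * q + n
  have hr : ∀ n, q < r n := fun n => by
    have : 0 < q / (n + 2 : ℝ) := by positivity
    simp only [r]; linarith
  have hrR : ∀ n, r n ≤ R n := fun n => by
    have h1 : q / (n + 2 : ℝ) ≤ q := div_le_self hq.le (by linarith [n.cast_nonneg (α := ℝ)])
    simp only [r, R]
    linarith [n.cast_nonneg (α := ℝ)]
  have hrlim : Tendsto r atTop (𝓝 q) := by
    have h1 : Tendsto (fun n : ℕ => q / (n + 2 : ℝ)) atTop (𝓝 0) :=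
      tendsto_const_nhds.div_atTop
        (tendsto_atTop_add_const_right _ _ tendsto_natCast_atTop_atTop)
    simpa [r] using h1.const_add q
  have hRlim : Tendsto R atTop atTop :=
    tendsto_atTop_add_const_left _ _ tendsto_natCast_atTop_atTop
  have hev : ∀ s ∈ Ioi q, ∀ᶠ n in atTop, s ∈ Ioc (r n) (R n) := fun s hs =>
    (hrlim.eventually_lt_const hs).and (hRlim.eventually_ge_atTop s)
  have hsub : ∀ n, Ioc (r n) (R n) ⊆ Ioi q := fun n s hs => (hr n).trans hs.1
  have t1 := tendsto_intervalIntegral_of_exhaust measurableSet_Ioi hi1 hrR hsub hev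
  have t2 := tendsto_intervalIntegral_of_exhaust measurableSet_Ioi hi2 hrR hsub hev
  have hRpos : ∀ n, 0 < R n := fun n => (hq.trans (hr n)).trans_le (hrR n)
  have him : ∀ ρ : ℝ, 0 < ρ → ∀ φ ∈ Icc 0 Real.pi, 0 ≤ ((ρ : ℂ) * Complex.exp (φ * Complex.I)).im := by
    intro ρ hρ φ hφ
    rw [im_mul_exp_mul_I]
    exact mul_nonneg (le_of_lt hρ) (Real.sin_nonneg_of_mem_Icc hφ)
  have t3 : Tendsto (fun n => upperArc f (R n)) atTop (𝓝 0) := by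
    refine tendsto_upperArc_zero hRpos (ε := fun n => C / R n) (fun n φ hφ => ?_)
      (tendsto_const_nhds.div_atTop hRlim)
    have hn := norm_mul_exp_mul_I (hRpos n).le φ
    have hqR : q < R n := (hr n).trans_le (hrR n)
    have h1 := hb _ (him _ (hRpos n) φ hφ) (by rw [hn]; exact hqR.le) (hsq _ (by rw [hn]; exact hqR))
    rw [hn] at h1
    have hp := hRpos n
    calc _ ≤ C / (1 + R n ^ 2) * R n := by gcongr
      _ ≤ C / R n ^ 2 * R n := by gcongr; linarith
      _ = C / R n := by field_simp
  have t4 : Tendsto (fun n => upperArc f (r n)) atTop (𝓝 (upperArc f q)) := by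
    refine tendsto_upperArc hc (C := C) ?_ (fun n => hq.trans (hr n)) ?_ ?_ hrlim
    · intro z hz
      exact (hb z hz.1 hz.2.1 hz.2.2).trans (div_le_self hC (by nlinarith [sq_nonneg ‖z‖]))
    · intro n φ hφ
      have hn := norm_mul_exp_mul_I (hq.trans (hr n)).le φ
      exact ⟨him _ (hq.trans (hr n)) φ hφ, by rw [hn]; exact (hr n).le,
        hsq _ (by rw [hn]; exact hr n)⟩
    · intro φ hφ hne
      exact ⟨him _ hq φ hφ, by rw [norm_mul_exp_mul_I hq.le], exp_sq_ne_neg hφ hne hq⟩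
  have hz : ∀ n, (∫ s in r n..R n, f s) + (∫ s in r n..R n, f (-s)) + upperArc f (R n)
      - upperArc f (r n) = 0 := by
    intro n
    refine halfAnnulus_integral_eq_zero (hq.trans (hr n)) (hrR n) (hc.mono ?_) (hd.mono ?_)
    · intro z hz
      exact ⟨hz.1, (hr n).le.trans hz.2.1, hsq z ((hr n).trans_le hz.2.1)⟩
    · intro z hz
      exact ⟨hz.1, (hr n).trans hz.2.1⟩
  have hlim := ((t1.add t2).add t3).sub t4
  simp only [hz] at hlim
  have := tendsto_nhds_unique hlim tendsto_const_nhds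
  linear_combination this

/-- Half annuli again, now with inner radius going to zero; `f` is bounded and the inner arc
shrinks, so the origin contributes nothing. -/
theorem upperInterior_integral_eq {f : ℂ → ℂ} {q : ℝ} (hq : 0 < q)
    (hc : ContinuousOn f {z | 0 ≤ z.im ∧ ‖z‖ ≤ q ∧ z ≠ 0 ∧ z ^ 2 ≠ -(q : ℂ) ^ 2})
    (hd : DifferentiableOn ℂ f {z | 0 < z.im ∧ ‖z‖ < q}) {C : ℝ}
    (hb : ∀ z : ℂ, 0 ≤ z.im → ‖z‖ ≤ q → z ≠ 0 → z ^ 2 ≠ -(q : ℂ) ^ 2 → ‖f z‖ ≤ C) :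
    (∫ s in Ioo 0 q, f s) + (∫ s in Ioo 0 q, f (-s)) = -upperArc f q := by
  have hsq : ∀ z : ℂ, ‖z‖ < q → z ^ 2 ≠ -(q : ℂ) ^ 2 := by
    intro z hz h
    have h3 : ‖z ^ 2‖ = ‖-(q : ℂ) ^ 2‖ := by rw [h]
    rw [norm_neg, norm_pow, norm_pow, Complex.norm_real, Real.norm_of_nonneg hq.le] at h3
    nlinarith [norm_nonneg z]
  have hC : 0 ≤ C := (norm_nonneg _).trans (hb (q : ℂ) (by simp)
      (by rw [Complex.norm_real, Real.norm_of_nonneg hq.le])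
      (by exact_mod_cast hq.ne') (sq_ne_neg_of_real hq q))
  have hmem : ∀ s ∈ Ioo 0 q, (s : ℂ) ∈ {z : ℂ | 0 ≤ z.im ∧ ‖z‖ ≤ q ∧ z ≠ 0 ∧ z ^ 2 ≠ -(q : ℂ) ^ 2} ∧
      (-s : ℂ) ∈ {z : ℂ | 0 ≤ z.im ∧ ‖z‖ ≤ q ∧ z ≠ 0 ∧ z ^ 2 ≠ -(q : ℂ) ^ 2} := by
    intro s hs
    have hn : ‖(s : ℂ)‖ = s := by rw [Complex.norm_real, Real.norm_of_nonneg hs.1.le]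
    have h0 : (s : ℂ) ≠ 0 := by exact_mod_cast hs.1.ne'
    refine ⟨⟨by simp, by rw [hn]; exact hs.2.le, h0, sq_ne_neg_of_real hq s⟩,
      ⟨by simp, by rw [norm_neg, hn]; exact hs.2.le, neg_ne_zero.2 h0, ?_⟩⟩
    rw [neg_sq]; exact sq_ne_neg_of_real hq s
  have hbi : ∀ g : ℝ → ℂ, ContinuousOn g (Ioo 0 q) → (∀ s ∈ Ioo 0 q, ‖g s‖ ≤ C) →
      IntegrableOn g (Ioo 0 q) := by
    intro g hg hgb
    refine (integrableOn_const (C := C) (by simp)).mono' (hg.aestronglyMeasurable measurableSet_Ioo) ?_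
    filter_upwards [ae_restrict_mem measurableSet_Ioo] with s hs using hgb s hs
  have hi1 : IntegrableOn (fun s : ℝ => f s) (Ioo 0 q) := by
    refine hbi _ (hc.comp Complex.continuous_ofReal.continuousOn fun s hs => (hmem s hs).1) ?_
    intro s hs
    obtain ⟨h1, h2, h3, h4⟩ := (hmem s hs).1
    exact hb s h1 h2 h3 h4
  have hi2 : IntegrableOn (fun s : ℝ => f (-s)) (Ioo 0 q) := by
    refine hbi _ (hc.comp Complex.continuous_ofReal.neg.continuousOn fun s hs => (hmem s hs).2) ?_
    intro s hs
    obtain ⟨h1, h2, h3, h4⟩ := (hmem s hs).2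
    exact hb (-s) h1 h2 h3 h4
  -- The shift by `2` gives `r n ≤ q / 2 ≤ R n` already for `n = 0`.
  let r : ℕ → ℝ := fun n => q / (n + 2 : ℝ)
  let R : ℕ → ℝ := fun n => q - q / (n + 2 : ℝ)
  have hr : ∀ n, 0 < r n := fun n => by positivity
  have hrh : ∀ n, r n ≤ q / 2 := fun n => by
    have : (2 : ℝ) ≤ n + 2 := by linarith [n.cast_nonneg (α := ℝ)]
    simp only [r]
    gcongr
  have hRq : ∀ n, R n < q := fun n => by have := hr n; simp only [r] at this; simp only [R]; linarith
  have hrR : ∀ n, r n ≤ R n := fun n => by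
    have := hrh n
    simp only [r] at this
    simp only [r, R]
    linarith
  have hrlim : Tendsto r atTop (𝓝 0) :=
    tendsto_const_nhds.div_atTop (tendsto_atTop_add_const_right _ _ tendsto_natCast_atTop_atTop)
  have hRlim : Tendsto R atTop (𝓝 q) := by simpa [R, r] using hrlim.const_sub q
  have hev : ∀ s ∈ Ioo 0 q, ∀ᶠ n in atTop, s ∈ Ioc (r n) (R n) := fun s hs =>
    (hrlim.eventually_lt_const hs.1).and (hRlim.eventually_const_le hs.2)
  have hsub : ∀ n, Ioc (r n) (R n) ⊆ Ioo 0 q := fun n s hs =>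
    ⟨(hr n).trans hs.1, hs.2.trans_lt (hRq n)⟩
  have t1 := tendsto_intervalIntegral_of_exhaust measurableSet_Ioo hi1 hrR hsub hev
  have t2 := tendsto_intervalIntegral_of_exhaust measurableSet_Ioo hi2 hrR hsub hev
  have hRpos : ∀ n, 0 < R n := fun n => (hr n).trans_le (hrR n)
  have him : ∀ ρ : ℝ, 0 < ρ → ∀ φ ∈ Icc 0 Real.pi, 0 ≤ ((ρ : ℂ) * Complex.exp (φ * Complex.I)).im := by
    intro ρ hρ φ hφ
    rw [im_mul_exp_mul_I]
    exact mul_nonneg (le_of_lt hρ) (Real.sin_nonneg_of_mem_Icc hφ)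
  have hne0 : ∀ z : ℂ, 0 < ‖z‖ → z ≠ 0 := fun z => norm_pos_iff.1
  have t3 : Tendsto (fun n => upperArc f (r n)) atTop (𝓝 0) := by
    refine tendsto_upperArc_zero hr (ε := fun n => C * r n) (fun n φ hφ => ?_)
      (by simpa using hrlim.const_mul C)
    have hn := norm_mul_exp_mul_I (hr n).le φ
    have hrq : r n < q := (hrR n).trans_lt (hRq n)
    have h1 := hb _ (him _ (hr n) φ hφ) (by rw [hn]; exact hrq.le)
      (hne0 _ (by rw [hn]; exact hr n)) (hsq _ (by rw [hn]; exact hrq))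
    have := (hr n).le
    gcongr
  have t4 : Tendsto (fun n => upperArc f (R n)) atTop (𝓝 (upperArc f q)) := by
    refine tendsto_upperArc hc (C := C) (fun z hz => hb z hz.1 hz.2.1 hz.2.2.1 hz.2.2.2)
      hRpos ?_ ?_ hRlim
    · intro n φ hφ
      have hn := norm_mul_exp_mul_I (hRpos n).le φ
      exact ⟨him _ (hRpos n) φ hφ, by rw [hn]; exact (hRq n).le,
        hne0 _ (by rw [hn]; exact hRpos n), hsq _ (by rw [hn]; exact hRq n)⟩
    · intro φ hφ hne
      have hn := norm_mul_exp_mul_I hq.le φ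
      exact ⟨him _ hq φ hφ, by rw [hn], hne0 _ (by rw [hn]; exact hq), exp_sq_ne_neg hφ hne hq⟩
  have hz : ∀ n, (∫ s in r n..R n, f s) + (∫ s in r n..R n, f (-s)) + upperArc f (R n)
      - upperArc f (r n) = 0 := by
    intro n
    refine halfAnnulus_integral_eq_zero (hr n) (hrR n) (hc.mono ?_) (hd.mono ?_)
    · intro z hz
      have hzq : ‖z‖ < q := hz.2.2.trans_lt (hRq n)
      exact ⟨hz.1, hzq.le, hne0 z ((hr n).trans_le hz.2.1), hsq z hzq⟩
    · intro z hz
      exact ⟨hz.1, hz.2.2.trans (hRq n)⟩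
  have hlim := ((t1.add t2).add t4).sub t3
  simp only [hz] at hlim
  have := tendsto_nhds_unique hlim tendsto_const_nhds
  linear_combination this

end HalfAnnulus

/-! ### The integral along `Σ`. -/

namespace NZBCData

open Set

variable {P : NZBCData} {t : ℝ}

variable (P) in
/-- The contour without the origin and the branch points. -/
def regContour : Set ℂ := {s | s ∈ P.contour ∧ s ≠ 0 ∧ s ^ 2 ≠ -(P.q₀ : ℂ) ^ 2}

theorem regContour_subset_Omega : P.regContour ⊆ P.Omega := by
  rintro s ⟨h1, h2, h3⟩
  refine ⟨h2, h3, ?_⟩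
  rcases h1 with h1 | h1 <;> simp [h1]

theorem conj_mem_regContour {s : ℂ} (hs : s ∈ P.regContour) : conj s ∈ P.regContour := by
  obtain ⟨h1, h2, h3⟩ := hs
  refine ⟨?_, (map_ne_zero _).2 h2, fun h => h3 ?_⟩
  · rcases h1 with h1 | h1
    · exact Or.inl (by simp [h1])
    · exact Or.inr (by simp [h1])
  · have := congrArg (starRingEnd ℂ) h
    simpa using this

theorem ofReal_mem_regContour (hq : 0 < P.q₀) {s : ℝ} (hs : s ≠ 0) : (s : ℂ) ∈ P.regContour :=
  ⟨Or.inl (by simp), by exact_mod_cast hs, sq_ne_neg_of_real hq s⟩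

theorem norm_circlePt (hq : 0 < P.q₀) (φ : ℝ) : ‖P.circlePt φ‖ = P.q₀ :=
  norm_mul_exp_mul_I hq.le φ

theorem continuous_circlePt : Continuous P.circlePt := by unfold circlePt; fun_prop

theorem circlePt_add_pi (φ : ℝ) : P.circlePt (φ + Real.pi) = -P.circlePt φ := by
  simp [circlePt, add_mul, Complex.exp_add]

theorem circlePt_mem_regContour (hq : 0 < P.q₀) {φ : ℝ} (h : P.circlePt φ ^ 2 ≠ -(P.q₀ : ℂ) ^ 2) :
    P.circlePt φ ∈ P.regContour :=
  ⟨Or.inr (norm_circlePt hq φ), norm_pos_iff.1 (by rw [norm_circlePt hq]; exact hq), h⟩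

theorem ae_circlePt_sq_ne (hq : 0 < P.q₀) : ∀ᵐ φ : ℝ, P.circlePt φ ^ 2 ≠ -(P.q₀ : ℂ) ^ 2 := by
  have hc : (range fun n : ℤ => (2 * n + 1) * Real.pi / 2).Countable := countable_range _
  filter_upwards [hc.ae_notMem volume] with φ hφ h
  apply hφ
  have hq' : (P.q₀ : ℂ) ≠ 0 := by exact_mod_cast hq.ne'
  have h3 : Complex.exp (φ * Complex.I) ^ 2 = -1 := by
    rw [circlePt, mul_pow] at h
    have : (P.q₀ : ℂ) ^ 2 * (Complex.exp (φ * Complex.I) ^ 2 + 1) = 0 := by linear_combination h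
    have := (mul_eq_zero.1 this).resolve_left (pow_ne_zero 2 hq')
    linear_combination this
  rw [Complex.exp_mul_I, ← Complex.ofReal_cos, ← Complex.ofReal_sin] at h3
  have h5 : Real.cos φ ^ 2 - Real.sin φ ^ 2 = -1 := by
    simpa [pow_two, -Complex.ofReal_cos, -Complex.ofReal_sin] using congrArg Complex.re h3
  have h6 : Real.cos φ = 0 := by nlinarith [Real.sin_sq_add_cos_sq φ]
  obtain ⟨n, hn⟩ := Real.cos_eq_zero_iff.1 h6
  exact ⟨n, hn.symm⟩

theorem ae_ofReal_mem_regContour (hq : 0 < P.q₀) : ∀ᵐ s : ℝ, (s : ℂ) ∈ P.regContour := by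
  have : ∀ᵐ s : ℝ, s ≠ 0 := by simp [ae_iff, measure_singleton]
  filter_upwards [this] with s hs using ofReal_mem_regContour hq hs

theorem ae_circlePt_mem_regContour (hq : 0 < P.q₀) : ∀ᵐ φ : ℝ, P.circlePt φ ∈ P.regContour := by
  filter_upwards [ae_circlePt_sq_ne hq] with φ hφ using circlePt_mem_regContour hq hφ

/-- The origin and the branch points are null sets in both parametrisations, so identities are only
needed where the boundary values are defined. -/
theorem contourIntegral_congr (hq : 0 < P.q₀) {f g : ℂ → ℂ} (h : EqOn f g P.regContour) :
    P.contourIntegral f = P.contourIntegral g := by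
  have h1 : (fun s : ℝ => f s) =ᵐ[volume] fun s : ℝ => g s := by
    filter_upwards [ae_ofReal_mem_regContour hq] with s hs using h hs
  have h2 : ∀ a b : ℝ, ∫ φ in a..b, f (P.circlePt φ) * (Complex.I * P.circlePt φ)
      = ∫ φ in a..b, g (P.circlePt φ) * (Complex.I * P.circlePt φ) := fun a b => by
    refine intervalIntegral.integral_congr_ae ?_
    filter_upwards [ae_circlePt_mem_regContour hq] with φ hφ _
    rw [h hφ]
  unfold contourIntegral
  rw [h2, h2, integral_congr_ae (ae_restrict_of_ae h1), integral_congr_ae (ae_restrict_of_ae h1)]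

theorem ContourIntegrable.congr (hq : 0 < P.q₀) {f g : ℂ → ℂ} (hf : P.ContourIntegrable f)
    (h : EqOn f g P.regContour) : P.ContourIntegrable g := by
  refine ⟨hf.1.congr ?_, hf.2.congr_ae (ae_restrict_of_ae ?_)⟩
  · filter_upwards [ae_ofReal_mem_regContour hq] with s hs using h hs
  · filter_upwards [ae_circlePt_mem_regContour hq] with φ hφ using h hφ

theorem contourIntegrable_of_norm_le (hq : 0 < P.q₀) {f : ℂ → ℂ} (hc : ContinuousOn f P.regContour)
    {C : ℝ} (hb : ∀ s ∈ P.regContour, ‖f s‖ ≤ C / (1 + ‖s‖ ^ 2)) : P.ContourIntegrable f := by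
  constructor
  · have h0 : ({0}ᶜ : Set ℝ) ∈ ae (volume : Measure ℝ) := by simp [mem_ae_iff]
    rw [← Measure.restrict_eq_self_of_ae_mem (s := {0}ᶜ) h0]
    refine integrableOn_of_norm_le_div (measurableSet_singleton 0).compl
      (hc.comp Complex.continuous_ofReal.continuousOn fun s hs => ofReal_mem_regContour hq hs)
      (C := C) fun s hs => ?_
    simpa using hb s (ofReal_mem_regContour hq hs)
  · have hT : IsOpen {φ : ℝ | P.circlePt φ ^ 2 ≠ -(P.q₀ : ℂ) ^ 2} :=
      isOpen_ne_fun (continuous_circlePt.pow 2) continuous_const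
    have hm : AEStronglyMeasurable (fun φ => f (P.circlePt φ)) volume := by
      rw [← Measure.restrict_eq_self_of_ae_mem (ae_circlePt_sq_ne hq)]
      exact (hc.comp continuous_circlePt.continuousOn
        fun φ hφ => circlePt_mem_regContour hq hφ).aestronglyMeasurable hT.measurableSet
    rw [intervalIntegrable_iff]
    refine Measure.integrableOn_of_bounded (M := C / (1 + P.q₀ ^ 2)) measure_Ioc_lt_top.ne hm ?_
    refine ae_restrict_of_ae ?_
    filter_upwards [ae_circlePt_mem_regContour hq] with φ hφ
    simpa [norm_circlePt hq] using hb _ hφ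

theorem ContourIntegrable.arc {f : ℂ → ℂ} (hf : P.ContourIntegrable f) {a b : ℝ}
    (h : uIcc a b ⊆ Icc 0 (2 * Real.pi)) :
    IntervalIntegrable (fun φ => f (P.circlePt φ) * (Complex.I * P.circlePt φ)) volume a b := by
  have h2 : IntervalIntegrable (fun φ => f (P.circlePt φ)) volume a b :=
    hf.2.mono_set (by rwa [uIcc_of_le (by positivity : (0 : ℝ) ≤ 2 * Real.pi)])
  exact h2.mul_continuousOn (continuous_const.mul continuous_circlePt).continuousOn

theorem ContourIntegrable.upper {f : ℂ → ℂ} (hf : P.ContourIntegrable f) :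
    IntervalIntegrable (fun φ => f (P.circlePt φ) * (Complex.I * P.circlePt φ)) volume 0 Real.pi :=
  hf.arc (by
    rw [uIcc_of_le Real.pi_pos.le]; exact Icc_subset_Icc_right (by linarith [Real.pi_pos]))

theorem ContourIntegrable.lower {f : ℂ → ℂ} (hf : P.ContourIntegrable f) :
    IntervalIntegrable (fun φ => f (P.circlePt φ) * (Complex.I * P.circlePt φ)) volume
      Real.pi (2 * Real.pi) :=
  hf.arc (by
    rw [uIcc_of_le (by linarith [Real.pi_pos])]; exact Icc_subset_Icc_left Real.pi_pos.le)

theorem ContourIntegrable.add {f g : ℂ → ℂ} (hf : P.ContourIntegrable f)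
    (hg : P.ContourIntegrable g) : P.ContourIntegrable fun s => f s + g s :=
  ⟨hf.1.add hg.1, hf.2.add hg.2⟩

theorem ContourIntegrable.const_mul {f : ℂ → ℂ} (hf : P.ContourIntegrable f) (c : ℂ) :
    P.ContourIntegrable fun s => c * f s :=
  ⟨hf.1.const_mul c, hf.2.const_mul c⟩

theorem ContourIntegrable.sub {f g : ℂ → ℂ} (hf : P.ContourIntegrable f)
    (hg : P.ContourIntegrable g) : P.ContourIntegrable fun s => f s - g s :=
  ⟨hf.1.sub hg.1, hf.2.sub hg.2⟩

theorem contourIntegral_add {f g : ℂ → ℂ} (hf : P.ContourIntegrable f) (hg : P.ContourIntegrable g) :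
    P.contourIntegral (fun s => f s + g s) = P.contourIntegral f + P.contourIntegral g := by
  unfold contourIntegral
  simp only [add_mul]
  rw [integral_add hf.1.integrableOn hg.1.integrableOn,
    integral_add hf.1.integrableOn hg.1.integrableOn,
    intervalIntegral.integral_add hf.upper hg.upper,
    intervalIntegral.integral_add hf.lower hg.lower]
  ring

theorem contourIntegral_const_mul (f : ℂ → ℂ) (c : ℂ) :
    P.contourIntegral (fun s => c * f s) = c * P.contourIntegral f := by
  unfold contourIntegral
  simp only [mul_assoc, integral_const_mul, intervalIntegral.integral_const_mul]
  ring

theorem contourIntegral_sub {f g : ℂ → ℂ} (hf : P.ContourIntegrable f) (hg : P.ContourIntegrable g) :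
    P.contourIntegral (fun s => f s - g s) = P.contourIntegral f - P.contourIntegral g := by
  have h := contourIntegral_add hf (hg.const_mul (-1))
  rw [contourIntegral_const_mul] at h
  simp only [neg_mul, one_mul, ← sub_eq_add_neg] at h
  exact h

/-- The lower half circle is the image of the upper one under `z ↦ -z`. In this form the pieces of
the contour match the two half-plane theorems applied to `f` and to `z ↦ f (-z)`. -/
theorem contourIntegral_eq_rays (hq : 0 < P.q₀) {f : ℂ → ℂ} (hf : P.ContourIntegrable f) :
    P.contourIntegral f = ((∫ s : ℝ in Ioi P.q₀, f s) + ∫ s : ℝ in Ioi P.q₀, f (-s))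
      - ((∫ s : ℝ in Ioo 0 P.q₀, f s) + ∫ s : ℝ in Ioo 0 P.q₀, f (-s))
      - upperArc f P.q₀ - upperArc (fun z => f (-z)) P.q₀ := by
  have h1 : ∫ s in {s : ℝ | P.q₀ < |s|}, f s =
      (∫ s : ℝ in Ioi P.q₀, f s) + ∫ s : ℝ in Ioi P.q₀, f (-s) := by
    have hset : {s : ℝ | P.q₀ < |s|} = Ioi P.q₀ ∪ Iio (-P.q₀) := by
      ext s
      simp only [mem_ofPred_eq, mem_union, mem_Ioi, mem_Iio, lt_abs]
      exact or_congr Iff.rfl ⟨fun h => by linarith, fun h => by linarith⟩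
    have hd : Disjoint (Ioi P.q₀) (Iio (-P.q₀)) := by
      rw [Set.disjoint_left]
      intro s h1 h2
      simp only [mem_Ioi, mem_Iio] at h1 h2
      linarith
    rw [hset, setIntegral_union hd measurableSet_Iio hf.1.integrableOn hf.1.integrableOn,
      ← integral_Iic_eq_integral_Iio, ← integral_comp_neg_Ioi P.q₀ fun s : ℝ => f s]
    simp
  have h2 : ∫ s in {s : ℝ | |s| < P.q₀}, f s =
      (∫ s : ℝ in Ioo 0 P.q₀, f s) + ∫ s : ℝ in Ioo 0 P.q₀, f (-s) := by
    have hset : {s : ℝ | |s| < P.q₀} = Ioo (-P.q₀) P.q₀ := by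
      ext s; simp [abs_lt]
    have hi : ∀ a b : ℝ, IntervalIntegrable (fun s : ℝ => f s) volume a b := fun a b =>
      hf.1.intervalIntegrable
    rw [hset, ← integral_Ioc_eq_integral_Ioo, ← integral_Ioc_eq_integral_Ioo,
      ← integral_Ioc_eq_integral_Ioo, ← intervalIntegral.integral_of_le (by linarith),
      ← intervalIntegral.integral_of_le hq.le, ← intervalIntegral.integral_of_le hq.le,
      ← intervalIntegral.integral_add_adjacent_intervals (hi (-P.q₀) 0) (hi 0 P.q₀)]
    have := intervalIntegral.integral_comp_neg (a := 0) (b := P.q₀) fun s : ℝ => f s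
    rw [neg_zero] at this
    rw [← this]
    simp [add_comm]
  have h3 : ∫ φ in Real.pi..(2 * Real.pi), f (P.circlePt φ) * (Complex.I * P.circlePt φ)
      = -upperArc (fun z => f (-z)) P.q₀ := by
    have := intervalIntegral.integral_comp_add_right (a := 0) (b := Real.pi)
      (fun φ => f (P.circlePt φ) * (Complex.I * P.circlePt φ)) Real.pi
    rw [zero_add, ← two_mul] at this
    rw [← this, upperArc, ← intervalIntegral.integral_neg]
    refine intervalIntegral.integral_congr fun φ _ => ?_
    simp only [circlePt_add_pi]
    rw [circlePt]
    ring
  rw [contourIntegral, h1, h2, h3]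
  unfold upperArc circlePt
  ring

theorem ContourIntegrable.comp_neg {f : ℂ → ℂ} (hf : P.ContourIntegrable f) :
    P.ContourIntegrable fun s => f (-s) := by
  refine ⟨by simpa using hf.1.comp_neg, ?_⟩
  have hpi := Real.pi_pos
  have hsub : ∀ a b : ℝ, uIcc a b ⊆ Icc 0 (2 * Real.pi) →
      IntervalIntegrable (fun φ => f (P.circlePt φ)) volume a b := fun a b h =>
    hf.2.mono_set (by rwa [uIcc_of_le (by positivity : (0 : ℝ) ≤ 2 * Real.pi)])
  have h1 := (hsub Real.pi (2 * Real.pi) (by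
    rw [uIcc_of_le (by linarith)]; exact Icc_subset_Icc_left hpi.le)).comp_add_right Real.pi
  have h2 := (hsub 0 Real.pi (by
    rw [uIcc_of_le hpi.le]; exact Icc_subset_Icc_right (by linarith))).comp_sub_right Real.pi
  simp only [circlePt_add_pi, sub_self, two_mul, add_sub_cancel_right, zero_add] at h1 h2
  have h3 : ∀ φ, P.circlePt (φ - Real.pi) = -P.circlePt φ := fun φ => by
    have := P.circlePt_add_pi (φ - Real.pi)
    rw [sub_add_cancel] at this
    rw [this, neg_neg]
  simp only [h3] at h2
  rw [two_mul]
  exact h1.trans h2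

/-- The map `s ↦ -s` exchanges `D⁺` and `D⁻`, hence reverses the orientation, and it also changes
the sign of `ds`. The two signs cancel, and statements about `D⁻` reduce to statements about `D⁺`.
-/
theorem contourIntegral_comp_neg (hq : 0 < P.q₀) {f : ℂ → ℂ} (hf : P.ContourIntegrable f) :
    P.contourIntegral (fun s => f (-s)) = P.contourIntegral f := by
  rw [contourIntegral_eq_rays hq hf, contourIntegral_eq_rays hq hf.comp_neg]
  simp only [neg_neg]
  ring

theorem mem_Omega_of_exterior (hq : 0 < P.q₀) {z : ℂ} (h1 : 0 ≤ z.im) (h2 : P.q₀ ≤ ‖z‖)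
    (h3 : z ^ 2 ≠ -(P.q₀ : ℂ) ^ 2) : z ∈ P.Omega :=
  ⟨norm_pos_iff.1 (hq.trans_le h2), h3, mul_nonneg (by nlinarith) h1⟩

theorem neg_mem_Omega_of_interior {z : ℂ} (h1 : 0 ≤ z.im) (h2 : ‖z‖ ≤ P.q₀) (h0 : z ≠ 0)
    (h3 : z ^ 2 ≠ -(P.q₀ : ℂ) ^ 2) : -z ∈ P.Omega := by
  refine ⟨neg_ne_zero.2 h0, by rwa [neg_sq], ?_⟩
  rw [norm_neg, Complex.neg_im]
  exact mul_nonneg_of_nonpos_of_nonpos (by nlinarith [norm_nonneg z]) (by linarith)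

/-- `D⁺` consists of the upper exterior of the disc and its lower half. Cauchy's theorem holds on
each, on the latter after `z ↦ -z`. -/
theorem contourIntegral_eq_zero (hq : 0 < P.q₀) {f : ℂ → ℂ} (hc : ContinuousOn f P.Omega)
    (hd : DifferentiableOn ℂ f P.Dplus) {C : ℝ} (hb : ∀ s ∈ P.Omega, ‖f s‖ ≤ C / (1 + ‖s‖ ^ 2)) :
    P.ContourIntegrable f ∧ P.contourIntegral f = 0 := by
  have hi : P.ContourIntegrable f := contourIntegrable_of_norm_le hq
    (hc.mono regContour_subset_Omega) fun s hs => hb s (regContour_subset_Omega hs)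
  have hC : 0 ≤ C := by
    have h1 := (norm_nonneg _).trans (hb (P.q₀ : ℂ)
      (regContour_subset_Omega (ofReal_mem_regContour hq hq.ne')))
    by_contra hC
    exact absurd h1 (not_le.2 (div_neg_of_neg_of_pos (not_le.1 hC) (by positivity)))
  refine ⟨hi, ?_⟩
  have h1 := upperExterior_integral_eq hq
    (hc.mono fun z hz => mem_Omega_of_exterior hq hz.1 hz.2.1 hz.2.2)
    (hd.mono fun z hz => mul_pos (by nlinarith [hz.2]) hz.1) (C := C)
    fun z h1 h2 h3 => hb z (mem_Omega_of_exterior hq h1 h2 h3)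
  have h2 := upperInterior_integral_eq (f := fun z => f (-z)) hq
    (hc.comp continuous_neg.continuousOn
      fun z hz => neg_mem_Omega_of_interior hz.1 hz.2.1 hz.2.2.1 hz.2.2.2)
    (hd.comp differentiable_neg.differentiableOn fun z hz => by
      show 0 < (‖-z‖ ^ 2 - P.q₀ ^ 2) * (-z).im
      rw [norm_neg, Complex.neg_im]
      exact mul_pos_of_neg_of_neg (by nlinarith [hz.2, norm_nonneg z]) (by linarith [hz.1]))
    (C := C) fun z h1 h2 h0 h3 => (hb (-z) (neg_mem_Omega_of_interior h1 h2 h0 h3)).trans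
      (div_le_self hC (by nlinarith [sq_nonneg ‖-z‖]))
  simp only [neg_neg] at h2
  rw [contourIntegral_eq_rays hq hi]
  linear_combination h1 - h2

end NZBCData

/-! ### Linear distance bounds and the Cauchy kernel on `Σ`. -/

theorem integral_inv_sub_conj {w : ℂ} (hw : w.im ≠ 0) :
    ∫ s : ℝ, ((s - w : ℂ)⁻¹ - (s - conj w : ℂ)⁻¹) = 2 * Real.pi * Complex.I * (w.im / |w.im| : ℝ) := by
  -- Up to a constant this is the Poisson kernel; the sign of `Im w` comes out of the scaling by `Im
  -- w`.
  have h1 : ∀ s : ℝ, ((s - w : ℂ)⁻¹ - (s - conj w : ℂ)⁻¹) =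
      2 * Complex.I / w.im * ((1 + ((s - w.re) / w.im) ^ 2)⁻¹ : ℝ) := by
    intro s
    have e1 : (s - w : ℂ) = (s - w.re : ℝ) - w.im * Complex.I := by
      conv_lhs => rw [← Complex.re_add_im w]
      push_cast; ring
    have e2 : (s - conj w : ℂ) = (s - w.re : ℝ) + w.im * Complex.I := by
      have : conj w = w.re - w.im * Complex.I := by apply Complex.ext <;> simp
      rw [this]; push_cast; ring
    rw [e1, e2]
    set a : ℝ := s - w.re
    set b : ℝ := w.im
    have hb : (b : ℂ) ≠ 0 := by exact_mod_cast hw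
    have hab : (a : ℂ) ^ 2 + b ^ 2 ≠ 0 := by
      have : 0 < a ^ 2 + b ^ 2 := by positivity
      exact_mod_cast this.ne'
    have hm : ((a : ℂ) - b * Complex.I) * (a + b * Complex.I) = a ^ 2 + b ^ 2 := by
      linear_combination (-(b : ℂ) ^ 2) * Complex.I_sq
    have h3 : (a : ℂ) - b * Complex.I ≠ 0 := fun h => hab (by rw [← hm, h, zero_mul])
    have h4 : (a : ℂ) + b * Complex.I ≠ 0 := fun h => hab (by rw [← hm, h, mul_zero])
    rw [inv_sub_inv h3 h4, hm]
    push_cast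
    have h5 : (1 : ℂ) + ((a : ℂ) / b) ^ 2 = (a ^ 2 + b ^ 2) / b ^ 2 := by field_simp; ring
    rw [h5, inv_div]
    field_simp
    ring
  simp_rw [h1]
  rw [integral_const_mul, integral_complex_ofReal,
    integral_sub_right_eq_self (fun s : ℝ => (1 + (s / w.im) ^ 2)⁻¹) w.re,
    Measure.integral_comp_div (fun s : ℝ => (1 + s ^ 2)⁻¹) w.im, integral_univ_inv_one_add_sq]
  have hb : (w.im : ℂ) ≠ 0 := by exact_mod_cast hw
  rcases lt_or_gt_of_ne hw with h | h
  · rw [abs_of_neg h]; push_cast; simp only [smul_eq_mul]; push_cast; field_simp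
  · rw [abs_of_pos h]; push_cast; simp only [smul_eq_mul]; push_cast; field_simp

theorem exists_le_norm_sub (w : ℂ) {r : ℝ} (hr : 0 < r) :
    ∃ c > 0, ∀ s : ℂ, r ≤ ‖s - w‖ → c * (1 + ‖s‖) ≤ ‖s - w‖ := by
  refine ⟨((1 + ‖w‖) / r + 1)⁻¹, by positivity, fun s hs => ?_⟩
  have h1 : ‖s‖ ≤ ‖w‖ + ‖s - w‖ := by
    calc ‖s‖ = ‖w + (s - w)‖ := by ring_nf
      _ ≤ _ := norm_add_le _ _
  have h2 : 1 + ‖w‖ ≤ (1 + ‖w‖) / r * ‖s - w‖ := by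
    rw [div_mul_eq_mul_div, le_div_iff₀ hr]
    exact mul_le_mul_of_nonneg_left hs (by positivity)
  rw [inv_mul_le_iff₀ (by positivity)]
  linarith

namespace NZBCData

open Set

variable {P : NZBCData} {t : ℝ}

theorem contour_compl (hq : 0 < P.q₀) : P.contourᶜ = P.Dplus ∪ P.Dminus := by
  ext z
  have h2 : ‖z‖ = P.q₀ ↔ ‖z‖ ^ 2 - P.q₀ ^ 2 = 0 := by
    rw [sub_eq_zero, sq_eq_sq₀ (norm_nonneg _) hq.le]
  simp only [contour, Dplus, Dminus, mem_compl_iff, mem_ofPred_eq, mem_union, h2]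
  rw [or_comm (a := z.im = 0), ← mul_eq_zero, ← ne_eq, ne_iff_lt_or_gt, or_comm]

theorem isClosed_contour : IsClosed P.contour :=
  (isClosed_eq Complex.continuous_im continuous_const).union
    (isClosed_eq continuous_norm continuous_const)

theorem Dminus_disjoint_Omega {s : ℂ} (hs : s ∈ P.Omega) : s ∉ P.Dminus := fun h =>
  absurd hs.2.2 (not_le.2 h)

theorem exists_le_norm_sub_of_isClosed {K : Set ℂ} (hK : IsClosed K) {w : ℂ} (hw : w ∉ K) :
    ∃ c > 0, ∀ s ∈ K, c * (1 + ‖s‖) ≤ ‖s - w‖ := by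
  obtain ⟨r, hr, hb⟩ := Metric.isOpen_iff.1 hK.isOpen_compl w hw
  obtain ⟨c, hc, h⟩ := exists_le_norm_sub w hr
  refine ⟨c, hc, fun s hs => h s ?_⟩
  by_contra hlt
  exact hb (by rw [Metric.mem_ball, dist_eq_norm]; exact not_le.1 hlt) hs

theorem inv_mul_le_of_le_mul {c n d : ℝ} (hc : 0 < c) (hn : 0 ≤ n) (h : c * (1 + n) ≤ d) :
    d⁻¹ ≤ c⁻¹ / (1 + n) := by
  rw [inv_eq_one_div, inv_eq_one_div c, div_div]
  exact one_div_le_one_div_of_le (by positivity) h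

theorem one_div_mul_one_div_le {n : ℝ} (hn : 0 ≤ n) :
    1 / (1 + n) * (1 / (1 + n)) ≤ 1 / (1 + n ^ 2) := by
  rw [one_div_mul_one_div]
  exact one_div_le_one_div_of_le (by positivity) (by nlinarith)

/-- A bound of order one times the reciprocal of a linear distance decays quadratically. -/
theorem norm_mul_inv_sub_le {s w a : ℂ} {C c : ℝ} (hc : 0 < c) (hC : 0 ≤ C)
    (ha : ‖a‖ ≤ C / (1 + ‖s‖)) (h : c * (1 + ‖s‖) ≤ ‖s - w‖) :
    ‖a * (s - w)⁻¹‖ ≤ C * c⁻¹ / (1 + ‖s‖ ^ 2) := by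
  rw [norm_mul, norm_inv]
  calc ‖a‖ * ‖s - w‖⁻¹ ≤ C / (1 + ‖s‖) * (c⁻¹ / (1 + ‖s‖)) :=
        mul_le_mul ha (inv_mul_le_of_le_mul hc (norm_nonneg _) h) (by positivity) (by positivity)
    _ = C * c⁻¹ * (1 / (1 + ‖s‖) * (1 / (1 + ‖s‖))) := by ring
    _ ≤ C * c⁻¹ * (1 / (1 + ‖s‖ ^ 2)) := by
        gcongr; exact one_div_mul_one_div_le (norm_nonneg _)
    _ = _ := by ring

theorem norm_inv_sub_inv_le {s w w' : ℂ} {c c' : ℝ} (hc : 0 < c) (hc' : 0 < c')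
    (h : c * (1 + ‖s‖) ≤ ‖s - w‖) (h' : c' * (1 + ‖s‖) ≤ ‖s - w'‖) :
    ‖(s - w)⁻¹ - (s - w')⁻¹‖ ≤ ‖w - w'‖ * c⁻¹ * c'⁻¹ / (1 + ‖s‖ ^ 2) := by
  have h1 : s - w ≠ 0 := norm_pos_iff.1 (lt_of_lt_of_le (by positivity) h)
  have h2 : s - w' ≠ 0 := norm_pos_iff.1 (lt_of_lt_of_le (by positivity) h')
  have e : (s - w)⁻¹ - (s - w')⁻¹ = (w - w') * (s - w)⁻¹ * (s - w')⁻¹ := by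
    rw [inv_sub_inv h1 h2]; field_simp; ring
  rw [e]
  refine norm_mul_inv_sub_le hc' (by positivity) ?_ h'
  rw [norm_mul, norm_inv, mul_div_assoc]
  gcongr
  exact inv_mul_le_of_le_mul hc (norm_nonneg _) h

theorem integral_eq_rays {f : ℝ → ℂ} {q : ℝ} (hq : 0 < q) (hf : Integrable f) :
    ∫ s, f s = ((∫ s in Ioi q, f s) + ∫ s in Ioi q, f (-s))
      + ((∫ s in Ioo 0 q, f s) + ∫ s in Ioo 0 q, f (-s)) := by
  have h1 : ∀ g : ℝ → ℂ, Integrable g →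
      ∫ s in Ioi 0, g s = (∫ s in Ioo 0 q, g s) + ∫ s in Ioi q, g s := fun g hg => by
    rw [← Ioc_union_Ioi_eq_Ioi hq.le, setIntegral_union
      (Ioc_disjoint_Ioi le_rfl) measurableSet_Ioi hg.integrableOn hg.integrableOn,
      integral_Ioc_eq_integral_Ioo]
  rw [← intervalIntegral.integral_Iic_add_Ioi (b := 0) hf.integrableOn hf.integrableOn]
  have h2 := integral_comp_neg_Ioi 0 f
  rw [neg_zero] at h2
  rw [← h2, h1 f hf, h1 _ hf.comp_neg]
  ring

/-- The companion pole at `w^*` provides quadratic decay. Both poles lie on the same side of the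
circle: inside if `Im w < 0`, outside if `Im w > 0`. On the pole-free side, Cauchy's theorem in both
half-planes trades the arcs for rays, which turns the contour integral into minus or plus the
integral over the whole real line. -/
theorem contourIntegral_inv_sub_conj (hq : 0 < P.q₀) {w : ℂ} (hw : w ∈ P.Dplus) :
    P.ContourIntegrable (fun s => (s - w)⁻¹ - (s - conj w)⁻¹) ∧
    P.contourIntegral (fun s => (s - w)⁻¹ - (s - conj w)⁻¹) = 2 * Real.pi * Complex.I := by
  have hwc : w ∉ P.contour := by
    have : w ∈ P.contourᶜ := by rw [contour_compl hq]; exact Or.inl hw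
    exact this
  have hwc' : conj w ∉ P.contour := by
    have : conj w ∈ P.contourᶜ := by rw [contour_compl hq]; exact Or.inr (conj_mem_Dminus.2 hw)
    exact this
  obtain ⟨c, hc, hcb⟩ := exists_le_norm_sub_of_isClosed isClosed_contour hwc
  obtain ⟨c', hc', hcb'⟩ := exists_le_norm_sub_of_isClosed isClosed_contour hwc'
  have hcont : ∀ K : Set ℂ, w ∉ K → conj w ∉ K →
      ContinuousOn (fun s => (s - w)⁻¹ - (s - conj w)⁻¹) K := fun K h1 h2 => by
    refine ContinuousOn.sub (ContinuousOn.inv₀ (by fun_prop) fun s hs => ?_)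
      (ContinuousOn.inv₀ (by fun_prop) fun s hs => ?_)
    · exact sub_ne_zero.2 (ne_of_mem_of_not_mem hs h1)
    · exact sub_ne_zero.2 (ne_of_mem_of_not_mem hs h2)
  have hdiff : ∀ K : Set ℂ, w ∉ K → conj w ∉ K →
      DifferentiableOn ℂ (fun s => (s - w)⁻¹ - (s - conj w)⁻¹) K := fun K h1 h2 => by
    refine DifferentiableOn.sub (DifferentiableOn.inv (by fun_prop) fun s hs => ?_)
      (DifferentiableOn.inv (by fun_prop) fun s hs => ?_)
    · exact sub_ne_zero.2 (ne_of_mem_of_not_mem hs h1)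
    · exact sub_ne_zero.2 (ne_of_mem_of_not_mem hs h2)
  have hi : P.ContourIntegrable (fun s => (s - w)⁻¹ - (s - conj w)⁻¹) :=
    contourIntegrable_of_norm_le hq (hcont _ (fun h => hwc h.1) fun h => hwc' h.1)
      fun s hs => norm_inv_sub_inv_le hc hc' (hcb s hs.1) (hcb' s hs.1)
  refine ⟨hi, ?_⟩
  have him : w.im ≠ 0 := fun h => hwc (Or.inl h)
  have hreal := integral_eq_rays hq hi.1
  rw [integral_inv_sub_conj him] at hreal
  rw [contourIntegral_eq_rays hq hi]
  have hwp : 0 < (‖w‖ ^ 2 - P.q₀ ^ 2) * w.im := hw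
  rcases lt_or_gt_of_ne him with hneg | hpos
  · have hlt : ‖w‖ < P.q₀ := by
      by_contra hle
      exact absurd hwp (not_lt.2 (mul_nonpos_of_nonneg_of_nonpos (by nlinarith) hneg.le))
    obtain ⟨d, hd, hdb⟩ := exists_le_norm_sub w (sub_pos.2 hlt)
    obtain ⟨d', hd', hdb'⟩ := exists_le_norm_sub (conj w) (sub_pos.2 hlt)
    have hb : ∀ s : ℂ, P.q₀ ≤ ‖s‖ → ‖(s - w)⁻¹ - (s - conj w)⁻¹‖ ≤
        ‖w - conj w‖ * d⁻¹ * d'⁻¹ / (1 + ‖s‖ ^ 2) := fun s hs => by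
      refine norm_inv_sub_inv_le hd hd' (hdb s ?_) (hdb' s ?_)
      · exact (sub_le_sub_right hs _).trans (norm_sub_norm_le s w)
      · refine (sub_le_sub_right hs _).trans ?_
        rw [← Complex.norm_conj w]
        exact norm_sub_norm_le s _
    have hK : w ∉ {z : ℂ | P.q₀ ≤ ‖z‖} := fun h => absurd hlt (not_lt.2 h)
    have hK' : conj w ∉ {z : ℂ | P.q₀ ≤ ‖z‖} := fun h => by
      rw [mem_ofPred_eq, Complex.norm_conj] at h
      exact absurd hlt (not_lt.2 h)
    have h1 := upperExterior_integral_eq hq ((hcont _ hK hK').mono fun z hz => hz.2.1)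
      ((hdiff _ hK hK').mono fun z hz => le_of_lt hz.2) fun z _ h _ => hb z h
    have h2 := upperExterior_integral_eq hq
      (((hcont _ hK hK').comp continuous_neg.continuousOn
        (s := {z : ℂ | P.q₀ ≤ ‖z‖}) fun z hz => by simpa using hz).mono fun z hz => hz.2.1)
      (((hdiff _ hK hK').comp differentiable_neg.differentiableOn
        (s := {z : ℂ | P.q₀ ≤ ‖z‖}) fun z hz => by simpa using hz).mono fun z hz => le_of_lt hz.2)
      (fun z _ h _ => by simpa using hb (-z) (by simpa using h))
    simp only [Function.comp_def, neg_neg] at h2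
    rw [abs_of_neg hneg, div_neg, div_self him] at hreal
    push_cast at hreal
    linear_combination hreal + h1 + h2
  · have hlt : P.q₀ < ‖w‖ := by
      by_contra hle
      exact absurd hwp (not_lt.2 (mul_nonpos_of_nonpos_of_nonneg
        (by nlinarith [norm_nonneg w]) hpos.le))
    have hK : w ∉ Metric.closedBall (0 : ℂ) P.q₀ := fun h => by
      rw [mem_closedBall_zero_iff] at h
      exact absurd hlt (not_lt.2 h)
    have hK' : conj w ∉ Metric.closedBall (0 : ℂ) P.q₀ := fun h => by
      rw [mem_closedBall_zero_iff, Complex.norm_conj] at h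
      exact absurd hlt (not_lt.2 h)
    obtain ⟨C, hC⟩ := (isCompact_closedBall (0 : ℂ) P.q₀).exists_bound_of_continuousOn
      (hcont _ hK hK')
    have hm : MapsTo (fun z : ℂ => -z) (Metric.closedBall (0 : ℂ) P.q₀)
        (Metric.closedBall (0 : ℂ) P.q₀) := fun z hz => by simpa using hz
    have hmem : ∀ z : ℂ, ‖z‖ ≤ P.q₀ → z ∈ Metric.closedBall (0 : ℂ) P.q₀ := fun z hz =>
      mem_closedBall_zero_iff.2 hz
    have h1 := upperInterior_integral_eq hq ((hcont _ hK hK').mono fun z hz => hmem z hz.2.1)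
      ((hdiff _ hK hK').mono fun z hz => hmem z (le_of_lt hz.2)) (C := C)
      fun z _ h _ _ => hC z (hmem z h)
    have h2 := upperInterior_integral_eq hq
      (((hcont _ hK hK').comp continuous_neg.continuousOn hm).mono fun z hz => hmem z hz.2.1)
      (((hdiff _ hK hK').comp differentiable_neg.differentiableOn hm).mono
        fun z hz => hmem z (le_of_lt hz.2)) (C := C)
      (fun z _ h _ _ => hC (-z) (hm (hmem z h)))
    simp only [Function.comp_def, neg_neg] at h2
    rw [abs_of_pos hpos, div_self him] at hreal
    push_cast at hreal
    linear_combination -hreal - h1 - h2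

end NZBCData

/-! ### Cauchy's formula on the two sides of `Σ`. -/

namespace NZBCData

open Set

variable {P : NZBCData} {t : ℝ}

theorem exists_le_norm_sub_of_mem_Dminus {w : ℂ} (hw : w ∈ P.Dminus) :
    ∃ c > 0, ∀ s ∈ P.Omega, c * (1 + ‖s‖) ≤ ‖s - w‖ := by
  obtain ⟨c, hc, h⟩ := exists_le_norm_sub_of_isClosed (isOpen_Dminus (P := P)).isClosed_compl
    (not_not.2 hw)
  exact ⟨c, hc, fun s hs => h s (Dminus_disjoint_Omega hs)⟩

theorem nonneg_of_norm_le_div {f : ℂ → ℂ} (hq : 0 < P.q₀) {C : ℝ}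
    (hb : ∀ s ∈ P.regContour, ‖f s‖ ≤ C / (1 + ‖s‖)) : 0 ≤ C := by
  have h1 := (norm_nonneg _).trans (hb (P.q₀ : ℂ) (ofReal_mem_regContour hq hq.ne'))
  by_contra hC
  exact absurd h1 (not_le.2 (div_neg_of_neg_of_pos (not_le.1 hC) (by positivity)))

theorem contourIntegral_cauchy_of_mem_Dminus (hq : 0 < P.q₀) {g : ℂ → ℂ}
    (hc : ContinuousOn g P.Omega) (hd : DifferentiableOn ℂ g P.Dplus) {C : ℝ}
    (hb : ∀ s ∈ P.Omega, ‖g s‖ ≤ C / (1 + ‖s‖)) {w : ℂ} (hw : w ∈ P.Dminus) :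
    P.ContourIntegrable (fun s => g s * (s - w)⁻¹) ∧
    P.contourIntegral (fun s => g s * (s - w)⁻¹) = 0 := by
  obtain ⟨c, hc0, hcb⟩ := exists_le_norm_sub_of_mem_Dminus hw
  have hC := nonneg_of_norm_le_div hq fun s hs => hb s (regContour_subset_Omega hs)
  have hne : ∀ s ∈ P.Omega, s - w ≠ 0 := fun s hs =>
    sub_ne_zero.2 fun h => Dminus_disjoint_Omega hs (h ▸ hw)
  refine contourIntegral_eq_zero hq (hc.mul (ContinuousOn.inv₀ (by fun_prop) hne))
    (hd.mul (DifferentiableOn.inv (by fun_prop) fun s hs => hne s (Dplus_subset_Omega hs)))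
    fun s hs => norm_mul_inv_sub_le hc0 hC (hb s hs) (hcb s hs)

/-- Subtract from `g` the multiple `g(w) κ` of `κ(s) = (w - w^*)/(s - w^*)`, which is analytic in
`D⁺`, decays like `1/s` and equals `1` at `w`. The quotient of the rest by `s - w` has no pole and
decays quadratically, so it integrates to zero. The part with `κ` is `g(w)` times the difference of
the Cauchy kernels at `w` and `w^*`. -/
theorem contourIntegral_cauchy (hq : 0 < P.q₀) {g : ℂ → ℂ}
    (hc : ContinuousOn g P.Omega) (hd : DifferentiableOn ℂ g P.Dplus) {C : ℝ}
    (hb : ∀ s ∈ P.Omega, ‖g s‖ ≤ C / (1 + ‖s‖)) {w : ℂ} (hw : w ∈ P.Dplus) :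
    P.ContourIntegrable (fun s => g s * (s - w)⁻¹) ∧
    P.contourIntegral (fun s => g s * (s - w)⁻¹) = 2 * Real.pi * Complex.I * g w := by
  have hw' : conj w ∈ P.Dminus := conj_mem_Dminus.2 hw
  obtain ⟨c, hc0, hcb⟩ := exists_le_norm_sub_of_mem_Dminus hw'
  have hC := nonneg_of_norm_le_div hq fun s hs => hb s (regContour_subset_Omega hs)
  have hne : ∀ s ∈ P.Omega, s - conj w ≠ 0 := fun s hs =>
    sub_ne_zero.2 fun h => Dminus_disjoint_Omega hs (h ▸ hw')
  let κ : ℂ → ℂ := fun s => (w - conj w) * (s - conj w)⁻¹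
  let F : ℂ → ℂ := fun s => g s - g w * κ s
  have hκw : κ w = 1 := mul_inv_cancel₀ (hne w (Dplus_subset_Omega hw))
  have hFw : F w = 0 := by simp only [F, hκw]; ring
  have hFc : ContinuousOn F P.Omega :=
    hc.sub (continuousOn_const.mul (continuousOn_const.mul (ContinuousOn.inv₀ (by fun_prop) hne)))
  have hFd : DifferentiableOn ℂ F P.Dplus :=
    hd.sub ((differentiableOn_const _).mul ((differentiableOn_const _).mul
      (DifferentiableOn.inv (by fun_prop) fun s hs => hne s (Dplus_subset_Omega hs))))
  have hDn : P.Dplus ∈ 𝓝 w := isOpen_Dplus.mem_nhds hw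
  have hOn : P.Omega ∈ 𝓝 w := mem_of_superset hDn Dplus_subset_Omega
  have hFw' : DifferentiableAt ℂ F w := hFd.differentiableAt hDn
  have hdc : ContinuousOn (dslope F w) P.Omega := (continuousOn_dslope hOn).2 ⟨hFc, hFw'⟩
  have hdd : DifferentiableOn ℂ (dslope F w) P.Dplus :=
    (Complex.differentiableOn_dslope hDn).2 hFd
  have hFb : ∀ s ∈ P.Omega, ‖F s‖ ≤ (C + ‖g w‖ * ‖w - conj w‖ * c⁻¹) / (1 + ‖s‖) := fun s hs => by
    calc ‖F s‖ ≤ ‖g s‖ + ‖g w * κ s‖ := norm_sub_le _ _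
      _ ≤ C / (1 + ‖s‖) + ‖g w‖ * (‖w - conj w‖ * (c⁻¹ / (1 + ‖s‖))) := by
          rw [norm_mul, norm_mul, norm_inv]
          gcongr
          · exact hb s hs
          · exact inv_mul_le_of_le_mul hc0 (norm_nonneg _) (hcb s hs)
      _ = _ := by ring
  obtain ⟨r, hr, hrb⟩ := Metric.eventually_nhds_iff_ball.1
    ((continuousAt_dslope_same.2 hFw').norm.eventually_lt_const (lt_add_one _))
  obtain ⟨d, hd0, hdb⟩ := exists_le_norm_sub w hr
  set C' := C + ‖g w‖ * ‖w - conj w‖ * c⁻¹ with hC'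
  have hC'0 : 0 ≤ C' := by positivity
  set B := ‖dslope F w w‖ + 1 with hB
  have hB0 : 0 ≤ B := by positivity
  have hds : ∀ s, s ≠ w → dslope F w s = F s * (s - w)⁻¹ := fun s hs => by
    rw [dslope_of_ne _ hs, slope_def_field, hFw, sub_zero, div_eq_mul_inv]
  have hdsb : ∀ s ∈ P.Omega, ‖dslope F w s‖ ≤
      (C' * d⁻¹ + B * (1 + (‖w‖ + r) ^ 2)) / (1 + ‖s‖ ^ 2) := fun s hs => by
    by_cases hsr : r ≤ ‖s - w‖
    · rw [hds s (by rintro rfl; rw [sub_self, norm_zero] at hsr; exact absurd hr (not_lt.2 hsr))]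
      refine (norm_mul_inv_sub_le hd0 hC'0 (hFb s hs) (hdb s hsr)).trans ?_
      gcongr
      exact le_add_of_nonneg_right (by positivity)
    · have h1 := hrb s (by rw [Metric.mem_ball, dist_eq_norm]; exact not_le.1 hsr)
      have h2 : ‖s‖ ≤ ‖w‖ + r := by
        calc ‖s‖ = ‖w + (s - w)‖ := by ring_nf
          _ ≤ ‖w‖ + ‖s - w‖ := norm_add_le _ _
          _ ≤ _ := by linarith
      rw [le_div_iff₀ (by positivity)]
      calc ‖dslope F w s‖ * (1 + ‖s‖ ^ 2) ≤ B * (1 + (‖w‖ + r) ^ 2) := by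
            gcongr
        _ ≤ _ := le_add_of_nonneg_left (by positivity)
  obtain ⟨hi1, hz1⟩ := contourIntegral_eq_zero hq hdc hdd hdsb
  obtain ⟨hi2, hz2⟩ := contourIntegral_inv_sub_conj hq hw
  have hwc : w ∉ P.contour := by
    have : w ∈ P.contourᶜ := by rw [contour_compl hq]; exact Or.inl hw
    exact this
  have heq : EqOn (fun s => dslope F w s + g w * ((s - w)⁻¹ - (s - conj w)⁻¹))
      (fun s => g s * (s - w)⁻¹) P.regContour := fun s hs => by
    have hsw : s ≠ w := fun h => hwc (h ▸ hs.1)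
    have h1 := sub_ne_zero.2 hsw
    have h2 := hne s (regContour_subset_Omega hs)
    simp only [hds s hsw, F, κ]
    field_simp
    ring
  refine ⟨(hi1.add (hi2.const_mul (g w))).congr hq heq, ?_⟩
  rw [← contourIntegral_congr hq heq, contourIntegral_add hi1 (hi2.const_mul _),
    contourIntegral_const_mul, hz1, hz2]
  ring

variable (P) in
/-- `D⁻ ∪ Σ` without the origin and the branch points `± i q₀`. -/
def OmegaMinus : Set ℂ := {z | conj z ∈ P.Omega}

theorem neg_mem_Omega {z : ℂ} : -z ∈ P.Omega ↔ z ∈ P.OmegaMinus := by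
  have h : ((conj z) ^ 2 = -(P.q₀ : ℂ) ^ 2) ↔ z ^ 2 = -(P.q₀ : ℂ) ^ 2 := by
    constructor <;> intro h <;> simpa using congrArg (starRingEnd ℂ) h
  simp only [Omega, OmegaMinus, mem_ofPred_eq, neg_sq, norm_neg, Complex.neg_im, Complex.norm_conj,
    Complex.conj_im, ne_eq, neg_eq_zero, map_eq_zero, h]

theorem neg_mem_OmegaMinus {z : ℂ} : -z ∈ P.OmegaMinus ↔ z ∈ P.Omega := by
  rw [← neg_mem_Omega, neg_neg]

theorem neg_mem_Dplus {z : ℂ} : -z ∈ P.Dplus ↔ z ∈ P.Dminus := by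
  simp only [Dplus, Dminus, mem_ofPred_eq, norm_neg, Complex.neg_im, mul_neg, neg_pos]

theorem neg_mem_Dminus {z : ℂ} : -z ∈ P.Dminus ↔ z ∈ P.Dplus := by
  rw [← neg_mem_Dplus, neg_neg]

theorem regContour_subset_OmegaMinus : P.regContour ⊆ P.OmegaMinus := fun _ hs =>
  regContour_subset_Omega (conj_mem_regContour hs)

theorem Dminus_subset_OmegaMinus : P.Dminus ⊆ P.OmegaMinus := fun _ hs =>
  Dplus_subset_Omega (conj_mem_Dplus.2 hs)

section lowerSide

variable {g : ℂ → ℂ} {C : ℝ}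

theorem contourIntegral_cauchy_minus (hq : 0 < P.q₀)
    (hc : ContinuousOn g P.OmegaMinus) (hd : DifferentiableOn ℂ g P.Dminus)
    (hb : ∀ s ∈ P.OmegaMinus, ‖g s‖ ≤ C / (1 + ‖s‖)) {w : ℂ} (hw : w ∈ P.Dminus) :
    P.ContourIntegrable (fun s => g s * (s - w)⁻¹) ∧
    P.contourIntegral (fun s => g s * (s - w)⁻¹) = -(2 * Real.pi * Complex.I * g w) := by
  obtain ⟨h1, h2⟩ := contourIntegral_cauchy (g := fun s => g (-s)) (C := C) hq
    (hc.comp continuous_neg.continuousOn fun s hs => neg_mem_OmegaMinus.2 hs)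
    (hd.comp differentiable_neg.differentiableOn fun s hs => neg_mem_Dminus.2 hs)
    (fun s hs => by simpa using hb (-s) (neg_mem_OmegaMinus.2 hs)) (neg_mem_Dplus.2 hw)
  have e : ∀ s : ℂ, -1 * (g (- -s) * (-s - -w)⁻¹) = g s * (s - w)⁻¹ := fun s => by
    rw [neg_neg, ← neg_sub', inv_neg]; ring
  have h3 := h1.comp_neg.const_mul (-1)
  have h4 := contourIntegral_const_mul (P := P) (fun s => g (- -s) * (-s - -w)⁻¹) (-1)
  simp only [e] at h3 h4
  refine ⟨h3, ?_⟩
  rw [h4, contourIntegral_comp_neg hq h1, h2, neg_neg]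
  ring

theorem contourIntegral_cauchy_minus_of_mem_Dplus (hq : 0 < P.q₀)
    (hc : ContinuousOn g P.OmegaMinus) (hd : DifferentiableOn ℂ g P.Dminus)
    (hb : ∀ s ∈ P.OmegaMinus, ‖g s‖ ≤ C / (1 + ‖s‖)) {w : ℂ} (hw : w ∈ P.Dplus) :
    P.ContourIntegrable (fun s => g s * (s - w)⁻¹) ∧
    P.contourIntegral (fun s => g s * (s - w)⁻¹) = 0 := by
  obtain ⟨h1, h2⟩ := contourIntegral_cauchy_of_mem_Dminus (g := fun s => g (-s)) (C := C) hq
    (hc.comp continuous_neg.continuousOn fun s hs => neg_mem_OmegaMinus.2 hs)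
    (hd.comp differentiable_neg.differentiableOn fun s hs => neg_mem_Dminus.2 hs)
    (fun s hs => by simpa using hb (-s) (neg_mem_OmegaMinus.2 hs)) (neg_mem_Dminus.2 hw)
  have e : ∀ s : ℂ, -1 * (g (- -s) * (-s - -w)⁻¹) = g s * (s - w)⁻¹ := fun s => by
    rw [neg_neg, ← neg_sub', inv_neg]; ring
  have h3 := h1.comp_neg.const_mul (-1)
  have h4 := contourIntegral_const_mul (P := P) (fun s => g (- -s) * (-s - -w)⁻¹) (-1)
  simp only [e] at h3 h4
  refine ⟨h3, ?_⟩
  rw [h4, contourIntegral_comp_neg hq h1, h2, mul_zero]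

theorem contourIntegral_eq_zero_minus (hq : 0 < P.q₀)
    (hc : ContinuousOn g P.OmegaMinus) (hd : DifferentiableOn ℂ g P.Dminus)
    (hb : ∀ s ∈ P.OmegaMinus, ‖g s‖ ≤ C / (1 + ‖s‖ ^ 2)) :
    P.ContourIntegrable g ∧ P.contourIntegral g = 0 := by
  obtain ⟨h1, h2⟩ := contourIntegral_eq_zero (f := fun s => g (-s)) (C := C) hq
    (hc.comp continuous_neg.continuousOn fun s hs => neg_mem_OmegaMinus.2 hs)
    (hd.comp differentiable_neg.differentiableOn fun s hs => neg_mem_Dminus.2 hs)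
    (fun s hs => by simpa using hb (-s) (neg_mem_OmegaMinus.2 hs))
  have h3 := h1.comp_neg
  have h4 := contourIntegral_comp_neg hq h1
  simp only [neg_neg] at h3 h4
  exact ⟨h3, h4.trans h2⟩

end lowerSide

/-- A pair of functions on the two sides of the contour that are analytic inside, continuous up to
the contour off the origin and the branch points, and bounded by `C / (1 + |z|)`. -/
structure SectionallyAnalytic (P : NZBCData) (gp gm : ℂ → ℂ) : Prop where
  continuousOn_plus : ContinuousOn gp P.Omega
  differentiableOn_plus : DifferentiableOn ℂ gp P.Dplus
  bound_plus : ∃ C : ℝ, ∀ s ∈ P.Omega, ‖gp s‖ ≤ C / (1 + ‖s‖)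
  continuousOn_minus : ContinuousOn gm P.OmegaMinus
  differentiableOn_minus : DifferentiableOn ℂ gm P.Dminus
  bound_minus : ∃ C : ℝ, ∀ s ∈ P.OmegaMinus, ‖gm s‖ ≤ C / (1 + ‖s‖)

namespace SectionallyAnalytic

variable {gp gm : ℂ → ℂ}

/-- The Cauchy integral of the function on the other side vanishes, since its integrand has no pole
there; subtracting it leaves only the jump in the formula. -/
theorem eq_of_mem_Dplus (hq : 0 < P.q₀) (h : P.SectionallyAnalytic gp gm) {w : ℂ}
    (hw : w ∈ P.Dplus) : P.ContourIntegrable (fun s => (s - w)⁻¹ * (gp s - gm s)) ∧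
    gp w = (2 * Real.pi * Complex.I)⁻¹ * P.contourIntegral fun s => (s - w)⁻¹ * (gp s - gm s) := by
  obtain ⟨C, hC⟩ := h.bound_plus
  obtain ⟨C', hC'⟩ := h.bound_minus
  obtain ⟨h1, h2⟩ := contourIntegral_cauchy hq h.continuousOn_plus h.differentiableOn_plus hC hw
  obtain ⟨h3, h4⟩ := contourIntegral_cauchy_minus_of_mem_Dplus hq h.continuousOn_minus
    h.differentiableOn_minus hC' hw
  have h5 := contourIntegral_sub h1 h3
  have h6 := h1.sub h3
  have e : ∀ s : ℂ, gp s * (s - w)⁻¹ - gm s * (s - w)⁻¹ = (s - w)⁻¹ * (gp s - gm s) := fun s => by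
    ring
  simp only [e] at h5 h6
  refine ⟨h6, ?_⟩
  rw [h5, h2, h4, sub_zero, inv_mul_cancel_left₀ Complex.two_pi_I_ne_zero]

theorem eq_of_mem_Dminus (hq : 0 < P.q₀) (h : P.SectionallyAnalytic gp gm) {w : ℂ}
    (hw : w ∈ P.Dminus) : P.ContourIntegrable (fun s => (s - w)⁻¹ * (gp s - gm s)) ∧
    gm w = (2 * Real.pi * Complex.I)⁻¹ * P.contourIntegral fun s => (s - w)⁻¹ * (gp s - gm s) := by
  obtain ⟨C, hC⟩ := h.bound_plus
  obtain ⟨C', hC'⟩ := h.bound_minus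
  obtain ⟨h1, h2⟩ := contourIntegral_cauchy_of_mem_Dminus hq h.continuousOn_plus
    h.differentiableOn_plus hC hw
  obtain ⟨h3, h4⟩ := contourIntegral_cauchy_minus hq h.continuousOn_minus
    h.differentiableOn_minus hC' hw
  have h5 := contourIntegral_sub h1 h3
  have h6 := h1.sub h3
  have e : ∀ s : ℂ, gp s * (s - w)⁻¹ - gm s * (s - w)⁻¹ = (s - w)⁻¹ * (gp s - gm s) := fun s => by
    ring
  simp only [e] at h5 h6
  refine ⟨h6, ?_⟩
  rw [h5, h2, h4, zero_sub, neg_neg, inv_mul_cancel_left₀ Complex.two_pi_I_ne_zero]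

end SectionallyAnalytic

end NZBCData

/-- Local boundedness everywhere and a rate of decay at infinity give a uniform bound. -/
theorem exists_bound_of_isBigO {S : Set ℂ} {f : ℂ → ℂ} {n : ℕ}
    (hloc : ∀ ζ, f =O[𝓝[S] ζ] fun _ => (1 : ℂ))
    (hinf : f =O[Bornology.cobounded ℂ ⊓ 𝓟 S] fun z => 1 / z ^ n) :
    ∃ C : ℝ, ∀ s ∈ S, ‖f s‖ ≤ C / (1 + ‖s‖ ^ n) := by
  obtain ⟨c, hc0, hc⟩ := hinf.exists_nonneg
  have hc' := eventually_inf_principal.1 hc.bound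
  obtain ⟨R, -, hR⟩ := (Filter.hasBasis_cobounded_norm (E := ℂ)).eventually_iff.1 hc'
  have hcomp : ∃ B : ℝ, ∀ s ∈ Metric.closedBall (0 : ℂ) (max R 1), s ∈ S → ‖f s‖ ≤ B := by
    refine (isCompact_closedBall (0 : ℂ) (max R 1)).induction_on
      (p := fun T => ∃ B : ℝ, ∀ s ∈ T, s ∈ S → ‖f s‖ ≤ B) ⟨0, by simp⟩ ?_ ?_ ?_
    · rintro s T hsT ⟨B, hB⟩
      exact ⟨B, fun z hz => hB z (hsT hz)⟩
    · rintro s T ⟨B, hB⟩ ⟨B', hB'⟩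
      refine ⟨max B B', fun z hz hzS => ?_⟩
      rcases hz with hz | hz
      · exact (hB z hz hzS).trans (le_max_left _ _)
      · exact (hB' z hz hzS).trans (le_max_right _ _)
    · intro ζ _
      obtain ⟨B, hB⟩ := (hloc ζ).bound
      refine ⟨_, mem_nhdsWithin_of_mem_nhds (eventually_nhdsWithin_iff.1 hB), B, fun z hz hzS => ?_⟩
      simpa using hz hzS
  obtain ⟨B, hB⟩ := hcomp
  refine ⟨max B 0 * (1 + (max R 1) ^ n) + 2 * c, fun s hs => ?_⟩
  rw [le_div_iff₀ (by positivity)]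
  have h1 : (1 : ℝ) ≤ max R 1 := le_max_right _ _
  rcases le_total ‖s‖ (max R 1) with hle | hle
  · have h2 : ‖f s‖ ≤ max B 0 := (hB s (mem_closedBall_zero_iff.2 hle) hs).trans (le_max_left _ _)
    calc ‖f s‖ * (1 + ‖s‖ ^ n) ≤ max B 0 * (1 + (max R 1) ^ n) := by gcongr
      _ ≤ _ := le_add_of_nonneg_right (by positivity)
  · have h2 := hR (x := s) ((le_max_left R 1).trans hle) hs
    have h3 : 1 ≤ ‖s‖ ^ n := one_le_pow₀ (h1.trans hle)
    rw [norm_div, norm_one, norm_pow] at h2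
    calc ‖f s‖ * (1 + ‖s‖ ^ n) ≤ c * (1 / ‖s‖ ^ n) * (2 * ‖s‖ ^ n) := by
          gcongr; linarith
      _ = 2 * c := by field_simp
      _ ≤ _ := le_add_of_nonneg_left (by positivity)

theorem HasExpansion.inv_sub {l : Filter ℂ} (hl : l ≤ Bornology.cobounded ℂ) (c : ℂ) :
    HasExpansion l (fun z => (z - c)⁻¹) 0 1 := by
  have h0 : ∀ᶠ z in l, z ≠ 0 := hl (Bornology.eventually_ne_cobounded 0)
  have h1 : HasExpansion l (fun z => 1 / z) 0 1 := by
    refine (isBigO_zero (E' := ℂ) (fun z : ℂ => 1 / z ^ 2) l).congr_left fun z => ?_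
    ring
  have h2 : HasExpansion l (fun z => 1 - c * (1 / z)) 1 (-c) := by
    refine (isBigO_zero (E' := ℂ) (fun z : ℂ => 1 / z ^ 2) l).congr_left fun z => ?_
    ring
  have h3 := h1.mul hl (h2.inv hl)
  simp only [zero_mul, mul_one, mul_neg] at h3
  refine HasExpansion.congr' (by simpa using h3) ?_
  filter_upwards [h0, hl (Bornology.eventually_ne_cobounded c)] with z hz hzc
  have : z - c ≠ 0 := sub_ne_zero.2 hzc
  field_simp

/-- Removal of the singularities at finitely many points. -/
theorem exists_differentiableOn_extension {ι : Type*} [Finite ι] {U : Set ℂ} (hU : IsOpen U)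
    {f : ℂ → ℂ} (p : ι → ℂ) (hf : DifferentiableOn ℂ f (U \ Set.range p))
    (hp : ∀ k, Tendsto (fun z => (z - p k) * f z) (𝓝[≠] p k) (𝓝 0)) :
    ∃ g : ℂ → ℂ, DifferentiableOn ℂ g U ∧ ∀ z ∉ Set.range p, g z = f z := by
  classical
  have hfin : (Set.range p).Finite := Set.finite_range p
  refine ⟨fun z => if z ∈ Set.range p then limUnder (𝓝[≠] z) f else f z, fun c hc => ?_,
    fun z hz => if_neg hz⟩
  by_cases hcp : c ∈ Set.range p
  · obtain ⟨k, rfl⟩ := hcp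
    set c := p k
    have hs : U \ (Set.range p \ {c}) ∈ 𝓝 c :=
      (hU.sdiff (hfin.subset Set.sdiff_subset).isClosed).mem_nhds ⟨hc, fun h => h.2 rfl⟩
    have ho : (fun z => f z - f c) =o[𝓝[≠] c] fun z => (z - c)⁻¹ := by
      have hne : ∀ᶠ z in 𝓝[≠] c, z - c ≠ 0 := by
        filter_upwards [self_mem_nhdsWithin] with z hz using sub_ne_zero.2 hz
      rw [isLittleO_iff_tendsto' (by
        filter_upwards [hne] with z hz h using absurd h (inv_ne_zero hz))]
      have h1 : Tendsto (fun z => (z - c) * f c) (𝓝[≠] c) (𝓝 0) := by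
        have : Tendsto (fun z => (z - c) * f c) (𝓝 c) (𝓝 ((c - c) * f c)) :=
          ((continuous_id.sub continuous_const).mul continuous_const).tendsto c
        rw [sub_self, zero_mul] at this
        exact this.mono_left nhdsWithin_le_nhds
      have h2 := (hp k).sub h1
      rw [sub_zero] at h2
      refine h2.congr fun z => ?_
      rw [div_inv_eq_mul]; ring
    have hd := Complex.differentiableOn_update_limUnder_of_isLittleO hs
      (hf.mono (by rintro z ⟨⟨h1, h2⟩, h3⟩; exact ⟨h1, fun h => h2 ⟨h, h3⟩⟩)) ho
    refine ((hd.differentiableAt hs).congr_of_eventuallyEq ?_).differentiableWithinAt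
    filter_upwards [hs] with z hz
    by_cases hzc : z = c
    · rw [hzc, Function.update_self, if_pos ⟨k, rfl⟩]
    · rw [Function.update_of_ne hzc, if_neg fun h => hz.2 ⟨h, hzc⟩]
  · have hs : U \ Set.range p ∈ 𝓝 c := (hU.sdiff hfin.isClosed).mem_nhds ⟨hc, hcp⟩
    refine ((hf.differentiableAt hs).congr_of_eventuallyEq ?_).differentiableWithinAt
    filter_upwards [hs] with z hz using if_neg hz.2

theorem DifferentiableOn.conj_comp_conj {f : ℂ → ℂ} {U V : Set ℂ} (hf : DifferentiableOn ℂ f U)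
    (hU : IsOpen U) (hV : ∀ z ∈ V, conj z ∈ U) :
    DifferentiableOn ℂ (fun z => conj (f (conj z))) V := fun z hz =>
  (differentiableAt_conj_conj_iff.2
    (hf.differentiableAt (hU.mem_nhds (hV z hz)))).differentiableWithinAt

/-! ### The integral of a jump and the coefficient of `1/z`. -/

namespace NZBCData

open Set

variable {P : NZBCData} {t : ℝ}

theorem isBigO_one_of_norm_le {f : ℂ → ℂ} {S : Set ℂ} {C : ℝ}
    (hb : ∀ s ∈ S, ‖f s‖ ≤ C / (1 + ‖s‖)) (ζ : ℂ) : f =O[𝓝[S] ζ] fun _ => (1 : ℂ) := by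
  refine IsBigO.of_bound |C| ?_
  filter_upwards [self_mem_nhdsWithin] with s hs
  rw [norm_one, mul_one]
  exact ((hb s hs).trans (div_le_div_of_nonneg_right (le_abs_self C) (by positivity))).trans
    (div_le_self (abs_nonneg C) (by linarith [norm_nonneg s]))

/-- A pair of sectionally analytic functions with the same coefficient of `1 / z` at infinity. -/
theorem SectionallyAnalytic.contourIntegral_sub {gp gm : ℂ → ℂ} (hq : 0 < P.q₀)
    (h : P.SectionallyAnalytic gp gm) {a : ℂ}
    (hp : HasExpansion (Bornology.cobounded ℂ ⊓ 𝓟 P.Omega) gp 0 a)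
    (hm : HasExpansion (Bornology.cobounded ℂ ⊓ 𝓟 P.OmegaMinus) gm 0 a) :
    P.ContourIntegrable (fun s => gp s - gm s) ∧
    P.contourIntegral (fun s => gp s - gm s) = -(2 * Real.pi * Complex.I * a) := by
  -- Any point of `D⁺` would do. Subtracting `a/(s - w^*)` from `gp` and `a/(s - w)` from `gm` puts
  -- each pole on the opposite side and leaves `O(1/s²)`, so both rests integrate to zero; the two
  -- kernels together contribute `-2πi a`.
  let w : ℂ := (2 * P.q₀ : ℝ) * Complex.I
  have hw : w ∈ P.Dplus := by
    have h1 : ‖w‖ = 2 * P.q₀ := by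
      simp only [w]
      rw [norm_mul, Complex.norm_I, mul_one, Complex.norm_real, Real.norm_of_nonneg (by positivity)]
    have h2 : w.im = 2 * P.q₀ := by simp [w]
    show 0 < (‖w‖ ^ 2 - P.q₀ ^ 2) * w.im
    rw [h1, h2]
    nlinarith [pow_pos hq 3]
  have hw' : conj w ∈ P.Dminus := conj_mem_Dminus.2 hw
  have hne : ∀ s ∈ P.Omega, s - conj w ≠ 0 := fun s hs =>
    sub_ne_zero.2 fun h => Dminus_disjoint_Omega hs (h ▸ hw')
  have hne' : ∀ s ∈ P.OmegaMinus, s - w ≠ 0 := fun s hs h => hne (conj s) hs (by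
    rw [← map_sub, h, map_zero])
  have hloc : ∀ (S : Set ℂ) (g : ℂ → ℂ) (v : ℂ), (∀ ζ, g =O[𝓝[S] ζ] fun _ => (1 : ℂ)) →
      (∀ ζ, (fun s => (s - v)⁻¹) =O[𝓝[S] ζ] fun _ => (1 : ℂ)) →
      HasExpansion (Bornology.cobounded ℂ ⊓ 𝓟 S) g 0 a →
      ∃ C : ℝ, ∀ s ∈ S, ‖g s - a * (s - v)⁻¹‖ ≤ C / (1 + ‖s‖ ^ 2) := by
    intro S g v hg hv he
    refine exists_bound_of_isBigO (fun ζ => (hg ζ).sub ((hv ζ).const_mul_left a)) ?_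
    have h1 := he.sub ((HasExpansion.const a).mul inf_le_left (HasExpansion.inv_sub inf_le_left v))
    refine h1.congr_left fun z => ?_
    ring
  have hinv : ∀ (S : Set ℂ) (v : ℂ), (∃ c > 0, ∀ s ∈ S, c * (1 + ‖s‖) ≤ ‖s - v‖) →
      ∀ ζ, (fun s => (s - v)⁻¹) =O[𝓝[S] ζ] fun _ => (1 : ℂ) := by
    rintro S v ⟨c, hc, hb⟩ ζ
    refine isBigO_one_of_norm_le (C := c⁻¹) (fun s hs => ?_) ζ
    rw [norm_inv]
    exact inv_mul_le_of_le_mul hc (norm_nonneg _) (hb s hs)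
  obtain ⟨c, hc, hcb⟩ := exists_le_norm_sub_of_mem_Dminus hw'
  obtain ⟨C, hC⟩ := h.bound_plus
  obtain ⟨C', hC'⟩ := h.bound_minus
  obtain ⟨C₁, hC₁⟩ := hloc P.Omega gp (conj w) (isBigO_one_of_norm_le hC)
    (hinv _ _ ⟨c, hc, hcb⟩) hp
  obtain ⟨C₂, hC₂⟩ := hloc P.OmegaMinus gm w (isBigO_one_of_norm_le hC')
    (hinv _ _ ⟨c, hc, fun s hs => by
      have := hcb (conj s) hs
      rwa [← map_sub, Complex.norm_conj, Complex.norm_conj] at this⟩) hm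
  obtain ⟨i1, z1⟩ := contourIntegral_eq_zero hq
    (h.continuousOn_plus.sub (continuousOn_const.mul (ContinuousOn.inv₀ (by fun_prop) hne)))
    (h.differentiableOn_plus.sub ((differentiableOn_const a).mul
      (DifferentiableOn.inv (by fun_prop) fun s hs => hne s (Dplus_subset_Omega hs)))) hC₁
  obtain ⟨i2, z2⟩ := contourIntegral_eq_zero_minus hq
    (h.continuousOn_minus.sub (continuousOn_const.mul (ContinuousOn.inv₀ (by fun_prop) hne')))
    (h.differentiableOn_minus.sub ((differentiableOn_const a).mul
      (DifferentiableOn.inv (by fun_prop) fun s hs => hne' s (Dminus_subset_OmegaMinus hs)))) hC₂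
  obtain ⟨i3, z3⟩ := contourIntegral_inv_sub_conj hq hw
  have hi := (i1.sub i2).sub (i3.const_mul a)
  have hz := NZBCData.contourIntegral_sub (i1.sub i2) (i3.const_mul a)
  rw [NZBCData.contourIntegral_sub i1 i2, contourIntegral_const_mul, z1, z2, z3] at hz
  have e : ∀ s : ℂ, gp s - a * (s - conj w)⁻¹ - (gm s - a * (s - w)⁻¹) -
      a * ((s - w)⁻¹ - (s - conj w)⁻¹) = gp s - gm s := fun s => by ring
  simp only [Pi.sub_apply, Pi.mul_apply, Pi.inv_apply, e] at hi hz
  refine ⟨hi, hz.trans (by ring)⟩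

end NZBCData

/-! ### Spectral singularities, the scattering relation and the jump. -/

namespace NZBCData

open Set

variable {P : NZBCData} {t : ℝ}

/-- `D⁺` is entered vertically from real points, upwards if `|s| ≥ q₀` and downwards otherwise, and
radially from the rest of the circle, outwards above the axis and inwards below. -/
theorem mem_closure_Dplus {s : ℂ} (hs : s ∈ P.regContour) : s ∈ closure P.Dplus := by
  have key : ∀ v : ℂ, (∀ᶠ ε : ℝ in 𝓝[>] 0, s + ε * v ∈ P.Dplus) → s ∈ closure P.Dplus := fun v h => by
    have ht : Tendsto (fun ε : ℝ => s + ε * v) (𝓝[>] 0) (𝓝 s) := by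
      have hc : Continuous fun ε : ℝ => s + ε * v := by fun_prop
      simpa using (hc.tendsto 0).mono_left nhdsWithin_le_nhds
    exact mem_closure_of_tendsto ht h
  have hpos : ∀ᶠ ε : ℝ in 𝓝[>] 0, 0 < ε := self_mem_nhdsWithin
  have hsmall : ∀ r : ℝ, 0 < r → ∀ᶠ ε : ℝ in 𝓝[>] 0, ε < r := fun r hr =>
    mem_nhdsWithin_of_mem_nhds (gt_mem_nhds hr)
  rcases hs.1 with h | h
  · have hn : ∀ a : ℝ, ‖s + a * Complex.I‖ ^ 2 = s.re ^ 2 + a ^ 2 := fun a => by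
      rw [← Complex.normSq_eq_norm_sq, Complex.normSq_apply]
      simp [h]; ring
    have hi : ∀ a : ℝ, (s + a * Complex.I).im = a := fun a => by simp [h]
    rcases le_or_gt (P.q₀ ^ 2) (s.re ^ 2) with hle | hlt
    · refine key Complex.I ?_
      filter_upwards [hpos] with ε hε
      show 0 < (‖s + ε * Complex.I‖ ^ 2 - P.q₀ ^ 2) * (s + ε * Complex.I).im
      rw [hn, hi]
      exact mul_pos (by nlinarith [pow_pos hε 2]) hε
    · refine key (-Complex.I) ?_
      have hd : 0 < min 1 (P.q₀ ^ 2 - s.re ^ 2) := lt_min one_pos (by linarith)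
      filter_upwards [hpos, hsmall _ hd] with ε hε hε'
      have e : s + ε * -Complex.I = s + (-ε : ℝ) * Complex.I := by push_cast; ring
      show 0 < (‖s + ε * -Complex.I‖ ^ 2 - P.q₀ ^ 2) * (s + ε * -Complex.I).im
      rw [e, hn, hi]
      have h1 := hε'.trans_le (min_le_left _ _)
      have h2 := hε'.trans_le (min_le_right _ _)
      exact mul_pos_of_neg_of_neg (by nlinarith) (by linarith)
  · have hs0 : 0 < ‖s‖ := norm_pos_iff.2 hs.2.1
    have hn : ∀ a : ℝ, 0 < 1 + a → ‖s + a * s‖ ^ 2 - P.q₀ ^ 2 = ((1 + a) ^ 2 - 1) * ‖s‖ ^ 2 := by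
      intro a ha
      have e : s + a * s = (1 + a : ℝ) * s := by push_cast; ring
      rw [e, norm_mul, Complex.norm_real, Real.norm_of_nonneg ha.le, ← h]
      ring
    have hi : ∀ a : ℝ, (s + a * s).im = (1 + a) * s.im := fun a => by simp; ring
    by_cases him : s.im = 0
    · refine key Complex.I ?_
      filter_upwards [hpos] with ε hε
      show 0 < (‖s + ε * Complex.I‖ ^ 2 - P.q₀ ^ 2) * (s + ε * Complex.I).im
      have e1 : ‖s + ε * Complex.I‖ ^ 2 = ‖s‖ ^ 2 + ε ^ 2 := by
        rw [← Complex.normSq_eq_norm_sq, ← Complex.normSq_eq_norm_sq, Complex.normSq_apply,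
          Complex.normSq_apply]
        simp [him]; ring
      rw [e1, h]
      simp only [Complex.add_im, him, Complex.im_ofReal_mul, Complex.I_im]
      have : 0 < ε ^ 2 := by positivity
      nlinarith
    rcases lt_or_gt_of_ne him with hneg | hp
    · refine key (-s) ?_
      filter_upwards [hpos, hsmall 1 one_pos] with ε hε hε'
      have e : s + ε * -s = s + (-ε : ℝ) * s := by push_cast; ring
      show 0 < (‖s + ε * -s‖ ^ 2 - P.q₀ ^ 2) * (s + ε * -s).im
      rw [e, hn _ (by linarith), hi]
      refine mul_pos_of_neg_of_neg (mul_neg_of_neg_of_pos (by nlinarith) (by positivity))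
        (mul_neg_of_pos_of_neg (by linarith) hneg)
    · refine key s ?_
      filter_upwards [hpos] with ε hε
      show 0 < (‖s + ε * s‖ ^ 2 - P.q₀ ^ 2) * (s + ε * s).im
      rw [hn _ (by linarith), hi]
      exact mul_pos (mul_pos (by nlinarith) (by positivity)) (mul_pos (by linarith) hp)

variable (P) in
/-- There are no spectral singularities. -/
def NoSpectralSingularity (t : ℝ) : Prop :=
  ∀ ζ ∈ P.contour, ζ ≠ 0 → ∃ c > 0, ∀ᶠ z in 𝓝[P.Dplus] ζ, c ≤ ‖P.s11 t z‖

theorem mem_regContour_of_mem_Omega (hq : 0 < P.q₀) {z : ℂ} (hz : z ∈ P.Omega)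
    (h : z ∉ P.Dplus) : z ∈ P.regContour := by
  refine ⟨?_, hz.1, hz.2.1⟩
  by_contra hc
  rcases (contour_compl hq ▸ hc : z ∈ P.Dplus ∪ P.Dminus) with h' | h'
  · exact h h'
  · exact Dminus_disjoint_Omega hz h'

/-- Continuity of `s₁₁` and density of `D⁺` extend the lower bound to contour points near `ζ`. The
case `ζ = ±i q₀`, where `s₁₁` need not be continuous, is included and is needed later. -/
theorem NoSpectralSingularity.s11_bound (hs : P.NoSpectralSingularity t) (h : P.Admissible t) {ζ : ℂ}
    (hζ : ζ ∈ P.contour) (h0 : ζ ≠ 0) : ∃ c > 0, ∀ᶠ z in 𝓝[P.Omega] ζ, c ≤ ‖P.s11 t z‖ := by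
  obtain ⟨c, hc, hev⟩ := hs ζ hζ h0
  refine ⟨c, hc, ?_⟩
  rw [eventually_nhdsWithin_iff] at hev ⊢
  filter_upwards [hev.eventually_nhds] with z hz hzO
  by_cases hzD : z ∈ P.Dplus
  · exact hz.self_of_nhds hzD
  · have hcl := mem_closure_Dplus (mem_regContour_of_mem_Omega h.pos hzO hzD)
    have := mem_closure_iff_nhdsWithin_neBot.1 hcl
    refine ge_of_tendsto ((s11_continuousOn h z hzO).mono Dplus_subset_Omega).norm ?_
    exact eventually_nhdsWithin_iff.2 hz

theorem NoSpectralSingularity.s11_ne_zero (hs : P.NoSpectralSingularity t) (h : P.Admissible t)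
    {z : ℂ} (hz : z ∈ P.regContour) : P.s11 t z ≠ 0 := by
  obtain ⟨c, hc, hev⟩ := hs.s11_bound h hz.1 hz.2.1
  exact norm_pos_iff.1 (hc.trans_le (hev.self_of_nhdsWithin (regContour_subset_Omega hz)))

theorem NoSpectralSingularity.s22_ne_zero (hs : P.NoSpectralSingularity t) (h : P.Admissible t)
    {z : ℂ} (hz : z ∈ P.regContour) : P.s22 t z ≠ 0 := by
  rw [s22_eq_conj h (regContour_subset_OmegaMinus hz)]
  exact (map_ne_zero _).2 (hs.s11_ne_zero h (conj_mem_regContour hz))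

/-- The Wronskian is constant in `x`, and its limit at `-∞` is `det Y₋`. -/
theorem wronskian_psiMinus (h : P.Admissible t) {s : ℂ} (hs : s ∈ P.regContour) (x : ℝ) :
    wronskian (P.psiMinus 0 x t s) (P.psiMinus 1 x t s) = P.gam s := by
  have j0 := (psiMinus_zero_spec h (regContour_subset_OmegaMinus hs)).1
  have j1 := isJost_psiMinus_one h (regContour_subset_Omega hs)
  have hc : ∀ y, wronskian (P.muMinus 0 y t s) (P.muMinus 1 y t s) =
      wronskian (P.psiMinus 0 x t s) (P.psiMinus 1 x t s) := fun y => by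
    rw [muMinus, muMinus, wronskian_smul, ← Complex.exp_add, sigma3_one_one, sigma3_zero_zero,
      j0.isLaxSolution.wronskian_eq j1.isLaxSolution x y]
    rw [show -(Complex.I * 1 * P.theta y t s) + -(Complex.I * -1 * P.theta y t s) = 0 by ring,
      Complex.exp_zero, one_mul]
  have l0 := tendsto_pi_nhds.1 j0.2
  have l1 := tendsto_pi_nhds.1 j1.2
  have hl : Tendsto (fun y => wronskian (P.muMinus 0 y t s) (P.muMinus 1 y t s)) atBot
      (𝓝 (Ymat P.qm s 0 0 * Ymat P.qm s 1 1 - Ymat P.qm s 1 0 * Ymat P.qm s 0 1)) :=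
    ((l0 0).mul (l1 1)).sub ((l0 1).mul (l1 0))
  have := tendsto_nhds_unique (tendsto_const_nhds.congr fun y => (hc y).symm) hl
  rw [this, Ymat_apply]
  have hs0 := hs.2.1
  simp only [Matrix.of_apply, Matrix.cons_val', Matrix.cons_val_zero, Matrix.cons_val_one,
    Matrix.cons_val_fin_one, gam, ← mul_conj_of_norm h.norm_qm]
  field_simp
  ring

/-- Cramer's rule; it converts the Wronskian definitions of the `s_ij` into `ψ₊ = ψ₋ S`. -/
theorem wronskian_cramer (a b c : Fin 2 → ℂ) (i : Fin 2) :
    wronskian b c * a i = wronskian a c * b i + wronskian b a * c i := by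
  fin_cases i <;> simp [wronskian] <;> ring

theorem psiPlus_zero_eq_scattering (h : P.Admissible t) {s : ℂ} (hs : s ∈ P.regContour) (x : ℝ)
    (i : Fin 2) : P.psiPlus 0 x t s i =
      P.s11 t s * P.psiMinus 0 x t s i + P.s21 t s * P.psiMinus 1 x t s i := by
  have hg := gam_ne_zero_of_mem (regContour_subset_Omega hs)
  have j0 := (psiMinus_zero_spec h (regContour_subset_OmegaMinus hs)).1.isLaxSolution
  have j1 := (isJost_psiMinus_one h (regContour_subset_Omega hs)).isLaxSolution
  have p0 := (isJost_psiPlus_zero h (regContour_subset_Omega hs)).isLaxSolution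
  have hw := wronskian_cramer (P.psiPlus 0 x t s) (P.psiMinus 0 x t s) (P.psiMinus 1 x t s) i
  rw [wronskian_psiMinus h hs, ← p0.wronskian_eq j1 0 x, ← j0.wronskian_eq p0 0 x] at hw
  rw [s11, s21]
  field_simp
  linear_combination hw

theorem psiPlus_one_eq_scattering (h : P.Admissible t) {s : ℂ} (hs : s ∈ P.regContour) (x : ℝ)
    (i : Fin 2) : P.psiPlus 1 x t s i =
      P.s12 t s * P.psiMinus 0 x t s i + P.s22 t s * P.psiMinus 1 x t s i := by
  have hg := gam_ne_zero_of_mem (regContour_subset_Omega hs)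
  have j0 := (psiMinus_zero_spec h (regContour_subset_OmegaMinus hs)).1.isLaxSolution
  have j1 := (isJost_psiMinus_one h (regContour_subset_Omega hs)).isLaxSolution
  have p1 := (psiPlus_one_spec h (regContour_subset_OmegaMinus hs)).1.isLaxSolution
  have hw := wronskian_cramer (P.psiPlus 1 x t s) (P.psiMinus 0 x t s) (P.psiMinus 1 x t s) i
  rw [wronskian_psiMinus h hs, ← p1.wronskian_eq j1 0 x, ← j0.wronskian_eq p1 0 x] at hw
  rw [s12, s22]
  field_simp
  linear_combination hw

theorem Mminus_eq_Mplus_mul (hns : P.NoSpectralSingularity t) (h : P.Admissible t) {s : ℂ}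
    (hs : s ∈ P.regContour) (x : ℝ) : P.Mminus x t s = P.Mplus x t s * (1 - P.G x t s) := by
  have h1 := hns.s11_ne_zero h hs
  have h2 := hns.s22_ne_zero h hs
  set E := Complex.exp (Complex.I * P.theta x t s) with hE
  have hE0 : E ≠ 0 := Complex.exp_ne_zero _
  have e1 : Complex.exp (2 * Complex.I * P.theta x t s) = E * E := by
    rw [hE, ← Complex.exp_add]; congr 1; ring
  have e2 : Complex.exp (-(2 * Complex.I * P.theta x t s)) = E⁻¹ * E⁻¹ := by
    rw [hE, ← Complex.exp_neg, ← Complex.exp_add]; congr 1; ring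
  have e3 : Complex.exp (-(Complex.I * sigma3 0 0 * P.theta x t s)) = E⁻¹ := by
    rw [hE, ← Complex.exp_neg, sigma3_zero_zero, mul_one]
  have e4 : Complex.exp (-(Complex.I * sigma3 1 1 * P.theta x t s)) = E := by
    rw [hE, sigma3_one_one]; congr 1; ring
  have a0 := psiPlus_zero_eq_scattering h hs x
  have a1 := psiPlus_one_eq_scattering h hs x
  have c0 : ∀ i, P.muMinus 0 x t s i =
      P.muPlus 0 x t s i / P.s11 t s - P.rho t s * (E⁻¹ * E⁻¹) * P.muMinus 1 x t s i := fun i => by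
    simp only [muMinus, muPlus, Pi.smul_apply, smul_eq_mul, a0 i, e3, e4, rho]
    field_simp
    ring
  have c1 : ∀ i, P.muPlus 1 x t s i / P.s22 t s = P.rhoTilde t s * (E * E) *
      (P.muPlus 0 x t s i / P.s11 t s)
      + (1 - P.rho t s * P.rhoTilde t s) * P.muMinus 1 x t s i := fun i => by
    simp only [muMinus, muPlus, Pi.smul_apply, smul_eq_mul, a0 i, a1 i, e3, e4, rho, rhoTilde]
    field_simp
    ring
  ext i j
  rw [Matrix.mul_apply, Fin.sum_univ_two]
  fin_cases i <;> fin_cases j <;> simp [Mminus, Mplus, G, e1, e2, c0, c1] <;> ring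

theorem Mplus_mul_G (hns : P.NoSpectralSingularity t) (h : P.Admissible t) {s : ℂ}
    (hs : s ∈ P.regContour) (x : ℝ) :
    P.Mplus x t s * P.G x t s = P.Mplus x t s - P.Mminus x t s := by
  rw [Mminus_eq_Mplus_mul hns h hs, mul_sub, mul_one, sub_sub_cancel]

end NZBCData

/-! ### The Riemann–Hilbert problem for `M`. -/

namespace NZBCData

open Set

variable {P : NZBCData} {t : ℝ}

/-- The antilinear involution of matrices that relates `M⁻(z)` to `M⁺(z^*)`. -/
noncomputable def conjMat (A : Matrix (Fin 2) (Fin 2) ℂ) : Matrix (Fin 2) (Fin 2) ℂ :=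
  !![conj (A 1 1), -conj (A 1 0); -conj (A 0 1), conj (A 0 0)]

theorem conjMat_apply (A : Matrix (Fin 2) (Fin 2) ℂ) (i j : Fin 2) :
    conjMat A i j = (if i = j then 1 else -1) * conj (A i.rev j.rev) := by
  fin_cases i <;> fin_cases j <;> simp [conjMat]

theorem continuous_conjMat : Continuous conjMat := by
  refine continuous_matrix fun i j => ?_
  simp only [conjMat_apply]
  exact continuous_const.mul (Complex.continuous_conj.comp (continuous_id.matrix_elem _ _))

theorem Mminus_eq_conjMat (h : P.Admissible t) (x : ℝ) {z : ℂ} (hz : z ∈ P.OmegaMinus) :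
    P.Mminus x t z = conjMat (P.Mplus x t (conj z)) := Mminus_eq_conj h x hz

theorem M_of_mem_Dplus (x : ℝ) {z : ℂ} (hz : z ∈ P.Dplus) : P.M x t z = P.Mplus x t z := if_pos hz

theorem M_of_mem_Dminus (x : ℝ) {z : ℂ} (hz : z ∈ P.Dminus) : P.M x t z = P.Mminus x t z :=
  if_neg fun h => Dminus_disjoint_Omega (Dplus_subset_Omega h) hz

theorem Mplus_continuousWithinAt (h : P.Admissible t) (x : ℝ) {s : ℂ} (hs : s ∈ P.Omega)
    (h0 : P.s11 t s ≠ 0) : ContinuousWithinAt (P.Mplus x t) P.Omega s := by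
  have c1 := fun i => muPlus_zero_continuousOn h x i s hs
  have c2 := fun i => muMinus_one_continuousOn h x i s hs
  have c3 := s11_continuousOn h s hs
  refine tendsto_pi_nhds.2 fun i => tendsto_pi_nhds.2 fun j => ?_
  fin_cases i <;> fin_cases j
  · exact (c1 0).div c3 h0
  · exact c2 0
  · exact (c1 1).div c3 h0
  · exact c2 1

theorem Mplus_differentiableAt (h : P.Admissible t) (x : ℝ) {s : ℂ} (hs : s ∈ P.Dplus)
    (h0 : P.s11 t s ≠ 0) (i j : Fin 2) : DifferentiableAt ℂ (fun z => P.Mplus x t z i j) s := by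
  have hD := isOpen_Dplus.mem_nhds hs
  have c1 := fun i => (muPlus_zero_differentiableOn h x i).differentiableAt hD
  have c2 := fun i => (muMinus_one_differentiableOn h x i).differentiableAt hD
  have c3 := (s11_differentiableOn h).differentiableAt hD
  fin_cases i <;> fin_cases j
  · exact (c1 0).div c3 h0
  · exact c2 0
  · exact (c1 1).div c3 h0
  · exact c2 1

theorem Mplus_meromorphicAt (h : P.Admissible t) (x : ℝ) {s : ℂ} (hs : s ∈ P.Dplus)
    (i j : Fin 2) : MeromorphicAt (fun z => P.Mplus x t z i j) s := by
  have hD := isOpen_Dplus.mem_nhds hs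
  have c1 := fun i => ((muPlus_zero_differentiableOn h x i).analyticAt hD).meromorphicAt
  have c2 := fun i => ((muMinus_one_differentiableOn h x i).analyticAt hD).meromorphicAt
  have c3 := ((s11_differentiableOn h).analyticAt hD).meromorphicAt
  fin_cases i <;> fin_cases j
  · exact (c1 0).div c3
  · exact c2 0
  · exact (c1 1).div c3
  · exact c2 1

theorem differentiableOn_conj_Dminus {f : ℂ → ℂ} (hf : DifferentiableOn ℂ f P.Dplus) :
    DifferentiableOn ℂ (fun z => conj (f (conj z))) P.Dminus :=
  hf.conj_comp_conj isOpen_Dplus fun _ hz => conj_mem_Dplus.2 hz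

theorem muMinus_zero_differentiableOn (h : P.Admissible t) (x : ℝ) (i : Fin 2) :
    DifferentiableOn ℂ (fun z => P.muMinus 0 x t z i) P.Dminus := by
  have c := fun i => differentiableOn_conj_Dminus (muMinus_one_differentiableOn h x i)
  fin_cases i
  · refine (c 1).congr fun z hz => ?_
    simp [muMinus_zero_eq_conj h x (Dminus_subset_OmegaMinus hz), conjJ]
  · refine (c 0).neg.congr fun z hz => ?_
    simp [muMinus_zero_eq_conj h x (Dminus_subset_OmegaMinus hz), conjJ]

theorem muPlus_one_differentiableOn (h : P.Admissible t) (x : ℝ) (i : Fin 2) :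
    DifferentiableOn ℂ (fun z => P.muPlus 1 x t z i) P.Dminus := by
  have c := fun i => differentiableOn_conj_Dminus (muPlus_zero_differentiableOn h x i)
  fin_cases i
  · refine (c 1).neg.congr fun z hz => ?_
    simp [muPlus_one_eq_conj h x (Dminus_subset_OmegaMinus hz), conjJ]
  · refine (c 0).congr fun z hz => ?_
    simp [muPlus_one_eq_conj h x (Dminus_subset_OmegaMinus hz), conjJ]

theorem s22_differentiableOn (h : P.Admissible t) : DifferentiableOn ℂ (P.s22 t) P.Dminus :=
  (differentiableOn_conj_Dminus (s11_differentiableOn h)).congr fun _ hz =>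
    s22_eq_conj h (Dminus_subset_OmegaMinus hz)

theorem Mminus_meromorphicAt (h : P.Admissible t) (x : ℝ) {s : ℂ} (hs : s ∈ P.Dminus)
    (i j : Fin 2) : MeromorphicAt (fun z => P.Mminus x t z i j) s := by
  have hD := isOpen_Dminus.mem_nhds hs
  have c1 := fun i => ((muPlus_one_differentiableOn h x i).analyticAt hD).meromorphicAt
  have c2 := fun i => ((muMinus_zero_differentiableOn h x i).analyticAt hD).meromorphicAt
  have c3 := ((s22_differentiableOn h).analyticAt hD).meromorphicAt
  fin_cases i <;> fin_cases j
  · exact c2 0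
  · exact (c1 0).div c3
  · exact c2 1
  · exact (c1 1).div c3

theorem M_meromorphicOn (h : P.Admissible t) (x : ℝ) (i j : Fin 2) :
    MeromorphicOn (fun z => P.M x t z i j) P.contourᶜ := by
  intro s hs
  rw [contour_compl h.pos] at hs
  rcases hs with hs | hs
  · refine (Mplus_meromorphicAt h x hs i j).congr (eventually_nhdsWithin_of_eventually_nhds ?_)
    filter_upwards [isOpen_Dplus.mem_nhds hs] with z hz
    rw [M_of_mem_Dplus x hz]
  · refine (Mminus_meromorphicAt h x hs i j).congr (eventually_nhdsWithin_of_eventually_nhds ?_)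
    filter_upwards [isOpen_Dminus.mem_nhds hs] with z hz
    rw [M_of_mem_Dminus x hz]

theorem M_tendsto_plus (hns : P.NoSpectralSingularity t) (h : P.Admissible t) (x : ℝ) {s : ℂ}
    (hs : s ∈ P.regContour) : Tendsto (P.M x t) (𝓝[P.Dplus] s) (𝓝 (P.Mplus x t s)) := by
  have hc := (Mplus_continuousWithinAt h x (regContour_subset_Omega hs)
    (hns.s11_ne_zero h hs)).mono Dplus_subset_Omega
  refine hc.tendsto.congr' ?_
  filter_upwards [self_mem_nhdsWithin] with z hz using (M_of_mem_Dplus x hz).symm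

theorem M_tendsto_minus (hns : P.NoSpectralSingularity t) (h : P.Admissible t) (x : ℝ) {s : ℂ}
    (hs : s ∈ P.regContour) : Tendsto (P.M x t) (𝓝[P.Dminus] s) (𝓝 (P.Mminus x t s)) := by
  have hs' := conj_mem_regContour hs
  have hc := (Mplus_continuousWithinAt h x (regContour_subset_Omega hs')
    (hns.s11_ne_zero h hs')).mono Dplus_subset_Omega
  have ht : Tendsto (starRingEnd ℂ) (𝓝[P.Dminus] s) (𝓝[P.Dplus] (conj s)) :=
    Complex.continuous_conj.continuousWithinAt.tendsto_nhdsWithin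
      fun z hz => conj_mem_Dplus.2 hz
  rw [Mminus_eq_conjMat h x (regContour_subset_OmegaMinus hs)]
  refine ((continuous_conjMat.tendsto _).comp (hc.tendsto.comp ht)).congr' ?_
  filter_upwards [self_mem_nhdsWithin] with z hz
  rw [M_of_mem_Dminus x hz, Mminus_eq_conjMat h x (Dminus_subset_OmegaMinus hz)]
  rfl

/-- Off `Σ` there are only the two regions, so growth conditions on `M` may be checked for `M⁺` and
`M⁻` separately. -/
theorem isBigO_inf_contour_compl (hq : 0 < P.q₀) {l : Filter ℂ} {f g : ℂ → ℂ}
    (hp : f =O[l ⊓ 𝓟 P.Dplus] g) (hm : f =O[l ⊓ 𝓟 P.Dminus] g) : f =O[l ⊓ 𝓟 P.contourᶜ] g := by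
  rw [contour_compl hq, ← sup_principal, inf_sup_left]
  exact hp.sup hm

theorem hasExpansion_M (h : P.Admissible t) (x : ℝ) {β : ℝ} (hβ : ∀ i j,
    HasExpansion (Bornology.cobounded ℂ ⊓ 𝓟 P.Omega) (fun z => P.Mplus x t z i j)
      ((1 : Matrix (Fin 2) (Fin 2) ℂ) i j) (P.expansionCoeff x t β i j)) (i j : Fin 2) :
    HasExpansion (Bornology.cobounded ℂ ⊓ 𝓟 P.contourᶜ) (fun z => P.M x t z i j)
      ((1 : Matrix (Fin 2) (Fin 2) ℂ) i j) (P.expansionCoeff x t β i j) := by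
  refine isBigO_inf_contour_compl h.pos ?_ ?_
  · refine ((hβ i j).mono (inf_le_inf_left _ (principal_mono.2 Dplus_subset_Omega))).congr' ?_
    filter_upwards [mem_inf_of_right (mem_principal_self _)] with z hz
    rw [M_of_mem_Dplus x hz]
  · refine ((hasExpansion_Mminus h x hβ i j).mono
      (inf_le_inf_left _ (principal_mono.2 Dminus_subset_OmegaMinus))).congr' ?_
    filter_upwards [mem_inf_of_right (mem_principal_self _)] with z hz
    rw [M_of_mem_Dminus x hz]

theorem tendsto_conj_zero : Tendsto (starRingEnd ℂ) (𝓝[P.OmegaMinus] 0) (𝓝[P.Omega] 0) := by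
  have := Complex.continuous_conj.continuousWithinAt.tendsto_nhdsWithin
    (s := P.OmegaMinus) (x := 0) (t := P.Omega) fun z hz => hz
  rwa [map_zero] at this

theorem Mminus_sub_zeroPart_isBigO (h : P.Admissible t) (x : ℝ) (i j : Fin 2) :
    (fun z => (P.Mminus x t z - P.zeroPart z) i j) =O[𝓝[P.OmegaMinus] 0] fun _ => (1 : ℂ) := by
  have h1 := (Mplus_sub_zeroPart_isBigO h x i.rev j.rev).comp_tendsto tendsto_conj_zero
  refine (IsBigO.of_norm_eventuallyLE ?_).trans (h1.norm_left.congr_right fun _ => rfl)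
  filter_upwards [self_mem_nhdsWithin] with z hz
  exact (Mminus_sub_zeroPart_eq h x hz i j).le

theorem isRHPSolution (hns : P.NoSpectralSingularity t) (h : P.Admissible t) (x : ℝ) :
    P.IsRHPSolution x t (P.M x t) (P.Mplus x t) (P.Mminus x t) where
  meromorphic := M_meromorphicOn h x
  boundary_plus s h1 h2 h3 := M_tendsto_plus hns h x ⟨h1, h2, h3⟩
  boundary_minus s h1 h2 h3 := M_tendsto_minus hns h x ⟨h1, h2, h3⟩
  jump s h1 h2 h3 := Mminus_eq_Mplus_mul hns h ⟨h1, h2, h3⟩ x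
  at_infinity i j := by
    obtain ⟨β, hβ⟩ := hasExpansion_Mplus h x
    exact (hasExpansion_M h x hβ i j).sub_isBigO inf_le_left
  at_zero i j := by
    refine isBigO_inf_contour_compl h.pos ?_ ?_
    · refine ((Mplus_sub_zeroPart_isBigO h x i j).mono
        (inf_le_inf_left _ (principal_mono.2 Dplus_subset_Omega))).congr' ?_ EventuallyEq.rfl
      filter_upwards [mem_inf_of_right (mem_principal_self _)] with z hz
      rw [M_of_mem_Dplus x hz]; rfl
    · refine ((Mminus_sub_zeroPart_isBigO h x i j).mono
        (inf_le_inf_left _ (principal_mono.2 Dminus_subset_OmegaMinus))).congr' ?_ EventuallyEq.rfl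
      filter_upwards [mem_inf_of_right (mem_principal_self _)] with z hz
      rw [M_of_mem_Dminus x hz]; rfl

end NZBCData

/-! ### Discrete spectrum, norming constants and residues. -/

namespace NZBCData

open Set

variable {P : NZBCData} {t : ℝ}

theorem deriv_s22 (h : P.Admissible t) {ξ : ℂ} (hξ : ξ ∈ P.Dplus) :
    deriv (P.s22 t) (conj ξ) = conj (deriv (P.s11 t) ξ) := by
  have he : P.s22 t =ᶠ[𝓝 (conj ξ)] (starRingEnd ℂ) ∘ P.s11 t ∘ (starRingEnd ℂ) := by
    filter_upwards [isOpen_Dminus.mem_nhds (conj_mem_Dminus.2 hξ)] with z hz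
    exact s22_eq_conj h (Dminus_subset_OmegaMinus hz)
  rw [he.deriv_eq, deriv_conj_conj]
  simp

theorem deriv_s11_hat (h : P.Admissible t) {ξ : ℂ} (hξ : ξ ∈ P.Dplus) :
    deriv (P.s11 t) ξ = P.qp / P.qm * deriv (P.s22 t) (P.hat ξ) * ((P.q₀ : ℂ) ^ 2 / ξ ^ 2) := by
  have hξ0 := (Dplus_subset_Omega hξ).1
  have he : P.s11 t =ᶠ[𝓝 ξ] fun z => P.qp / P.qm * P.s22 t (P.hat z) := by
    filter_upwards [isOpen_Dplus.mem_nhds hξ] with z hz using s11_eq_hat h (Dplus_subset_Omega hz)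
  have hh : HasDerivAt P.hat ((P.q₀ : ℂ) ^ 2 / ξ ^ 2) ξ := by
    have h1 := (hasDerivAt_inv hξ0).const_mul (-(P.q₀ : ℂ) ^ 2)
    refine (h1.congr_deriv (by ring)).congr_of_eventuallyEq (.of_forall fun z => ?_)
    rw [hat, div_eq_mul_inv]
  have hs := ((s22_differentiableOn h).differentiableAt
    (isOpen_Dminus.mem_nhds (hat_mem_Dminus h.pos hξ))).hasDerivAt
  rw [he.deriv_eq]
  exact (((hs.comp ξ hh).const_mul (P.qp / P.qm)).congr_deriv (by ring)).deriv

section Norming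

variable {ξ : ℂ}

/-- As `γ ≠ 0`, a zero of `s₁₁` is a zero of the Wronskian, and the two solutions are proportional.
-/
theorem b_spec (h : P.Admissible t) (hξ : ξ ∈ P.Omega) (h0 : P.s11 t ξ = 0) (x : ℝ) :
    P.psiPlus 0 x t ξ = P.b t ξ • P.psiMinus 1 x t ξ := by
  have hw : wronskian (P.psiPlus 0 0 t ξ) (P.psiMinus 1 0 t ξ) = 0 := by
    rw [s11, div_eq_zero_iff] at h0
    exact h0.resolve_right (gam_ne_zero_of_mem hξ)
  have j1 := isJost_psiMinus_one h hξ
  exact Classical.epsilon_spec (p := fun c => ∀ x, P.psiPlus 0 x t ξ = c • P.psiMinus 1 x t ξ)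
    ((isJost_psiPlus_zero h hξ).isLaxSolution.exists_smul h j1.isLaxSolution hw (j1.ne_zero h 0)) x

theorem eq_b_of_forall (h : P.Admissible t) (hξ : ξ ∈ P.Omega) {c : ℂ}
    (hc : ∀ x, P.psiPlus 0 x t ξ = c • P.psiMinus 1 x t ξ) : c = P.b t ξ := by
  have h1 := Classical.epsilon_spec
    (p := fun c => ∀ x, P.psiPlus 0 x t ξ = c • P.psiMinus 1 x t ξ) ⟨c, hc⟩ 0
  rw [hc 0] at h1
  exact smul_left_injective ℂ ((isJost_psiMinus_one h hξ).ne_zero h 0) h1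

theorem bTilde_spec_of_forall {c : ℂ} {η : ℂ}
    (hc : ∀ x, P.psiPlus 1 x t η = c • P.psiMinus 0 x t η) (x : ℝ) :
    P.psiPlus 1 x t η = P.bTilde t η • P.psiMinus 0 x t η :=
  Classical.epsilon_spec (p := fun c => ∀ x, P.psiPlus 1 x t η = c • P.psiMinus 0 x t η) ⟨c, hc⟩ x

theorem psiPlus_one_conj_of_zero (h : P.Admissible t) (hξ : ξ ∈ P.Omega) (h0 : P.s11 t ξ = 0)
    (x : ℝ) : P.psiPlus 1 x t (conj ξ) = (-conj (P.b t ξ)) • P.psiMinus 0 x t (conj ξ) := by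
  have hξ' : conj (conj ξ) ∈ P.Omega := by rwa [Complex.conj_conj]
  rw [psiPlus_one_eq_conj h x hξ', psiMinus_zero_eq_conj h x hξ', Complex.conj_conj, b_spec h hξ h0,
    conjJ_smul, neg_smul]

theorem bTilde_conj (h : P.Admissible t) (hξ : ξ ∈ P.Omega) (h0 : P.s11 t ξ = 0) :
    P.bTilde t (conj ξ) = -conj (P.b t ξ) := by
  have h1 := psiPlus_one_conj_of_zero h hξ h0
  have h2 := bTilde_spec_of_forall h1 0
  rw [h1 0] at h2
  have hξ' : conj (conj ξ) ∈ P.Omega := by rwa [Complex.conj_conj]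
  exact (smul_left_injective ℂ ((psiMinus_zero_spec h hξ').1.ne_zero h 0) h2).symm

theorem CTilde_conj (h : P.Admissible t) (hξ : ξ ∈ P.Dplus) (h0 : P.s11 t ξ = 0) :
    P.CTilde t (conj ξ) = -conj (P.C t ξ) := by
  rw [CTilde, C, bTilde_conj h (Dplus_subset_Omega hξ) h0, deriv_s22 h hξ, map_div₀, neg_div]

/-- Under `hat` the proportionality constant acquires `-q₊/q₋^*`, and the derivative acquires
`q₊/q₋` together with the derivative of `-q₀²/z`. In the quotient `q₊` cancels. -/
theorem C_hat (h : P.Admissible t) (hξ : ξ ∈ P.Dplus) (h0 : P.s11 t ξ = 0) :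
    P.C t (P.hat (conj ξ)) =
      -(P.qm / conj P.qm) * ((P.q₀ : ℂ) / conj ξ) ^ 2 * P.CTilde t (conj ξ) := by
  have hξO := Dplus_subset_Omega hξ
  have hc0 : conj ξ ≠ 0 := (map_ne_zero _).2 hξO.1
  have hD : P.hat (conj ξ) ∈ P.Dplus := by
    rw [hat_conj, conj_mem_Dplus]; exact hat_mem_Dminus h.pos hξ
  have hO := Dplus_subset_Omega hD
  have hh : P.hat (P.hat (conj ξ)) = conj ξ := hat_hat h.pos hc0
  have hm := h.qm_ne_zero
  have hp := h.qp_ne_zero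
  have hm' : conj P.qm ≠ 0 := (map_ne_zero _).2 hm
  have hq' : (P.q₀ : ℂ) ≠ 0 := by exact_mod_cast h.pos.ne'
  have hb : -(P.qp / conj P.qm) * P.bTilde t (conj ξ) = P.b t (P.hat (conj ξ)) := by
    refine eq_b_of_forall h hO fun x => ?_
    have h1 := bTilde_spec_of_forall (psiPlus_one_conj_of_zero h hξO h0) x
    rw [psiPlus_zero_eq_hat h x hO, psiMinus_one_eq_hat h x hO, hh, h1, smul_smul, smul_smul]
    congr 1
    have := hO.1
    field_simp
  rw [C, CTilde, ← hb, deriv_s11_hat h hD, hh]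
  have : P.hat (conj ξ) = -(P.q₀ : ℂ) ^ 2 / conj ξ := rfl
  rw [this]
  -- At a multiple zero both norming constants are `0` by the convention for division, so the
  -- identity needs no simplicity.
  by_cases hd : deriv (P.s22 t) (conj ξ) = 0
  · simp [hd]
  · field_simp

end Norming

/-- The zeros of `s₁₁` in the upper part of `D⁺` are the distinct simple zeros `z n`. -/
structure IsDiscreteSpectrum (P : NZBCData) (t : ℝ) {N : ℕ} (z : Fin N → ℂ) : Prop where
  injective : Function.Injective z
  mem : ∀ n, z n ∈ P.Dplus ∧ 0 < (z n).im
  zeros : ∀ w ∈ P.Dplus, 0 < w.im → (P.s11 t w = 0 ↔ ∃ n, z n = w)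
  simple : ∀ n, deriv (P.s11 t) (z n) ≠ 0

namespace IsDiscreteSpectrum

variable {N : ℕ} {z : Fin N → ℂ}

theorem xi_inr (n : Fin N) : P.xi z (Sum.inr n) = P.hat (conj (z n)) := rfl

theorem xi_inl (n : Fin N) : P.xi z (Sum.inl n) = z n := rfl

theorem xi_mem (hd : P.IsDiscreteSpectrum t z) (hq : 0 < P.q₀) : ∀ k, P.xi z k ∈ P.Dplus := by
  rintro (n | n)
  · exact (hd.mem n).1
  · rw [xi_inr, hat_conj, conj_mem_Dplus]
    exact hat_mem_Dminus hq (hd.mem n).1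

theorem xi_inr_im (hd : P.IsDiscreteSpectrum t z) (hq : 0 < P.q₀) (n : Fin N) :
    (P.xi z (Sum.inr n)).im < 0 := by
  have h0 := (Dplus_subset_Omega (hd.mem n).1).1
  have hn : 0 < ‖z n‖ := norm_pos_iff.2 h0
  rw [xi_inr, hat_im, Complex.conj_im, Complex.norm_conj]
  refine div_neg_of_neg_of_pos (mul_neg_of_pos_of_neg (by positivity) ?_) (by positivity)
  linarith [(hd.mem n).2]

theorem xi_injective (hd : P.IsDiscreteSpectrum t z) (hq : 0 < P.q₀) :
    Function.Injective (P.xi z) := by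
  rintro (m | m) (n | n) hmn
  · rw [xi_inl, xi_inl] at hmn
    rw [hd.injective hmn]
  · have h1 := hd.xi_inr_im hq n
    rw [← hmn, xi_inl] at h1
    exact absurd (hd.mem m).2 h1.not_gt
  · have h1 := hd.xi_inr_im hq m
    rw [hmn, xi_inl] at h1
    exact absurd (hd.mem n).2 h1.not_gt
  · rw [xi_inr, xi_inr] at hmn
    have h0 := fun n => (map_ne_zero (starRingEnd ℂ)).2 (Dplus_subset_Omega (hd.mem n).1).1
    have h1 := congrArg P.hat hmn
    rw [hat_hat hq (h0 m), hat_hat hq (h0 n)] at h1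
    rw [hd.injective ((starRingEnd ℂ).injective h1)]

/-- The involution `w ↦ -q₀²/w^*` preserves `D⁺` and the zeros of `s₁₁` and exchanges the upper with
the lower part, so the hypothesis on the upper part determines all zeros. -/
theorem s11_eq_zero_iff (hd : P.IsDiscreteSpectrum t z) (h : P.Admissible t) {w : ℂ}
    (hw : w ∈ P.Dplus) : P.s11 t w = 0 ↔ ∃ k, P.xi z k = w := by
  have hw0 := (Dplus_subset_Omega hw).1
  have him : w.im ≠ 0 := fun h0 => by
    have : 0 < (‖w‖ ^ 2 - P.q₀ ^ 2) * w.im := hw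
    rw [h0, mul_zero] at this
    exact lt_irrefl _ this
  rcases lt_or_gt_of_ne him with hneg | hpos
  · have hD : conj (P.hat w) ∈ P.Dplus := conj_mem_Dplus.2 (hat_mem_Dminus h.pos hw)
    have hi : 0 < (conj (P.hat w)).im := by
      have hn : 0 < ‖w‖ := norm_pos_iff.2 hw0
      have hq := h.pos
      rw [Complex.conj_im, hat_im, ← neg_div, ← mul_neg]
      have : 0 < -w.im := by linarith
      positivity
    have h1 : P.s11 t w = 0 ↔ P.s11 t (conj (P.hat w)) = 0 := by
      rw [s11_eq_hat h (Dplus_subset_Omega hw), s22_eq_conj h (Dplus_subset_Omega hD)]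
      have := div_ne_zero h.qp_ne_zero h.qm_ne_zero
      rw [mul_eq_zero, or_iff_right this, map_eq_zero]
    rw [h1, hd.zeros _ hD hi]
    constructor
    · rintro ⟨n, hn⟩
      refine ⟨Sum.inr n, ?_⟩
      rw [xi_inr, hn, Complex.conj_conj, hat_hat h.pos hw0]
    · rintro ⟨n | n, hn⟩
      · rw [← hn] at hneg
        exact absurd (hd.mem n).2 hneg.not_gt
      · refine ⟨n, ?_⟩
        have h0 := (map_ne_zero (starRingEnd ℂ)).2 (Dplus_subset_Omega (hd.mem n).1).1
        rw [← hn, xi_inr, hat_hat h.pos h0, Complex.conj_conj]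
  · rw [hd.zeros w hw hpos]
    constructor
    · rintro ⟨n, hn⟩
      exact ⟨Sum.inl n, hn⟩
    · rintro ⟨n | n, hn⟩
      · exact ⟨n, hn⟩
      · have := hd.xi_inr_im h.pos n
        rw [hn] at this
        exact absurd hpos this.not_gt

theorem s11_xi (hd : P.IsDiscreteSpectrum t z) (h : P.Admissible t) (k : Fin N ⊕ Fin N) :
    P.s11 t (P.xi z k) = 0 :=
  (hd.s11_eq_zero_iff h (hd.xi_mem h.pos k)).2 ⟨k, rfl⟩

theorem s22_eq_zero_iff (hd : P.IsDiscreteSpectrum t z) (h : P.Admissible t) {w : ℂ}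
    (hw : w ∈ P.Dminus) : P.s22 t w = 0 ↔ ∃ k, conj (P.xi z k) = w := by
  rw [s22_eq_conj h (Dminus_subset_OmegaMinus hw), map_eq_zero,
    hd.s11_eq_zero_iff h (conj_mem_Dplus.2 hw)]
  refine exists_congr fun k => ⟨fun hk => by rw [hk, Complex.conj_conj], fun hk => by
    rw [← hk, Complex.conj_conj]⟩

theorem deriv_s11_xi (hd : P.IsDiscreteSpectrum t z) (h : P.Admissible t) :
    ∀ k, deriv (P.s11 t) (P.xi z k) ≠ 0 := by
  rintro (n | n)
  · exact hd.simple n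
  · have hD := hd.xi_mem h.pos (Sum.inr n)
    have h0 := (map_ne_zero (starRingEnd ℂ)).2 (Dplus_subset_Omega (hd.mem n).1).1
    have hq' : (P.q₀ : ℂ) ≠ 0 := by exact_mod_cast h.pos.ne'
    rw [deriv_s11_hat h hD, xi_inr, hat_hat h.pos h0, deriv_s22 h (hd.mem n).1]
    refine mul_ne_zero (mul_ne_zero (div_ne_zero h.qp_ne_zero h.qm_ne_zero)
      ((map_ne_zero _).2 (hd.simple n))) (div_ne_zero (pow_ne_zero 2 hq') (pow_ne_zero 2 ?_))
    exact hat_ne_zero h.pos h0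

end IsDiscreteSpectrum

section Residue

variable {ξ : ℂ}

theorem muPlus_zero_of_zero (h : P.Admissible t) (hξ : ξ ∈ P.Omega) (h0 : P.s11 t ξ = 0) (x : ℝ) :
    P.muPlus 0 x t ξ =
      (P.b t ξ * Complex.exp (-(2 * Complex.I * P.theta x t ξ))) • P.muMinus 1 x t ξ := by
  rw [muPlus, b_spec h hξ h0, psiMinus_one_eq, smul_smul, smul_smul, sigma3_zero_zero]
  congr 1
  rw [show -(2 * Complex.I * P.theta x t ξ) =
    -(Complex.I * 1 * P.theta x t ξ) + -(Complex.I * P.theta x t ξ) by ring, Complex.exp_add]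
  ring

/-- `(w - ξ)/s₁₁(w)` is the inverse of a difference quotient and tends to `1/s₁₁'(ξ)`, while
`μ₊₁(ξ)` is a multiple of `μ₋₂(ξ)`. -/
theorem Mplus_residue (h : P.Admissible t) (hξ : ξ ∈ P.Dplus) (h0 : P.s11 t ξ = 0)
    (h1 : deriv (P.s11 t) ξ ≠ 0) (x : ℝ) :
    Tendsto (fun w => (w - ξ) • P.Mplus x t w) (𝓝[≠] ξ) (𝓝 (P.resPlus x t ξ)) := by
  have hD := isOpen_Dplus.mem_nhds hξ
  have hs := ((s11_differentiableOn h).differentiableAt hD).hasDerivAt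
  have hslope := (hasDerivAt_iff_tendsto_slope.1 hs).inv₀ h1
  have c1 : ∀ i, Tendsto (fun w => P.muPlus 0 x t w i) (𝓝[≠] ξ) (𝓝 (P.muPlus 0 x t ξ i)) := fun i =>
    (((muPlus_zero_differentiableOn h x i).differentiableAt hD).continuousAt.tendsto).mono_left
      nhdsWithin_le_nhds
  have c2 : ∀ i, Tendsto (fun w => P.muMinus 1 x t w i) (𝓝[≠] ξ) (𝓝 (P.muMinus 1 x t ξ i)) :=
    fun i => (((muMinus_one_differentiableOn h x i).differentiableAt hD).continuousAt.tendsto).mono_left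
      nhdsWithin_le_nhds
  have c3 : Tendsto (fun w => w - ξ) (𝓝[≠] ξ) (𝓝 0) := by
    have : Tendsto (fun w => w - ξ) (𝓝 ξ) (𝓝 (ξ - ξ)) := (continuous_id.sub continuous_const).tendsto ξ
    rw [sub_self] at this
    exact this.mono_left nhdsWithin_le_nhds
  have k1 : ∀ i, Tendsto (fun w => (w - ξ) * (P.muPlus 0 x t w i / P.s11 t w)) (𝓝[≠] ξ)
      (𝓝 (P.C t ξ * Complex.exp (-(2 * Complex.I * P.theta x t ξ)) * P.muMinus 1 x t ξ i)) := fun i => by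
    have hl := hslope.mul (c1 i)
    rw [muPlus_zero_of_zero h (Dplus_subset_Omega hξ) h0] at hl
    have e : P.C t ξ * Complex.exp (-(2 * Complex.I * P.theta x t ξ)) * P.muMinus 1 x t ξ i =
        (deriv (P.s11 t) ξ)⁻¹ * ((P.b t ξ * Complex.exp (-(2 * Complex.I * P.theta x t ξ))) •
          P.muMinus 1 x t ξ) i := by
      simp only [C, Pi.smul_apply, smul_eq_mul]; ring
    rw [e]
    refine hl.congr fun w => ?_
    rw [slope_def_field, h0, sub_zero, inv_div]
    ring
  have k2 : ∀ i, Tendsto (fun w => (w - ξ) * P.muMinus 1 x t w i) (𝓝[≠] ξ) (𝓝 0) := fun i => by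
    simpa using c3.mul (c2 i)
  refine tendsto_pi_nhds.2 fun i => tendsto_pi_nhds.2 fun j => ?_
  fin_cases i <;> fin_cases j
  · simpa [resPlus, Mplus] using k1 0
  · simpa [resPlus, Mplus] using k2 0
  · simpa [resPlus, Mplus] using k1 1
  · simpa [resPlus, Mplus] using k2 1

theorem resMinus_conj (h : P.Admissible t) (hξ : ξ ∈ P.Dplus) (h0 : P.s11 t ξ = 0) (x : ℝ) :
    P.resMinus x t (conj ξ) = conjMat (P.resPlus x t ξ) := by
  have hξ' : conj (conj ξ) ∈ P.Omega := by
    rw [Complex.conj_conj]; exact Dplus_subset_Omega hξ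
  have he : conj (Complex.exp (-(2 * Complex.I * P.theta x t ξ))) =
      Complex.exp (2 * Complex.I * P.theta x t (conj ξ)) := by
    rw [← Complex.exp_conj, theta_conj]; simp [map_ofNat]
  rw [resMinus, resPlus, CTilde_conj h hξ h0, ← he, muMinus_zero_eq_conj h x hξ', Complex.conj_conj]
  ext i j
  fin_cases i <;> fin_cases j <;> simp [conjMat, conjJ]

theorem conjMat_smul (c : ℂ) (A : Matrix (Fin 2) (Fin 2) ℂ) :
    conjMat (c • A) = conj c • conjMat A := by
  ext i j
  simp only [conjMat_apply, Matrix.smul_apply, smul_eq_mul, map_mul]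
  ring

theorem tendsto_conj_punctured : Tendsto (starRingEnd ℂ) (𝓝[≠] (conj ξ)) (𝓝[≠] ξ) := by
  have h := Complex.continuous_conj.continuousWithinAt.tendsto_nhdsWithin
    (s := {conj ξ}ᶜ) (x := conj ξ) (t := {ξ}ᶜ) fun z hz hz' => hz (by
      rw [mem_singleton_iff] at hz' ⊢; rw [← hz', Complex.conj_conj])
  rwa [Complex.conj_conj] at h

theorem M_residue_plus (h : P.Admissible t) (hξ : ξ ∈ P.Dplus) (h0 : P.s11 t ξ = 0)
    (h1 : deriv (P.s11 t) ξ ≠ 0) (x : ℝ) :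
    Tendsto (fun w => (w - ξ) • P.M x t w) (𝓝[≠] ξ) (𝓝 (P.resPlus x t ξ)) := by
  refine (Mplus_residue h hξ h0 h1 x).congr' (eventually_nhdsWithin_of_eventually_nhds ?_)
  filter_upwards [isOpen_Dplus.mem_nhds hξ] with w hw
  rw [M_of_mem_Dplus x hw]

theorem M_residue_minus (h : P.Admissible t) (hξ : ξ ∈ P.Dplus) (h0 : P.s11 t ξ = 0)
    (h1 : deriv (P.s11 t) ξ ≠ 0) (x : ℝ) :
    Tendsto (fun w => (w - conj ξ) • P.M x t w) (𝓝[≠] conj ξ) (𝓝 (P.resMinus x t (conj ξ))) := by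
  rw [resMinus_conj h hξ h0]
  refine ((continuous_conjMat.tendsto _).comp
    ((Mplus_residue h hξ h0 h1 x).comp tendsto_conj_punctured)).congr'
      (eventually_nhdsWithin_of_eventually_nhds ?_)
  filter_upwards [isOpen_Dminus.mem_nhds (conj_mem_Dminus.2 hξ)] with w hw
  rw [M_of_mem_Dminus x hw, Mminus_eq_conjMat h x (Dminus_subset_OmegaMinus hw)]
  simp only [Function.comp_apply, conjMat_smul, map_sub, Complex.conj_conj]

end Residue

end NZBCData

theorem HasExpansion.sum {l : Filter ℂ} {ι : Type*} (s : Finset ι) {f : ι → ℂ → ℂ} {a b : ι → ℂ}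
    (h : ∀ k, HasExpansion l (f k) (a k) (b k)) :
    HasExpansion l (fun z => ∑ k ∈ s, f k z) (∑ k ∈ s, a k) (∑ k ∈ s, b k) := by
  classical
  induction s using Finset.induction_on with
  | empty => simpa using HasExpansion.const (l := l) 0
  | insert k s hk ih => simpa only [Finset.sum_insert hk] using (h k).add ih

theorem HasExpansion.const_mul {l : Filter ℂ} {f : ℂ → ℂ} {a b : ℂ} (hf : HasExpansion l f a b)
    (c : ℂ) : HasExpansion l (fun z => c * f z) (c * a) (c * b) := by
  refine (IsBigO.const_mul_left hf c).congr_left fun z => ?_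
  ring

/-! ### The explicit singular part of `M`. -/

namespace NZBCData

open Set

variable {P : NZBCData} {t : ℝ} {N : ℕ} {z : Fin N → ℂ}

variable (P) in
/-- The part of `M` that is explicit: the limit at infinity, the pole at the origin and the poles
at the discrete spectrum. -/
noncomputable def polePart (x t : ℝ) {N : ℕ} (z : Fin N → ℂ) (w : ℂ) : Matrix (Fin 2) (Fin 2) ℂ :=
  1 + P.zeroPart w
    + ∑ k, (w - conj (P.xi z k))⁻¹ • P.resMinus x t (conj (P.xi z k))
    + ∑ k, (w - P.xi z k)⁻¹ • P.resPlus x t (P.xi z k)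

theorem polePart_apply (x : ℝ) (w : ℂ) (i j : Fin 2) : P.polePart x t z w i j =
    (1 : Matrix (Fin 2) (Fin 2) ℂ) i j + P.zeroPart w i j
    + ∑ k, P.resMinus x t (conj (P.xi z k)) i j * (w - conj (P.xi z k))⁻¹
    + ∑ k, P.resPlus x t (P.xi z k) i j * (w - P.xi z k)⁻¹ := by
  simp only [polePart, Matrix.add_apply, Matrix.sum_apply, Matrix.smul_apply, smul_eq_mul,
    mul_comm]

theorem zeroPart_apply (w : ℂ) (i j : Fin 2) :
    P.zeroPart w i j = (Complex.I • (sigma3 * Qmat P.qm)) i j * w⁻¹ := by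
  simp only [zeroPart, Matrix.smul_apply, smul_eq_mul]; ring

variable (P) in
/-- The coefficient of `1 / w` in the expansion of `polePart` at infinity. -/
noncomputable def poleCoeff (x t : ℝ) {N : ℕ} (z : Fin N → ℂ) : Matrix (Fin 2) (Fin 2) ℂ :=
  Complex.I • (sigma3 * Qmat P.qm)
    + ∑ k, (P.resMinus x t (conj (P.xi z k)) + P.resPlus x t (P.xi z k))

theorem hasExpansion_polePart {l : Filter ℂ} (hl : l ≤ Bornology.cobounded ℂ) (x : ℝ) (i j : Fin 2) :
    HasExpansion l (fun w => P.polePart x t z w i j) ((1 : Matrix (Fin 2) (Fin 2) ℂ) i j)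
      (P.poleCoeff x t z i j) := by
  have h0 := HasExpansion.inv_sub hl 0
  simp only [sub_zero] at h0
  have h := (((HasExpansion.const (l := l) ((1 : Matrix (Fin 2) (Fin 2) ℂ) i j)).add
    (h0.const_mul ((Complex.I • (sigma3 * Qmat P.qm)) i j))).add
    (HasExpansion.sum Finset.univ fun k => (HasExpansion.inv_sub hl (conj (P.xi z k))).const_mul
      (P.resMinus x t (conj (P.xi z k)) i j))).add
    (HasExpansion.sum Finset.univ fun k => (HasExpansion.inv_sub hl (P.xi z k)).const_mul
      (P.resPlus x t (P.xi z k) i j))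
  simp only [mul_zero, mul_one, Finset.sum_const_zero, add_zero, zero_add] at h
  have e : P.poleCoeff x t z i j = (Complex.I • (sigma3 * Qmat P.qm)) i j
      + ∑ k, P.resMinus x t (conj (P.xi z k)) i j + ∑ k, P.resPlus x t (P.xi z k) i j := by
    simp only [poleCoeff, Matrix.add_apply, Matrix.sum_apply, Finset.sum_add_distrib, add_assoc]
  rw [e]
  refine h.congr' (.of_forall fun w => ?_)
  simp only [polePart_apply, zeroPart_apply]

/-- The pole at the origin is split off so that `w = 0` is allowed; the remainder of `M` is
estimated there. -/
theorem differentiableAt_polePart_sub_zeroPart (x : ℝ) {w : ℂ} (h1 : ∀ k, w ≠ P.xi z k)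
    (h2 : ∀ k, w ≠ conj (P.xi z k)) (i j : Fin 2) :
    DifferentiableAt ℂ (fun w => P.polePart x t z w i j - P.zeroPart w i j) w := by
  have h1' := fun k => sub_ne_zero.2 (h1 k)
  have h2' := fun k => sub_ne_zero.2 (h2 k)
  have e : (fun w => P.polePart x t z w i j - P.zeroPart w i j) = fun w =>
      (1 : Matrix (Fin 2) (Fin 2) ℂ) i j
      + ∑ k, P.resMinus x t (conj (P.xi z k)) i j * (w - conj (P.xi z k))⁻¹
      + ∑ k, P.resPlus x t (P.xi z k) i j * (w - P.xi z k)⁻¹ := by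
    ext w; rw [polePart_apply]; ring
  rw [e]
  refine (DifferentiableAt.add (differentiableAt_const _) (.fun_sum fun k _ => ?_)).add
    (.fun_sum fun k _ => ?_)
  · exact (differentiableAt_const _).mul ((differentiableAt_id.sub_const _).inv (h2' k))
  · exact (differentiableAt_const _).mul ((differentiableAt_id.sub_const _).inv (h1' k))

theorem differentiableAt_polePart (x : ℝ) {w : ℂ} (h0 : w ≠ 0) (h1 : ∀ k, w ≠ P.xi z k)
    (h2 : ∀ k, w ≠ conj (P.xi z k)) (i j : Fin 2) :
    DifferentiableAt ℂ (fun w => P.polePart x t z w i j) w := by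
  have e : (fun w => P.polePart x t z w i j) =
      fun w => P.polePart x t z w i j - P.zeroPart w i j
        + (Complex.I • (sigma3 * Qmat P.qm)) i j * w⁻¹ := by
    ext w; rw [← zeroPart_apply]; ring
  rw [e]
  exact (differentiableAt_polePart_sub_zeroPart x h1 h2 i j).add
    ((differentiableAt_const _).mul (differentiableAt_inv h0))

/-- The residue of `polePart` at a point of the discrete spectrum in `D⁺`. -/
theorem tendsto_sub_mul_polePart (hd : P.IsDiscreteSpectrum t z) (hq : 0 < P.q₀) (x : ℝ)
    (n : Fin N ⊕ Fin N) (i j : Fin 2) :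
    Tendsto (fun w => (w - P.xi z n) * P.polePart x t z w i j) (𝓝[≠] P.xi z n)
      (𝓝 (P.resPlus x t (P.xi z n) i j)) := by
  set ξ := P.xi z n with hξ
  have hD : ξ ∈ P.Dplus := hd.xi_mem hq n
  have hreg : ∀ (r η : ℂ), ξ ≠ η →
      Tendsto (fun w => (w - ξ) * (r * (w - η)⁻¹)) (𝓝[≠] ξ) (𝓝 0) := fun r η hη => by
    have hc : ContinuousAt (fun w => (w - ξ) * (r * (w - η)⁻¹)) ξ :=
      ContinuousAt.mul (by fun_prop) (continuousAt_const.mul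
        (ContinuousAt.inv₀ (by fun_prop) (sub_ne_zero.2 hη)))
    have := hc.tendsto
    rw [sub_self, zero_mul] at this
    exact this.mono_left nhdsWithin_le_nhds
  have hsing : Tendsto (fun w => (w - ξ) * (P.resPlus x t ξ i j * (w - ξ)⁻¹)) (𝓝[≠] ξ)
      (𝓝 (P.resPlus x t ξ i j)) := by
    refine tendsto_const_nhds.congr' ?_
    filter_upwards [self_mem_nhdsWithin] with w hw
    have : w - ξ ≠ 0 := sub_ne_zero.2 hw
    field_simp
  have h0 := hreg ((Complex.I • (sigma3 * Qmat P.qm)) i j) 0 (Dplus_subset_Omega hD).1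
  have hone : Tendsto (fun w => (w - ξ) * (1 : Matrix (Fin 2) (Fin 2) ℂ) i j) (𝓝[≠] ξ) (𝓝 0) := by
    have hc : Continuous fun w => (w - ξ) * (1 : Matrix (Fin 2) (Fin 2) ℂ) i j := by fun_prop
    have := hc.tendsto ξ
    rw [sub_self, zero_mul] at this
    exact this.mono_left nhdsWithin_le_nhds
  have hm : ∀ k, ξ ≠ conj (P.xi z k) := fun k hk =>
    Dminus_disjoint_Omega (Dplus_subset_Omega hD) (hk ▸ conj_mem_Dminus.2 (hd.xi_mem hq k))
  have hs1 := tendsto_finsetSum Finset.univ fun k _ =>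
    hreg (P.resMinus x t (conj (P.xi z k)) i j) _ (hm k)
  have hs2 : Tendsto (fun w => ∑ k, (w - ξ) * (P.resPlus x t (P.xi z k) i j * (w - P.xi z k)⁻¹))
      (𝓝[≠] ξ) (𝓝 (∑ k, if k = n then P.resPlus x t ξ i j else 0)) := by
    refine tendsto_finsetSum Finset.univ fun k _ => ?_
    by_cases hk : k = n
    · subst hk; rw [if_pos rfl]; exact hsing
    · rw [if_neg hk]; exact hreg _ _ fun h => hk (hd.xi_injective hq h.symm)
  have h := ((hone.add h0).add hs1).add hs2
  simp only [Finset.sum_const_zero, add_zero, zero_add, Finset.sum_ite_eq', Finset.mem_univ,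
    if_true] at h
  refine h.congr fun w => ?_
  rw [polePart_apply, zeroPart_apply, ← Finset.mul_sum, ← Finset.mul_sum]
  simp only [sub_zero]
  ring

theorem conjMat_add (A B : Matrix (Fin 2) (Fin 2) ℂ) : conjMat (A + B) = conjMat A + conjMat B := by
  ext i j
  simp only [conjMat_apply, Matrix.add_apply, map_add]
  ring

theorem conjMat_sum {ι : Type*} (s : Finset ι) (A : ι → Matrix (Fin 2) (Fin 2) ℂ) :
    conjMat (∑ k ∈ s, A k) = ∑ k ∈ s, conjMat (A k) := by
  ext i j
  simp only [conjMat_apply, Matrix.sum_apply, map_sum, Finset.mul_sum]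

theorem conjMat_conjMat (A : Matrix (Fin 2) (Fin 2) ℂ) : conjMat (conjMat A) = A := by
  ext i j
  fin_cases i <;> fin_cases j <;> simp [conjMat]

/-- The residues at `ξ_k` and `ξ_k^*` correspond under the involution. The explicit part thus has
the symmetry of `M`, and the remainder in `D⁻` is the mirror image of the one in `D⁺`. -/
theorem conjMat_polePart (hd : P.IsDiscreteSpectrum t z) (h : P.Admissible t) (x : ℝ) (w : ℂ) :
    conjMat (P.polePart x t z (conj w)) = P.polePart x t z w := by
  have h1 : conjMat 1 = 1 := by
    ext i j
    fin_cases i <;> fin_cases j <;> simp [conjMat]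
  have h2 : conjMat (P.zeroPart (conj w)) = P.zeroPart w := by
    rw [zeroPart_eq, zeroPart_eq]
    ext i j
    fin_cases i <;> fin_cases j <;> simp [conjMat]
  have h3 := fun k => resMinus_conj h (hd.xi_mem h.pos k) (hd.s11_xi h k) x
  simp only [polePart, conjMat_add, conjMat_sum, conjMat_smul, h1, h2, h3, conjMat_conjMat, map_inv₀,
    map_sub, Complex.conj_conj]
  abel

end NZBCData

/-! ### The regular part of `M`. -/

namespace NZBCData

open Set

variable {P : NZBCData} {t : ℝ} {N : ℕ} {z : Fin N → ℂ}

/-- Unlike continuity this covers the branch points: the Volterra bound holds on all of `Omega`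
outside the disc of radius `|ζ|/2`. -/
theorem muMinus_one_isBigO_one (h : P.Admissible t) (x : ℝ) (i : Fin 2) {ζ : ℂ} (h0 : ζ ≠ 0) :
    (fun w => P.muMinus 1 x t w i) =O[𝓝[P.Omega] ζ] fun _ => (1 : ℂ) := by
  have hpos : 0 < ‖ζ‖ := norm_pos_iff.2 h0
  obtain ⟨⟨W, -, hW⟩, -⟩ := muMinus_one_regular h (half_pos hpos)
  refine IsBigO.of_bound (W x) ?_
  filter_upwards [self_mem_nhdsWithin, mem_nhdsWithin_of_mem_nhds
    (continuous_norm.continuousAt.eventually (lt_mem_nhds (half_lt_self hpos)))] with w hw hw'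
  rw [norm_one, mul_one]
  exact hW w hw (le_of_lt hw') x i

theorem muPlus_zero_isBigO_one (h : P.Admissible t) (x : ℝ) (i : Fin 2) {ζ : ℂ} (h0 : ζ ≠ 0) :
    (fun w => P.muPlus 0 x t w i) =O[𝓝[P.Omega] ζ] fun _ => (1 : ℂ) := by
  refine (muMinus_one_isBigO_one h.reflect (-x) i.rev h0).congr' ?_ EventuallyEq.rfl
  filter_upwards [self_mem_nhdsWithin] with w hw
  rw [muPlus_zero_eq_reflect h x hw]
  fin_cases i <;> rfl

theorem Mplus_isBigO_one (hns : P.NoSpectralSingularity t) (h : P.Admissible t) (x : ℝ) (i j : Fin 2)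
    {ζ : ℂ} (hζ : ζ ∈ P.contour) (h0 : ζ ≠ 0) :
    (fun w => P.Mplus x t w i j) =O[𝓝[P.Omega] ζ] fun _ => (1 : ℂ) := by
  obtain ⟨c, hc, hb⟩ := hns.s11_bound h hζ h0
  have hs : (fun w => (P.s11 t w)⁻¹) =O[𝓝[P.Omega] ζ] fun _ => (1 : ℂ) := by
    refine IsBigO.of_bound c⁻¹ ?_
    filter_upwards [hb] with w hw
    rw [norm_one, mul_one, norm_inv]
    exact inv_anti₀ hc hw
  have hd : ∀ i, (fun w => P.muPlus 0 x t w i / P.s11 t w) =O[𝓝[P.Omega] ζ] fun _ => (1 : ℂ) :=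
    fun i => by
      have := (muPlus_zero_isBigO_one h x i h0).mul hs
      simp only [mul_one] at this
      simpa only [div_eq_mul_inv] using this
  fin_cases i <;> fin_cases j
  · exact hd 0
  · exact muMinus_one_isBigO_one h x 0 h0
  · exact hd 1
  · exact muMinus_one_isBigO_one h x 1 h0

namespace IsDiscreteSpectrum

theorem xi_ne_of_mem_contour (hd : P.IsDiscreteSpectrum t z) (hq : 0 < P.q₀) {w : ℂ}
    (hw : w ∈ P.contour) (k : Fin N ⊕ Fin N) : w ≠ P.xi z k := fun h => by
  have : w ∈ P.contourᶜ := by rw [contour_compl hq]; exact Or.inl (h ▸ hd.xi_mem hq k)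
  exact this hw

theorem conj_xi_ne_of_mem_contour (hd : P.IsDiscreteSpectrum t z) (hq : 0 < P.q₀) {w : ℂ}
    (hw : w ∈ P.contour) (k : Fin N ⊕ Fin N) : w ≠ conj (P.xi z k) := fun h => by
  have : w ∈ P.contourᶜ := by
    rw [contour_compl hq]; exact Or.inr (h ▸ conj_mem_Dminus.2 (hd.xi_mem hq k))
  exact this hw

theorem conj_xi_ne_of_mem_Omega (hd : P.IsDiscreteSpectrum t z) (hq : 0 < P.q₀) {w : ℂ}
    (hw : w ∈ P.Omega) (k : Fin N ⊕ Fin N) : w ≠ conj (P.xi z k) := fun h =>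
  Dminus_disjoint_Omega hw (h ▸ conj_mem_Dminus.2 (hd.xi_mem hq k))

theorem s11_ne_zero (hd : P.IsDiscreteSpectrum t z) (hns : P.NoSpectralSingularity t)
    (h : P.Admissible t) {w : ℂ} (hw : w ∈ P.Omega) (hk : w ∉ range (P.xi z)) : P.s11 t w ≠ 0 := by
  by_cases hD : w ∈ P.Dplus
  · exact fun h0 => hk ((hd.s11_eq_zero_iff h hD).1 h0)
  · exact hns.s11_ne_zero h (mem_regContour_of_mem_Omega h.pos hw hD)

end IsDiscreteSpectrum

/-- The regular part of `M⁺`. -/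
theorem exists_regularPart_plus (hd : P.IsDiscreteSpectrum t z) (hns : P.NoSpectralSingularity t)
    (h : P.Admissible t) (x : ℝ) {β : ℝ} (hβ : ∀ i j,
      HasExpansion (Bornology.cobounded ℂ ⊓ 𝓟 P.Omega) (fun w => P.Mplus x t w i j)
        ((1 : Matrix (Fin 2) (Fin 2) ℂ) i j) (P.expansionCoeff x t β i j)) (i j : Fin 2) :
    ∃ g : ℂ → ℂ, ContinuousOn g P.Omega ∧ DifferentiableOn ℂ g P.Dplus ∧
      (∃ C : ℝ, ∀ s ∈ P.Omega, ‖g s‖ ≤ C / (1 + ‖s‖)) ∧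
      (∀ w ∉ range (P.xi z), g w = P.Mplus x t w i j - P.polePart x t z w i j) ∧
      HasExpansion (Bornology.cobounded ℂ ⊓ 𝓟 P.Omega) g 0
        (P.expansionCoeff x t β i j - P.poleCoeff x t z i j) := by
  set f : ℂ → ℂ := fun w => P.Mplus x t w i j - P.polePart x t z w i j with hf
  have hfin : (range (P.xi z)).Finite := finite_range _
  have hdiff : ∀ w ∈ P.Omega, w ∉ range (P.xi z) →
      DifferentiableAt ℂ (fun w => P.polePart x t z w i j) w := fun w hw hk =>
    differentiableAt_polePart x hw.1 (fun k hk' => hk ⟨k, hk'.symm⟩)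
      (hd.conj_xi_ne_of_mem_Omega h.pos hw) i j
  have hfd : DifferentiableOn ℂ f (P.Dplus \ range (P.xi z)) := fun w hw =>
    ((Mplus_differentiableAt h x hw.1 (hd.s11_ne_zero hns h (Dplus_subset_Omega hw.1) hw.2) i j).sub
      (hdiff w (Dplus_subset_Omega hw.1) hw.2)).differentiableWithinAt
  have hfc : ∀ w ∈ P.Omega, w ∉ range (P.xi z) → ContinuousWithinAt f P.Omega w := fun w hw hk => by
    have h1 := Mplus_continuousWithinAt h x hw (hd.s11_ne_zero hns h hw hk)
    exact (tendsto_pi_nhds.1 (tendsto_pi_nhds.1 h1 i) j).sub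
      (hdiff w hw hk).continuousAt.continuousWithinAt
  -- The residues of `M⁺` and of the explicit part agree, so the poles are removable.
  have hres : ∀ k, Tendsto (fun w => (w - P.xi z k) * f w) (𝓝[≠] P.xi z k) (𝓝 0) := fun k => by
    have h1 := tendsto_pi_nhds.1 (tendsto_pi_nhds.1 (Mplus_residue h (hd.xi_mem h.pos k)
      (hd.s11_xi h k) (hd.deriv_s11_xi h k) x) i) j
    have h2 := h1.sub (tendsto_sub_mul_polePart hd h.pos x k i j)
    rw [sub_self] at h2
    refine h2.congr fun w => ?_
    simp only [hf, Matrix.smul_apply, smul_eq_mul]; ring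
  obtain ⟨g, hgd, hgf⟩ := exists_differentiableOn_extension isOpen_Dplus (P.xi z) hfd hres
  have hnear : ∀ w ∉ range (P.xi z), ∀ᶠ v in 𝓝 w, g v = f v := fun w hw => by
    filter_upwards [hfin.isClosed.isOpen_compl.mem_nhds hw] with v hv using hgf v hv
  have hgc : ContinuousOn g P.Omega := fun w hw => by
    by_cases hD : w ∈ P.Dplus
    · exact (hgd.differentiableAt (isOpen_Dplus.mem_nhds hD)).continuousAt.continuousWithinAt
    · have hk : w ∉ range (P.xi z) := fun ⟨k, hk⟩ => hD (hk ▸ hd.xi_mem h.pos k)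
      exact (hfc w hw hk).congr_of_eventuallyEq
        (mem_nhdsWithin_of_mem_nhds (hnear w hk)) (hgf w hk)
  have hgexp : HasExpansion (Bornology.cobounded ℂ ⊓ 𝓟 P.Omega) g 0
      (P.expansionCoeff x t β i j - P.poleCoeff x t z i j) := by
    have h1 := (hβ i j).sub (hasExpansion_polePart (P := P) (t := t) (z := z) inf_le_left x i j)
    rw [sub_self] at h1
    refine h1.congr' (mem_inf_of_left ?_)
    filter_upwards [Bornology.isBounded_def.1 hfin.isBounded] with w hw
    exact (hgf w fun hk => hw hk).symm
  refine ⟨g, hgc, hgd, ?_, hgf, hgexp⟩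
  -- At the origin the singular part cancels; at other contour points, branch points included, `M⁺`
  -- is bounded for lack of spectral singularities; in `D⁺` the function is continuous; points of
  -- `D⁻` have neighbourhoods that miss `Omega`.
  have hloc : ∀ ζ, g =O[𝓝[P.Omega] ζ] fun _ => (1 : ℂ) := fun ζ => by
    by_cases hζ : ζ ∈ P.contour
    · have hk : ζ ∉ range (P.xi z) := fun ⟨k, hk⟩ =>
        hd.xi_ne_of_mem_contour h.pos hζ k hk.symm
      have hreg := (differentiableAt_polePart_sub_zeroPart (P := P) (t := t) x
        (hd.xi_ne_of_mem_contour h.pos hζ) (hd.conj_xi_ne_of_mem_contour h.pos hζ) i j).continuousAt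
      have hreg' : (fun w => P.polePart x t z w i j - P.zeroPart w i j) =O[𝓝[P.Omega] ζ]
          fun _ => (1 : ℂ) := (hreg.tendsto.isBigO_one ℂ).mono nhdsWithin_le_nhds
      have hmain : (fun w => P.Mplus x t w i j - P.zeroPart w i j) =O[𝓝[P.Omega] ζ]
          fun _ => (1 : ℂ) := by
        by_cases h0 : ζ = 0
        · rw [h0]; exact Mplus_sub_zeroPart_isBigO h x i j
        · refine (Mplus_isBigO_one hns h x i j hζ h0).sub ?_
          have hc : ContinuousAt (fun w => P.zeroPart w i j) ζ := by
            simp only [zeroPart_apply]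
            exact continuousAt_const.mul (continuousAt_inv₀ h0)
          exact (hc.tendsto.isBigO_one ℂ).mono nhdsWithin_le_nhds
      refine (hmain.sub hreg').congr' ?_ EventuallyEq.rfl
      filter_upwards [mem_nhdsWithin_of_mem_nhds (hnear ζ hk)] with w hw
      rw [hw]; simp only [hf]; ring
    · rcases (contour_compl h.pos ▸ hζ : ζ ∈ P.Dplus ∪ P.Dminus) with hD | hD
      · exact ((hgd.differentiableAt (isOpen_Dplus.mem_nhds hD)).continuousAt.tendsto.isBigO_one
          ℂ).mono nhdsWithin_le_nhds
      · refine IsBigO.of_bound 0 ?_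
        filter_upwards [self_mem_nhdsWithin, mem_nhdsWithin_of_mem_nhds (isOpen_Dminus.mem_nhds hD)]
          with w hw hw'
        exact absurd hw' (Dminus_disjoint_Omega hw)
  obtain ⟨C, hC⟩ := exists_bound_of_isBigO (n := 1) hloc (by
    have := hgexp.sub_isBigO inf_le_left
    simpa using this)
  exact ⟨C, by simpa using hC⟩

/-- The regular parts of `M⁺` and `M⁻`. -/
theorem exists_regularPart (hd : P.IsDiscreteSpectrum t z) (hns : P.NoSpectralSingularity t)
    (h : P.Admissible t) (x : ℝ) {β : ℝ} (hβ : ∀ i j,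
      HasExpansion (Bornology.cobounded ℂ ⊓ 𝓟 P.Omega) (fun w => P.Mplus x t w i j)
        ((1 : Matrix (Fin 2) (Fin 2) ℂ) i j) (P.expansionCoeff x t β i j)) :
    ∃ gp gm : Fin 2 → Fin 2 → ℂ → ℂ, (∀ i j, P.SectionallyAnalytic (gp i j) (gm i j)) ∧
      (∀ i j, ∀ w ∉ range (P.xi z),
        gp i j w = P.Mplus x t w i j - P.polePart x t z w i j) ∧
      (∀ i j, ∀ w ∈ P.OmegaMinus, conj w ∉ range (P.xi z) →
        gm i j w = P.Mminus x t w i j - P.polePart x t z w i j) ∧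
      (∀ i j, HasExpansion (Bornology.cobounded ℂ ⊓ 𝓟 P.Omega) (gp i j) 0
        (P.expansionCoeff x t β i j - P.poleCoeff x t z i j)) ∧
      (∀ i j, HasExpansion (Bornology.cobounded ℂ ⊓ 𝓟 P.OmegaMinus) (gm i j) 0
        (P.expansionCoeff x t β i j - P.poleCoeff x t z i j)) := by
  choose g hc hdf hb hg hexp using exists_regularPart_plus hd hns h x hβ
  let ε : Fin 2 → Fin 2 → ℂ := fun i j => if i = j then 1 else -1
  have hε : ∀ i j, ‖ε i j‖ = 1 := fun i j => by
    simp only [ε]; split_ifs <;> simp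
  -- The function on the lower side is defined as the mirror image, entry by entry with the signs of
  -- `conjMat`, so that analyticity and bounds carry over.
  let gm : Fin 2 → Fin 2 → ℂ → ℂ := fun i j w => ε i j * conj (g i.rev j.rev (conj w))
  have hgm : ∀ i j, ∀ w ∈ P.OmegaMinus, conj w ∉ range (P.xi z) →
      gm i j w = P.Mminus x t w i j - P.polePart x t z w i j := fun i j w hw hk => by
    simp only [gm]
    rw [hg _ _ _ hk, Mminus_eq_conjMat h x hw, ← conjMat_polePart hd h x w, conjMat_apply,
      conjMat_apply, map_sub]
    ring
  refine ⟨g, gm, fun i j => ⟨hc i j, hdf i j, hb i j, ?_, ?_, ?_⟩, hg, hgm, hexp, fun i j => ?_⟩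
  · exact continuousOn_const.mul (Complex.continuous_conj.comp_continuousOn
      ((hc i.rev j.rev).comp Complex.continuous_conj.continuousOn fun w hw => hw))
  · exact (differentiableOn_const _).mul (differentiableOn_conj_Dminus (hdf i.rev j.rev))
  · obtain ⟨C, hC⟩ := hb i.rev j.rev
    refine ⟨C, fun s hs => ?_⟩
    have := hC (conj s) hs
    rw [norm_mul, hε, one_mul, Complex.norm_conj]
    rwa [Complex.norm_conj] at this
  · have h1 := (hasExpansion_Mminus h x hβ i j).sub
      (hasExpansion_polePart (P := P) (t := t) (z := z) inf_le_left x i j)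
    rw [sub_self] at h1
    refine h1.congr' ?_
    have hfin : ((starRingEnd ℂ) '' range (P.xi z)).Finite := (finite_range _).image _
    filter_upwards [mem_inf_of_right (mem_principal_self P.OmegaMinus), mem_inf_of_left
      (Bornology.isBounded_def.1 hfin.isBounded)] with w hw hk
    exact (hgm i j w hw fun hk' => hk ⟨_, hk', Complex.conj_conj w⟩).symm

end NZBCData

/-! ### Cauchy representation of `M` and its value at the discrete spectrum. -/

namespace NZBCData

open Set

variable {P : NZBCData} {t : ℝ} {N : ℕ} {z : Fin N → ℂ}

/-- Regular parts `gp`, `gm` of `M⁺`, `M⁻` whose difference on the contour is `M⁺ G`. -/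
structure IsRegularPart (P : NZBCData) (x t : ℝ) {N : ℕ} (z : Fin N → ℂ)
    (gp gm : Fin 2 → Fin 2 → ℂ → ℂ) : Prop where
  analytic : ∀ i j, P.SectionallyAnalytic (gp i j) (gm i j)
  plus_eq : ∀ i j, ∀ w ∉ range (P.xi z), gp i j w = P.Mplus x t w i j - P.polePart x t z w i j
  minus_eq : ∀ i j, ∀ w ∈ P.OmegaMinus, conj w ∉ range (P.xi z) →
    gm i j w = P.Mminus x t w i j - P.polePart x t z w i j

namespace IsRegularPart

variable {x : ℝ} {gp gm : Fin 2 → Fin 2 → ℂ → ℂ}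

theorem sub_eq (hr : P.IsRegularPart x t z gp gm) (hd : P.IsDiscreteSpectrum t z)
    (hns : P.NoSpectralSingularity t) (h : P.Admissible t) (i j : Fin 2) {s : ℂ}
    (hs : s ∈ P.regContour) : gp i j s - gm i j s = (P.Mplus x t s * P.G x t s) i j := by
  rw [hr.plus_eq i j s fun ⟨k, hk⟩ => hd.xi_ne_of_mem_contour h.pos hs.1 k hk.symm,
    hr.minus_eq i j s (regContour_subset_OmegaMinus hs) fun ⟨k, hk⟩ =>
      hd.xi_ne_of_mem_contour h.pos (conj_mem_regContour hs).1 k hk.symm,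
    Mplus_mul_G hns h hs, Matrix.sub_apply]
  ring

theorem cauchy_plus (hr : P.IsRegularPart x t z gp gm) (hd : P.IsDiscreteSpectrum t z)
    (hns : P.NoSpectralSingularity t) (h : P.Admissible t) (i j : Fin 2) {w : ℂ}
    (hw : w ∈ P.Dplus) :
    P.ContourIntegrable (fun s => (s - w)⁻¹ * (P.Mplus x t s * P.G x t s) i j) ∧
    gp i j w = (2 * Real.pi * Complex.I)⁻¹ *
      P.contourIntegral fun s => (s - w)⁻¹ * (P.Mplus x t s * P.G x t s) i j := by
  obtain ⟨h1, h2⟩ := (hr.analytic i j).eq_of_mem_Dplus h.pos hw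
  have he : EqOn (fun s => (s - w)⁻¹ * (gp i j s - gm i j s))
      (fun s => (s - w)⁻¹ * (P.Mplus x t s * P.G x t s) i j) P.regContour := fun s hs => by
    simp only [hr.sub_eq hd hns h i j hs]
  exact ⟨h1.congr h.pos he, h2.trans (by rw [contourIntegral_congr h.pos he])⟩

theorem cauchy_minus (hr : P.IsRegularPart x t z gp gm) (hd : P.IsDiscreteSpectrum t z)
    (hns : P.NoSpectralSingularity t) (h : P.Admissible t) (i j : Fin 2) {w : ℂ}
    (hw : w ∈ P.Dminus) :
    P.ContourIntegrable (fun s => (s - w)⁻¹ * (P.Mplus x t s * P.G x t s) i j) ∧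
    gm i j w = (2 * Real.pi * Complex.I)⁻¹ *
      P.contourIntegral fun s => (s - w)⁻¹ * (P.Mplus x t s * P.G x t s) i j := by
  obtain ⟨h1, h2⟩ := (hr.analytic i j).eq_of_mem_Dminus h.pos hw
  have he : EqOn (fun s => (s - w)⁻¹ * (gp i j s - gm i j s))
      (fun s => (s - w)⁻¹ * (P.Mplus x t s * P.G x t s) i j) P.regContour := fun s hs => by
    simp only [hr.sub_eq hd hns h i j hs]
  exact ⟨h1.congr h.pos he, h2.trans (by rw [contourIntegral_congr h.pos he])⟩

theorem contourIntegrable_div (hr : P.IsRegularPart x t z gp gm) (hd : P.IsDiscreteSpectrum t z)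
    (hns : P.NoSpectralSingularity t) (h : P.Admissible t) {w : ℂ} (hw : w ∉ P.contour)
    (i j : Fin 2) :
    P.ContourIntegrable fun s => ((s - w)⁻¹ • (P.Mplus x t s * P.G x t s)) i j := by
  rcases (contour_compl h.pos ▸ hw : w ∈ P.Dplus ∪ P.Dminus) with hD | hD
  · exact (hr.cauchy_plus hd hns h i j hD).1
  · exact (hr.cauchy_minus hd hns h i j hD).1

theorem M_eq (hr : P.IsRegularPart x t z gp gm) (hd : P.IsDiscreteSpectrum t z)
    (hns : P.NoSpectralSingularity t) (h : P.Admissible t) {w : ℂ} (hw : w ∉ P.contour)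
    (hk : ∀ k, w ≠ P.xi z k ∧ w ≠ conj (P.xi z k)) :
    P.M x t w = P.polePart x t z w + (2 * Real.pi * Complex.I)⁻¹ •
      P.contourIntegralMat fun s => (s - w)⁻¹ • (P.Mplus x t s * P.G x t s) := by
  ext i j
  rw [Matrix.add_apply, Matrix.smul_apply, smul_eq_mul]
  rcases (contour_compl h.pos ▸ hw : w ∈ P.Dplus ∪ P.Dminus) with hD | hD
  · have h1 := (hr.cauchy_plus hd hns h i j hD).2
    rw [hr.plus_eq i j w fun ⟨k, hk'⟩ => (hk k).1 hk'.symm] at h1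
    rw [M_of_mem_Dplus x hD]
    exact sub_eq_iff_eq_add'.1 h1
  · have h1 := (hr.cauchy_minus hd hns h i j hD).2
    rw [hr.minus_eq i j w (Dminus_subset_OmegaMinus hD) fun ⟨k, hk'⟩ => (hk k).2 (by
      rw [hk', Complex.conj_conj])] at h1
    rw [M_of_mem_Dminus x hD]
    exact sub_eq_iff_eq_add'.1 h1

end IsRegularPart

theorem eq_of_eqOn_punctured {f g : ℂ → ℂ} {ξ : ℂ} (hf : ContinuousAt f ξ) (hg : ContinuousAt g ξ)
    (h : f =ᶠ[𝓝[≠] ξ] g) : f ξ = g ξ :=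
  tendsto_nhds_unique (hf.tendsto.mono_left nhdsWithin_le_nhds)
    ((hg.tendsto.mono_left nhdsWithin_le_nhds).congr' h.symm)

theorem resPlus_one (x : ℝ) (ξ : ℂ) (i : Fin 2) : P.resPlus x t ξ i 1 = 0 := by
  fin_cases i <;> simp [resPlus]

theorem resPlus_zero (x : ℝ) (ξ : ℂ) (i : Fin 2) : P.resPlus x t ξ i 0 =
    P.C t ξ * Complex.exp (-(2 * Complex.I * P.theta x t ξ)) * P.muMinus 1 x t ξ i := by
  fin_cases i <;> simp [resPlus]

theorem resMinus_zero (x : ℝ) (ξ : ℂ) (i : Fin 2) : P.resMinus x t ξ i 0 = 0 := by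
  fin_cases i <;> simp [resMinus]

theorem resMinus_one (x : ℝ) (ξ : ℂ) (i : Fin 2) : P.resMinus x t ξ i 1 =
    P.CTilde t ξ * Complex.exp (2 * Complex.I * P.theta x t ξ) * P.muMinus 0 x t ξ i := by
  fin_cases i <;> simp [resMinus]

theorem polePart_one (x : ℝ) (w : ℂ) (i : Fin 2) : P.polePart x t z w i 1 =
    ![-conj P.qm / w, 1] i + ∑ k, P.CTilde t (conj (P.xi z k))
      * Complex.exp (2 * Complex.I * P.theta x t (conj (P.xi z k)))
      / (w - conj (P.xi z k)) * P.muMinus 0 x t (conj (P.xi z k)) i := by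
  have h1 : (1 : Matrix (Fin 2) (Fin 2) ℂ) i 1 + P.zeroPart w i 1 = ![-conj P.qm / w, 1] i := by
    rw [zeroPart_eq]; revert i; simp [Fin.forall_fin_two, neg_div]
  rw [polePart_apply, h1]
  simp only [resPlus_one, zero_mul, Finset.sum_const_zero, add_zero, resMinus_one]
  congr 1
  exact Finset.sum_congr rfl fun k _ => by ring

theorem polePart_zero (x : ℝ) (w : ℂ) (i : Fin 2) : P.polePart x t z w i 0 =
    ![1, P.qm / w] i + ∑ k, P.C t (P.xi z k)
      * Complex.exp (-(2 * Complex.I * P.theta x t (P.xi z k)))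
      / (w - P.xi z k) * P.muMinus 1 x t (P.xi z k) i := by
  have h1 : (1 : Matrix (Fin 2) (Fin 2) ℂ) i 0 + P.zeroPart w i 0 = ![1, P.qm / w] i := by
    rw [zeroPart_eq]; revert i; simp [Fin.forall_fin_two]
  rw [polePart_apply, h1]
  simp only [resMinus_zero, zero_mul, Finset.sum_const_zero, add_zero, resPlus_zero]
  congr 1
  exact Finset.sum_congr rfl fun k _ => by ring

theorem continuousAt_vec_div {a c w : ℂ} (hw : w ≠ 0) (i : Fin 2) :
    ContinuousAt (fun w => ![a / w, c] i) w ∧ ContinuousAt (fun w => ![c, a / w] i) w := by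
  have h : ContinuousAt (fun w => a / w) w := continuousAt_const.div continuousAt_id hw
  fin_cases i
  · exact ⟨h, continuousAt_const⟩
  · exact ⟨continuousAt_const, h⟩

theorem continuousAt_sum_div {ι : Type*} (s : Finset ι) {a c η : ι → ℂ} {w : ℂ}
    (hw : ∀ k, w ≠ η k) : ContinuousAt (fun w => ∑ k ∈ s, a k / (w - η k) * c k) w :=
  tendsto_finsetSum s fun k _ => (((continuousAt_const (y := a k)).div
    (continuousAt_id.sub continuousAt_const) (sub_ne_zero.2 (hw k))).mul continuousAt_const).tendsto

namespace IsRegularPart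

variable {x : ℝ} {gp gm : Fin 2 → Fin 2 → ℂ → ℂ}

/-- The second column of `M⁺` is `μ₋₂`, and the second column of the residues in `D⁺` is zero. All
terms are therefore continuous at `ξ_n`, and the Cauchy formula for the regular part holds at `ξ_n`
itself. -/
theorem muMinus_one_eq (hr : P.IsRegularPart x t z gp gm) (hd : P.IsDiscreteSpectrum t z)
    (hns : P.NoSpectralSingularity t) (h : P.Admissible t) (n : Fin N ⊕ Fin N) (i : Fin 2) :
    P.muMinus 1 x t (P.xi z n) i = P.polePart x t z (P.xi z n) i 1 + (2 * Real.pi * Complex.I)⁻¹ *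
      P.contourIntegral fun s => (P.Mplus x t s * P.G x t s) i 1 / (s - P.xi z n) := by
  set ξ := P.xi z n
  have hD : ξ ∈ P.Dplus := hd.xi_mem h.pos n
  have hO := Dplus_subset_Omega hD
  have hn := isOpen_Dplus.mem_nhds hD
  have h1 := (hr.cauchy_plus hd hns h i 1 hD).2
  have hg : ContinuousAt (gp i 1) ξ :=
    ((hr.analytic i 1).differentiableOn_plus.differentiableAt hn).continuousAt
  have hm : ContinuousAt (fun w => P.muMinus 1 x t w i) ξ :=
    ((muMinus_one_differentiableOn h x i).differentiableAt hn).continuousAt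
  have hp : ContinuousAt (fun w => P.polePart x t z w i 1) ξ := by
    simp only [polePart_one]
    exact (continuousAt_vec_div hO.1 i).1.add
      (continuousAt_sum_div _ (hd.conj_xi_ne_of_mem_Omega h.pos hO))
  have hfin : ((range (P.xi z)) \ {ξ}).Finite := (finite_range _).subset sdiff_subset
  have he : gp i 1 =ᶠ[𝓝[≠] ξ] fun w => P.muMinus 1 x t w i - P.polePart x t z w i 1 := by
    filter_upwards [self_mem_nhdsWithin, mem_nhdsWithin_of_mem_nhds
      (hfin.isClosed.isOpen_compl.mem_nhds fun hk => hk.2 rfl)] with w hw hw'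
    rw [hr.plus_eq i 1 w fun hk => hw' ⟨hk, hw⟩]
    fin_cases i <;> simp [Mplus]
  have h2 := eq_of_eqOn_punctured hg (hm.sub hp) he
  rw [h1, Pi.sub_apply] at h2
  simp only [div_eq_mul_inv, mul_comm _ (_ - ξ)⁻¹]
  linear_combination -h2

theorem muMinus_zero_eq (hr : P.IsRegularPart x t z gp gm) (hd : P.IsDiscreteSpectrum t z)
    (hns : P.NoSpectralSingularity t) (h : P.Admissible t) (n : Fin N ⊕ Fin N) (i : Fin 2) :
    P.muMinus 0 x t (conj (P.xi z n)) i =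
      P.polePart x t z (conj (P.xi z n)) i 0 + (2 * Real.pi * Complex.I)⁻¹ *
      P.contourIntegral fun s => (P.Mplus x t s * P.G x t s) i 0 / (s - conj (P.xi z n)) := by
  set η := conj (P.xi z n) with hη
  have hD : η ∈ P.Dminus := conj_mem_Dminus.2 (hd.xi_mem h.pos n)
  have hn := isOpen_Dminus.mem_nhds hD
  have h1 := (hr.cauchy_minus hd hns h i 0 hD).2
  have hg : ContinuousAt (gm i 0) η :=
    ((hr.analytic i 0).differentiableOn_minus.differentiableAt hn).continuousAt
  have hm : ContinuousAt (fun w => P.muMinus 0 x t w i) η :=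
    ((muMinus_zero_differentiableOn h x i).differentiableAt hn).continuousAt
  have hp : ContinuousAt (fun w => P.polePart x t z w i 0) η := by
    simp only [polePart_zero]
    exact (continuousAt_vec_div (ne_zero_of_im_ne (P := P) (ne_of_lt hD)).1 i).2.add
      (continuousAt_sum_div _ fun k hk =>
        Dminus_disjoint_Omega (Dplus_subset_Omega (hd.xi_mem h.pos k)) (hk ▸ hD))
  have hfin : (((starRingEnd ℂ) '' range (P.xi z)) \ {η}).Finite :=
    ((finite_range _).image _).subset sdiff_subset
  have he : gm i 0 =ᶠ[𝓝[≠] η] fun w => P.muMinus 0 x t w i - P.polePart x t z w i 0 := by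
    filter_upwards [self_mem_nhdsWithin, mem_nhdsWithin_of_mem_nhds
      (hfin.isClosed.isOpen_compl.mem_nhds fun hk => hk.2 rfl), mem_nhdsWithin_of_mem_nhds hn]
      with w hw hw' hwD
    rw [hr.minus_eq i 0 w (Dminus_subset_OmegaMinus hwD)
      fun hk => hw' ⟨⟨_, hk, Complex.conj_conj w⟩, hw⟩]
    fin_cases i <;> simp [Mminus]
  have h2 := eq_of_eqOn_punctured hg (hm.sub hp) he
  rw [h1, Pi.sub_apply] at h2
  simp only [div_eq_mul_inv, mul_comm _ (_ - η)⁻¹]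
  linear_combination -h2

end IsRegularPart

theorem poleCoeff_one_zero (x : ℝ) : P.poleCoeff x t z 1 0 = P.qm + ∑ k, P.C t (P.xi z k)
    * Complex.exp (-(2 * Complex.I * P.theta x t (P.xi z k))) * P.muMinus 1 x t (P.xi z k) 1 := by
  have h1 : (Complex.I • (sigma3 * Qmat P.qm)) 1 0 = P.qm := by
    have hI : Complex.I * Complex.I = -1 := Complex.I_mul_I
    simp [sigma3, Qmat]
    linear_combination -P.qm * hI
  rw [poleCoeff, Matrix.add_apply, h1, Matrix.sum_apply]
  simp only [Matrix.add_apply, resMinus_zero, resPlus_zero, zero_add]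

end NZBCData

theorem mainTheorem4 (P : NZBCData) (t : ℝ)
    (hq₀ : 0 < P.q₀) (hqm : ‖P.qm‖ = P.q₀) (hqp : ‖P.qp‖ = P.q₀)
    (hlim_m : Tendsto (fun x => P.q x t) atBot (𝓝 P.qm))
    (hlim_p : Tendsto (fun x => P.q x t) atTop (𝓝 P.qp))
    (hsmooth : ContDiff ℝ 2 fun x => P.q x t)
    (hint_m : IntegrableOn (fun x => (1 + |x|) * ‖P.q x t - P.qm‖) (Set.Iic 0))
    (hint_p : IntegrableOn (fun x => (1 + |x|) * ‖P.q x t - P.qp‖) (Set.Ici 0))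
    (hint_1 : Integrable (iteratedDeriv 1 fun x => P.q x t))
    (hint_2 : Integrable (iteratedDeriv 2 fun x => P.q x t))
    -- no spectral singularities: `s₁₁` stays away from zero near each point of `Σ \ {0}`
    (hsing : ∀ ζ ∈ P.contour, ζ ≠ 0 → ∃ c > 0, ∀ᶠ z in 𝓝[P.Dplus] ζ, c ≤ ‖P.s11 t z‖)
    -- the zeros of `s₁₁` in `D⁺ ∩ {Im z > 0}` are the `z_n`, and they are simple
    {N : ℕ} (z : Fin N → ℂ) (hinj : Function.Injective z)
    (hz : ∀ n, z n ∈ P.Dplus ∧ 0 < (z n).im)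
    (hzeros : ∀ w ∈ P.Dplus, 0 < w.im → (P.s11 t w = 0 ↔ ∃ n, z n = w))
    (hsimple : ∀ n, deriv (P.s11 t) (z n) ≠ 0)
    (x : ℝ) :
    -- `M` solves the Riemann-Hilbert problem
    P.IsRHPSolution x t (P.M x t) (P.Mplus x t) (P.Mminus x t) ∧
    -- the discrete spectrum consists of the quartets
    (∀ w ∈ P.Dplus, P.s11 t w = 0 ↔ ∃ k, P.xi z k = w) ∧
    (∀ w ∈ P.Dminus, P.s22 t w = 0 ↔ ∃ k, conj (P.xi z k) = w) ∧
    -- the norming constants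
    (∀ k, P.CTilde t (conj (P.xi z k)) = -conj (P.C t (P.xi z k))) ∧
    (∀ n, P.C t (P.xi z (Sum.inr n)) =
      -(P.qm / conj P.qm) * ((P.q₀ : ℂ) / conj (z n)) ^ 2 * P.CTilde t (conj (z n))) ∧
    -- the residues at the simple poles
    (∀ k, Tendsto (fun w => (w - P.xi z k) • P.M x t w) (𝓝[≠] P.xi z k)
      (𝓝 (P.resPlus x t (P.xi z k)))) ∧
    (∀ k, Tendsto (fun w => (w - conj (P.xi z k)) • P.M x t w) (𝓝[≠] conj (P.xi z k))
      (𝓝 (P.resMinus x t (conj (P.xi z k))))) ∧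
    -- all the integrals along `Σ` below converge absolutely
    (∀ i j, P.ContourIntegrable fun s => (P.Mplus x t s * P.G x t s) i j) ∧
    (∀ w ∉ P.contour, ∀ i j,
      P.ContourIntegrable fun s => ((s - w)⁻¹ • (P.Mplus x t s * P.G x t s)) i j) ∧
    -- the solution of the Riemann-Hilbert problem
    (∀ w ∉ P.contour, (∀ k, w ≠ P.xi z k ∧ w ≠ conj (P.xi z k)) →
      P.M x t w = 1 + (Complex.I / w) • (NZBCData.sigma3 * NZBCData.Qmat P.qm)
        + ∑ k, (w - conj (P.xi z k))⁻¹ • P.resMinus x t (conj (P.xi z k))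
        + ∑ k, (w - P.xi z k)⁻¹ • P.resPlus x t (P.xi z k)
        + (2 * Real.pi * Complex.I)⁻¹ •
          P.contourIntegralMat fun s => (s - w)⁻¹ • (P.Mplus x t s * P.G x t s)) ∧
    -- the second column at `ξ_n` and the first column at `ξ_n^*`
    (∀ n i, P.muMinus 1 x t (P.xi z n) i =
      ![-conj P.qm / P.xi z n, 1] i
        + ∑ k, P.CTilde t (conj (P.xi z k))
            * Complex.exp (2 * Complex.I * P.theta x t (conj (P.xi z k)))
            / (P.xi z n - conj (P.xi z k)) * P.muMinus 0 x t (conj (P.xi z k)) i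
        + (2 * Real.pi * Complex.I)⁻¹ *
          P.contourIntegral fun s => (P.Mplus x t s * P.G x t s) i 1 / (s - P.xi z n)) ∧
    (∀ n i, P.muMinus 0 x t (conj (P.xi z n)) i =
      ![1, P.qm / conj (P.xi z n)] i
        + ∑ k, P.C t (P.xi z k)
            * Complex.exp (-(2 * Complex.I * P.theta x t (P.xi z k)))
            / (conj (P.xi z n) - P.xi z k) * P.muMinus 1 x t (P.xi z k) i
        + (2 * Real.pi * Complex.I)⁻¹ *
          P.contourIntegral fun s => (P.Mplus x t s * P.G x t s) i 0 / (s - conj (P.xi z n))) ∧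
    -- the expansion as `z → ∞`
    (∀ i j, (fun w => (P.M x t w - 1 - (1 / w) •
        (Complex.I • (NZBCData.sigma3 * NZBCData.Qmat P.qm)
          + ∑ k, (P.resMinus x t (conj (P.xi z k)) + P.resPlus x t (P.xi z k))
          - (2 * Real.pi * Complex.I)⁻¹ •
            P.contourIntegralMat fun s => P.Mplus x t s * P.G x t s)) i j)
      =O[Bornology.cobounded ℂ ⊓ 𝓟 P.contourᶜ] fun w => 1 / w ^ 2) ∧
    -- the reconstruction formula for the potential
    P.q x t = P.qm
      + ∑ k, P.C t (P.xi z k) * Complex.exp (-(2 * Complex.I * P.theta x t (P.xi z k)))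
          * P.muMinus 1 x t (P.xi z k) 1
      - (2 * Real.pi * Complex.I)⁻¹ *
        P.contourIntegral fun s => (P.Mplus x t s * P.G x t s) 1 0 := by
  have h : P.Admissible t := by
    refine ⟨hq₀, hqm, hqp, hlim_m, hlim_p, hsmooth, hint_m, hint_p, ?_, ?_⟩
    · simpa only [iteratedDeriv_one] using hint_1
    · simpa only [iteratedDeriv_succ, iteratedDeriv_zero] using hint_2
  have hns : P.NoSpectralSingularity t := hsing
  have hd : P.IsDiscreteSpectrum t z := ⟨hinj, hz, hzeros, hsimple⟩
  obtain ⟨β, hβ⟩ := NZBCData.hasExpansion_Mplus h x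
  obtain ⟨gp, gm, h1, h2, h3, h4, h5⟩ := NZBCData.exists_regularPart hd hns h x hβ
  have hr : P.IsRegularPart x t z gp gm := ⟨h1, h2, h3⟩
  have hsub := fun i j => (h1 i j).contourIntegral_sub hq₀ (h4 i j) (h5 i j)
  have heq : ∀ i j, Set.EqOn (fun s => gp i j s - gm i j s)
      (fun s => (P.Mplus x t s * P.G x t s) i j) P.regContour := fun i j s hs =>
    hr.sub_eq hd hns h i j hs
  -- The coefficient of `1/z` of the regular part is that of `M`, known from the Jost solutions,
  -- minus that of the explicit part; the integral of the jump is `-2πi` times it.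
  have hint : ∀ i j, (2 * Real.pi * Complex.I)⁻¹ *
      P.contourIntegral (fun s => (P.Mplus x t s * P.G x t s) i j) =
      P.poleCoeff x t z i j - P.expansionCoeff x t β i j := fun i j => by
    rw [← NZBCData.contourIntegral_congr hq₀ (heq i j), (hsub i j).2, mul_neg,
      inv_mul_cancel_left₀ Complex.two_pi_I_ne_zero, neg_sub]
  have hxi := hd.xi_mem hq₀
  refine ⟨NZBCData.isRHPSolution hns h x, fun w hw => hd.s11_eq_zero_iff h hw,
    fun w hw => hd.s22_eq_zero_iff h hw, fun k => NZBCData.CTilde_conj h (hxi k) (hd.s11_xi h k),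
    fun n => NZBCData.C_hat h (hz n).1 (hd.s11_xi h (Sum.inl n)),
    fun k => NZBCData.M_residue_plus h (hxi k) (hd.s11_xi h k) (hd.deriv_s11_xi h k) x,
    fun k => NZBCData.M_residue_minus h (hxi k) (hd.s11_xi h k) (hd.deriv_s11_xi h k) x,
    fun i j => (hsub i j).1.congr hq₀ (heq i j),
    fun w hw => hr.contourIntegrable_div hd hns h hw, fun w hw hk => hr.M_eq hd hns h hw hk,
    fun n i => ?_, fun n i => ?_, fun i j => ?_, ?_⟩
  · rw [hr.muMinus_one_eq hd hns h, NZBCData.polePart_one]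
  · rw [hr.muMinus_zero_eq hd hns h, NZBCData.polePart_zero]
  -- The error bound comes from the Jost solutions; only the name of the coefficient changes, by the
  -- identity `hint`.
  · refine IsBigO.congr_left (NZBCData.hasExpansion_M h x hβ i j) fun w => ?_
    have h6 := hint i j
    rw [NZBCData.poleCoeff] at h6
    simp only [Matrix.sub_apply, Matrix.smul_apply, smul_eq_mul, NZBCData.contourIntegralMat,
      Matrix.of_apply, h6]
    ring
  · have h6 := hint 1 0
    rw [NZBCData.poleCoeff_one_zero] at h6
    have h7 : P.expansionCoeff x t β 1 0 = P.q x t := rfl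
    rw [h7] at h6
    linear_combination h6
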